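/- Let $S$ be a closed oriented hyperbolic surface (a compact quotient of the hyperbolic plane by a discrete group of orientation-preserving isometries acting freely), let $T^1S$ be its unit tangent bundle with the Sasaki metric and its Riemannian distance $d$, and let $Z$ be the vector field generating the geodesic flow $\mathcal G^t$ on $T^1S$, with hyperbolic splitting $E^{ss}_Z\oplus\mathbb R Z\oplus E^{uu}_Z$. A curve $c\colon\mathbb R\to T^1S$ is said to be $\varepsilon$-shadowed by the orbit of $x\in T^1S$ if there is a differentiable reparametrization $s\colon\mathbb R\to\mathbb R$ with $|s'(t)-1|\le\varepsilon$ and $d(c(s(t)),\mathcal G^t(x))\le\varepsilon$ for all $t\in\mathbb R$. Then there is $\varepsilon_0>0$ such that for every $\varepsilon\in(0,\varepsilon_0)$ there is $\delta>0$ with the following property. Let $f\colon T^1S\to T^1S$ be any partially hyperbolic $C^1$ diffeomorphism with splitting $E^s_f\oplus E^c_f\oplus E^u_f$ that is dynamically coherent, i.e. there are $f$-invariant foliations $\mathcal F^{cs}$ and $\mathcal F^{cu}$ tangent to $E^s_f\oplus E^c_f$ and $E^c_f\oplus E^u_f$. Suppose that $E^s_f,E^c_f,E^u_f$ are $\delta$-close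 at every point to $E^{ss}_Z,\mathbb RZ,E^{uu}_Z$ respectively, and let $X^c_f$ be a continuous nowhere vanishing vector field tangent to $E^c_f$ with $\|X^c_f(x)-Z(x)\|\le\delta$ for all $x$. Let $c_1,c_2\colon\mathbb R\to T^1S$ be two different center leaves, i.e. leaves of the intersection foliation of $\mathcal F^{cs}$ and $\mathcal F^{cu}$, parametrized so that $c_i'(t)=X^c_f(c_i(t))$. Then each $c_i$ is $\varepsilon$-shadowed by exactly one orbit of $\mathcal G^t$, and the orbits shadowing $c_1$ and $c_2$ are different. -/

import Mathlib

open Filter Topology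
open scoped Real

noncomputable section

/-! ### The unit tangent bundle of the hyperbolic plane -/

/-- The group `SL(2, ℝ)`, acting on the hyperbolic plane (the upper half-plane with the metric
`(dx² + dy²) / y²`) by Möbius transformations, which are its orientation preserving isometries. -/
abbrev SL2R : Type := Matrix.SpecialLinearGroup (Fin 2) ℝ

/-- The denominator `c z + d` of a Möbius transformation. -/
def mobDenom (g : SL2R) (z : UpperHalfPlane) : ℂ := (g 1 0 : ℂ) * z + (g 1 1 : ℂ)

theorem mobDenom_ne_zero (g : SL2R) (z : UpperHalfPlane) : mobDenom g z ≠ 0 := by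
  have h := UpperHalfPlane.denom_ne_zero (g : GL (Fin 2) ℝ) z
  simpa [UpperHalfPlane.denom, mobDenom] using h

theorem coe_smul_eq (g : SL2R) (z : UpperHalfPlane) :
    ((g • z : UpperHalfPlane) : ℂ) = ((g 0 0 : ℂ) * z + (g 0 1 : ℂ)) / mobDenom g z := by
  rw [UpperHalfPlane.coe_specialLinearGroup_apply]
  simp [mobDenom]

theorem im_smul_eq (g : SL2R) (z : UpperHalfPlane) :
    (g • z : UpperHalfPlane).im = z.im / ‖mobDenom g z‖ ^ 2 := by
  have h := UpperHalfPlane.im_smul_eq_div_normSq (g : GL (Fin 2) ℝ) z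
  have h2 : UpperHalfPlane.denom (g : GL (Fin 2) ℝ) z = mobDenom g z := by
    simp [UpperHalfPlane.denom, mobDenom]
  rw [h2, Complex.normSq_eq_norm_sq] at h
  simp only [Matrix.SpecialLinearGroup.coeToGL_det,
    Units.val_one, abs_one, one_mul] at h
  exact h

theorem mobDenom_mul (g h : SL2R) (z : UpperHalfPlane) :
    mobDenom (g * h) z = mobDenom g (h • z) * mobDenom h z := by
  have hz := mobDenom_ne_zero h z
  rw [mobDenom, mobDenom, coe_smul_eq]
  field_simp
  simp only [mobDenom, Matrix.SpecialLinearGroup.coe_mul, Matrix.mul_apply, Fin.sum_univ_two]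
  push_cast
  ring

theorem mobDenom_one (z : UpperHalfPlane) : mobDenom 1 z = 1 := by simp [mobDenom]

/-- A unit tangent vector of the hyperbolic plane: a point `pt` and a tangent vector `vec` at `pt`
(a complex number) of hyperbolic length `‖vec‖ / im pt = 1`. -/
@[ext] structure UnitTangent where
  pt : UpperHalfPlane
  vec : ℂ
  norm_vec : ‖vec‖ = pt.im

namespace UnitTangent

/-- The topology of the unit tangent bundle, as a subspace of pairs (point, vector). -/
instance : TopologicalSpace UnitTangent :=
  TopologicalSpace.induced (fun p => (p.pt, p.vec)) inferInstance

/-- The action of `SL(2, ℝ)` on unit tangent vectors by the derivatives of Möbius transformations: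
the derivative of `z ↦ (a z + b) / (c z + d)` is multiplication by `1 / (c z + d)²`. -/
instance : MulAction SL2R UnitTangent where
  smul g p := ⟨g • p.pt, p.vec / mobDenom g p.pt ^ 2, by
    rw [im_smul_eq, norm_div, norm_pow, p.norm_vec]⟩
  one_smul p := by
    apply UnitTangent.ext
    · exact one_smul _ _
    · change p.vec / mobDenom 1 p.pt ^ 2 = p.vec
      simp [mobDenom_one]
  mul_smul g h p := by
    apply UnitTangent.ext
    · exact mul_smul _ _ _
    · change p.vec / mobDenom (g * h) p.pt ^ 2 =
        p.vec / mobDenom h p.pt ^ 2 / mobDenom g (h • p.pt) ^ 2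
      rw [mobDenom_mul, mul_pow, div_div, mul_comm]

@[simp] theorem smul_pt (g : SL2R) (p : UnitTangent) : (g • p).pt = g • p.pt := rfl

@[simp] theorem smul_vec (g : SL2R) (p : UnitTangent) :
    (g • p).vec = p.vec / mobDenom g p.pt ^ 2 := rfl

/-- The upward unit tangent vector at the point `i`. -/
def base : UnitTangent := ⟨UpperHalfPlane.I, Complex.I, by simp⟩

/-- The matrix `diag (exp (t / 2), exp (-t / 2))`. -/
def geoMat (t : ℝ) : SL2R :=
  ⟨!![Real.exp (t / 2), 0; 0, Real.exp (-(t / 2))], by simp [Matrix.det_fin_two, ← Real.exp_add]⟩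

/-- Every unit tangent vector is the image of the upward vector at `i` under some isometry. -/
theorem exists_smul_base (p : UnitTangent) : ∃ g : SL2R, g • base = p := by
  obtain ⟨z, v, hv⟩ := p
  set φ : ℝ := Complex.arg (-Complex.I * v) / 2 with hφ
  have hdet : !![Real.cos φ, Real.sin φ; -Real.sin φ, Real.cos φ].det = 1 := by
    rw [Matrix.det_fin_two_of]
    linear_combination Real.sin_sq_add_cos_sq φ
  obtain ⟨k, hkd⟩ : ∃ k : SL2R,
      (k : Matrix (Fin 2) (Fin 2) ℝ) = !![Real.cos φ, Real.sin φ; -Real.sin φ, Real.cos φ] :=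
    ⟨⟨_, hdet⟩, rfl⟩
  have hne : Complex.exp (-(φ * Complex.I)) ≠ 0 := Complex.exp_ne_zero _
  have hden : (-(Real.sin φ : ℂ)) * Complex.I + Real.cos φ = Complex.exp (-(φ * Complex.I)) := by
    rw [← neg_mul, Complex.exp_mul_I, Complex.cos_neg, Complex.sin_neg]
    push_cast
    ring
  have hk : k • base = ⟨UpperHalfPlane.I, v / z.im, by
      rw [norm_div, hv, Complex.norm_real, Real.norm_of_nonneg z.im_pos.le,
        div_self z.im_pos.ne']; simp⟩ := by
    have hm : mobDenom k UpperHalfPlane.I = Complex.exp (-(φ * Complex.I)) := by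
      rw [← hden]
      simp [mobDenom, hkd]
    apply UnitTangent.ext
    · apply UpperHalfPlane.ext
      rw [smul_pt, coe_smul_eq]
      change _ / mobDenom _ UpperHalfPlane.I = _
      rw [hm, div_eq_iff hne, ← hden]
      simp [base, hkd]
      ring_nf
      simp
    · rw [smul_vec]
      change Complex.I / mobDenom _ UpperHalfPlane.I ^ 2 = v / z.im
      have h1 := Complex.norm_mul_exp_arg_mul_I (-Complex.I * v)
      have h2 : ‖-Complex.I * v‖ = z.im := by simp [hv]
      rw [h2] at h1
      have h3 : Complex.exp (-(φ * Complex.I)) ^ 2 *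
          Complex.exp (Complex.arg (-Complex.I * v) * Complex.I) = 1 := by
        rw [← Complex.exp_nat_mul, ← Complex.exp_add, hφ]
        rw [← Complex.exp_zero]
        congr 1
        push_cast
        ring
      have hz : (z.im : ℂ) ≠ 0 := by exact_mod_cast z.im_pos.ne'
      rw [hm, div_eq_div_iff (pow_ne_zero 2 hne) hz]
      have h4 : v = Complex.I * (-Complex.I * v) := by
        rw [← mul_assoc]; simp
      rw [h4, ← h1]
      linear_combination (-(Complex.I * z.im)) * h3
  refine ⟨z.toSL2R * k, ?_⟩
  rw [mul_smul, hk]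
  apply UnitTangent.ext
  · exact UpperHalfPlane.toSL2R_smul_I z
  · rw [smul_vec]
    have hs : (0 : ℝ) < √z.im := Real.sqrt_pos.2 z.im_pos
    have hm : mobDenom z.toSL2R UpperHalfPlane.I = ((1 / √z.im : ℝ) : ℂ) := by
      simp [mobDenom, UpperHalfPlane.coe_toSL2R]
    change v / z.im / mobDenom z.toSL2R UpperHalfPlane.I ^ 2 = v
    have hsq : ((1 / √z.im : ℝ) : ℂ) ^ 2 = ((z.im)⁻¹ : ℝ) := by
      rw [← Complex.ofReal_pow, div_pow, Real.sq_sqrt z.im_pos.le]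
      simp
    have hz : (z.im : ℂ) ≠ 0 := by exact_mod_cast z.im_pos.ne'
    rw [hm, hsq]
    push_cast
    field_simp

/-- The isometry taking the upward vector at `i` to a given vector is unique up to sign. -/
theorem smul_base_eq_iff (g h : SL2R) : g • base = h • base ↔ h = g ∨ h = -g := by
  constructor
  · intro e
    have e2 : (g⁻¹ * h) • base = base := by rw [mul_smul, ← e, inv_smul_smul]
    have key : ∀ k : SL2R, k • base = base → k = 1 ∨ k = -1 := by
      intro k hk
      have h1 : Complex.I / mobDenom k UpperHalfPlane.I ^ 2 = Complex.I :=
        congrArg UnitTangent.vec hk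
      have h2 : ((k 0 0 : ℂ) * Complex.I + (k 0 1 : ℂ)) / mobDenom k UpperHalfPlane.I =
          Complex.I := by
        have := congrArg (fun p : UnitTangent => (p.pt : ℂ)) hk
        simpa [coe_smul_eq, base] using this
      have hd := mobDenom_ne_zero k UpperHalfPlane.I
      rw [div_eq_iff (pow_ne_zero 2 hd)] at h1
      rw [div_eq_iff hd] at h2
      have h3 : mobDenom k UpperHalfPlane.I ^ 2 = 1 := by
        apply mul_left_cancel₀ Complex.I_ne_zero
        rw [mul_one]; exact h1.symm
      have hden : mobDenom k UpperHalfPlane.I = (k 1 0 : ℂ) * Complex.I + (k 1 1 : ℂ) := by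
        simp [mobDenom]
      have h4 : mobDenom k UpperHalfPlane.I = 1 ∨ mobDenom k UpperHalfPlane.I = -1 := by
        simpa using h3
      rcases h4 with h4 | h4
      · left
        rw [h4] at h2 hden
        have a1 := congrArg Complex.re hden
        have a2 := congrArg Complex.im hden
        have a3 := congrArg Complex.re h2
        have a4 := congrArg Complex.im h2
        simp at a1 a2 a3 a4
        ext i j
        fin_cases i <;> fin_cases j <;> simp [*]
      · right
        rw [h4] at h2 hden
        have a1 := congrArg Complex.re hden
        have a2 := congrArg Complex.im hden
        have a3 := congrArg Complex.re h2
        have a4 := congrArg Complex.im h2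
        simp at a1 a2 a3 a4
        ext i j
        fin_cases i <;> fin_cases j <;> simp [*]
        all_goals linarith
    rcases key _ e2 with h0 | h0
    · left; rw [inv_mul_eq_iff_eq_mul] at h0; simpa using h0
    · right; rw [inv_mul_eq_iff_eq_mul] at h0; simpa using h0
  · rintro (rfl | rfl)
    · rfl
    · apply UnitTangent.ext
      · apply UpperHalfPlane.ext
        rw [smul_pt, smul_pt, coe_smul_eq, coe_smul_eq, mobDenom, mobDenom,
          ← neg_div_neg_eq]
        simp
        congr 1 <;> ring
      · rw [smul_vec, smul_vec, mobDenom, mobDenom]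
        simp
        congr 1; ring

/-- The geodesic flow of the hyperbolic plane: if the isometry `g` takes the upward vector at `i`
to `p`, then the geodesic with initial vector `p` is the image under `g` of the vertical geodesic
`t ↦ exp t * i`.  -/
def geodesicFlow (t : ℝ) (p : UnitTangent) : UnitTangent :=
  (Classical.choose p.exists_smul_base * geoMat t) • base

theorem geodesicFlow_smul_base (t : ℝ) (g : SL2R) :
    geodesicFlow t (g • base) = (g * geoMat t) • base := by
  have h := Classical.choose_spec (g • base).exists_smul_base
  rw [geodesicFlow, smul_base_eq_iff]
  rcases (smul_base_eq_iff _ _).1 h with h | h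
  · left; rw [← h]
  · right
    nth_rewrite 1 [h]
    rw [neg_mul]

theorem geodesicFlow_smul (t : ℝ) (g : SL2R) (p : UnitTangent) :
    geodesicFlow t (g • p) = g • geodesicFlow t p := by
  obtain ⟨h, rfl⟩ := p.exists_smul_base
  rw [← mul_smul, geodesicFlow_smul_base, geodesicFlow_smul_base, mul_assoc, mul_smul]

theorem geodesicFlow_zero (p : UnitTangent) : geodesicFlow 0 p = p := by
  obtain ⟨h, rfl⟩ := p.exists_smul_base
  rw [geodesicFlow_smul_base]
  congr 1
  have : geoMat 0 = 1 := by
    ext i j; fin_cases i <;> fin_cases j <;> simp [geoMat]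
  rw [this, mul_one]

theorem coe_geoMat_smul (t : ℝ) :
    ((geoMat t • base.pt : UpperHalfPlane) : ℂ) = (Real.exp t : ℝ) * Complex.I := by
  have h : Real.exp t = Real.exp (t / 2) * Real.exp (t / 2) := by
    rw [← Real.exp_add]; ring_nf
  rw [coe_smul_eq, h]
  simp [geoMat, mobDenom, base, Complex.exp_neg]
  ring

/-- The base point of the geodesic flow moves along a geodesic with unit speed. -/
theorem dist_geodesicFlow (s t : ℝ) (p : UnitTangent) :
    dist (geodesicFlow s p).pt (geodesicFlow t p).pt = |s - t| := by
  obtain ⟨g, rfl⟩ := p.exists_smul_base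
  rw [geodesicFlow_smul_base, geodesicFlow_smul_base, smul_pt, smul_pt, mul_smul, mul_smul,
    dist_smul]
  have hre (t : ℝ) : (geoMat t • base.pt : UpperHalfPlane).re = 0 := by
    rw [← UpperHalfPlane.coe_re, coe_geoMat_smul]; simp
  have him (t : ℝ) : (geoMat t • base.pt : UpperHalfPlane).im = Real.exp t := by
    rw [← UpperHalfPlane.coe_im, coe_geoMat_smul]; simp [Complex.exp_ofReal_re]
  rw [UpperHalfPlane.dist_of_re_eq (by rw [hre, hre]), him, him, Real.log_exp, Real.log_exp,
    Real.dist_eq]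

/-- The vector carried by the geodesic flow is the velocity of the base point. -/
theorem hasDerivAt_geodesicFlow (t : ℝ) (p : UnitTangent) :
    HasDerivAt (fun s => ((geodesicFlow s p).pt : ℂ)) (geodesicFlow t p).vec t := by
  obtain ⟨g, rfl⟩ := p.exists_smul_base
  have hfun : (fun s => ((geodesicFlow s (g • base)).pt : ℂ)) = fun s : ℝ =>
      ((g 0 0 : ℂ) * ((Real.exp s : ℝ) * Complex.I) + (g 0 1 : ℂ)) /
        ((g 1 0 : ℂ) * ((Real.exp s : ℝ) * Complex.I) + (g 1 1 : ℂ)) := by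
    funext s
    rw [geodesicFlow_smul_base, smul_pt, mul_smul, coe_smul_eq, mobDenom, coe_geoMat_smul]
  have hden : (g 1 0 : ℂ) * ((Real.exp t : ℝ) * Complex.I) + (g 1 1 : ℂ) ≠ 0 := by
    rw [← coe_geoMat_smul]; exact mobDenom_ne_zero g _
  have hdet : (g 0 0 : ℂ) * g 1 1 - g 0 1 * g 1 0 = 1 := by
    have := g.det_coe
    rw [Matrix.det_fin_two] at this
    exact_mod_cast this
  have hvec : (geodesicFlow t (g • base)).vec = (Real.exp t : ℝ) * Complex.I /
      ((g 1 0 : ℂ) * ((Real.exp t : ℝ) * Complex.I) + (g 1 1 : ℂ)) ^ 2 := by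
    have h : Real.exp t = Real.exp (t / 2) * Real.exp (t / 2) := by
      rw [← Real.exp_add]; ring_nf
    rw [geodesicFlow_smul_base, mul_smul, smul_vec, smul_pt, mobDenom, coe_geoMat_smul]
    congr 1
    rw [h, smul_vec]
    simp [geoMat, mobDenom, base, Complex.exp_neg]
    ring
  have he : HasDerivAt (fun s : ℝ => ((Real.exp s : ℝ) : ℂ) * Complex.I)
      (((Real.exp t : ℝ) : ℂ) * Complex.I) t :=
    (Real.hasDerivAt_exp t).ofReal_comp.mul_const _
  rw [hfun, hvec]
  refine (((he.const_mul _).add_const _).div ((he.const_mul _).add_const _) hden).congr_deriv ?_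
  congr 1
  linear_combination ((Real.exp t : ℝ) * Complex.I) * hdet

/-- The flow rotating every unit tangent vector by the angle `θ` in its tangent plane. -/
def rotate (θ : ℝ) (p : UnitTangent) : UnitTangent :=
  ⟨p.pt, Complex.exp (θ * Complex.I) * p.vec, by
    rw [norm_mul, Complex.norm_exp_ofReal_mul_I, one_mul, p.norm_vec]⟩

theorem rotate_smul (θ : ℝ) (g : SL2R) (p : UnitTangent) :
    rotate θ (g • p) = g • rotate θ p := by
  apply UnitTangent.ext
  · rfl
  · simp [rotate, mul_div_assoc]

end UnitTangent

/-! ### Closed hyperbolic surfaces and their unit tangent bundles -/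

/-- `Γ \ ℍ` is a closed (connected, oriented) hyperbolic surface: `Γ` is discrete, an element of `Γ`
with a fixed point in the hyperbolic plane acts as the identity, and the quotient is compact.
(The matrix `-1`, which acts trivially, may or may not belong to `Γ`.) -/
structure IsClosedSurfaceGroup (Γ : Subgroup SL2R) : Prop where
  discrete : DiscreteTopology Γ
  free : ∀ g ∈ Γ, ∀ z : UpperHalfPlane, g • z = z → ∀ w : UpperHalfPlane, g • w = w
  cocompact : CompactSpace (MulAction.orbitRel.Quotient Γ UpperHalfPlane)

/-- The unit tangent bundle `T¹S` of the surface `S = Γ \ ℍ`, with the quotient topology. -/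
abbrev T1S (Γ : Subgroup SL2R) : Type := MulAction.orbitRel.Quotient Γ UnitTangent

/-- The model of the tangent spaces of `T¹S`. Coordinates `0, 1, 2` refer to the frame `Z, Y, K` of
`T¹S` consisting of the geodesic vector field `Z`, the horizontal vector field `Y` perpendicular to
it, and the vertical vector field `K`. This frame is invariant under isometries, so it trivializes
the tangent bundle of `T¹S`; the Riemannian metric of `T¹S` is the one in which it is orthonormal
(the Sasaki metric), so that the norm of a tangent vector is the Euclidean norm of its coordinates. -/
abbrev V3 : Type := EuclideanSpace ℝ (Fin 3)

namespace T1S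

variable {Γ : Subgroup SL2R}

/-- The geodesic flow of the surface. -/
def geodesicFlow (t : ℝ) : T1S Γ → T1S Γ :=
  Quotient.map (UnitTangent.geodesicFlow t) (by
    rintro p q ⟨g, rfl⟩
    exact ⟨g, (UnitTangent.geodesicFlow_smul t g q).symm⟩)

/-- Rotation of unit tangent vectors by the angle `θ`. -/
def rotate (θ : ℝ) : T1S Γ → T1S Γ :=
  Quotient.map (UnitTangent.rotate θ) (by
    rintro p q ⟨g, rfl⟩
    exact ⟨g, (UnitTangent.rotate_smul θ g q).symm⟩)

/-- The flow that transports a unit tangent vector in parallel along the geodesic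
perpendicular to it. -/
def sideFlow (t : ℝ) (x : T1S Γ) : T1S Γ :=
  rotate (-(π / 2)) (geodesicFlow t (rotate (π / 2) x))

/-- The parametrization of `T¹S` near `x` by the tangent space at `x`: follow the flows of
`Z`, `Y` and `K` for the times `v 0`, `v 1` and `v 2`. It is smooth, takes `0` to `x`, and its
derivative at `0` takes the standard basis to `Z x, Y x, K x`. -/
def param (x : T1S Γ) (v : V3) : T1S Γ :=
  rotate (v 2) (sideFlow (v 1) (geodesicFlow (v 0) x))

/-- `L` is the derivative at `p` of a map `c` from a normed space `F` to `T¹S`, as a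
linear map from `F` to the tangent space of `T¹S` at `c p`: in the parametrization around `c p`,
`c (p + h)` is `L h + o(h)`. -/
def HasDeriv {F : Type*} [NormedAddCommGroup F] [NormedSpace ℝ F]
    (c : F → T1S Γ) (L : F →L[ℝ] V3) (p : F) : Prop :=
  ∃ r : F → V3, r =o[𝓝 0] (fun h => h) ∧
    ∀ᶠ h in 𝓝 (0 : F), c (p + h) = param (c p) (L h + r h)

/-- `v` is the velocity at time `t` of the curve `c` in `T¹S`. -/
def HasVelocity (c : ℝ → T1S Γ) (v : V3) (t : ℝ) : Prop :=
  HasDeriv c (ContinuousLinearMap.toSpanSingleton ℝ v) t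

/-- `L` is the derivative at `x` of a map `f` from `T¹S` to itself, as a linear map from
the tangent space at `x` to the tangent space at `f x`. -/
def HasTangentMap (f : T1S Γ → T1S Γ) (L : V3 →L[ℝ] V3) (x : T1S Γ) : Prop :=
  HasDeriv (fun v => f (param x v)) L 0

/-- The Riemannian distance on `T¹S`: the infimum of the lengths of `C¹` curves. -/
def rdist (x y : T1S Γ) : ℝ :=
  sInf {l : ℝ | ∃ (c : ℝ → T1S Γ) (v : ℝ → V3), Continuous v ∧ (∀ t, HasVelocity c (v t) t) ∧
    c 0 = x ∧ c 1 = y ∧ l = ∫ t in (0 : ℝ)..1, ‖v t‖}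

/-- The vector field `Z` generating the geodesic flow (in the frame it is constant). -/
def geodesicField (_x : T1S Γ) : V3 := EuclideanSpace.single 0 1

/-- The strong stable bundle of the geodesic flow `G`: the tangent vectors that are contracted to
`0` by the derivative of `G t` as `t → +∞`. -/
def geodesicStable (x : T1S Γ) : Set V3 :=
  {v | ∃ L : ℝ → (V3 →L[ℝ] V3), (∀ t, HasTangentMap (geodesicFlow t) (L t) x) ∧
    Tendsto (fun t => L t v) atTop (𝓝 0)}

/-- The strong unstable bundle of the geodesic flow `G`: the tangent vectors that are contracted to
`0` by the derivative of `G t` as `t → -∞`. -/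
def geodesicUnstable (x : T1S Γ) : Set V3 :=
  {v | ∃ L : ℝ → (V3 →L[ℝ] V3), (∀ t, HasTangentMap (geodesicFlow t) (L t) x) ∧
    Tendsto (fun t => L t v) atBot (𝓝 0)}

/-- The center bundle of the geodesic flow: the line spanned by `Z`. -/
def geodesicCenter (x : T1S Γ) : Set V3 :=
  (Submodule.span ℝ {geodesicField x} : Submodule ℝ V3)

/-- Two sets of tangent vectors at a point (linear subspaces in the applications) are `δ`-close:
their unit vectors are within Hausdorff distance `δ`. -/
def SubspacesClose (δ : ℝ) (E F : Set V3) : Prop :=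
  (∀ v ∈ E, ‖v‖ = 1 → ∃ w ∈ F, ‖w‖ = 1 ∧ ‖v - w‖ ≤ δ) ∧
    ∀ w ∈ F, ‖w‖ = 1 → ∃ v ∈ E, ‖v‖ = 1 ∧ ‖v - w‖ ≤ δ

/-! ### Partially hyperbolic diffeomorphisms -/

/-- `f` is a `C¹` diffeomorphism of `T¹S` with derivative `Df`. -/
structure IsC1Diffeo (f : T1S Γ ≃ₜ T1S Γ) (Df : T1S Γ → (V3 ≃L[ℝ] V3)) : Prop where
  hasTangentMap : ∀ x, HasTangentMap f (Df x : V3 →L[ℝ] V3) x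
  continuous_deriv : Continuous fun x => (Df x : V3 →L[ℝ] V3)

/-- The derivative of the iterate `f^n` at `x`, by the chain rule. -/
def iterDeriv (f : T1S Γ ≃ₜ T1S Γ) (Df : T1S Γ → (V3 ≃L[ℝ] V3)) : ℕ → T1S Γ → (V3 →L[ℝ] V3)
  | 0, _ => ContinuousLinearMap.id ℝ V3
  | n + 1, x => (iterDeriv f Df n (f x)).comp (Df x : V3 →L[ℝ] V3)

/-- A `Df`-invariant continuous subbundle of the tangent bundle, with nonzero fibers. (The tangent
bundle being trivialized, a family of subspaces is continuous when the orthogonal projections to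
them are.) -/
structure IsInvariantSubbundle (f : T1S Γ ≃ₜ T1S Γ) (Df : T1S Γ → (V3 ≃L[ℝ] V3))
    (E : T1S Γ → Submodule ℝ V3) : Prop where
  nontrivial : ∀ x, E x ≠ ⊥
  continuous : Continuous fun x => (E x).starProjection
  invariant : ∀ x, (E x).map ((Df x : V3 →L[ℝ] V3) : V3 →ₗ[ℝ] V3) = E (f x)

/-- `f` is a partially hyperbolic diffeomorphism with derivative `Df` and splitting
`Es ⊕ Ec ⊕ Eu`. -/
structure IsPartiallyHyperbolic (f : T1S Γ ≃ₜ T1S Γ) (Df : T1S Γ → (V3 ≃L[ℝ] V3))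
    (Es Ec Eu : T1S Γ → Submodule ℝ V3) : Prop where
  isC1Diffeo : IsC1Diffeo f Df
  stable : IsInvariantSubbundle f Df Es
  center : IsInvariantSubbundle f Df Ec
  unstable : IsInvariantSubbundle f Df Eu
  splitting : ∀ x, DirectSum.IsInternal ![Es x, Ec x, Eu x]
  domination : ∃ l : ℕ, 0 < l ∧ ∀ x, ∀ vs ∈ Es x, ∀ vc ∈ Ec x, ∀ vu ∈ Eu x,
    ‖vs‖ = 1 → ‖vc‖ = 1 → ‖vu‖ = 1 →
      ‖iterDeriv f Df l x vs‖ < min 1 ‖iterDeriv f Df l x vc‖ ∧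
        max 1 ‖iterDeriv f Df l x vc‖ < ‖iterDeriv f Df l x vu‖

/-! ### Foliations and dynamical coherence -/

variable (Γ) in
/-- A (topological) foliation of `T¹S` by surfaces, given by an atlas of foliation charts. The
plaques of a chart `e` are the sets where the last coordinate of `e` is a given constant. -/
structure SurfaceFoliation where
  atlas : Set (OpenPartialHomeomorph (T1S Γ) ((ℝ × ℝ) × ℝ))
  target_eq : ∀ e ∈ atlas, e.target = Set.univ
  cover : ∀ x, ∃ e ∈ atlas, x ∈ e.source
  /-- Near every common point of two charts, points in the same plaque of one chart are in the
  same plaque of the other. -/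
  compatible : ∀ e ∈ atlas, ∀ e' ∈ atlas, ∀ x ∈ e.source ∩ e'.source,
    ∃ U ∈ 𝓝 x, U ⊆ e.source ∩ e'.source ∧
      ∀ y ∈ U, ∀ y' ∈ U, (e y).2 = (e y').2 → (e' y).2 = (e' y').2

namespace SurfaceFoliation

/-- A curve that stays in a leaf and is continuous in the leaf: it is continuous and locally
contained in a plaque. -/
def IsLeafCurve (W : SurfaceFoliation Γ) (c : ℝ → T1S Γ) : Prop :=
  Continuous c ∧ ∀ t, ∃ e ∈ W.atlas, c t ∈ e.source ∧
    ∀ᶠ s in 𝓝 t, c s ∈ e.source ∧ (e (c s)).2 = (e (c t)).2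

/-- The leaf through `x`. -/
def leaf (W : SurfaceFoliation Γ) (x : T1S Γ) : Set (T1S Γ) :=
  {y | ∃ c : ℝ → T1S Γ, W.IsLeafCurve c ∧ c 0 = x ∧ c 1 = y}

/-- The leaves are `C¹` immersed surfaces tangent to the plane field `P`. -/
def IsTangentTo (W : SurfaceFoliation Γ) (P : T1S Γ → Submodule ℝ V3) : Prop :=
  ∀ e ∈ W.atlas, ∀ a : ℝ, ∃ L : ℝ × ℝ → (ℝ × ℝ →L[ℝ] V3), Continuous L ∧
    ∀ u, HasDeriv (fun u => e.symm (u, a)) (L u) u ∧ Function.Injective (L u) ∧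
      LinearMap.range (L u : ℝ × ℝ →ₗ[ℝ] V3) = P (e.symm (u, a))

/-- `f` takes leaves to leaves. -/
def IsInvariant (W : SurfaceFoliation Γ) (f : T1S Γ ≃ₜ T1S Γ) : Prop :=
  ∀ x, f '' W.leaf x = W.leaf (f x)

end SurfaceFoliation

/-- The partially hyperbolic diffeomorphism `f` with splitting `Es ⊕ Ec ⊕ Eu` is dynamically
coherent, as witnessed by the invariant foliations `Wcs` tangent to `Es ⊕ Ec` and `Wcu` tangent to
`Ec ⊕ Eu`. -/
structure IsDynamicallyCoherent (f : T1S Γ ≃ₜ T1S Γ) (Es Ec Eu : T1S Γ → Submodule ℝ V3)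
    (Wcs Wcu : SurfaceFoliation Γ) : Prop where
  invariant_cs : Wcs.IsInvariant f
  invariant_cu : Wcu.IsInvariant f
  tangent_cs : Wcs.IsTangentTo fun x => Es x ⊔ Ec x
  tangent_cu : Wcu.IsTangentTo fun x => Ec x ⊔ Eu x

/-- The leaf through `x` of the center foliation, the intersection of `Wcs` and `Wcu`: the points
that can be joined to `x` by a curve that lies in a leaf of `Wcs` and in a leaf of `Wcu`. -/
def centerLeaf (Wcs Wcu : SurfaceFoliation Γ) (x : T1S Γ) : Set (T1S Γ) :=
  {y | ∃ c : ℝ → T1S Γ, Wcs.IsLeafCurve c ∧ Wcu.IsLeafCurve c ∧ c 0 = x ∧ c 1 = y}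

/-- `c` is a center leaf, parametrized as a curve tangent to the vector field `X`. -/
structure IsCenterLeaf (Wcs Wcu : SurfaceFoliation Γ) (X : T1S Γ → V3) (c : ℝ → T1S Γ) :
    Prop where
  hasVelocity : ∀ t, HasVelocity c (X (c t)) t
  leafCurve_cs : Wcs.IsLeafCurve c
  leafCurve_cu : Wcu.IsLeafCurve c
  range_eq : Set.range c = centerLeaf Wcs Wcu (c 0)

/-- The continuous vector field `X` orients the line field `Ec`. -/
structure Orients (X : T1S Γ → V3) (Ec : T1S Γ → Submodule ℝ V3) : Prop where
  continuous : Continuous X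
  mem : ∀ x, X x ∈ Ec x
  ne_zero : ∀ x, X x ≠ 0

/-! ### Shadowing -/

/-- The curve `c` is `ε`-shadowed by the orbit of `x` under the geodesic flow. -/
def IsShadowedBy (ε : ℝ) (c : ℝ → T1S Γ) (x : T1S Γ) : Prop :=
  ∃ s s' : ℝ → ℝ, (∀ t, HasDerivAt s (s' t) t ∧ |s' t - 1| ≤ ε) ∧
    ∀ t, rdist (c (s t)) (geodesicFlow t x) ≤ ε

/-- The orbit of `x` under the geodesic flow. -/
def orbit (x : T1S Γ) : Set (T1S Γ) := Set.range fun t : ℝ => geodesicFlow t x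

end T1S

end

/-! The map `proj` presents T¹S as the quotient of SL(2, ℝ) by the discrete group `signedGroup Γ`
and is a covering, so curves are studied upstairs. There the geodesic flow is right multiplication
by `geoMat t`, and a velocity is a traceless matrix whose coefficients `matD`, `matU`, `matL`
measure the flow, stable and unstable directions.

Existence of a shadow. A lifted center leaf solves g' = gM with M close to a multiple of diag(1,
-1). An indefinite quadratic form increases along every combination of the rows of g, so by
compactness some combination stays in the contracted cone for all times; reversing time gives a
second one. Taken as the rows of h⁻¹, they keep h⁻¹g in a thin tube around the diagonal geodesic
(`exists_solution_in_cone`, `exists_geodesic_near`, `exists_tube`).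

Uniqueness of the shadow. Two lifted geodesics at bounded distance for all times coincide up to sign
(`eq_geoMat_of_bounded`). Smallness of ε serves only to make the deck transformation relating the
lifts independent of time (`exists_shadow_unique`).

Different leaves have different shadows. Suppose two center curves lie in the tube of one geodesic,
with coordinates (t, x, y). The center-stable leaf of the first is a graph y = G(t, x), the
center-unstable leaf of the second is a graph x = G'(t, y), and the graphs meet in a third center
curve. If the first and the third differ, the strip between them in the center-stable leaf is filled
with center curves, because the center-unstable foliation traces a foliation on the strip
(`IsTube.exists_between`). Apply an iterate of f⁻¹ that expands E^s by a large factor K. The images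
of the center curves are still tangent to E^c and at bounded distance from each other, so they all
lie in the tube of one geodesic, of a width independent of K (`exists_coord_bound`). But an arc
across the strip is stretched by a factor proportional to K in the stable coordinate, which is
impossible for large K (`arc_length_le`, `IsTube.not_lt`). So the first curve meets the third at
time 0, and the second does too, by the same argument with f in place of f⁻¹ (`center_curves_eq`).
Center leaves with a common point are equal.

Nothing here solves a differential equation for the center direction, which is only continuous; the
charts of the two foliations provide both existence and uniqueness of curves. -/

noncomputable section

/-! ### T¹S as a quotient of SL(2, ℝ) by a discrete group. -/

namespace UnitTangent

theorem continuous_iff {A : Type*} [TopologicalSpace A] {f : A → UnitTangent} :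
    Continuous f ↔ Continuous (fun a => (f a).pt) ∧ Continuous (fun a => (f a).vec) := by
  rw [continuous_induced_rng]
  exact continuous_prodMk

theorem continuous_pt : Continuous UnitTangent.pt := (continuous_iff.1 continuous_id).1

theorem continuous_vec : Continuous UnitTangent.vec := (continuous_iff.1 continuous_id).2

theorem continuous_mobDenom : Continuous fun x : SL2R × UpperHalfPlane => mobDenom x.1 x.2 := by
  have h (i j : Fin 2) : Continuous fun x : SL2R × UpperHalfPlane => x.1 i j :=
    (continuous_apply j).comp
      (Matrix.SpecialLinearGroup.continuous_apply _ continuous_fst i)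
  unfold mobDenom
  exact (((Complex.continuous_ofReal.comp (h 1 0)).mul
    (UpperHalfPlane.continuous_coe.comp continuous_snd))).add
    (Complex.continuous_ofReal.comp (h 1 1))

instance : ContinuousSMul SL2R UnitTangent where
  continuous_smul := by
    refine continuous_iff.2 ⟨?_, ?_⟩
    · simp only [smul_pt]
      exact continuous_fst.smul (continuous_pt.comp continuous_snd)
    · simp only [smul_vec]
      refine (continuous_vec.comp continuous_snd).div
        ((continuous_mobDenom.comp (continuous_fst.prodMk
          (continuous_pt.comp continuous_snd))).pow 2) ?_
      intro x
      exact pow_ne_zero 2 (mobDenom_ne_zero _ _)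

instance : T2Space UnitTangent :=
  T2Space.of_injective_continuous (f := fun p : UnitTangent => (p.pt, p.vec))
    (fun p q h => by
      simp only [Prod.mk.injEq] at h
      exact UnitTangent.ext h.1 h.2)
    (continuous_pt.prodMk continuous_vec)

/-- Followed by the base point map, the orbit map becomes `g ↦ g • I`, which is proper. Hence the
orbit map is itself proper, so closed, and being surjective it is a quotient map. -/
theorem isQuotientMap_smul_base : IsQuotientMap fun g : SL2R => g • base := by
  have hc : Continuous fun g : SL2R => g • base := continuous_id.smul continuous_const
  have hp : IsProperMap fun g : SL2R => g • base :=
    isProperMap_of_comp_of_t2 hc continuous_pt UpperHalfPlane.isProperMap_smul_I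
  exact hp.isClosedMap.isQuotientMap hc fun p => p.exists_smul_base

end UnitTangent

/-- The group generated by `Γ` and `-1`. -/
def signedGroup (Γ : Subgroup SL2R) : Subgroup SL2R where
  carrier := {g | g ∈ Γ ∨ -g ∈ Γ}
  one_mem' := Or.inl Γ.one_mem
  mul_mem' := by
    rintro a b (ha | ha) (hb | hb)
    · exact Or.inl (Γ.mul_mem ha hb)
    · exact Or.inr (by simpa using Γ.mul_mem ha hb)
    · exact Or.inr (by simpa using Γ.mul_mem ha hb)
    · exact Or.inl (by simpa using Γ.mul_mem ha hb)
  inv_mem' := by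
    rintro a (ha | ha)
    · exact Or.inl (Γ.inv_mem ha)
    · exact Or.inr (by simpa using Γ.inv_mem ha)

theorem mem_signedGroup_of_mem {Γ : Subgroup SL2R} {g : SL2R} (hg : g ∈ Γ) :
    g ∈ signedGroup Γ := Or.inl hg

/-- Two elements of `-Γ` near 1 have a quotient in `Γ` near 1, hence coincide. So at most one
element of `-Γ` lies near 1, and if it is not 1 a smaller neighbourhood avoids it. -/
theorem isDiscrete_signedGroup {Γ : Subgroup SL2R} (hΓ : IsClosedSurfaceGroup Γ) :
    ∃ V ∈ 𝓝 (1 : SL2R), ∀ g ∈ signedGroup Γ, g ∈ V → g = 1 := by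
  have hd := hΓ.discrete
  obtain ⟨V, hV, hV1⟩ : ∃ V ∈ 𝓝 (1 : SL2R), ∀ g ∈ Γ, g ∈ V → g = 1 := by
    have h1 : ({1} : Set Γ) ∈ 𝓝 (1 : Γ) := (isOpen_discrete _).mem_nhds rfl
    rw [nhds_subtype_eq_comap] at h1
    obtain ⟨V, hV, h⟩ := h1
    refine ⟨V, hV, fun g hg hgV => ?_⟩
    have : (⟨g, hg⟩ : Γ) ∈ ({1} : Set Γ) := h hgV
    simpa using this
  have hdiv : Tendsto (fun p : SL2R × SL2R => p.1⁻¹ * p.2) (𝓝 (1, 1)) (𝓝 1) := by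
    have : Continuous fun p : SL2R × SL2R => p.1⁻¹ * p.2 := by fun_prop
    simpa using this.tendsto (1, 1)
  have h2 := hdiv hV
  rw [nhds_prod_eq] at h2
  obtain ⟨W, hW, W', hW', hWW⟩ := Filter.mem_prod_iff.1 h2
  have huniq : ∀ g g' : SL2R, -g ∈ Γ → -g' ∈ Γ → g ∈ W ∩ W' → g' ∈ W ∩ W' → g = g' := by
    intro g g' hg hg' h h'
    have h3 : g⁻¹ * g' ∈ Γ := by simpa using Γ.mul_mem (Γ.inv_mem hg) hg'
    have h4 : g⁻¹ * g' ∈ V := @hWW (g, g') (Set.mk_mem_prod h.1 h'.2)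
    exact (inv_mul_eq_one.1 (hV1 _ h3 h4))
  by_cases hex : ∃ g : SL2R, -g ∈ Γ ∧ g ∈ W ∩ W' ∧ g ≠ 1
  · obtain ⟨g, hg, hgW, hg1⟩ := hex
    refine ⟨V ∩ (W ∩ W') ∩ {g}ᶜ, inter_mem (inter_mem hV (inter_mem hW hW'))
      (isOpen_compl_singleton.mem_nhds (Ne.symm hg1)), ?_⟩
    rintro k (hk | hk) hkV
    · exact hV1 k hk hkV.1.1
    · exact absurd (huniq k g hk hg hkV.1.2 hgW) hkV.2
  · push Not at hex
    refine ⟨V ∩ (W ∩ W'), inter_mem hV (inter_mem hW hW'), ?_⟩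
    rintro k (hk | hk) hkV
    · exact hV1 k hk hkV.1
    · exact hex k hk hkV.2

theorem isDiscrete_coe_signedGroup {Γ : Subgroup SL2R} (hΓ : IsClosedSurfaceGroup Γ) :
    IsDiscrete (signedGroup Γ : Set SL2R) := by
  obtain ⟨V, hV, hV1⟩ := isDiscrete_signedGroup hΓ
  have : DiscreteTopology (signedGroup Γ) := by
    refine discreteTopology_of_isOpen_singleton_one ?_
    rw [isOpen_singleton_iff_nhds_eq_pure]
    refine le_antisymm (le_pure_iff.2 ?_) (pure_le_nhds _)
    rw [nhds_subtype_eq_comap]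
    exact ⟨V, hV, fun g hg => Subtype.ext (hV1 g g.2 hg)⟩
  exact ⟨this⟩

namespace T1S

/-- The point of `T¹S` represented by the image of the upward vector at `i` under `g`. -/
def proj (Γ : Subgroup SL2R) (g : SL2R) : T1S Γ := Quotient.mk _ (g • UnitTangent.base)

variable {Γ : Subgroup SL2R}

theorem proj_surjective : Function.Surjective (proj Γ) := by
  intro x
  obtain ⟨p, rfl⟩ := Quotient.exists_rep x
  obtain ⟨g, rfl⟩ := p.exists_smul_base
  exact ⟨g, rfl⟩

/-- The stabilizer of the base vector is {1, -1}. Enlarging Γ by -1 absorbs it, so that the fibres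
of `proj` are orbits of a group acting freely by left multiplication. -/
theorem proj_eq_iff {g h : SL2R} : proj Γ g = proj Γ h ↔ ∃ γ ∈ signedGroup Γ, h = γ * g := by
  have h1 : proj Γ g = proj Γ h ↔ ∃ γ : Γ, γ • (h • UnitTangent.base) = g • UnitTangent.base := by
    rw [proj, proj, Quotient.eq]
    rfl
  rw [h1]
  constructor
  · rintro ⟨γ, hγ⟩
    have h2 : (γ * h : SL2R) • UnitTangent.base = g • UnitTangent.base := by
      rw [mul_smul]; exact hγ
    rcases (UnitTangent.smul_base_eq_iff _ _).1 h2 with h3 | h3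
    · exact ⟨(γ : SL2R)⁻¹, Or.inl (Γ.inv_mem γ.2), by rw [h3]; group⟩
    · refine ⟨-(γ : SL2R)⁻¹, Or.inr (by simp), ?_⟩
      rw [h3]; simp
  · rintro ⟨γ, hγ | hγ, rfl⟩
    · exact ⟨⟨γ⁻¹, Γ.inv_mem hγ⟩, by
        change γ⁻¹ • ((γ * g) • UnitTangent.base) = _
        rw [← mul_smul]; simp⟩
    · refine ⟨⟨(-γ)⁻¹, Γ.inv_mem hγ⟩, ?_⟩
      change (-γ)⁻¹ • ((γ * g) • UnitTangent.base) = _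
      rw [← mul_smul, UnitTangent.smul_base_eq_iff]
      right
      simp

theorem proj_mul_left {γ : SL2R} (hγ : γ ∈ signedGroup Γ) (g : SL2R) :
    proj Γ (γ * g) = proj Γ g := (proj_eq_iff.2 ⟨γ, hγ, rfl⟩).symm

theorem proj_neg (g : SL2R) : proj Γ (-g) = proj Γ g := by
  have h := proj_mul_left (Γ := Γ) (γ := -1) (Or.inr (by simp)) g
  rwa [neg_mul, one_mul] at h

theorem isQuotientMap_proj : IsQuotientMap (proj Γ) :=
  (isQuotientMap_quotient_mk' (s := MulAction.orbitRel Γ UnitTangent)).comp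
    UnitTangent.isQuotientMap_smul_base

theorem continuous_proj : Continuous (proj Γ) := isQuotientMap_proj.continuous

theorem isQuotientCoveringMap_proj (hΓ : IsClosedSurfaceGroup Γ) :
    IsQuotientCoveringMap (proj Γ) (signedGroup Γ) :=
  isQuotientMap_proj.isQuotientCoveringMap_of_subgroup _ (isDiscrete_coe_signedGroup hΓ) (by
    intro g h
    rw [proj_eq_iff]
    constructor
    · rintro ⟨γ, hγ, rfl⟩; simpa using hγ
    · intro hh; exact ⟨_, hh, by simp⟩)

theorem isCoveringMap_proj (hΓ : IsClosedSurfaceGroup Γ) : IsCoveringMap (proj Γ) :=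
  (isQuotientCoveringMap_proj hΓ).isCoveringMap

/-- Some compact set of `SL(2, ℝ)` covers `T¹S`. -/
theorem exists_isCompact_proj_image (hΓ : IsClosedSurfaceGroup Γ) :
    ∃ K : Set SL2R, IsCompact K ∧ proj Γ '' K = Set.univ := by
  have := hΓ.cocompact
  have hopen : IsOpenQuotientMap
      (Quotient.mk (MulAction.orbitRel Γ UpperHalfPlane)) :=
    MulAction.isOpenQuotientMap_quotientMk
  obtain ⟨B, hB, hBc⟩ : ∃ B : Set UpperHalfPlane, IsCompact B ∧
      (Quotient.mk (MulAction.orbitRel Γ UpperHalfPlane)) '' B = Set.univ := by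
    obtain ⟨s, hs⟩ := isCompact_univ.elim_finite_subcover
      (fun n : ℕ => (Quotient.mk (MulAction.orbitRel Γ UpperHalfPlane)) ''
        (Metric.ball UpperHalfPlane.I n))
      (fun n => hopen.isOpenMap _ Metric.isOpen_ball) (by
        intro x _
        obtain ⟨z, rfl⟩ := Quotient.exists_rep x
        obtain ⟨n, hn⟩ := exists_nat_gt (dist z UpperHalfPlane.I)
        exact Set.mem_iUnion.2 ⟨n, z, hn, rfl⟩)
    refine ⟨⋃ n ∈ s, Metric.closedBall UpperHalfPlane.I n,
      s.isCompact_biUnion fun n _ => isCompact_closedBall _ _, ?_⟩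
    refine Set.eq_univ_of_univ_subset (hs.trans ?_)
    rw [Set.image_iUnion₂]
    exact Set.iUnion₂_mono fun n _ => Set.image_mono Metric.ball_subset_closedBall
  -- Properness of `g ↦ g • I` turns a compact set of points into a compact set of matrices.
  refine ⟨(fun g : SL2R => g • UpperHalfPlane.I) ⁻¹' B,
    UpperHalfPlane.isProperMap_smul_I.isCompact_preimage hB, ?_⟩
  refine Set.eq_univ_of_forall fun x => ?_
  obtain ⟨g, rfl⟩ := proj_surjective x
  have : (Quotient.mk (MulAction.orbitRel Γ UpperHalfPlane)) (g • UpperHalfPlane.I) ∈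
      (Quotient.mk (MulAction.orbitRel Γ UpperHalfPlane)) '' B := hBc ▸ Set.mem_univ _
  obtain ⟨z, hz, he⟩ := this
  obtain ⟨γ, hγ⟩ := Quotient.exact he
  refine ⟨γ * g, ?_, proj_mul_left (mem_signedGroup_of_mem γ.2) g⟩
  change (γ * g : SL2R) • UpperHalfPlane.I ∈ B
  rw [mul_smul]
  have h2 : (γ : SL2R) • (g • UpperHalfPlane.I) = z := hγ
  rwa [h2]

theorem compactSpace (hΓ : IsClosedSurfaceGroup Γ) : CompactSpace (T1S Γ) := by
  obtain ⟨K, hK, h⟩ := exists_isCompact_proj_image hΓ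
  exact ⟨h ▸ hK.image continuous_proj⟩

/-- The injectivity radius of `T¹S` is positive. -/
theorem exists_nhds_one_conj (hΓ : IsClosedSurfaceGroup Γ) :
    ∃ U ∈ 𝓝 (1 : SL2R), ∀ g : SL2R, ∀ γ ∈ signedGroup Γ, g⁻¹ * γ * g ∈ U → γ = 1 := by
  obtain ⟨K, hK, hKc⟩ := exists_isCompact_proj_image hΓ
  obtain ⟨V, hV, hV1⟩ := isDiscrete_signedGroup hΓ
  have hloc : ∀ k ∈ K, ∃ N ∈ 𝓝 k, ∃ U ∈ 𝓝 (1 : SL2R), ∀ g ∈ N, ∀ u ∈ U, g * u * g⁻¹ ∈ V := by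
    intro k _
    have hc : Continuous fun p : SL2R × SL2R => p.1 * p.2 * p.1⁻¹ := by fun_prop
    have h1 : Tendsto (fun p : SL2R × SL2R => p.1 * p.2 * p.1⁻¹) (𝓝 (k, 1)) (𝓝 1) := by
      simpa using hc.tendsto (k, 1)
    have h2 := h1 hV
    rw [nhds_prod_eq] at h2
    obtain ⟨N, hN, U, hU, h3⟩ := Filter.mem_prod_iff.1 h2
    exact ⟨N, hN, U, hU, fun g hg u hu => @h3 (g, u) (Set.mk_mem_prod hg hu)⟩
  choose! N hN U hU hNU using hloc
  obtain ⟨s, hsK, hs⟩ := hK.elim_nhds_subcover N hN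
  refine ⟨⋂ k ∈ s, U k, (Filter.biInter_finset_mem s).2 fun k hk => hU k (hsK k hk), ?_⟩
  intro g γ hγ hg
  -- Multiplying `g` on the left by an element of `signedGroup Γ` replaces γ by a conjugate in that
  -- group, so `g` may be moved into `K`, where the neighbourhoods are uniform.
  have hgK : proj Γ g ∈ proj Γ '' K := hKc ▸ Set.mem_univ _
  obtain ⟨k, hk, he⟩ := hgK
  obtain ⟨β, hβ, rfl⟩ := proj_eq_iff.1 he
  obtain ⟨k', hk', hkk'⟩ := Set.mem_iUnion₂.1 (hs hk)
  have h1 := hNU k' (hsK k' hk') k hkk' _ (Set.mem_iInter₂.1 hg k' hk')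
  have h2 : k * ((β * k)⁻¹ * γ * (β * k)) * k⁻¹ = β⁻¹ * γ * β := by group
  rw [h2] at h1
  have h3 := hV1 _ (Subgroup.mul_mem _ (Subgroup.mul_mem _ (Subgroup.inv_mem _ hβ) hγ) hβ) h1
  have h4 : γ = β * (β⁻¹ * γ * β) * β⁻¹ := by group
  rw [h4, h3]; group

theorem geodesicFlow_proj (t : ℝ) (g : SL2R) :
    geodesicFlow t (proj Γ g) = proj Γ (g * UnitTangent.geoMat t) :=
  congrArg (Quotient.mk _) (UnitTangent.geodesicFlow_smul_base t g)

end T1S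

end

noncomputable section

/-! ### One-parameter groups representing the frame -/

theorem SL2R.mul_entry (g h : SL2R) (i j : Fin 2) :
    (g * h) i j = g i 0 * h 0 j + g i 1 * h 1 j := by
  rw [Matrix.SpecialLinearGroup.coe_mul, Matrix.mul_apply, Fin.sum_univ_two]

theorem UnitTangent.geoMat_entries (t : ℝ) : geoMat t 0 0 = Real.exp (t / 2) ∧ geoMat t 0 1 = 0 ∧
    geoMat t 1 0 = 0 ∧ geoMat t 1 1 = Real.exp (-(t / 2)) := ⟨rfl, rfl, rfl, rfl⟩

/-- Right multiplication by this matrix rotates unit tangent vectors by `θ`. -/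
def rotMat (θ : ℝ) : SL2R :=
  ⟨!![Real.cos (θ / 2), Real.sin (θ / 2); -Real.sin (θ / 2), Real.cos (θ / 2)], by
    rw [Matrix.det_fin_two_of]
    linear_combination Real.sin_sq_add_cos_sq (θ / 2)⟩

/-- Right multiplication by this matrix is the flow of the frame field `Y`. -/
def sideMat (t : ℝ) : SL2R :=
  ⟨!![Real.cosh (t / 2), -Real.sinh (t / 2); -Real.sinh (t / 2), Real.cosh (t / 2)], by
    rw [Matrix.det_fin_two_of]
    linear_combination Real.cosh_sq (t / 2)⟩

theorem rotMat_entries (θ : ℝ) : rotMat θ 0 0 = Real.cos (θ / 2) ∧ rotMat θ 0 1 = Real.sin (θ / 2) ∧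
    rotMat θ 1 0 = -Real.sin (θ / 2) ∧ rotMat θ 1 1 = Real.cos (θ / 2) := ⟨rfl, rfl, rfl, rfl⟩

theorem sideMat_entries (t : ℝ) : sideMat t 0 0 = Real.cosh (t / 2) ∧
    sideMat t 0 1 = -Real.sinh (t / 2) ∧ sideMat t 1 0 = -Real.sinh (t / 2) ∧
    sideMat t 1 1 = Real.cosh (t / 2) := ⟨rfl, rfl, rfl, rfl⟩

/-- The flow of `Y` is that of `Z` conjugated by a quarter turn. This makes `sideFlow` right
multiplication by a one-parameter group, like the other two flows. -/
theorem rotMat_geoMat_rotMat (t : ℝ) :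
    rotMat (π / 2) * UnitTangent.geoMat t * rotMat (-(π / 2)) = sideMat t := by
  have h2 : (√2 / 2 * (√2 / 2) : ℝ) = 1 / 2 := by
    have := Real.mul_self_sqrt (show (0 : ℝ) ≤ 2 by norm_num)
    linear_combination this / 4
  have h3 : π / 2 / 2 = π / 4 := by ring
  have h4 : -(π / 2) / 2 = -(π / 4) := by ring
  have e1 := Real.cosh_eq (t / 2)
  have e2 := Real.sinh_eq (t / 2)
  have key : ∀ i j, (rotMat (π / 2) * UnitTangent.geoMat t * rotMat (-(π / 2))) i j =
      sideMat t i j := by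
    intro i j
    fin_cases i <;> fin_cases j <;>
      simp only [Fin.zero_eta, Fin.mk_one, SL2R.mul_entry, rotMat_entries, sideMat_entries,
        UnitTangent.geoMat_entries, h3, h4, Real.cos_neg, Real.sin_neg,
        Real.cos_pi_div_four, Real.sin_pi_div_four, e1, e2]
    · linear_combination (Real.exp (t / 2) + Real.exp (-(t / 2))) * h2
    · linear_combination (-Real.exp (t / 2) + Real.exp (-(t / 2))) * h2
    · linear_combination (-Real.exp (t / 2) + Real.exp (-(t / 2))) * h2
    · linear_combination (Real.exp (t / 2) + Real.exp (-(t / 2))) * h2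
  ext i j
  exact key i j

theorem rotate_base (θ : ℝ) : UnitTangent.rotate θ UnitTangent.base = rotMat θ • UnitTangent.base := by
  have hden : mobDenom (rotMat θ) UpperHalfPlane.I = Complex.exp (-((θ / 2 : ℝ) * Complex.I)) := by
    rw [← neg_mul, Complex.exp_mul_I, Complex.cos_neg, Complex.sin_neg]
    simp [mobDenom, rotMat]
    ring
  have hne : Complex.exp (-((θ / 2 : ℝ) * Complex.I)) ≠ 0 := Complex.exp_ne_zero _
  symm
  apply UnitTangent.ext
  · apply UpperHalfPlane.ext
    rw [UnitTangent.smul_pt, coe_smul_eq]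
    have hm := mobDenom_ne_zero (rotMat θ) UpperHalfPlane.I
    change _ / mobDenom _ UpperHalfPlane.I = Complex.I
    rw [div_eq_iff hm]
    simp [mobDenom, rotMat, UnitTangent.base]
    ring_nf
    simp
  · rw [UnitTangent.smul_vec]
    change Complex.I / mobDenom _ UpperHalfPlane.I ^ 2 = Complex.exp (θ * Complex.I) * Complex.I
    rw [hden, div_eq_iff (pow_ne_zero 2 hne), ← Complex.exp_nat_mul, mul_right_comm,
      ← Complex.exp_add]
    have : (θ : ℂ) * Complex.I + ((2 : ℕ) : ℂ) * (-((θ / 2 : ℝ) * Complex.I)) = 0 := by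
      push_cast; ring
    rw [this]; simp

/-- The diagonal coefficient of the matrix representing a tangent vector. -/
def matD : V3 →L[ℝ] ℝ := (1 / 2 : ℝ) • EuclideanSpace.proj 0

/-- The upper right coefficient of the matrix representing a tangent vector. -/
def matU : V3 →L[ℝ] ℝ := (1 / 2 : ℝ) • (EuclideanSpace.proj 2 - EuclideanSpace.proj 1)

/-- The lower left coefficient of the matrix representing a tangent vector. -/
def matL : V3 →L[ℝ] ℝ := (-(1 / 2) : ℝ) • (EuclideanSpace.proj 1 + EuclideanSpace.proj 2)

theorem matD_apply (v : V3) : matD v = v 0 / 2 := by simp [matD]; ring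
theorem matU_apply (v : V3) : matU v = (v 2 - v 1) / 2 := by simp [matU]; ring
theorem matL_apply (v : V3) : matL v = -(v 1 + v 2) / 2 := by simp [matL]; ring

/-- The tangent vector represented by a matrix with the given upper right, lower left and lower
right coefficients. -/
def matEquiv : V3 ≃L[ℝ] ℝ × ℝ × ℝ :=
  LinearEquiv.toContinuousLinearEquiv
    { toFun := fun v => (matU v, matL v, -matD v)
      invFun := fun w => !₂[-2 * w.2.2, -(w.1 + w.2.1), w.1 - w.2.1]
      map_add' := fun v w => by simp; ring
      map_smul' := fun r v => by simp
      left_inv := fun v => by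
        ext i
        fin_cases i <;> simp [matU_apply, matL_apply, matD_apply] <;> ring
      right_inv := fun w => by
        simp [matU_apply, matL_apply, matD_apply]
        ext <;> simp <;> ring }

theorem matEquiv_apply (v : V3) : matEquiv v = (matU v, matL v, -matD v) := rfl

/-- The parametrization of `SL(2, ℝ)` around `1` corresponding to `T1S.param`. -/
def paramMat (v : V3) : SL2R := UnitTangent.geoMat (v 0) * sideMat (v 1) * rotMat (v 2)

theorem paramMat_zero : paramMat 0 = 1 := by
  have key : ∀ i j, paramMat 0 i j = (1 : SL2R) i j := by
    intro i j
    fin_cases i <;> fin_cases j <;>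
      simp [paramMat, SL2R.mul_entry, rotMat_entries, sideMat_entries,
        UnitTangent.geoMat_entries]
  ext i j
  exact key i j

theorem paramMat_00 (v : V3) : paramMat v 0 0 = Real.exp (v 0 / 2) *
    (Real.cosh (v 1 / 2) * Real.cos (v 2 / 2) + Real.sinh (v 1 / 2) * Real.sin (v 2 / 2)) := by
  simp only [paramMat, SL2R.mul_entry, rotMat_entries, sideMat_entries, UnitTangent.geoMat_entries]
  ring

theorem paramMat_01 (v : V3) : paramMat v 0 1 = Real.exp (v 0 / 2) *
    (Real.cosh (v 1 / 2) * Real.sin (v 2 / 2) - Real.sinh (v 1 / 2) * Real.cos (v 2 / 2)) := by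
  simp only [paramMat, SL2R.mul_entry, rotMat_entries, sideMat_entries, UnitTangent.geoMat_entries]
  ring

theorem paramMat_10 (v : V3) : paramMat v 1 0 = Real.exp (-(v 0 / 2)) *
    (-Real.sinh (v 1 / 2) * Real.cos (v 2 / 2) - Real.cosh (v 1 / 2) * Real.sin (v 2 / 2)) := by
  simp only [paramMat, SL2R.mul_entry, rotMat_entries, sideMat_entries, UnitTangent.geoMat_entries]
  ring

theorem paramMat_11 (v : V3) : paramMat v 1 1 = Real.exp (-(v 0 / 2)) *
    (Real.cosh (v 1 / 2) * Real.cos (v 2 / 2) - Real.sinh (v 1 / 2) * Real.sin (v 2 / 2)) := by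
  simp only [paramMat, SL2R.mul_entry, rotMat_entries, sideMat_entries, UnitTangent.geoMat_entries]
  ring

section entries

variable (i : Fin 3)

theorem hasStrictFDerivAt_half_coord (i : Fin 3) :
    HasStrictFDerivAt (fun v : V3 => v i / 2)
      ((1 / 2 : ℝ) • (EuclideanSpace.proj i : V3 →L[ℝ] ℝ)) 0 := by
  have h := ((1 / 2 : ℝ) • (EuclideanSpace.proj i : V3 →L[ℝ] ℝ)).hasStrictFDerivAt (x := 0)
  refine h.congr_of_eventuallyEq (Eventually.of_forall fun v => ?_)
  simp; ring

theorem hasStrictFDerivAt_paramMat_00 :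
    HasStrictFDerivAt (fun v => paramMat v 0 0) matD 0 := by
  have h0 := hasStrictFDerivAt_half_coord 0
  have h1 := hasStrictFDerivAt_half_coord 1
  have h2 := hasStrictFDerivAt_half_coord 2
  simp only [paramMat_00]
  convert! h0.exp.mul ((h1.cosh.mul h2.cos).add (h1.sinh.mul h2.sin)) using 1
  ext v
  simp [matD_apply]; ring

theorem hasStrictFDerivAt_paramMat_01 :
    HasStrictFDerivAt (fun v => paramMat v 0 1) matU 0 := by
  have h0 := hasStrictFDerivAt_half_coord 0
  have h1 := hasStrictFDerivAt_half_coord 1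
  have h2 := hasStrictFDerivAt_half_coord 2
  simp only [paramMat_01]
  convert! h0.exp.mul ((h1.cosh.mul h2.sin).sub (h1.sinh.mul h2.cos)) using 1
  ext v
  simp [matU_apply]; ring

theorem hasStrictFDerivAt_paramMat_10 :
    HasStrictFDerivAt (fun v => paramMat v 1 0) matL 0 := by
  have h0 := hasStrictFDerivAt_half_coord 0
  have h1 := hasStrictFDerivAt_half_coord 1
  have h2 := hasStrictFDerivAt_half_coord 2
  simp only [paramMat_10]
  convert! h0.neg.exp.mul ((h1.sinh.neg.mul h2.cos).sub (h1.cosh.mul h2.sin)) using 1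
  ext v
  simp [matL_apply]; ring

theorem hasStrictFDerivAt_paramMat_11 :
    HasStrictFDerivAt (fun v => paramMat v 1 1) (-matD) 0 := by
  have h0 := hasStrictFDerivAt_half_coord 0
  have h1 := hasStrictFDerivAt_half_coord 1
  have h2 := hasStrictFDerivAt_half_coord 2
  simp only [paramMat_11]
  convert! h0.neg.exp.mul ((h1.cosh.mul h2.cos).sub (h1.sinh.mul h2.sin)) using 1
  ext v
  simp [matD_apply]; ring

end entries

/-- Three entries of a matrix that are coordinates near the identity. -/
def entries3 (g : SL2R) : ℝ × ℝ × ℝ := (g 0 1, g 1 0, g 1 1)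

theorem continuous_entry (i j : Fin 2) : Continuous fun g : SL2R => g i j :=
  (continuous_apply j).comp (Matrix.SpecialLinearGroup.continuous_apply _ continuous_id i)

theorem continuous_entries3 : Continuous entries3 :=
  (continuous_entry 0 1).prodMk ((continuous_entry 1 0).prodMk (continuous_entry 1 1))

theorem SL2R.det_eq (g : SL2R) : g 0 0 * g 1 1 - g 0 1 * g 1 0 = 1 := by
  have h := g.det_coe
  rwa [Matrix.det_fin_two] at h

theorem SL2R.ext_entries {g h : SL2R} (h00 : g 0 0 = h 0 0) (h01 : g 0 1 = h 0 1)
    (h10 : g 1 0 = h 1 0) (h11 : g 1 1 = h 1 1) : g = h := by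
  ext i j
  fin_cases i <;> fin_cases j <;> assumption

theorem SL2R.continuousAt_iff {A : Type*} [TopologicalSpace A] {g : A → SL2R} {a : A} :
    ContinuousAt g a ↔ ContinuousAt (fun q => g q 0 0) a ∧ ContinuousAt (fun q => g q 0 1) a ∧
      ContinuousAt (fun q => g q 1 0) a ∧ ContinuousAt (fun q => g q 1 1) a := by
  have h1 : ContinuousAt g a ↔ ContinuousAt (fun q => (g q : Matrix (Fin 2) (Fin 2) ℝ)) a :=
    Topology.IsInducing.subtypeVal.continuousAt_iff
  rw [h1]
  refine (continuousAt_pi (f := fun q => (g q : Matrix (Fin 2) (Fin 2) ℝ))).trans ?_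
  have h2 (i : Fin 2) : ContinuousAt (fun q => (g q : Matrix (Fin 2) (Fin 2) ℝ) i) a ↔
      ∀ j, ContinuousAt (fun q => g q i j) a := continuousAt_pi
  rw [Fin.forall_fin_two, h2, h2, Fin.forall_fin_two, Fin.forall_fin_two, and_assoc]

theorem SL2R.continuous_iff {A : Type*} [TopologicalSpace A] {g : A → SL2R} :
    Continuous g ↔ Continuous (fun q => g q 0 0) ∧ Continuous (fun q => g q 0 1) ∧
      Continuous (fun q => g q 1 0) ∧ Continuous (fun q => g q 1 1) := by
  simp only [continuous_iff_continuousAt, SL2R.continuousAt_iff, forall_and]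

/-- The determinant recovers the missing entry `g 0 0` because it is multiplied by `g 1 1`. -/
theorem eq_of_entries3_eq {g h : SL2R} (he : entries3 g = entries3 h) (hg : g 1 1 ≠ 0) :
    g = h := by
  simp only [entries3, Prod.mk.injEq] at he
  obtain ⟨h01, h10, h11⟩ := he
  refine SL2R.ext_entries ?_ h01 h10 h11
  have h1 := g.det_eq
  have h2 := h.det_eq
  rw [← h01, ← h10, ← h11] at h2
  exact mul_right_cancel₀ hg (by linarith)

theorem continuous_paramMat : Continuous paramMat := by
  have h (i : Fin 3) : Continuous fun v : V3 => v i := by fun_prop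
  rw [SL2R.continuous_iff]
  simp only [paramMat_00, paramMat_01, paramMat_10, paramMat_11]
  refine ⟨?_, ?_, ?_, ?_⟩ <;> fun_prop

/-- The derivative is invertible, so the inverse function theorem applies to three entries; they
serve as a chart of SL(2, ℝ) at 1. -/
theorem hasStrictFDerivAt_entries3_paramMat :
    HasStrictFDerivAt (fun v => entries3 (paramMat v)) (matEquiv : V3 →L[ℝ] ℝ × ℝ × ℝ) 0 :=
  hasStrictFDerivAt_paramMat_01.prodMk
    (hasStrictFDerivAt_paramMat_10.prodMk hasStrictFDerivAt_paramMat_11)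

/-- The local inverse of `paramMat`. -/
def logMat (g : SL2R) : V3 := hasStrictFDerivAt_entries3_paramMat.localInverse _ _ _ (entries3 g)

theorem logMat_one : logMat 1 = 0 := by
  have := hasStrictFDerivAt_entries3_paramMat.localInverse_apply_image
  rwa [paramMat_zero] at this

theorem hasFDerivAt_localInverse_entries3 :
    HasFDerivAt (hasStrictFDerivAt_entries3_paramMat.localInverse _ _ _)
      (matEquiv.symm : ℝ × ℝ × ℝ →L[ℝ] V3) (entries3 1) := by
  have := hasStrictFDerivAt_entries3_paramMat.to_localInverse.hasFDerivAt
  rwa [paramMat_zero] at this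

theorem continuousAt_logMat : ContinuousAt logMat 1 :=
  hasFDerivAt_localInverse_entries3.continuousAt.comp continuous_entries3.continuousAt

theorem eventually_logMat_paramMat : ∀ᶠ v in 𝓝 (0 : V3), logMat (paramMat v) = v :=
  hasStrictFDerivAt_entries3_paramMat.eventually_left_inverse

theorem eventually_paramMat_logMat : ∀ᶠ g in 𝓝 (1 : SL2R), paramMat (logMat g) = g := by
  have h1 := hasStrictFDerivAt_entries3_paramMat.eventually_right_inverse
  rw [paramMat_zero] at h1
  have h2 : ∀ᶠ g in 𝓝 (1 : SL2R), (paramMat (logMat g)) 1 1 ≠ 0 := by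
    have h3 : ContinuousAt (fun g => paramMat (logMat g) 1 1) 1 :=
      ((continuous_entry 1 1).comp continuous_paramMat).continuousAt.comp continuousAt_logMat
    apply h3.eventually_ne
    simp [logMat_one, paramMat_zero]
  filter_upwards [continuous_entries3.continuousAt.eventually h1, h2] with g hg hg2
  exact eq_of_entries3_eq hg hg2

namespace T1S

variable {Γ : Subgroup SL2R}

theorem rotate_proj (θ : ℝ) (g : SL2R) : rotate θ (proj Γ g) = proj Γ (g * rotMat θ) := by
  refine congrArg (Quotient.mk _) ?_
  rw [UnitTangent.rotate_smul, rotate_base, mul_smul]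

theorem sideFlow_proj (t : ℝ) (g : SL2R) : sideFlow t (proj Γ g) = proj Γ (g * sideMat t) := by
  rw [sideFlow, rotate_proj, geodesicFlow_proj, rotate_proj, mul_assoc, mul_assoc, ← mul_assoc
    (rotMat _), rotMat_geoMat_rotMat]

theorem param_proj (g : SL2R) (v : V3) : param (proj Γ g) v = proj Γ (g * paramMat v) := by
  rw [param, geodesicFlow_proj, sideFlow_proj, rotate_proj, paramMat, mul_assoc, mul_assoc,
    mul_assoc]

theorem param_zero (x : T1S Γ) : param x 0 = x := by
  obtain ⟨g, rfl⟩ := proj_surjective x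
  rw [param_proj, paramMat_zero, mul_one]

theorem continuous_param (x : T1S Γ) : Continuous (param x) := by
  obtain ⟨g, rfl⟩ := proj_surjective x
  simp only [funext (param_proj g)]
  exact continuous_proj.comp (continuous_const.mul continuous_paramMat)

/-- A local inverse of the parametrization around `x`. -/
structure IsLocalLog (x : T1S Γ) (l : T1S Γ → V3) : Prop where
  continuousAt : ContinuousAt l x
  apply_self : l x = 0
  param_log : ∀ᶠ y in 𝓝 x, param x (l y) = y
  log_param : ∀ᶠ v in 𝓝 0, l (param x v) = v

theorem exists_localSection (hΓ : IsClosedSurfaceGroup Γ) (g : SL2R) :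
    ∃ s : T1S Γ → SL2R, ContinuousAt s (proj Γ g) ∧ s (proj Γ g) = g ∧
      (∀ᶠ y in 𝓝 (proj Γ g), proj Γ (s y) = y) ∧ ∀ᶠ k in 𝓝 g, s (proj Γ k) = k := by
  obtain ⟨e, hge, he⟩ := (isCoveringMap_proj hΓ).isLocalHomeomorph g
  have he' (k : SL2R) : proj Γ k = e k := congrFun he k
  refine ⟨e.symm, ?_, ?_, ?_, ?_⟩
  · rw [he']; exact e.continuousAt_symm (e.map_source hge)
  · rw [he']; exact e.left_inv hge
  · simp only [he']; exact e.eventually_right_inverse (e.map_source hge)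
  · simp only [he']; exact e.eventually_left_inverse hge

theorem exists_isLocalLog (hΓ : IsClosedSurfaceGroup Γ) (x : T1S Γ) :
    ∃ l, IsLocalLog x l := by
  obtain ⟨g, rfl⟩ := proj_surjective x
  obtain ⟨s, hs, hsg, hs1, hs2⟩ := exists_localSection hΓ g
  have hc : ContinuousAt (fun y => g⁻¹ * s y) (proj Γ g) := continuousAt_const.mul hs
  have h1 : g⁻¹ * s (proj Γ g) = 1 := by rw [hsg]; simp
  refine ⟨fun y => logMat (g⁻¹ * s y), ?_, ?_, ?_, ?_⟩
  · exact ContinuousAt.comp (g := logMat) (f := fun y => g⁻¹ * s y)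
      (by rw [h1]; exact continuousAt_logMat) hc
  · simp only [h1, logMat_one]
  · have h2 : ∀ᶠ y in 𝓝 (proj Γ g), paramMat (logMat (g⁻¹ * s y)) = g⁻¹ * s y := by
      refine hc.eventually (p := fun k => paramMat (logMat k) = k) ?_
      beta_reduce
      rw [h1]
      exact eventually_paramMat_logMat
    filter_upwards [h2, hs1] with y hy hy1
    rw [param_proj, hy, mul_inv_cancel_left, hy1]
  · have hc2 : ContinuousAt (fun v => g * paramMat v) 0 :=
      continuousAt_const.mul continuous_paramMat.continuousAt
    have h2 : ∀ᶠ v in 𝓝 (0 : V3), s (proj Γ (g * paramMat v)) = g * paramMat v := by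
      refine hc2.eventually (p := fun k => s (proj Γ k) = k) ?_
      beta_reduce
      rwa [paramMat_zero, mul_one]
    filter_upwards [h2, eventually_logMat_paramMat] with v hv hv2
    rw [param_proj, hv, inv_mul_cancel_left, hv2]

variable {F : Type*} [NormedAddCommGroup F] [NormedSpace ℝ F]

/-- All calculus on T¹S goes through this translation to derivatives between normed spaces.
Continuity is a separate clause because `l` is controlled only near `c p` and may take small values
at distant points. -/
theorem hasDeriv_iff {c : F → T1S Γ} {L : F →L[ℝ] V3} {p : F} {l : T1S Γ → V3}
    (hl : IsLocalLog (c p) l) :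
    HasDeriv c L p ↔ ContinuousAt c p ∧ HasFDerivAt (fun q => l (c q)) L p := by
  have hshift : Tendsto (fun h : F => p + h) (𝓝 0) (𝓝 p) := by
    have : Continuous fun h : F => p + h := by fun_prop
    simpa using this.tendsto 0
  constructor
  · rintro ⟨r, hr, he⟩
    have hr0 : Tendsto (fun h => L h + r h) (𝓝 0) (𝓝 0) := by
      have h1 : Tendsto (fun h => L h) (𝓝 0) (𝓝 0) := by simpa using L.continuous.tendsto 0
      have h2 : Tendsto r (𝓝 0) (𝓝 0) := hr.trans_tendsto tendsto_id
      simpa using h1.add h2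
    constructor
    · have h1 : Tendsto (fun h => param (c p) (L h + r h)) (𝓝 0) (𝓝 (c p)) := by
        have := (continuous_param (c p)).tendsto 0
        rw [param_zero] at this
        exact this.comp hr0
      have h2 : Tendsto (fun h => c (p + h)) (𝓝 0) (𝓝 (c p)) :=
        h1.congr' (he.mono fun h hh => hh.symm)
      have h3 : Tendsto (fun q : F => q - p) (𝓝 p) (𝓝 0) := by
        have : Continuous fun q : F => q - p := by fun_prop
        simpa using this.tendsto p
      have := h2.comp h3
      simpa [Function.comp_def, ContinuousAt] using this
    · have h1 : ∀ᶠ h in 𝓝 0, l (c (p + h)) = L h + r h := by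
        filter_upwards [he, hr0.eventually hl.log_param] with h hh hh2
        rw [hh, hh2]
      rw [hasFDerivAt_iff_isLittleO_nhds_zero]
      refine hr.congr' ?_ (Eventually.of_forall fun _ => rfl)
      filter_upwards [h1] with h hh
      rw [hh, hl.apply_self]; simp
  · rintro ⟨hc, hd⟩
    refine ⟨fun h => l (c (p + h)) - L h, ?_, ?_⟩
    · rw [hasFDerivAt_iff_isLittleO_nhds_zero] at hd
      simpa [hl.apply_self] using hd
    · filter_upwards [hshift.eventually (hc.eventually hl.param_log)] with h hh
      simp [hh]

theorem HasDeriv.continuousAt (hΓ : IsClosedSurfaceGroup Γ) {c : F → T1S Γ} {L : F →L[ℝ] V3}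
    {p : F} (h : HasDeriv c L p) : ContinuousAt c p := by
  obtain ⟨l, hl⟩ := exists_isLocalLog hΓ (c p)
  exact ((hasDeriv_iff hl).1 h).1

theorem HasDeriv.congr {c c' : F → T1S Γ} {L : F →L[ℝ] V3} {p : F}
    (h : HasDeriv c L p) (he : c' =ᶠ[𝓝 p] c) : HasDeriv c' L p := by
  obtain ⟨r, hr, hh⟩ := h
  have hshift : Tendsto (fun h : F => p + h) (𝓝 0) (𝓝 p) := by
    have : Continuous fun h : F => p + h := by fun_prop
    simpa using this.tendsto 0
  refine ⟨r, hr, ?_⟩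
  filter_upwards [hh, hshift.eventually he] with h h1 h2
  rw [h2, h1, he.self_of_nhds]

theorem HasDeriv.comp (hΓ : IsClosedSurfaceGroup Γ) {F' : Type*} [NormedAddCommGroup F']
    [NormedSpace ℝ F'] {c : F → T1S Γ} {L : F →L[ℝ] V3} {u : F' → F} {u' : F' →L[ℝ] F} {p : F'}
    (h : HasDeriv c L (u p)) (hu : HasFDerivAt u u' p) :
    HasDeriv (fun q => c (u q)) (L.comp u') p := by
  obtain ⟨l, hl⟩ := exists_isLocalLog hΓ (c (u p))
  obtain ⟨h1, h2⟩ := (hasDeriv_iff hl).1 h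
  exact (hasDeriv_iff (c := fun q => c (u q)) hl).2
    ⟨h1.comp (f := u) hu.continuousAt, h2.comp p hu⟩

theorem HasTangentMap.comp_hasDeriv (hΓ : IsClosedSurfaceGroup Γ) {f : T1S Γ → T1S Γ}
    {D : V3 →L[ℝ] V3} {c : F → T1S Γ} {L : F →L[ℝ] V3} {p : F}
    (h : HasTangentMap f D (c p)) (hc : HasDeriv c L p) :
    HasDeriv (fun q => f (c q)) (D.comp L) p := by
  obtain ⟨l, hl⟩ := exists_isLocalLog hΓ (c p)
  obtain ⟨h1, h2⟩ := (hasDeriv_iff hl).1 hc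
  have h' : HasDeriv (fun v => f (param (c p) v)) D (l (c p)) := by
    rw [hl.apply_self]; exact h
  refine (HasDeriv.comp hΓ (u := fun q => l (c q)) h' h2).congr ?_
  filter_upwards [h1.eventually hl.param_log] with q hq
  simp [hq]

theorem hasDeriv_param_zero (x : T1S Γ) :
    HasDeriv (param x) (ContinuousLinearMap.id ℝ V3) 0 :=
  ⟨fun _ => 0, Asymptotics.isLittleO_zero _ _, Eventually.of_forall fun h => by
    simp [param_zero]⟩

theorem HasTangentMap.comp (hΓ : IsClosedSurfaceGroup Γ) {f f' : T1S Γ → T1S Γ}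
    {D D' : V3 →L[ℝ] V3} {x : T1S Γ} (h : HasTangentMap f D (f' x)) (h' : HasTangentMap f' D' x) :
    HasTangentMap (fun y => f (f' y)) (D.comp D') x := by
  refine HasTangentMap.comp_hasDeriv hΓ (c := fun v => f' (param x v)) ?_ h'
  rwa [param_zero]

theorem hasTangentMap_id (x : T1S Γ) :
    HasTangentMap (fun y => y) (ContinuousLinearMap.id ℝ V3) x := hasDeriv_param_zero x

/-- In logarithmic charts the inverse has `f` as a local left inverse; the continuity that this
criterion needs is free, since `f` is a homeomorphism. -/
theorem HasTangentMap.symm (hΓ : IsClosedSurfaceGroup Γ) (f : T1S Γ ≃ₜ T1S Γ)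
    {D : V3 ≃L[ℝ] V3} {x : T1S Γ} (h : HasTangentMap f (D : V3 →L[ℝ] V3) x) :
    HasTangentMap f.symm (D.symm : V3 →L[ℝ] V3) (f x) := by
  obtain ⟨l, hl⟩ := exists_isLocalLog hΓ x
  obtain ⟨l', hl'⟩ := exists_isLocalLog hΓ (f x)
  have hc : ContinuousAt (fun w => f.symm (param (f x) w)) 0 :=
    (f.symm.continuous.comp (continuous_param _)).continuousAt
  have h0 : f.symm (param (f x) 0) = x := by simp [param_zero]
  have h1 := ((hasDeriv_iff (c := fun v => f (param x v)) (l := l')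
    (by simpa only [param_zero] using hl')).1 h).2
  refine (hasDeriv_iff (l := l) (by simpa only [h0] using hl)).2 ⟨hc, ?_⟩
  refine HasFDerivAt.of_local_left_inverse (f := fun v => l' (f (param x v))) ?_ ?_ ?_
  · exact ContinuousAt.comp (by rw [h0]; exact hl.continuousAt) hc
  · simpa only [h0, hl.apply_self] using h1
  · have h2 : ∀ᶠ w in 𝓝 (0 : V3), param x (l (f.symm (param (f x) w))) =
        f.symm (param (f x) w) := by
      refine hc.eventually (p := fun y => param x (l y) = y) ?_
      beta_reduce
      rw [h0]; exact hl.param_log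
    filter_upwards [h2, hl'.log_param] with w hw hw2
    rw [hw, f.apply_symm_apply, hw2]

end T1S

end

/-! ### Derivatives of maps into SL(2, ℝ) in the left-invariant frame. -/

noncomputable section

/-- `L` is the derivative of `g` at `p` as a map to the Lie algebra, with respect to the frame:
the matrix derivative of `g` is `g p` times the matrix representing `L`. -/
structure HasFrameDeriv {F : Type*} [NormedAddCommGroup F] [NormedSpace ℝ F]
    (g : F → SL2R) (L : F →L[ℝ] V3) (p : F) : Prop where
  entry00 : HasFDerivAt (fun q => g q 0 0) (g p 0 0 • matD.comp L + g p 0 1 • matL.comp L) p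
  entry01 : HasFDerivAt (fun q => g q 0 1) (g p 0 0 • matU.comp L - g p 0 1 • matD.comp L) p
  entry10 : HasFDerivAt (fun q => g q 1 0) (g p 1 0 • matD.comp L + g p 1 1 • matL.comp L) p
  entry11 : HasFDerivAt (fun q => g q 1 1) (g p 1 0 • matU.comp L - g p 1 1 • matD.comp L) p

namespace HasFrameDeriv

variable {F : Type*} [NormedAddCommGroup F] [NormedSpace ℝ F]
  {F' : Type*} [NormedAddCommGroup F'] [NormedSpace ℝ F']
  {g : F → SL2R} {L : F →L[ℝ] V3} {p : F}

theorem continuousAt (h : HasFrameDeriv g L p) : ContinuousAt g p :=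
  SL2R.continuousAt_iff.2 ⟨h.entry00.continuousAt, h.entry01.continuousAt,
    h.entry10.continuousAt, h.entry11.continuousAt⟩

theorem comp {u : F' → F} {u' : F' →L[ℝ] F} {p : F'} (h : HasFrameDeriv g L (u p))
    (hu : HasFDerivAt u u' p) : HasFrameDeriv (fun q => g (u q)) (L.comp u') p where
  entry00 := (h.entry00.comp p hu).congr_fderiv (by ext; simp)
  entry01 := (h.entry01.comp p hu).congr_fderiv (by ext; simp)
  entry10 := (h.entry10.comp p hu).congr_fderiv (by ext; simp)
  entry11 := (h.entry11.comp p hu).congr_fderiv (by ext; simp)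

theorem congr {g' : F → SL2R} (h : HasFrameDeriv g L p) (he : g' =ᶠ[𝓝 p] g) :
    HasFrameDeriv g' L p := by
  have h0 : g' p = g p := he.self_of_nhds
  have h1 (i j : Fin 2) : (fun q => g' q i j) =ᶠ[𝓝 p] fun q => g q i j :=
    he.mono fun q hq => congrArg (fun k : SL2R => k i j) hq
  constructor <;> rw [h0]
  · exact h.entry00.congr_of_eventuallyEq (h1 _ _)
  · exact h.entry01.congr_of_eventuallyEq (h1 _ _)
  · exact h.entry10.congr_of_eventuallyEq (h1 _ _)
  · exact h.entry11.congr_of_eventuallyEq (h1 _ _)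

theorem mul_left (h : HasFrameDeriv g L p) (k : SL2R) :
    HasFrameDeriv (fun q => k * g q) L p where
  entry00 := by
    simp only [SL2R.mul_entry]
    exact ((h.entry00.const_mul _).add (h.entry10.const_mul _)).congr_fderiv (by ext; simp; ring)
  entry01 := by
    simp only [SL2R.mul_entry]
    exact ((h.entry01.const_mul _).add (h.entry11.const_mul _)).congr_fderiv (by ext; simp; ring)
  entry10 := by
    simp only [SL2R.mul_entry]
    exact ((h.entry00.const_mul _).add (h.entry10.const_mul _)).congr_fderiv (by ext; simp; ring)
  entry11 := by
    simp only [SL2R.mul_entry]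
    exact ((h.entry01.const_mul _).add (h.entry11.const_mul _)).congr_fderiv (by ext; simp; ring)

end HasFrameDeriv

theorem hasFrameDeriv_paramMat_zero :
    HasFrameDeriv paramMat (ContinuousLinearMap.id ℝ V3) 0 where
  entry00 := hasStrictFDerivAt_paramMat_00.hasFDerivAt.congr_fderiv (by
    ext; simp [paramMat_zero])
  entry01 := hasStrictFDerivAt_paramMat_01.hasFDerivAt.congr_fderiv (by
    ext; simp [paramMat_zero])
  entry10 := hasStrictFDerivAt_paramMat_10.hasFDerivAt.congr_fderiv (by
    ext; simp [paramMat_zero])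
  entry11 := hasStrictFDerivAt_paramMat_11.hasFDerivAt.congr_fderiv (by
    ext; simp [paramMat_zero])

theorem SL2R.inv_entries (g : SL2R) :
    g⁻¹ 0 0 = g 1 1 ∧ g⁻¹ 0 1 = -g 0 1 ∧ g⁻¹ 1 0 = -g 1 0 ∧ g⁻¹ 1 1 = g 0 0 := by
  rw [Matrix.SpecialLinearGroup.coe_inv, Matrix.adjugate_fin_two]
  simp

namespace T1S

variable {Γ : Subgroup SL2R} {F : Type*} [NormedAddCommGroup F] [NormedSpace ℝ F]

/-- Near `p` the lift equals `g p * paramMat w`, with `w` the logarithm of the projected map: both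
are lifts of the same map close to `g p`, so the local section identifies them. -/
theorem HasDeriv.hasFrameDeriv (hΓ : IsClosedSurfaceGroup Γ) {g : F → SL2R} {L : F →L[ℝ] V3}
    {p : F} (h : HasDeriv (fun q => proj Γ (g q)) L p) (hg : ContinuousAt g p) :
    HasFrameDeriv g L p := by
  obtain ⟨l, hl⟩ := exists_isLocalLog hΓ (proj Γ (g p))
  obtain ⟨hc, hd⟩ := (hasDeriv_iff (c := fun q => proj Γ (g q)) hl).1 h
  obtain ⟨s, -, -, -, hs⟩ := exists_localSection hΓ (g p)
  have hw0 : l (proj Γ (g p)) = 0 := hl.apply_self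
  have h1 : ContinuousAt (fun q => g p * paramMat (l (proj Γ (g q)))) p :=
    continuousAt_const.mul (continuous_paramMat.continuousAt.comp
      (f := fun q => l (proj Γ (g q))) hd.continuousAt)
  have h2 : ∀ᶠ q in 𝓝 p, g p * paramMat (l (proj Γ (g q))) = g q := by
    have h3 : ∀ᶠ q in 𝓝 p, s (proj Γ (g p * paramMat (l (proj Γ (g q))))) =
        g p * paramMat (l (proj Γ (g q))) := by
      refine h1.eventually (p := fun k => s (proj Γ k) = k) ?_
      beta_reduce
      rwa [hw0, paramMat_zero, mul_one]
    filter_upwards [h3, hg.eventually hs, hc.eventually hl.param_log] with q hq1 hq2 hq3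
    rw [param_proj] at hq3
    rw [← hq1, hq3, hq2]
  have h4 : HasFrameDeriv (fun q => g p * paramMat (l (proj Γ (g q)))) L p := by
    refine HasFrameDeriv.mul_left ?_ _
    have h5 : HasFrameDeriv paramMat (ContinuousLinearMap.id ℝ V3) (l (proj Γ (g p))) := by
      rw [hw0]; exact hasFrameDeriv_paramMat_zero
    exact h5.comp (u := fun q => l (proj Γ (g q))) hd
  exact h4.congr (h2.mono fun q hq => hq.symm)

end T1S

/-- After translation by `(g p)⁻¹` the map passes through 1, where `logMat` is differentiable with
derivative inverse to `matEquiv` in the entries. Near `p` the logarithm downstairs equals this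
`logMat`. -/
theorem HasFrameDeriv.hasDeriv_proj {Γ : Subgroup SL2R} {F : Type*} [NormedAddCommGroup F]
    [NormedSpace ℝ F] (hΓ : IsClosedSurfaceGroup Γ) {g : F → SL2R} {L : F →L[ℝ] V3}
    {p : F} (h : HasFrameDeriv g L p) : T1S.HasDeriv (fun q => T1S.proj Γ (g q)) L p := by
  obtain ⟨l, hl⟩ := T1S.exists_isLocalLog hΓ (T1S.proj Γ (g p))
  refine (T1S.hasDeriv_iff (c := fun q => T1S.proj Γ (g q)) hl).2
    ⟨T1S.continuous_proj.continuousAt.comp (f := g) h.continuousAt, ?_⟩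
  have hk := h.mul_left (g p)⁻¹
  have hk1 : (g p)⁻¹ * g p = 1 := inv_mul_cancel _
  have h1 : HasFDerivAt (fun q => entries3 ((g p)⁻¹ * g q))
      ((matEquiv : V3 →L[ℝ] ℝ × ℝ × ℝ).comp L) p := by
    refine (hk.entry01.prodMk (hk.entry10.prodMk hk.entry11)).congr_fderiv ?_
    simp only [hk1]
    refine ContinuousLinearMap.ext fun v => ?_
    simp [matEquiv_apply]
  have h2 : HasFDerivAt (fun q => logMat ((g p)⁻¹ * g q)) L p := by
    have h3 := hasFDerivAt_localInverse_entries3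
    rw [← hk1] at h3
    refine (h3.comp p h1).congr_fderiv ?_
    refine ContinuousLinearMap.ext fun v => ?_
    simp
  refine h2.congr_of_eventuallyEq ?_
  have h3 : ∀ᶠ q in 𝓝 p, paramMat (logMat ((g p)⁻¹ * g q)) = (g p)⁻¹ * g q := by
    refine hk.continuousAt.eventually (p := fun k => paramMat (logMat k) = k) ?_
    beta_reduce
    rw [hk1]; exact eventually_paramMat_logMat
  have h4 : ∀ᶠ q in 𝓝 p, l (T1S.param (T1S.proj Γ (g p)) (logMat ((g p)⁻¹ * g q))) =
      logMat ((g p)⁻¹ * g q) := by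
    refine h2.continuousAt.eventually
      (p := fun v => l (T1S.param (T1S.proj Γ (g p)) v) = v) ?_
    beta_reduce
    rw [hk1, logMat_one]; exact hl.log_param
  filter_upwards [h3, h4] with q hq3 hq4
  rw [T1S.param_proj, hq3, mul_inv_cancel_left] at hq4
  exact hq4

/-! ### Coordinates on `SL(2, ℝ)` adapted to the geodesic through the identity -/

/-- The coordinates `(t, x, y)`: time along the geodesic, stable and unstable coordinate. -/
def coordMat (q : ℝ × ℝ × ℝ) : SL2R :=
  ⟨!![Real.exp (q.1 / 2) * (1 + q.2.1 * q.2.2), Real.exp (q.1 / 2) * q.2.1;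
      Real.exp (-(q.1 / 2)) * q.2.2, Real.exp (-(q.1 / 2))], by
    rw [Matrix.det_fin_two_of]
    have : Real.exp (q.1 / 2) * Real.exp (-(q.1 / 2)) = 1 := by rw [← Real.exp_add]; simp
    linear_combination this⟩

theorem coordMat_entries (q : ℝ × ℝ × ℝ) :
    coordMat q 0 0 = Real.exp (q.1 / 2) * (1 + q.2.1 * q.2.2) ∧
    coordMat q 0 1 = Real.exp (q.1 / 2) * q.2.1 ∧
    coordMat q 1 0 = Real.exp (-(q.1 / 2)) * q.2.2 ∧
    coordMat q 1 1 = Real.exp (-(q.1 / 2)) := ⟨rfl, rfl, rfl, rfl⟩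

/-- The coordinates of a matrix. -/
def coord (g : SL2R) : ℝ × ℝ × ℝ := (-2 * Real.log (g 1 1), g 0 1 * g 1 1, g 1 0 / g 1 1)

theorem coord_coordMat (q : ℝ × ℝ × ℝ) : coord (coordMat q) = q := by
  have : Real.exp (q.1 / 2) * Real.exp (-(q.1 / 2)) = 1 := by rw [← Real.exp_add]; simp
  have h2 := Real.exp_ne_zero (-(q.1 / 2))
  simp only [coord, coordMat_entries, Real.log_exp]
  ext
  · simp; ring
  · simp only; linear_combination q.2.1 * this
  · simp only; field_simp

theorem coordMat_coord {g : SL2R} (hg : 0 < g 1 1) : coordMat (coord g) = g := by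
  have h1 : Real.exp (-(-2 * Real.log (g 1 1) / 2)) = g 1 1 := by
    rw [show -(-2 * Real.log (g 1 1) / 2) = Real.log (g 1 1) by ring, Real.exp_log hg]
  have h2 : Real.exp (-2 * Real.log (g 1 1) / 2) = (g 1 1)⁻¹ := by
    rw [show -2 * Real.log (g 1 1) / 2 = -Real.log (g 1 1) by ring, Real.exp_neg,
      Real.exp_log hg]
  have hd := g.det_eq
  have h3 := hg.ne'
  refine SL2R.ext_entries ?_ ?_ ?_ ?_ <;> simp only [coordMat_entries, coord, h1, h2] <;>
    field_simp
  linarith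

theorem coordMat_11_pos (q : ℝ × ℝ × ℝ) : 0 < coordMat q 1 1 := Real.exp_pos _

theorem continuous_coordMat : Continuous coordMat := by
  rw [SL2R.continuous_iff]
  simp only [coordMat_entries]
  refine ⟨?_, ?_, ?_, ?_⟩ <;> fun_prop

theorem continuousAt_coord {g : SL2R} (hg : g 1 1 ≠ 0) : ContinuousAt coord g := by
  have h (i j : Fin 2) := (continuous_entry i j).continuousAt (x := g)
  exact (continuousAt_const.mul ((h 1 1).log hg)).prodMk
    (((h 0 1).mul (h 1 1)).prodMk ((h 1 0).div (h 1 1) hg))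

/-- The derivative of the coordinates, as a map from coordinate vectors to frame vectors. -/
def frameD (q : ℝ × ℝ × ℝ) : (ℝ × ℝ × ℝ) ≃L[ℝ] V3 :=
  LinearEquiv.toContinuousLinearEquiv
    { toFun := fun w =>
        !₂[w.1 + 2 * q.2.2 * (w.2.1 + q.2.1 * w.1),
          -(w.2.1 + q.2.1 * w.1 + (w.2.2 - q.2.2 * w.1 - q.2.2 ^ 2 * (w.2.1 + q.2.1 * w.1))),
          w.2.1 + q.2.1 * w.1 - (w.2.2 - q.2.2 * w.1 - q.2.2 ^ 2 * (w.2.1 + q.2.1 * w.1))]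
      invFun := fun v => (2 * matD v - 2 * q.2.2 * matU v,
        (1 + 2 * q.2.1 * q.2.2) * matU v - 2 * matD v * q.2.1,
        2 * matD v * q.2.2 + matL v - matU v * q.2.2 ^ 2)
      map_add' := fun v w => by ext i; fin_cases i <;> simp <;> ring
      map_smul' := fun r v => by ext i; fin_cases i <;> simp <;> ring
      left_inv := fun w => by
        ext <;> simp [matU_apply, matL_apply, matD_apply] <;> ring
      right_inv := fun v => by
        ext i
        fin_cases i <;> simp [matU_apply, matL_apply, matD_apply] <;> ring }

theorem frameD_symm_apply (q : ℝ × ℝ × ℝ) (v : V3) : (frameD q).symm v =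
    (2 * matD v - 2 * q.2.2 * matU v, (1 + 2 * q.2.1 * q.2.2) * matU v - 2 * matD v * q.2.1,
        2 * matD v * q.2.2 + matL v - matU v * q.2.2 ^ 2) := rfl

theorem frameD_apply (q w : ℝ × ℝ × ℝ) : frameD q w =
    !₂[w.1 + 2 * q.2.2 * (w.2.1 + q.2.1 * w.1),
      -(w.2.1 + q.2.1 * w.1 + (w.2.2 - q.2.2 * w.1 - q.2.2 ^ 2 * (w.2.1 + q.2.1 * w.1))),
      w.2.1 + q.2.1 * w.1 - (w.2.2 - q.2.2 * w.1 - q.2.2 ^ 2 * (w.2.1 + q.2.1 * w.1))] := rfl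

theorem matD_frameD (q w : ℝ × ℝ × ℝ) :
    matD (frameD q w) = w.1 / 2 + q.2.2 * (w.2.1 + q.2.1 * w.1) := by
  rw [matD_apply, frameD_apply]; simp; ring

theorem matU_frameD (q w : ℝ × ℝ × ℝ) : matU (frameD q w) = w.2.1 + q.2.1 * w.1 := by
  rw [matU_apply, frameD_apply]; simp; ring

theorem matL_frameD (q w : ℝ × ℝ × ℝ) : matL (frameD q w) =
    w.2.2 - q.2.2 * w.1 - q.2.2 ^ 2 * (w.2.1 + q.2.1 * w.1) := by
  rw [matL_apply, frameD_apply]; simp; ring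

theorem continuous_frameD : Continuous fun q => (frameD q : ℝ × ℝ × ℝ →L[ℝ] V3) := by
  rw [continuous_clm_apply]
  intro w
  simp only [ContinuousLinearEquiv.coe_coe, frameD_apply]
  refine (PiLp.continuous_toLp 2 _).comp (continuous_pi fun i => ?_)
  fin_cases i <;> simp <;> fun_prop

theorem continuous_frameD_symm : Continuous fun q => ((frameD q).symm : V3 →L[ℝ] ℝ × ℝ × ℝ) := by
  rw [continuous_clm_apply]
  intro w
  simp only [ContinuousLinearEquiv.coe_coe, frameD_symm_apply]
  fun_prop

theorem hasFrameDeriv_coordMat (q : ℝ × ℝ × ℝ) :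
    HasFrameDeriv coordMat (frameD q : ℝ × ℝ × ℝ →L[ℝ] V3) q := by
  have ht : HasFDerivAt (fun q : ℝ × ℝ × ℝ => q.1 / 2)
      ((1 / 2 : ℝ) • ContinuousLinearMap.fst ℝ ℝ (ℝ × ℝ)) q :=
    (hasFDerivAt_fst.const_mul (1 / 2 : ℝ)).congr_of_eventuallyEq
      (Eventually.of_forall fun q => by ring)
  have hx : HasFDerivAt (fun q : ℝ × ℝ × ℝ => q.2.1)
      ((ContinuousLinearMap.fst ℝ ℝ ℝ).comp (ContinuousLinearMap.snd ℝ ℝ (ℝ × ℝ))) q :=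
    hasFDerivAt_fst.comp q hasFDerivAt_snd
  have hy : HasFDerivAt (fun q : ℝ × ℝ × ℝ => q.2.2)
      ((ContinuousLinearMap.snd ℝ ℝ ℝ).comp (ContinuousLinearMap.snd ℝ ℝ (ℝ × ℝ))) q :=
    hasFDerivAt_snd.comp q hasFDerivAt_snd
  constructor <;> simp only [coordMat_entries]
  · refine (ht.exp.mul ((hx.mul hy).const_add 1)).congr_fderiv ?_
    refine ContinuousLinearMap.ext fun w => ?_
    simp [matD_frameD, matL_frameD]; ring
  · refine (ht.exp.mul hx).congr_fderiv ?_
    refine ContinuousLinearMap.ext fun w => ?_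
    simp [matD_frameD, matU_frameD]; ring
  · refine (ht.neg.exp.mul hy).congr_fderiv ?_
    refine ContinuousLinearMap.ext fun w => ?_
    simp [matD_frameD, matL_frameD]; ring
  · refine (ht.neg.exp).congr_fderiv ?_
    refine ContinuousLinearMap.ext fun w => ?_
    simp [matD_frameD, matU_frameD]; ring

theorem HasFrameDeriv.hasFDerivAt_coord {F : Type*} [NormedAddCommGroup F] [NormedSpace ℝ F]
    {g : F → SL2R} {L : F →L[ℝ] V3} {p : F} (h : HasFrameDeriv g L p) (hg : g p 1 1 ≠ 0) :
    HasFDerivAt (fun q => coord (g q))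
      (((frameD (coord (g p))).symm : V3 →L[ℝ] ℝ × ℝ × ℝ).comp L) p := by
  have hd := (g p).det_eq
  have hinv : HasFDerivAt (fun q => g q 1 0 / g q 1 1) _ p :=
    (h.entry10.mul ((hasDerivAt_inv hg).comp_hasFDerivAt p h.entry11)).congr_of_eventuallyEq
      (Eventually.of_forall fun q => div_eq_mul_inv _ _)
  refine (((h.entry11.log hg).const_mul (-2)).prodMk ((h.entry01.mul h.entry11).prodMk
    hinv)).congr_fderiv ?_
  refine ContinuousLinearMap.ext fun v => ?_
  simp only [ContinuousLinearMap.comp_apply, ContinuousLinearEquiv.coe_coe, frameD_symm_apply,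
    coord]
  ext
  · simp; field_simp; ring
  · simp; field_simp; linear_combination (matU (L v)) * hd
  · simp; field_simp; ring

theorem T1S.hasDeriv_proj_coordMat {Γ : Subgroup SL2R} (hΓ : IsClosedSurfaceGroup Γ) (h : SL2R)
    (q : ℝ × ℝ × ℝ) : HasDeriv (fun q => proj Γ (h * coordMat q))
      (frameD q : ℝ × ℝ × ℝ →L[ℝ] V3) q :=
  ((hasFrameDeriv_coordMat q).mul_left h).hasDeriv_proj hΓ

end

noncomputable section

/-! ### Curves in `SL(2, ℝ)` -/

theorem V3.abs_apply_le (v : V3) (i : Fin 3) : |v i| ≤ ‖v‖ := PiLp.norm_apply_le v i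

theorem V3.norm_le_sum (v : V3) : ‖v‖ ≤ |v 0| + |v 1| + |v 2| := by
  rw [EuclideanSpace.norm_eq, Fin.sum_univ_three]
  simp only [Real.norm_eq_abs]
  rw [Real.sqrt_le_iff]
  have h0 := abs_nonneg (v 0)
  have h1 := abs_nonneg (v 1)
  have h2 := abs_nonneg (v 2)
  exact ⟨by positivity, by nlinarith [mul_nonneg h0 h1, mul_nonneg h0 h2, mul_nonneg h1 h2]⟩

theorem abs_matD_le (v : V3) : |matD v| ≤ ‖v‖ := by
  have h0 := V3.abs_apply_le v 0
  rw [matD_apply]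
  rw [abs_le] at *
  constructor <;> linarith [norm_nonneg v]

theorem abs_matU_le (v : V3) : |matU v| ≤ ‖v‖ := by
  have h1 := V3.abs_apply_le v 1
  have h2 := V3.abs_apply_le v 2
  rw [matU_apply]
  rw [abs_le] at *
  constructor <;> linarith

theorem abs_matL_le (v : V3) : |matL v| ≤ ‖v‖ := by
  have h1 := V3.abs_apply_le v 1
  have h2 := V3.abs_apply_le v 2
  rw [matL_apply]
  rw [abs_le] at *
  constructor <;> linarith

/-- `v` is the velocity of the curve `g` at time `t`, expressed in the frame. -/
def HasFrameVel (g : ℝ → SL2R) (v : V3) (t : ℝ) : Prop :=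
  HasFrameDeriv g (ContinuousLinearMap.toSpanSingleton ℝ v) t

namespace HasFrameVel

variable {g : ℝ → SL2R} {v : V3} {t : ℝ}

theorem entry00 (h : HasFrameVel g v t) :
    HasDerivAt (fun s => g s 0 0) (g t 0 0 * matD v + g t 0 1 * matL v) t :=
  h.1.hasDerivAt.congr_deriv (by simp)

theorem entry01 (h : HasFrameVel g v t) :
    HasDerivAt (fun s => g s 0 1) (g t 0 0 * matU v - g t 0 1 * matD v) t :=
  h.2.hasDerivAt.congr_deriv (by simp)

theorem entry10 (h : HasFrameVel g v t) :
    HasDerivAt (fun s => g s 1 0) (g t 1 0 * matD v + g t 1 1 * matL v) t :=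
  h.3.hasDerivAt.congr_deriv (by simp)

theorem entry11 (h : HasFrameVel g v t) :
    HasDerivAt (fun s => g s 1 1) (g t 1 0 * matU v - g t 1 1 * matD v) t :=
  h.4.hasDerivAt.congr_deriv (by simp)

theorem mul_left (h : HasFrameVel g v t) (k : SL2R) : HasFrameVel (fun s => k * g s) v t :=
  HasFrameDeriv.mul_left h k

theorem hasDerivAt_coord (h : HasFrameVel g v t) (hg : g t 1 1 ≠ 0) :
    HasDerivAt (fun s => coord (g s)) ((frameD (coord (g t))).symm v) t :=
  (HasFrameDeriv.hasFDerivAt_coord h hg).hasDerivAt.congr_deriv (by simp)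

end HasFrameVel

theorem HasFrameDeriv.comp_hasDerivAt {F : Type*} [NormedAddCommGroup F] [NormedSpace ℝ F]
    {g : F → SL2R} {L : F →L[ℝ] V3} {u : ℝ → F} {w : F} {t : ℝ}
    (h : HasFrameDeriv g L (u t)) (hu : HasDerivAt u w t) :
    HasFrameVel (fun s => g (u s)) (L w) t := by
  have h1 := h.comp hu.hasFDerivAt
  unfold HasFrameVel
  convert! h1 using 1
  ext; simp

theorem T1S.HasDeriv.comp_hasDerivAt {Γ : Subgroup SL2R} (hΓ : IsClosedSurfaceGroup Γ)
    {F : Type*} [NormedAddCommGroup F] [NormedSpace ℝ F]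
    {c : F → T1S Γ} {L : F →L[ℝ] V3} {u : ℝ → F} {w : F} {t : ℝ}
    (h : HasDeriv c L (u t)) (hu : HasDerivAt u w t) :
    HasVelocity (fun s => c (u s)) (L w) t := by
  have h1 := HasDeriv.comp hΓ h hu.hasFDerivAt
  unfold HasVelocity
  convert! h1 using 1
  ext; simp

/-- The squared Frobenius distance of a matrix to the identity. -/
def distOneSq (g : SL2R) : ℝ :=
  (g 0 0 - 1) ^ 2 + g 0 1 ^ 2 + g 1 0 ^ 2 + (g 1 1 - 1) ^ 2

theorem distOneSq_nonneg (g : SL2R) : 0 ≤ distOneSq g := by unfold distOneSq; positivity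

/-- Each entry deviates from that of the identity by at most the square root of `distOneSq`, and the
topology of SL(2, ℝ) is the entrywise one. -/
theorem exists_distOneSq_lt_imp_mem {U : Set SL2R} (hU : U ∈ 𝓝 (1 : SL2R)) :
    ∃ ε > 0, ∀ g, distOneSq g < ε → g ∈ U := by
  by_contra! hcon
  have hseq : ∀ n : ℕ, ∃ g, distOneSq g < 1 / ((n : ℝ) + 1) ∧ g ∉ U :=
    fun n => hcon _ (by positivity)
  choose g hg hgU using hseq
  have hlim : Tendsto (fun n => distOneSq (g n)) atTop (𝓝 0) :=
    squeeze_zero (fun n => distOneSq_nonneg _) (fun n => (hg n).le)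
      tendsto_one_div_add_atTop_nhds_zero_nat
  have key (f : SL2R → ℝ) (hf : ∀ k, f k ^ 2 ≤ distOneSq k) :
      Tendsto (fun n => f (g n)) atTop (𝓝 0) := by
    have h1 : Tendsto (fun n => f (g n) ^ 2) atTop (𝓝 0) :=
      squeeze_zero (fun n => sq_nonneg _) (fun n => hf _) hlim
    have h2 := h1.sqrt
    simp only [Real.sqrt_sq_eq_abs, Real.sqrt_zero] at h2
    exact tendsto_zero_iff_abs_tendsto_zero _ |>.2 h2
  have h00 := key (fun k => k 0 0 - 1) (fun k => by
    unfold distOneSq; nlinarith [sq_nonneg (k 0 1), sq_nonneg (k 1 0), sq_nonneg (k 1 1 - 1)])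
  have h01 := key (fun k => k 0 1) (fun k => by
    unfold distOneSq; nlinarith [sq_nonneg (k 0 0 - 1), sq_nonneg (k 1 0), sq_nonneg (k 1 1 - 1)])
  have h10 := key (fun k => k 1 0) (fun k => by
    unfold distOneSq; nlinarith [sq_nonneg (k 0 0 - 1), sq_nonneg (k 0 1), sq_nonneg (k 1 1 - 1)])
  have h11 := key (fun k => k 1 1 - 1) (fun k => by
    unfold distOneSq; nlinarith [sq_nonneg (k 0 1), sq_nonneg (k 1 0), sq_nonneg (k 0 0 - 1)])
  have hg1 : Tendsto g atTop (𝓝 1) := by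
    have hind : IsInducing fun k : SL2R => (k : Matrix (Fin 2) (Fin 2) ℝ) :=
      Topology.IsInducing.subtypeVal
    refine hind.tendsto_nhds_iff.2 ?_
    refine (tendsto_pi_nhds (f := fun n => (g n : Matrix (Fin 2) (Fin 2) ℝ))).2 ?_
    intro i
    refine (tendsto_pi_nhds (f := fun n => (g n : Matrix (Fin 2) (Fin 2) ℝ) i)).2 ?_
    intro j
    fin_cases i <;> fin_cases j
    · simpa using h00.add_const 1
    · simpa using h01
    · simpa using h10
    · simpa using h11.add_const 1
  obtain ⟨n, hn⟩ := (hg1.eventually hU).exists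
  exact hgU n hn

/-- The displacement of a curve is controlled by its length. -/
theorem distOneSq_le_of_hasFrameVel {g : ℝ → SL2R} {v : ℝ → V3} (hv : Continuous v)
    (hg : ∀ r, HasFrameVel g (v r) r) :
    distOneSq ((g 0)⁻¹ * g 1) + 1 ≤ Real.exp (32 * ∫ r in (0 : ℝ)..1, ‖v r‖) := by
  set u : ℝ → SL2R := fun r => (g 0)⁻¹ * g r with hu
  have hud (r : ℝ) : HasFrameVel u (v r) r := (hg r).mul_left _
  set N : ℝ → ℝ := fun r => ∫ s in (0 : ℝ)..r, ‖v s‖ with hN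
  have hNd (r : ℝ) : HasDerivAt N ‖v r‖ r :=
    intervalIntegral.integral_hasDerivAt_right (hv.norm.intervalIntegrable _ _)
      (hv.norm.stronglyMeasurableAtFilter _ _) hv.norm.continuousAt
  have hE (r : ℝ) := (((((hud r).entry00.sub_const 1).pow 2).add ((hud r).entry01.pow 2)).add
    ((hud r).entry10.pow 2)).add (((hud r).entry11.sub_const 1).pow 2)
  have hF (r : ℝ) := ((hE r).add_const 1).mul ((hNd r).const_mul (-32)).exp
  -- Gronwall's argument. The derivative of `distOneSq` is twice a sum of eight terms, each a
  -- deviation times an entry times a coefficient of the velocity, hence at most 2(E + 1)‖v‖. This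
  -- gives the rate 32.
  have hanti : Antitone fun r => (distOneSq (u r) + 1) * Real.exp (-32 * N r) := by
    refine antitone_of_hasDerivAt_nonpos (fun r => hF r) (fun r => ?_)
    have hs (w z : ℝ) : |w * z| ≤ (w ^ 2 + z ^ 2) / 2 := by
      rw [abs_mul]; nlinarith [sq_nonneg (|w| - |z|), sq_abs w, sq_abs z]
    set E := distOneSq (u r) with hEdef
    have hE0 : 0 ≤ E := distOneSq_nonneg _
    set a := u r 0 0
    set b := u r 0 1
    set c := u r 1 0
    set d := u r 1 1
    have hEe : E = (a - 1) ^ 2 + b ^ 2 + c ^ 2 + (d - 1) ^ 2 := rfl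
    have bd (w z m : ℝ) (hw : w ^ 2 ≤ E) (hz : z ^ 2 ≤ 2 * E + 2) (hm : |m| ≤ ‖v r‖) :
        w * (z * m) ≤ 2 * (E + 1) * ‖v r‖ := by
      have h1 := hs w z
      have h2 : |w * z| ≤ 2 * (E + 1) := by linarith
      calc w * (z * m) = w * z * m := by ring
        _ ≤ |w * z * m| := le_abs_self _
        _ = |w * z| * |m| := abs_mul _ _
        _ ≤ 2 * (E + 1) * ‖v r‖ := mul_le_mul h2 hm (abs_nonneg _) (by linarith)
    have hmD := abs_matD_le (v r)
    have hmU := abs_matU_le (v r)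
    have hmL := abs_matL_le (v r)
    have hmD' : |-matD (v r)| ≤ ‖v r‖ := by rwa [abs_neg]
    have wa : (a - 1) ^ 2 ≤ E := by rw [hEe]; nlinarith [sq_nonneg b, sq_nonneg c, sq_nonneg (d-1)]
    have wb : b ^ 2 ≤ E := by rw [hEe]; nlinarith [sq_nonneg (a-1), sq_nonneg c, sq_nonneg (d-1)]
    have wc : c ^ 2 ≤ E := by rw [hEe]; nlinarith [sq_nonneg (a-1), sq_nonneg b, sq_nonneg (d-1)]
    have wd : (d - 1) ^ 2 ≤ E := by rw [hEe]; nlinarith [sq_nonneg b, sq_nonneg c, sq_nonneg (a-1)]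
    have za : a ^ 2 ≤ 2 * E + 2 := by nlinarith [sq_nonneg (a - 2)]
    have zb : b ^ 2 ≤ 2 * E + 2 := by linarith
    have zc : c ^ 2 ≤ 2 * E + 2 := by linarith
    have zd : d ^ 2 ≤ 2 * E + 2 := by nlinarith [sq_nonneg (d - 2)]
    have i1 := bd _ _ _ wa za hmD
    have i2 := bd _ _ _ wa zb hmL
    have i3 := bd _ _ _ wb za hmU
    have i4 := bd _ _ _ wb zb hmD'
    have i5 := bd _ _ _ wc zc hmD
    have i6 := bd _ _ _ wc zd hmL
    have i7 := bd _ _ _ wd zc hmU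
    have i8 := bd _ _ _ wd zd hmD'
    have hexp := Real.exp_pos (-32 * N r)
    simp only [Pi.add_apply, Pi.pow_apply, Nat.cast_ofNat, Nat.add_one_sub_one, pow_one]
    change (2 * (a - 1) * (a * matD (v r) + b * matL (v r)) +
      2 * b * (a * matU (v r) - b * matD (v r)) +
      2 * c * (c * matD (v r) + d * matL (v r)) +
      2 * (d - 1) * (c * matU (v r) - d * matD (v r))) * Real.exp (-32 * N r) +
      (E + 1) * (Real.exp (-32 * N r) * (-32 * ‖v r‖)) ≤ 0
    have : (2 * (a - 1) * (a * matD (v r) + b * matL (v r)) +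
      2 * b * (a * matU (v r) - b * matD (v r)) +
      2 * c * (c * matD (v r) + d * matL (v r)) +
      2 * (d - 1) * (c * matU (v r) - d * matD (v r))) ≤ 32 * (E + 1) * ‖v r‖ := by linarith
    nlinarith
  have h01 := hanti (show (0 : ℝ) ≤ 1 by norm_num)
  have hu0 : u 0 = 1 := inv_mul_cancel _
  have hN0 : N 0 = 0 := by simp [hN]
  have hd1 : distOneSq 1 = 0 := by simp [distOneSq]
  simp only [hu0, hN0, hd1, mul_zero, Real.exp_zero, zero_add, mul_one] at h01
  have hexp : Real.exp (32 * N 1) * Real.exp (-32 * N 1) = 1 := by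
    rw [← Real.exp_add]; simp
  have hp := Real.exp_pos (32 * N 1)
  calc distOneSq (u 1) + 1 = ((distOneSq (u 1) + 1) * Real.exp (-32 * N 1)) *
        Real.exp (32 * N 1) := by rw [mul_assoc, mul_comm (Real.exp (-32 * N 1)), hexp, mul_one]
    _ ≤ 1 * Real.exp (32 * N 1) := mul_le_mul_of_nonneg_right h01 hp.le
    _ = _ := by rw [one_mul]

/-! ### The Riemannian distance -/

theorem coordMat_zero (t : ℝ) : coordMat (t, 0, 0) = UnitTangent.geoMat t := by
  refine SL2R.ext_entries ?_ ?_ ?_ ?_ <;>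
    simp [coordMat_entries, UnitTangent.geoMat_entries]

namespace T1S

variable {Γ : Subgroup SL2R}

/-- Lifting of maps from simply connected spaces to `SL(2, ℝ)`. -/
theorem exists_lift (hΓ : IsClosedSurfaceGroup Γ) {A : Type*} [TopologicalSpace A]
    [SimplyConnectedSpace A] [LocallyPathConnectedSpace A] {c : A → T1S Γ} (hc : Continuous c)
    {a : A} {g₀ : SL2R} (h₀ : proj Γ g₀ = c a) :
    ∃ g : A → SL2R, Continuous g ∧ g a = g₀ ∧ ∀ b, proj Γ (g b) = c b := by
  obtain ⟨G, ⟨hG0, hG⟩, -⟩ :=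
    (isCoveringMap_proj hΓ).existsUnique_continuousMap_lifts ⟨c, hc⟩ a g₀ h₀
  exact ⟨G, G.continuous, hG0, fun b => congrFun hG b⟩

theorem continuous_of_hasVelocity (hΓ : IsClosedSurfaceGroup Γ) {c : ℝ → T1S Γ} {v : ℝ → V3}
    (h : ∀ t, HasVelocity c (v t) t) : Continuous c :=
  continuous_iff_continuousAt.2 fun t => HasDeriv.continuousAt hΓ (h t)

/-- A curve in `T¹S` with velocity `v` lifts to a curve in `SL(2, ℝ)` with velocity `v`. -/
theorem exists_lift_hasFrameVel (hΓ : IsClosedSurfaceGroup Γ) {c : ℝ → T1S Γ} {v : ℝ → V3}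
    (h : ∀ t, HasVelocity c (v t) t) {a : ℝ} {g₀ : SL2R} (h₀ : proj Γ g₀ = c a) :
    ∃ g : ℝ → SL2R, g a = g₀ ∧ (∀ t, proj Γ (g t) = c t) ∧ ∀ t, HasFrameVel g (v t) t := by
  obtain ⟨g, hg, hga, hgc⟩ := exists_lift hΓ (continuous_of_hasVelocity hΓ h) h₀
  refine ⟨g, hga, hgc, fun t => ?_⟩
  have h1 : HasDeriv (fun q => proj Γ (g q)) (ContinuousLinearMap.toSpanSingleton ℝ (v t)) t := by
    rw [funext hgc]; exact h t
  exact h1.hasFrameDeriv hΓ hg.continuousAt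

/-- The lengths of curves joining two points. -/
def lengths (x y : T1S Γ) : Set ℝ :=
  {l : ℝ | ∃ (c : ℝ → T1S Γ) (v : ℝ → V3), Continuous v ∧ (∀ t, HasVelocity c (v t) t) ∧
    c 0 = x ∧ c 1 = y ∧ l = ∫ t in (0 : ℝ)..1, ‖v t‖}

theorem length_mem_lengths (hΓ : IsClosedSurfaceGroup Γ) (h : SL2R) (p q : ℝ × ℝ × ℝ) :
    (∫ r in (0 : ℝ)..1, ‖frameD (p + r • (q - p)) (q - p)‖) ∈
      lengths (proj Γ (h * coordMat p)) (proj Γ (h * coordMat q)) := by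
  have hline (r : ℝ) : HasDerivAt (fun r : ℝ => p + r • (q - p)) (q - p) r := by
    simpa using ((hasDerivAt_id r).smul_const (q - p)).const_add p
  refine ⟨fun r => proj Γ (h * coordMat (p + r • (q - p))),
    fun r => frameD (p + r • (q - p)) (q - p), ?_, fun r => ?_, by simp, by simp, rfl⟩
  · have hc : Continuous fun r : ℝ => p + r • (q - p) := by fun_prop
    exact (continuous_clm_apply.1 continuous_frameD (q - p)).comp hc
  · exact (hasDeriv_proj_coordMat hΓ h _).comp_hasDerivAt hΓ
      (u := fun r : ℝ => p + r • (q - p)) (hline r)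

/-- Without this, `rdist` could be the default infimum 0 of the empty set. A row vector (s, t)
orthogonal to neither second column is one of the columns, or their sum if they are orthogonal. With
it as second row of `m`, both `m * g` and `m * k` are, up to sign, in the range of the coordinates,
where a segment joins them. -/
theorem lengths_nonempty (hΓ : IsClosedSurfaceGroup Γ) (x y : T1S Γ) : (lengths x y).Nonempty := by
  obtain ⟨g, rfl⟩ := proj_surjective x
  obtain ⟨k, rfl⟩ := proj_surjective y
  obtain ⟨s, t, hst, hg, hk⟩ : ∃ s t : ℝ, s ^ 2 + t ^ 2 ≠ 0 ∧ s * g 0 1 + t * g 1 1 ≠ 0 ∧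
      s * k 0 1 + t * k 1 1 ≠ 0 := by
    have hg0 : g 0 1 ^ 2 + g 1 1 ^ 2 ≠ 0 := by
      intro h0
      have h1 : g 0 1 = 0 := by nlinarith [sq_nonneg (g 0 1), sq_nonneg (g 1 1)]
      have h2 : g 1 1 = 0 := by nlinarith [sq_nonneg (g 0 1), sq_nonneg (g 1 1)]
      have := g.det_eq
      rw [h1, h2] at this
      simp at this
    have hk0 : k 0 1 ^ 2 + k 1 1 ^ 2 ≠ 0 := by
      intro h0
      have h1 : k 0 1 = 0 := by nlinarith [sq_nonneg (k 0 1), sq_nonneg (k 1 1)]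
      have h2 : k 1 1 = 0 := by nlinarith [sq_nonneg (k 0 1), sq_nonneg (k 1 1)]
      have := k.det_eq
      rw [h1, h2] at this
      simp at this
    by_cases h : g 0 1 * k 0 1 + g 1 1 * k 1 1 = 0
    · refine ⟨g 0 1 + k 0 1, g 1 1 + k 1 1, ?_, ?_, ?_⟩
      · intro h3
        apply hg0
        nlinarith [sq_nonneg (k 0 1), sq_nonneg (k 1 1), sq_nonneg (g 0 1), sq_nonneg (g 1 1)]
      · intro h3; apply hg0; linarith
      · intro h3; apply hk0; linarith
    · refine ⟨g 0 1, g 1 1, hg0, ?_, h⟩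
      intro h3; apply hg0; linarith
  obtain ⟨m, hm0, hm1⟩ : ∃ m : SL2R, m 1 0 = s ∧ m 1 1 = t := by
    refine ⟨⟨!![t / (s ^ 2 + t ^ 2), -s / (s ^ 2 + t ^ 2); s, t], ?_⟩, rfl, rfl⟩
    rw [Matrix.det_fin_two_of]; field_simp; ring
  have main : ∀ k : SL2R, (m * k) 1 1 ≠ 0 → ∃ q, proj Γ (m⁻¹ * coordMat q) = proj Γ k := by
    intro k hk
    rcases lt_or_gt_of_ne hk with hk | hk
    · refine ⟨coord (-(m * k)), ?_⟩
      rw [coordMat_coord (by simpa using hk), mul_neg, proj_neg, inv_mul_cancel_left]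
    · exact ⟨coord (m * k), by rw [coordMat_coord hk, inv_mul_cancel_left]⟩
  obtain ⟨p, hp⟩ := main g (by rwa [SL2R.mul_entry, hm0, hm1])
  obtain ⟨q, hq⟩ := main k (by rwa [SL2R.mul_entry, hm0, hm1])
  rw [← hp, ← hq]
  exact ⟨_, length_mem_lengths hΓ _ p q⟩

theorem lengths_bddBelow (x y : T1S Γ) : BddBelow (lengths x y) := by
  refine ⟨0, ?_⟩
  rintro _ ⟨c, v, -, -, -, -, rfl⟩
  exact intervalIntegral.integral_nonneg (by norm_num) fun _ _ => norm_nonneg _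

/-- Lift an almost shortest curve so that it starts at `g`, and bound the displacement of its end
point by its length. -/
theorem exists_mul_of_rdist_lt (hΓ : IsClosedSurfaceGroup Γ) {g : SL2R} {y : T1S Γ} {ℓ : ℝ}
    (h : rdist (proj Γ g) y < ℓ) :
    ∃ k : SL2R, proj Γ (g * k) = y ∧ distOneSq k + 1 ≤ Real.exp (32 * ℓ) := by
  obtain ⟨l, ⟨c, v, hv, hcv, hc0, hc1, rfl⟩, hl⟩ :=
    exists_lt_of_csInf_lt (lengths_nonempty hΓ _ _) h
  obtain ⟨G, hG0, hGc, hGv⟩ := exists_lift_hasFrameVel hΓ hcv (a := 0) hc0.symm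
  refine ⟨g⁻¹ * G 1, by rw [mul_inv_cancel_left, hGc, hc1], ?_⟩
  rw [← hG0]
  refine (distOneSq_le_of_hasFrameVel hv hGv).trans (Real.exp_le_exp.2 ?_)
  linarith

/-- The coordinate segment to the axis is short: since |y| ≤ 1, the three frame components of its
velocity are at most 2|x|, 2|x| + |y| and 2|x| + |y|. -/
theorem rdist_coordMat_le (hΓ : IsClosedSurfaceGroup Γ) (h : SL2R) {t x y : ℝ} (hy : |y| ≤ 1) :
    rdist (proj Γ (h * coordMat (t, x, y))) (proj Γ (h * UnitTangent.geoMat t)) ≤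
      8 * (|x| + |y|) := by
  rw [← coordMat_zero]
  refine (csInf_le (lengths_bddBelow _ _) (length_mem_lengths hΓ h (t, x, y) (t, 0, 0))).trans ?_
  have hb : ∀ r ∈ Set.uIoc (0 : ℝ) 1, ‖‖frameD ((t, x, y) + r • ((t, 0, 0) - (t, x, y)))
      ((t, 0, 0) - (t, x, y))‖‖ ≤ 8 * (|x| + |y|) := by
    intro r hr
    rw [Set.uIoc_of_le zero_le_one] at hr
    rw [norm_norm]
    refine (V3.norm_le_sum _).trans ?_
    rw [frameD_apply]
    simp only [Prod.mk_sub_mk, Prod.smul_mk, Prod.mk_add_mk, sub_self, zero_sub, smul_eq_mul,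
      Matrix.cons_val_zero, Matrix.cons_val_one, Matrix.cons_val]
    set z := y + r * -y with hz
    have hz1 : |z| ≤ 1 := by
      have : z = (1 - r) * y := by rw [hz]; ring
      rw [this, abs_mul, abs_of_nonneg (by linarith [hr.2])]
      nlinarith [abs_nonneg y, hr.1, hr.2]
    have hzx : |z * x| ≤ |x| := by rw [abs_mul]; nlinarith [abs_nonneg x, abs_nonneg z]
    have hzzx : |z ^ 2 * x| ≤ |x| := by
      rw [pow_two, mul_assoc, abs_mul]; nlinarith [abs_nonneg (z * x), abs_nonneg z]
    have e1 : |0 + 2 * z * (-x + (x + r * -x) * 0)| ≤ 2 * |x| := by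
      have : 0 + 2 * z * (-x + (x + r * -x) * 0) = -(2 * (z * x)) := by ring
      rw [this, abs_neg, abs_mul, abs_two]; linarith
    have e2 : |-(-x + (x + r * -x) * 0 + (-y - z * 0 - z ^ 2 * (-x + (x + r * -x) * 0)))| ≤
        2 * |x| + |y| := by
      have : -(-x + (x + r * -x) * 0 + (-y - z * 0 - z ^ 2 * (-x + (x + r * -x) * 0))) =
        x + y + -(z ^ 2 * x) := by ring
      rw [this]
      refine (abs_add_three _ _ _).trans ?_
      rw [abs_neg]; linarith
    have e3 : |-x + (x + r * -x) * 0 - (-y - z * 0 - z ^ 2 * (-x + (x + r * -x) * 0))| ≤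
        2 * |x| + |y| := by
      have : -x + (x + r * -x) * 0 - (-y - z * 0 - z ^ 2 * (-x + (x + r * -x) * 0)) =
        -x + y + -(z ^ 2 * x) := by ring
      rw [this]
      refine (abs_add_three _ _ _).trans ?_
      rw [abs_neg, abs_neg]; linarith
    linarith [abs_nonneg x, abs_nonneg y]
  have := intervalIntegral.norm_integral_le_of_norm_le_const hb
  rw [sub_zero, abs_one, mul_one] at this
  exact (le_abs_self _).trans this

end T1S

end

noncomputable section

/-! ### Shadowing of curves close to the geodesic flow -/

/-- A linear system whose coefficient matrix is close to `diag (1, -1)` up to positive scaling has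
a solution that stays in a cone around the contracted direction for all times. -/
theorem exists_solution_in_cone {c₁ d₁ c₂ d₂ m u l : ℝ → ℝ} {θ : ℝ} (hθ : 0 < θ) (hθ1 : θ ≤ 1 / 4)
    (hc₁ : ∀ t, HasDerivAt c₁ (c₁ t * m t + d₁ t * l t) t)
    (hd₁ : ∀ t, HasDerivAt d₁ (c₁ t * u t - d₁ t * m t) t)
    (hc₂ : ∀ t, HasDerivAt c₂ (c₂ t * m t + d₂ t * l t) t)
    (hd₂ : ∀ t, HasDerivAt d₂ (c₂ t * u t - d₂ t * m t) t)
    (hdet : ∀ t, c₁ t * d₂ t - d₁ t * c₂ t ≠ 0)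
    (hu : ∀ t, |u t| ≤ 2 * θ * m t) (hl : ∀ t, |l t| ≤ 2 * θ * m t) :
    ∃ r s : ℝ, r ^ 2 + s ^ 2 = 1 ∧
      ∀ t, |r * c₁ t + s * c₂ t| ≤ 2 * θ * |r * d₁ t + s * d₂ t| := by
  set Q : ℝ × ℝ → ℝ → ℝ := fun p t =>
    (p.1 * c₁ t + p.2 * c₂ t) ^ 2 - (2 * θ) ^ 2 * (p.1 * d₁ t + p.2 * d₂ t) ^ 2 with hQ
  -- The derivative of c² - (2θ)²d² is at least 2m(c² + (2θ)²d²) - 8θm|cd|, which is nonnegative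
  -- because 4θ|cd| ≤ c² + (2θ)²d².
  have hmono (p : ℝ × ℝ) : Monotone (Q p) := by
    have hder (t : ℝ) := ((((hc₁ t).const_mul p.1).add ((hc₂ t).const_mul p.2)).pow 2).sub
      (((((hd₁ t).const_mul p.1).add ((hd₂ t).const_mul p.2)).pow 2).const_mul ((2 * θ) ^ 2))
    refine monotone_of_hasDerivAt_nonneg (fun t => hder t) fun t => ?_
    simp only [Pi.add_apply, Nat.cast_ofNat, Nat.add_one_sub_one, pow_one, Pi.zero_apply]
    set c := p.1 * c₁ t + p.2 * c₂ t with hc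
    set d := p.1 * d₁ t + p.2 * d₂ t with hd
    have hm : 0 ≤ m t := by
      have := (abs_nonneg _).trans (hu t)
      by_contra hneg
      push Not at hneg
      nlinarith
    have e : 2 * c * (p.1 * (c₁ t * m t + d₁ t * l t) + p.2 * (c₂ t * m t + d₂ t * l t)) -
        (2 * θ) ^ 2 * (2 * d * (p.1 * (c₁ t * u t - d₁ t * m t) +
          p.2 * (c₂ t * u t - d₂ t * m t))) =
        2 * m t * (c ^ 2 + (2 * θ) ^ 2 * d ^ 2) + 2 * (c * d) * (l t - (2 * θ) ^ 2 * u t) := by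
      rw [hc, hd]; ring
    change 0 ≤ 2 * c * (p.1 * (c₁ t * m t + d₁ t * l t) + p.2 * (c₂ t * m t + d₂ t * l t)) -
        (2 * θ) ^ 2 * (2 * d * (p.1 * (c₁ t * u t - d₁ t * m t) +
          p.2 * (c₂ t * u t - d₂ t * m t)))
    rw [e]
    have h1 : |l t - (2 * θ) ^ 2 * u t| ≤ 4 * θ * m t := by
      have h2 : |(2 * θ) ^ 2 * u t| ≤ 2 * θ * m t := by
        rw [abs_mul, abs_of_nonneg (by positivity)]
        have h3 : (2 * θ) ^ 2 ≤ 1 := by nlinarith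
        have := mul_le_mul h3 (hu t) (abs_nonneg _) zero_le_one
        linarith
      have h4 := abs_sub (l t) ((2 * θ) ^ 2 * u t)
      linarith [hl t]
    have h2 : 4 * θ * |c * d| ≤ c ^ 2 + (2 * θ) ^ 2 * d ^ 2 := by
      rw [abs_mul]
      nlinarith [sq_nonneg (|c| - 2 * θ * |d|), sq_abs c, sq_abs d]
    have h3 : |c * d * (l t - (2 * θ) ^ 2 * u t)| ≤ |c * d| * (4 * θ * m t) := by
      rw [abs_mul (c * d)]
      exact mul_le_mul_of_nonneg_left h1 (abs_nonneg _)
    have h5 := neg_abs_le (c * d * (l t - (2 * θ) ^ 2 * u t))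
    nlinarith
  have hQc (t : ℝ) : Continuous fun p : ℝ × ℝ => Q p t := by
    simp only [hQ]; fun_prop
  set S : Set (ℝ × ℝ) := {p | p.1 ^ 2 + p.2 ^ 2 = 1} with hS
  have hScl : IsClosed S := isClosed_eq (by fun_prop) continuous_const
  have hSc : IsCompact S := by
    refine (isCompact_Icc (a := ((-1, -1) : ℝ × ℝ)) (b := (1, 1))).of_isClosed_subset hScl ?_
    rintro ⟨a, b⟩ hab
    simp only [hS, Set.mem_ofPred_eq] at hab
    simp only [Set.mem_Icc, Prod.mk_le_mk]
    exact ⟨⟨by nlinarith, by nlinarith⟩, by nlinarith, by nlinarith⟩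
  -- Unit initial vectors whose solution is in the cone at time n. These compact sets decrease by
  -- monotonicity of `Q`, and none is empty because some solution has c = 0 at time n. A common
  -- point is in the cone at every integer time n ≥ 0, hence at all earlier times as well.
  set C : ℕ → Set (ℝ × ℝ) := fun n => S ∩ {p | Q p n ≤ 0} with hC
  have hCcl (n : ℕ) : IsClosed (C n) := hScl.inter (isClosed_le (hQc n) continuous_const)
  obtain ⟨⟨r, s⟩, hrs⟩ : (⋂ n, C n).Nonempty := by
    refine IsCompact.nonempty_iInter_of_sequence_nonempty_isCompact_isClosed C ?_ ?_
      (hSc.inter_right (isClosed_le (hQc _) continuous_const)) hCcl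
    · rintro n p ⟨hp, hp2⟩
      exact ⟨hp, (hmono p (by simp)).trans hp2⟩
    · intro n
      have hne : c₂ n ^ 2 + c₁ n ^ 2 ≠ 0 := by
        intro h0
        have h1 : c₁ n = 0 := by nlinarith [sq_nonneg (c₁ n), sq_nonneg (c₂ n)]
        have h2 : c₂ n = 0 := by nlinarith [sq_nonneg (c₁ n), sq_nonneg (c₂ n)]
        apply hdet n; rw [h1, h2]; ring
      have hpos : 0 < c₂ n ^ 2 + c₁ n ^ 2 := lt_of_le_of_ne (by positivity) hne.symm
      set w := √(c₂ n ^ 2 + c₁ n ^ 2) with hw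
      have hw2 : w ^ 2 = c₂ n ^ 2 + c₁ n ^ 2 := Real.sq_sqrt hpos.le
      have hw0 : 0 < w := Real.sqrt_pos.2 hpos
      refine ⟨(-c₂ n / w, c₁ n / w), ?_, ?_⟩
      · simp only [hS, Set.mem_ofPred_eq]
        field_simp
        linarith
      · simp only [hQ, Set.mem_ofPred_eq]
        have h1 : -c₂ n / w * c₁ n + c₁ n / w * c₂ n = 0 := by ring
        rw [h1]
        have := mul_nonneg (sq_nonneg (2 * θ))
          (sq_nonneg (-c₂ n / w * d₁ n + c₁ n / w * d₂ n))
        linarith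
  rw [Set.mem_iInter] at hrs
  refine ⟨r, s, (hrs 0).1, fun t => ?_⟩
  obtain ⟨n, hn⟩ := exists_nat_ge t
  have h1 : Q (r, s) t ≤ 0 := (hmono _ hn).trans (hrs n).2
  have h2 : (r * c₁ t + s * c₂ t) ^ 2 ≤ (2 * θ * |r * d₁ t + s * d₂ t|) ^ 2 := by
    rw [mul_pow, sq_abs]
    simp only [hQ] at h1
    linarith
  exact abs_le_of_sq_le_sq h2 (by positivity)

theorem const_sign_of_ne_zero {f : ℝ → ℝ} (hf : Continuous f) (h0 : ∀ t, f t ≠ 0) :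
    (∀ t, 0 < f t) ∨ ∀ t, f t < 0 := by
  by_contra! h
  obtain ⟨⟨s, hs⟩, t, ht⟩ := h
  obtain ⟨r, hr⟩ := mem_range_of_exists_le_of_exists_ge hf ⟨s, hs⟩ ⟨t, ht⟩
  exact h0 r hr

/-- A curve in `SL(2, ℝ)` that moves in a cone around the direction of the geodesic flow stays in
a tube around a geodesic. -/
theorem exists_geodesic_near {g : ℝ → SL2R} {v : ℝ → V3} (hg : ∀ t, HasFrameVel g (v t) t) {θ : ℝ}
    (hθ : 0 < θ) (hθ1 : θ ≤ 1 / 4)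
    (hU : ∀ t, |matU (v t)| ≤ θ * v t 0) (hL : ∀ t, |matL (v t)| ≤ θ * v t 0) :
    ∃ h : SL2R, ∀ t, 0 < (h⁻¹ * g t) 1 1 ∧ |(coord (h⁻¹ * g t)).2.1| ≤ 3 * θ ∧
      |(coord (h⁻¹ * g t)).2.2| ≤ 3 * θ := by
  have hm (t : ℝ) : 2 * θ * matD (v t) = θ * v t 0 := by rw [matD_apply]; ring
  obtain ⟨r, s, hrs, hcone⟩ := exists_solution_in_cone hθ hθ1 (fun t => (hg t).entry00)
    (fun t => (hg t).entry01) (fun t => (hg t).entry10) (fun t => (hg t).entry11)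
    (fun t => by rw [(g t).det_eq]; exact one_ne_zero)
    (fun t => (hU t).trans (hm t).ge) (fun t => (hL t).trans (hm t).ge)
  -- Reversing time and exchanging the columns turns the expanded direction into the contracted one.
  -- The result is a combination of rows dominated by its first entry for all times.
  obtain ⟨r', s', hrs', hcone'⟩ := exists_solution_in_cone
    (c₁ := fun t => g (-t) 0 1) (d₁ := fun t => g (-t) 0 0)
    (c₂ := fun t => g (-t) 1 1) (d₂ := fun t => g (-t) 1 0)
    (m := fun t => matD (v (-t))) (u := fun t => -matL (v (-t)))
    (l := fun t => -matU (v (-t))) hθ hθ1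
    (fun t => ((hg (-t)).entry01.scomp t (hasDerivAt_neg t)).congr_deriv (by simp; ring))
    (fun t => ((hg (-t)).entry00.scomp t (hasDerivAt_neg t)).congr_deriv (by simp; ring))
    (fun t => ((hg (-t)).entry11.scomp t (hasDerivAt_neg t)).congr_deriv (by simp; ring))
    (fun t => ((hg (-t)).entry10.scomp t (hasDerivAt_neg t)).congr_deriv (by simp; ring))
    (fun t => by
      have := (g (-t)).det_eq
      intro h0; linarith)
    (fun t => by rw [abs_neg]; exact (hL (-t)).trans (hm (-t)).ge)
    (fun t => by rw [abs_neg]; exact (hU (-t)).trans (hm (-t)).ge)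
  have hcone2 : ∀ t, |r' * g t 0 1 + s' * g t 1 1| ≤ 2 * θ * |r' * g t 0 0 + s' * g t 1 0| :=
    fun t => by simpa using hcone' (-t)
  -- the entries are nowhere zero
  have hdne (t : ℝ) : r * g t 0 1 + s * g t 1 1 ≠ 0 := by
    intro h0
    have h1 := hcone t
    rw [h0, abs_zero, mul_zero] at h1
    have h2 : r * g t 0 0 + s * g t 1 0 = 0 := abs_eq_zero.1 (le_antisymm h1 (abs_nonneg _))
    have hd := (g t).det_eq
    have hr : r = 0 := by linear_combination (g t 1 1) * h2 - (g t 1 0) * h0 - r * hd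
    have hs : s = 0 := by linear_combination (g t 0 0) * h0 - (g t 0 1) * h2 - s * hd
    rw [hr, hs] at hrs; norm_num at hrs
  have hane (t : ℝ) : r' * g t 0 0 + s' * g t 1 0 ≠ 0 := by
    intro h0
    have h1 := hcone2 t
    rw [h0, abs_zero, mul_zero] at h1
    have h2 : r' * g t 0 1 + s' * g t 1 1 = 0 := abs_eq_zero.1 (le_antisymm h1 (abs_nonneg _))
    have hd := (g t).det_eq
    have hr : r' = 0 := by linear_combination (g t 1 1) * h0 - (g t 1 0) * h2 - r' * hd
    have hs : s' = 0 := by linear_combination (g t 0 0) * h2 - (g t 0 1) * h0 - s' * hd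
    rw [hr, hs] at hrs'; norm_num at hrs'
  have hprod (t : ℝ) : |(r' * g t 0 1 + s' * g t 1 1) * (r * g t 0 0 + s * g t 1 0)| ≤
      4 * θ ^ 2 * |(r' * g t 0 0 + s' * g t 1 0) * (r * g t 0 1 + s * g t 1 1)| := by
    rw [abs_mul, abs_mul]
    have := mul_le_mul (hcone2 t) (hcone t) (abs_nonneg _) (by positivity)
    linarith
  have hdetD (t : ℝ) : (r' * g t 0 0 + s' * g t 1 0) * (r * g t 0 1 + s * g t 1 1) -
      (r' * g t 0 1 + s' * g t 1 1) * (r * g t 0 0 + s * g t 1 0) = r' * s - s' * r := by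
    linear_combination (r' * s - s' * r) * (g t).det_eq
  have hθ2 : 4 * θ ^ 2 ≤ 1 / 4 := by nlinarith
  -- Were the combinations dependent, the two products in `hdetD` would be equal, while the second
  -- is at most a quarter of the first, which is not zero.
  have hD : r' * s - s' * r ≠ 0 := by
    intro h0
    have h1 := hdetD 0
    have h2 := hprod 0
    have h3 := mul_ne_zero (hane 0) (hdne 0)
    rw [h0] at h1
    rw [sub_eq_zero.1 h1] at h2 h3
    have h4 := abs_pos.2 h3
    nlinarith
  obtain ⟨e, he, hpos⟩ : ∃ e : ℝ, e ^ 2 = 1 ∧ ∀ t, 0 < e * (r * g t 0 1 + s * g t 1 1) := by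
    have hcont : Continuous fun t => r * g t 0 1 + s * g t 1 1 :=
      continuous_iff_continuousAt.2 fun t =>
        ((hg t).entry01.continuousAt.const_mul r).add ((hg t).entry11.continuousAt.const_mul s)
    rcases const_sign_of_ne_zero hcont hdne with h | h
    · exact ⟨1, by norm_num, fun t => by simpa using h t⟩
    · exact ⟨-1, by norm_num, fun t => by have := h t; linarith⟩
  set D := r' * s - s' * r with hDdef
  have he0 : e ≠ 0 := by rintro rfl; norm_num at he
  -- The two combinations, scaled to determinant 1 and to a positive lower right entry, are the rows
  -- of the inverse of the required matrix.
  obtain ⟨k, hk00, hk01, hk10, hk11⟩ : ∃ k : SL2R, k 0 0 = r' / (D * e) ∧ k 0 1 = s' / (D * e) ∧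
      k 1 0 = e * r ∧ k 1 1 = e * s := by
    refine ⟨⟨!![r' / (D * e), s' / (D * e); e * r, e * s], ?_⟩, rfl, rfl, rfl, rfl⟩
    rw [Matrix.det_fin_two_of]
    field_simp
    rw [hDdef]
  refine ⟨k⁻¹, fun t => ?_⟩
  rw [inv_inv]
  have h01 : (k * g t) 0 1 = (r' * g t 0 1 + s' * g t 1 1) / (D * e) := by
    rw [SL2R.mul_entry, hk00, hk01]; ring
  have h10 : (k * g t) 1 0 = e * (r * g t 0 0 + s * g t 1 0) := by
    rw [SL2R.mul_entry, hk10, hk11]; ring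
  have h11 : (k * g t) 1 1 = e * (r * g t 0 1 + s * g t 1 1) := by
    rw [SL2R.mul_entry, hk10, hk11]; ring
  refine ⟨by rw [h11]; exact hpos t, ?_, ?_⟩
  · simp only [coord]
    rw [h01, h11]
    have e1 : (r' * g t 0 1 + s' * g t 1 1) / (D * e) * (e * (r * g t 0 1 + s * g t 1 1)) =
        (r' * g t 0 1 + s' * g t 1 1) * (r * g t 0 1 + s * g t 1 1) / D := by field_simp
    rw [e1, abs_div, div_le_iff₀ (abs_pos.2 hD), abs_mul]
    have h1 := hprod t
    have h2 := hdetD t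
    have h3 := mul_le_mul_of_nonneg_right (hcone2 t) (abs_nonneg (r * g t 0 1 + s * g t 1 1))
    have h4 : |(r' * g t 0 0 + s' * g t 1 0) * (r * g t 0 1 + s * g t 1 1)| ≤ |D| +
        |(r' * g t 0 1 + s' * g t 1 1) * (r * g t 0 0 + s * g t 1 0)| := by
      rw [← h2]
      have := abs_add_le ((r' * g t 0 0 + s' * g t 1 0) * (r * g t 0 1 + s * g t 1 1) -
        (r' * g t 0 1 + s' * g t 1 1) * (r * g t 0 0 + s * g t 1 0))
        ((r' * g t 0 1 + s' * g t 1 1) * (r * g t 0 0 + s * g t 1 0))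
      rwa [sub_add_cancel] at this
    rw [mul_assoc, ← abs_mul (r' * g t 0 0 + s' * g t 1 0)] at h3
    set P := |(r' * g t 0 0 + s' * g t 1 0) * (r * g t 0 1 + s * g t 1 1)|
    have hP : 0 ≤ P := abs_nonneg _
    -- From P ≤ |D| + P / 4. Then 2θP ≤ (8/3)θ|D|, which explains the width 3θ.
    have h5 : 3 * P ≤ 4 * |D| := by
      have := mul_le_mul_of_nonneg_right hθ2 hP
      linarith
    have h6 := mul_le_mul_of_nonneg_left h5 hθ.le
    have h7 : 0 ≤ θ * |D| := mul_nonneg hθ.le (abs_nonneg _)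
    linarith
  · simp only [coord]
    rw [h10, h11, mul_div_mul_left _ _ he0, abs_div, div_le_iff₀ (abs_pos.2 (hdne t))]
    have := abs_nonneg (r * g t 0 1 + s * g t 1 1)
    nlinarith [hcone t]

/-- Two geodesics at bounded distance are the same up to the sign of the matrix. -/
theorem eq_geoMat_of_bounded {k : SL2R} {T₀ T₁ : ℝ → ℝ} {C : ℝ}
    (h0t : Tendsto T₀ atTop atTop) (h1t : Tendsto T₁ atTop atTop)
    (h0b : Tendsto T₀ atBot atBot) (h1b : Tendsto T₁ atBot atBot)
    (hC : ∀ t, |(UnitTangent.geoMat (-T₀ t) * k * UnitTangent.geoMat (T₁ t)) 0 1| ≤ C ∧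
      |(UnitTangent.geoMat (-T₀ t) * k * UnitTangent.geoMat (T₁ t)) 1 0| ≤ C) :
    ∃ r, k = UnitTangent.geoMat r ∨ k = -UnitTangent.geoMat r := by
  have e01 (t : ℝ) : (UnitTangent.geoMat (-T₀ t) * k * UnitTangent.geoMat (T₁ t)) 0 1 =
      k 0 1 * Real.exp (-(T₀ t + T₁ t) / 2) := by
    simp only [SL2R.mul_entry, UnitTangent.geoMat_entries]
    rw [show -(T₀ t + T₁ t) / 2 = -T₀ t / 2 + -(T₁ t / 2) by ring, Real.exp_add]
    ring
  have e10 (t : ℝ) : (UnitTangent.geoMat (-T₀ t) * k * UnitTangent.geoMat (T₁ t)) 1 0 =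
      k 1 0 * Real.exp ((T₀ t + T₁ t) / 2) := by
    simp only [SL2R.mul_entry, UnitTangent.geoMat_entries]
    rw [show (T₀ t + T₁ t) / 2 = -(-T₀ t / 2) + T₁ t / 2 by ring, Real.exp_add]
    ring
  have key (a : ℝ) (E : ℝ → ℝ) (l : Filter ℝ) [l.NeBot] (hE : Tendsto E l atTop)
      (hb : ∀ t, |a * Real.exp (E t)| ≤ C) : a = 0 := by
    by_contra ha
    have h1 : Tendsto (fun t => |a| * Real.exp (E t)) l atTop :=
      (Real.tendsto_exp_atTop.comp hE).const_mul_atTop (abs_pos.2 ha)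
    obtain ⟨t, ht⟩ := (h1.eventually_gt_atTop C).exists
    have := hb t
    rw [abs_mul, Real.abs_exp] at this
    linarith
  -- The lower left entry carries a factor that blows up in the future, the upper right entry one
  -- that blows up in the past; boundedness kills both.
  have h10 : k 1 0 = 0 := by
    refine key _ (fun t => (T₀ t + T₁ t) / 2) atTop ?_ fun t => by rw [← e10]; exact (hC t).2
    exact (h0t.atTop_add_atTop h1t).atTop_div_const two_pos
  have h01 : k 0 1 = 0 := by
    refine key _ (fun t => -(T₀ t + T₁ t) / 2) atBot ?_ fun t => by rw [← e01]; exact (hC t).1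
    exact (tendsto_neg_atBot_atTop.comp (h0b.atBot_add_atBot h1b)).atTop_div_const two_pos
  have hd := k.det_eq
  rw [h10, h01, mul_zero, sub_zero] at hd
  have hne : k 0 0 ≠ 0 := by intro h; rw [h] at hd; simp at hd
  have h11 : k 1 1 = (k 0 0)⁻¹ := eq_inv_of_mul_eq_one_right hd
  refine ⟨2 * Real.log |k 0 0|, ?_⟩
  have e1 : Real.exp (2 * Real.log |k 0 0| / 2) = |k 0 0| := by
    rw [mul_div_cancel_left₀ _ two_ne_zero, Real.exp_log (abs_pos.2 hne)]
  have e2 : Real.exp (-(2 * Real.log |k 0 0| / 2)) = |k 0 0|⁻¹ := by rw [Real.exp_neg, e1]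
  rcases lt_or_gt_of_ne hne with h | h
  · right
    rw [abs_of_neg h] at e1 e2 ⊢
    refine SL2R.ext_entries ?_ ?_ ?_ ?_ <;>
      simp only [Matrix.SpecialLinearGroup.coe_neg, Matrix.neg_apply, UnitTangent.geoMat_entries,
        e1, e2, h01, h10, h11, neg_neg, neg_zero, inv_neg]
  · left
    rw [abs_of_pos h] at e1 e2 ⊢
    refine SL2R.ext_entries ?_ ?_ ?_ ?_ <;>
      simp only [UnitTangent.geoMat_entries, e1, e2, h01, h10, h11]

end

/-! ### Existence and uniqueness of the shadowing orbit. -/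

noncomputable section

open T1S UnitTangent

/-- A function on the line with derivative bounded below by a positive constant is a
diffeomorphism. -/
theorem exists_inverse_of_deriv_ge {T T' : ℝ → ℝ} {a : ℝ} (ha : 0 < a)
    (hT : ∀ t, HasDerivAt T (T' t) t) (hT' : ∀ t, a ≤ T' t) :
    Tendsto T atTop atTop ∧ Tendsto T atBot atBot ∧ ∃ s : ℝ → ℝ, (∀ t, T (s t) = t) ∧
      (∀ t, s (T t) = t) ∧ ∀ t, HasDerivAt s (T' (s t))⁻¹ t := by
  have hd (t : ℝ) : HasDerivAt (fun t => T t - a * t) (T' t - a) t :=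
    ((hT t).sub ((hasDerivAt_id t).const_mul a)).congr_deriv (by ring)
  have hmono : Monotone fun t => T t - a * t :=
    monotone_of_deriv_nonneg (fun t => (hd t).differentiableAt) fun t => by
      rw [(hd t).deriv]; linarith [hT' t]
  have htop : Tendsto T atTop atTop := by
    refine tendsto_atTop_mono' _ ?_ (tendsto_atTop_add_const_left _ (T 0)
      (tendsto_id.const_mul_atTop ha))
    filter_upwards [eventually_ge_atTop 0] with t ht
    have := hmono ht
    simp only [mul_zero, sub_zero, id] at this ⊢
    linarith
  have hbot : Tendsto T atBot atBot := by
    refine tendsto_atBot_mono' _ ?_ (tendsto_atBot_add_const_left _ (T 0)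
      (tendsto_id.const_mul_atBot ha))
    filter_upwards [eventually_le_atBot 0] with t ht
    have := hmono ht
    simp only [mul_zero, sub_zero, id] at this ⊢
    linarith
  have hstrict : StrictMono T := strictMono_of_deriv_pos fun t => by
    rw [(hT t).deriv]; linarith [hT' t]
  have hcont : Continuous T := continuous_iff_continuousAt.2 fun t => (hT t).continuousAt
  let e := hstrict.orderIsoOfSurjective T (hcont.surjective htop hbot)
  have he1 (t : ℝ) : T (e.symm t) = t := e.apply_symm_apply t
  refine ⟨htop, hbot, e.symm, he1, fun t => e.symm_apply_apply t, fun t => ?_⟩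
  refine HasDerivAt.of_local_left_inverse e.toHomeomorph.symm.continuous.continuousAt
    (hT _) (by linarith [hT' (e.symm t)]) (Eventually.of_forall he1)

/-- The reason for the form of `coordMat`: sliding along the axis changes only the time, so all base
points on a geodesic define the same tube. -/
theorem geoMat_mul_coordMat (r : ℝ) (q : ℝ × ℝ × ℝ) :
    geoMat r * coordMat q = coordMat (q.1 + r, q.2.1, q.2.2) := by
  refine SL2R.ext_entries ?_ ?_ ?_ ?_ <;>
    simp only [SL2R.mul_entry, coordMat_entries, geoMat_entries, add_div, neg_add, Real.exp_add] <;>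
    ring

theorem geoMat_add (r t : ℝ) : geoMat (r + t) = geoMat r * geoMat t := by
  rw [← coordMat_zero t, geoMat_mul_coordMat, ← coordMat_zero, add_comm]

theorem geoMat_zero : geoMat 0 = 1 := by
  refine SL2R.ext_entries ?_ ?_ ?_ ?_ <;> simp [geoMat_entries]

theorem geoMat_neg (r : ℝ) : geoMat (-r) = (geoMat r)⁻¹ := by
  rw [eq_inv_iff_mul_eq_one, ← geoMat_add, neg_add_cancel, geoMat_zero]

/-- A curve whose velocity stays in a narrow cone around the geodesic field, reparametrized by the
time of a geodesic close to it. -/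
theorem exists_geodesic_coord {g : ℝ → SL2R} {v : ℝ → V3} (hg : ∀ t, HasFrameVel g (v t) t)
    {θ a : ℝ} (hθ : 0 < θ) (hθ1 : θ ≤ 1 / 4) (ha : 0 < a) (hv : ∀ t, a ≤ v t 0)
    (hU : ∀ t, |matU (v t)| ≤ θ * v t 0) (hL : ∀ t, |matL (v t)| ≤ θ * v t 0) :
    ∃ (h : SL2R) (s s' x y : ℝ → ℝ), (∀ t, HasDerivAt s (s' t) t) ∧
      (∀ t, 0 < s' t ∧ |(s' t)⁻¹ - v (s t) 0| ≤ 6 * θ ^ 2 * v (s t) 0) ∧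
      Function.Surjective s ∧
      Continuous x ∧ Continuous y ∧ (∀ t, |x t| ≤ 3 * θ ∧ |y t| ≤ 3 * θ) ∧
      ∀ t, g (s t) = h * coordMat (t, x t, y t) := by
  obtain ⟨h, hh⟩ := exists_geodesic_near hg hθ hθ1 hU hL
  have hgh (t : ℝ) : HasFrameVel (fun t => h⁻¹ * g t) (v t) t := (hg t).mul_left h⁻¹
  have hq (t : ℝ) := (hgh t).hasDerivAt_coord (hh t).1.ne'
  set q : ℝ → ℝ × ℝ × ℝ := fun t => coord (h⁻¹ * g t) with hqdef
  have hT (t : ℝ) : HasDerivAt (fun t => (q t).1) (v t 0 - 2 * (q t).2.2 * matU (v t)) t := by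
    refine ((hasFDerivAt_fst (𝕜 := ℝ) (p := q t)).comp_hasDerivAt t (hq t)).congr_deriv ?_
    simp only [frameD_symm_apply, matD_apply, ContinuousLinearMap.coe_fst']
    simp only [hqdef]
    ring
  -- The geodesic time of the curve has speed `v 0 - 2 y matU v`, and the correction is at most 2 ·
  -- 3θ · θ times `v 0`. It is at most half of `v 0`, so the geodesic time is a global parameter,
  -- with inverse `s`.
  have hT1 (t : ℝ) : |v t 0 - 2 * (q t).2.2 * matU (v t) - v t 0| ≤ 6 * θ ^ 2 * v t 0 := by
    rw [show v t 0 - 2 * (q t).2.2 * matU (v t) - v t 0 = -(2 * ((q t).2.2 * matU (v t))) by ring,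
      abs_neg, abs_mul, abs_mul, abs_two]
    have := mul_le_mul (hh t).2.2 (hU t) (abs_nonneg _) (by positivity)
    linarith
  have hθ2 : 6 * θ ^ 2 ≤ 1 / 2 := by nlinarith
  have hT2 (t : ℝ) : a / 2 ≤ v t 0 - 2 * (q t).2.2 * matU (v t) := by
    have h1 := (abs_le.1 (hT1 t)).1
    have h2 := mul_le_mul_of_nonneg_right hθ2 (ha.le.trans (hv t))
    linarith [hv t]
  obtain ⟨-, -, s, hs1, hs2, hs3⟩ := exists_inverse_of_deriv_ge (half_pos ha) hT hT2
  have hqc : Continuous q := continuous_iff_continuousAt.2 fun t => (hq t).continuousAt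
  have hsc : Continuous s := continuous_iff_continuousAt.2 fun t => (hs3 t).continuousAt
  refine ⟨h, s, _, fun t => (q (s t)).2.1, fun t => (q (s t)).2.2, hs3, fun t => ⟨?_, ?_⟩,
    fun t => ⟨_, hs2 t⟩, by fun_prop, by fun_prop, fun t => (hh (s t)).2, fun t => ?_⟩
  · exact inv_pos.2 (by linarith [hT2 (s t)])
  · rw [inv_inv]; exact hT1 _
  · rw [← inv_mul_eq_iff_eq_mul, ← coordMat_coord (hh (s t)).1]
    congr 1
    ext1
    · exact (hs1 t).symm ▸ hs1 t
    · rfl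

namespace T1S

variable {Γ : Subgroup SL2R}

/-- The coordinate representation of a curve with velocity close to the geodesic field. -/
theorem exists_tube (hΓ : IsClosedSurfaceGroup Γ) {c : ℝ → T1S Γ} {v : ℝ → V3}
    (hc : ∀ t, HasVelocity c (v t) t) {θ : ℝ} (hθ : 0 < θ) (hθ1 : θ ≤ 1 / 16)
    (hv : ∀ t, ‖v t - EuclideanSpace.single 0 1‖ ≤ θ / 2) :
    ∃ (h : SL2R) (s s' x y : ℝ → ℝ), (∀ t, HasDerivAt s (s' t) t ∧ |s' t - 1| ≤ 2 * θ) ∧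
      Function.Surjective s ∧ Continuous x ∧ Continuous y ∧
      (∀ t, |x t| ≤ 3 * θ ∧ |y t| ≤ 3 * θ) ∧
      ∀ t, c (s t) = proj Γ (h * coordMat (t, x t, y t)) := by
  obtain ⟨g₀, hg₀⟩ := proj_surjective (Γ := Γ) (c 0)
  obtain ⟨g, -, hgc, hg⟩ := exists_lift_hasFrameVel hΓ hc hg₀
  have hv0 (t : ℝ) : |v t 0 - 1| ≤ θ / 2 := by
    simpa using (V3.abs_apply_le (v t - EuclideanSpace.single 0 1) 0).trans (hv t)
  have hv1 (t : ℝ) : |v t 1| ≤ θ / 2 := by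
    simpa using (V3.abs_apply_le (v t - EuclideanSpace.single 0 1) 1).trans (hv t)
  have hv2 (t : ℝ) : |v t 2| ≤ θ / 2 := by
    simpa using (V3.abs_apply_le (v t - EuclideanSpace.single 0 1) 2).trans (hv t)
  have hvhalf (t : ℝ) : 1 / 2 ≤ v t 0 := by linarith [(abs_le.1 (hv0 t)).1]
  have hθv (t : ℝ) : θ * (1 / 2) ≤ θ * v t 0 := mul_le_mul_of_nonneg_left (hvhalf t) hθ.le
  obtain ⟨h, s, s', x, y, hs, hs', hsurj, hx, hy, hxy, hgs⟩ := exists_geodesic_coord hg hθ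
    (by linarith) one_half_pos hvhalf
    (fun t => by
      rw [matU_apply, abs_le]
      have h1 := abs_le.1 (hv1 t); have h2 := abs_le.1 (hv2 t)
      constructor <;> linarith [hθv t])
    (fun t => by
      rw [matL_apply, abs_le]
      have h1 := abs_le.1 (hv1 t); have h2 := abs_le.1 (hv2 t)
      constructor <;> linarith [hθv t])
  refine ⟨h, s, s', x, y, fun t => ⟨hs t, ?_⟩, hsurj, hx, hy, hxy, fun t => by rw [← hgs, hgc]⟩
  obtain ⟨hpos, h1⟩ := hs' t
  have h2 := abs_le.1 (hv0 (s t))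
  -- The reciprocal of s' is within θ/2 + 7θ/16 < θ of 1, hence s' is within 2θ of 1.
  have h3 : 6 * θ ^ 2 * v (s t) 0 ≤ θ * (7 / 16) := by
    have : 6 * θ ^ 2 ≤ θ * (6 / 16) := by nlinarith
    nlinarith
  have h4 := abs_le.1 h1
  have h5 : 1 - θ ≤ (s' t)⁻¹ := by linarith
  have h6 : (s' t)⁻¹ ≤ 1 + θ := by linarith
  have h7 : s' t * (s' t)⁻¹ = 1 := mul_inv_cancel₀ hpos.ne'
  have h8 := mul_le_mul_of_nonneg_left h5 hpos.le
  have h9 := mul_le_mul_of_nonneg_left h6 hpos.le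
  rw [h7] at h8 h9
  rw [abs_le]
  constructor <;> nlinarith

/-- The factor 48 is 8 · (3 + 3): the constant of `rdist_coordMat_le` applied to |x|, |y| ≤ 3θ. -/
theorem isShadowedBy_of_tube (hΓ : IsClosedSurfaceGroup Γ) {c : ℝ → T1S Γ} {h : SL2R}
    {s s' x y : ℝ → ℝ} {θ ε : ℝ} (hs : ∀ t, HasDerivAt s (s' t) t ∧ |s' t - 1| ≤ 2 * θ)
    (hxy : ∀ t, |x t| ≤ 3 * θ ∧ |y t| ≤ 3 * θ)
    (hc : ∀ t, c (s t) = proj Γ (h * coordMat (t, x t, y t))) (hθ1 : θ ≤ 1 / 16)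
    (hε : 48 * θ ≤ ε) : IsShadowedBy ε c (proj Γ h) := by
  have hθ : 0 ≤ θ := by linarith [(abs_nonneg _).trans (hxy 0).1]
  refine ⟨s, s', fun t => ⟨(hs t).1, (hs t).2.trans (by linarith)⟩, fun t => ?_⟩
  rw [hc, geodesicFlow_proj]
  refine (rdist_coordMat_le hΓ h
    ((hxy t).2.trans (by linarith))).trans ?_
  linarith [(hxy t).1, (hxy t).2]

theorem orbit_proj_mul_geoMat (h : SL2R) (r : ℝ) :
    orbit (proj Γ (h * geoMat r)) = orbit (proj Γ h) := by
  ext z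
  constructor
  · rintro ⟨t, rfl⟩
    refine ⟨r + t, ?_⟩
    simp only [geodesicFlow_proj, mul_assoc, geoMat_add]
  · rintro ⟨t, rfl⟩
    refine ⟨-r + t, ?_⟩
    simp only [geodesicFlow_proj, mul_assoc, geoMat_add]
    rw [← mul_assoc (geoMat r), ← geoMat_add, add_neg_cancel, geoMat_zero, one_mul]

/-- A curve in a small tube around a geodesic is shadowed by no other geodesic. -/
theorem exists_shadow_unique (hΓ : IsClosedSurfaceGroup Γ) :
    ∃ ε₀ > 0, ε₀ ≤ 1 / 2 ∧ ∀ ε, 0 < ε → ε < ε₀ → ∀ (c : ℝ → T1S Γ) (h : SL2R) (s s' x y : ℝ → ℝ),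
      (∀ t, HasDerivAt s (s' t) t) → (∀ t, 1 / 2 ≤ s' t) → Function.Surjective s →
      Continuous x → Continuous y → (∀ t, |x t| ≤ 1 ∧ |y t| ≤ 1) →
      (∀ t, c (s t) = proj Γ (h * coordMat (t, x t, y t))) →
      ∀ z, IsShadowedBy ε c z → orbit z = orbit (proj Γ h) := by
  obtain ⟨U, hU, hU1⟩ := exists_nhds_one_conj hΓ
  have hcont : ContinuousAt (fun p : SL2R × SL2R => p.1 * p.2⁻¹) (1, 1) := by fun_prop
  have hV : {g : SL2R | |g 0 0| < 2 ∧ |g 0 1| < 2 ∧ |g 1 0| < 2 ∧ |g 1 1| < 2} ∈ 𝓝 (1 : SL2R) := by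
    have e (i j : Fin 2) : Continuous fun g : SL2R => |g i j| := (continuous_entry i j).abs
    refine ((isOpen_lt (e 0 0) continuous_const).inter ((isOpen_lt (e 0 1) continuous_const).inter
      ((isOpen_lt (e 1 0) continuous_const).inter (isOpen_lt (e 1 1) continuous_const)))).mem_nhds ?_
    simp
  obtain ⟨V₀, hV₀, hVU⟩ : ∃ V ∈ 𝓝 (1 : SL2R), ∀ a ∈ V, ∀ b ∈ V, a * b⁻¹ ∈ U := by
    have h1 : (fun p : SL2R × SL2R => p.1 * p.2⁻¹) ⁻¹' U ∈ 𝓝 (1, 1) :=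
      hcont (by simpa using hU)
    rw [nhds_prod_eq, mem_prod_same_iff] at h1
    obtain ⟨V, hV, hVs⟩ := h1
    exact ⟨V, hV, fun a ha b hb => hVs (Set.mk_mem_prod ha hb)⟩
  obtain ⟨V, hVsub, hVo, h1V⟩ := mem_nhds_iff.1 (inter_mem hV₀ hV)
  obtain ⟨r, hr, hrV⟩ := exists_distOneSq_lt_imp_mem (hVo.mem_nhds h1V)
  obtain ⟨ε₁, hε₁, hε₁r⟩ : ∃ ε₁ > 0, Real.exp (64 * ε₁) < r + 1 := by
    have h1 : ContinuousAt (fun e : ℝ => Real.exp (64 * e)) 0 := by fun_prop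
    have h2 : ∀ᶠ e in 𝓝 (0 : ℝ), Real.exp (64 * e) < r + 1 :=
      h1.eventually (gt_mem_nhds (by simpa using hr))
    obtain ⟨e, he, he'⟩ := ((h2.filter_mono nhdsWithin_le_nhds).and
      (self_mem_nhdsWithin (s := Set.Ioi (0 : ℝ)))).exists
    exact ⟨e, he', he⟩
  refine ⟨min ε₁ (1 / 2), by positivity, min_le_right _ _, ?_⟩
  intro ε hε hε0 c h s s' x y hs hs' hsurj hx hy hxy hc z ⟨σ, σ', hσ, hσd⟩
  obtain ⟨k₀, rfl⟩ := proj_surjective (Γ := Γ) z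
  have hε1 : ε < ε₁ := hε0.trans_le (min_le_left _ _)
  have hε2 : ε < 1 / 2 := hε0.trans_le (min_le_right _ _)
  -- the inverse of `s`
  have hsmono : StrictMono s := strictMono_of_deriv_pos fun t => by
    rw [(hs t).deriv]; linarith [hs' t]
  obtain ⟨-, -, S, hS1, -, hS3⟩ := exists_inverse_of_deriv_ge one_half_pos hs hs'
  have hSc : Continuous S := continuous_iff_continuousAt.2 fun t => (hS3 t).continuousAt
  obtain ⟨hσtop, hσbot, -⟩ := exists_inverse_of_deriv_ge one_half_pos (fun t => (hσ t).1)
    fun t => by have := abs_le.1 (hσ t).2; linarith [this.1]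
  have hσc : Continuous σ := continuous_iff_continuousAt.2 fun t => (hσ t).1.continuousAt
  have hSmono : StrictMono S := fun a b hab => by
    rw [← hsmono.lt_iff_lt, hS1, hS1]; exact hab
  have hStop : Tendsto S atTop atTop := by
    refine tendsto_atTop_atTop.2 fun b => ⟨s b, fun t ht => ?_⟩
    rw [← hsmono.le_iff_le, hS1]; exact ht
  have hSbot : Tendsto S atBot atBot := by
    refine tendsto_atBot_atBot.2 fun b => ⟨s b, fun t ht => ?_⟩
    rw [← hsmono.le_iff_le, hS1]; exact ht
  set τ : ℝ → ℝ := fun t => S (σ t) with hτ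
  set p : ℝ → SL2R := fun t => h * coordMat (τ t, x (τ t), y (τ t)) with hp
  have hτc : Continuous τ := hSc.comp hσc
  have hpc : Continuous p := continuous_const.mul (continuous_coordMat.comp (by fun_prop))
  have hcp (t : ℝ) : c (σ t) = proj Γ (p t) := by rw [hp, ← hc, hS1]
  have hw : Continuous fun t => k₀ * geoMat t := by
    have : Continuous fun t => coordMat (t, 0, 0) := continuous_coordMat.comp (by fun_prop)
    simp only [← coordMat_zero]
    exact continuous_const.mul this
  -- At each time, closeness in the quotient gives an element of `signedGroup Γ` that brings the two
  -- lifts together. The distance is an infimum of lengths, so the strict bound 2ε is used to pick a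
  -- curve.
  have hex (t : ℝ) : ∃ γ ∈ signedGroup Γ, (p t)⁻¹ * γ⁻¹ * (k₀ * geoMat t) ∈ V := by
    have h1 := hσd t
    rw [hcp, geodesicFlow_proj] at h1
    obtain ⟨k, hk1, hk2⟩ := exists_mul_of_rdist_lt hΓ (h1.trans_lt (by linarith : ε < 2 * ε))
    obtain ⟨γ, hγ, hγ2⟩ := proj_eq_iff.1 hk1
    refine ⟨γ, hγ, hrV _ ?_⟩
    rw [hγ2, show (p t)⁻¹ * γ⁻¹ * (γ * (p t * k)) = k by group]
    have : Real.exp (32 * (2 * ε)) ≤ Real.exp (64 * ε₁) := Real.exp_le_exp.2 (by linarith)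
    linarith
  choose γ hγ hγV using hex
  -- The choice made at t₀ still works at nearby times, and two valid choices differ by an element
  -- that the positive injectivity radius forces to be 1. So γ is locally constant.
  have hconst : ∀ t, γ t = γ 0 := by
    have : IsLocallyConstant γ := by
      rw [IsLocallyConstant.iff_eventually_eq]
      intro t₀
      have hk : Continuous fun t => (p t)⁻¹ * (γ t₀)⁻¹ * (k₀ * geoMat t) :=
        (hpc.inv.mul continuous_const).mul hw
      filter_upwards [hk.continuousAt.eventually (hVo.mem_nhds (hγV t₀))] with t ht
      have h1 := hVU _ (hVsub ht).1 _ (hVsub (hγV t)).1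
      rw [show (p t)⁻¹ * (γ t₀)⁻¹ * (k₀ * geoMat t) * ((p t)⁻¹ * (γ t)⁻¹ * (k₀ * geoMat t))⁻¹ =
        (p t)⁻¹ * ((γ t₀)⁻¹ * γ t) * p t by group] at h1
      exact (inv_mul_eq_one.1 (hU1 _ _ (Subgroup.mul_mem _ (Subgroup.inv_mem _ (hγ t₀)) (hγ t))
        h1)).symm
    exact fun t => this.apply_eq_of_isPreconnected isPreconnected_univ trivial trivial
  -- With γ constant, two lifted geodesics remain at bounded distance for all times. The matrix to
  -- be bounded is a product of a matrix with rows (1 + xy, x), (y, 1) and one with entries below 2,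
  -- whence C = 2 · 2 + 2.
  obtain ⟨r, hr⟩ := eq_geoMat_of_bounded (k := h⁻¹ * (γ 0)⁻¹ * k₀) (T₀ := τ) (T₁ := fun t => t)
    (C := 6) (hStop.comp hσtop) tendsto_id (hSbot.comp hσbot) tendsto_id (fun t => by
      have h1 := (hVsub (hγV t)).2
      set k := (p t)⁻¹ * (γ t)⁻¹ * (k₀ * geoMat t) with hk
      have h2 : geoMat (-τ t) * (h⁻¹ * (γ 0)⁻¹ * k₀) * geoMat t =
          coordMat (0, x (τ t), y (τ t)) * k := by
        have h3 := geoMat_mul_coordMat (τ t) (0, x (τ t), y (τ t))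
        simp only [zero_add] at h3
        rw [hk, hp]
        simp only
        rw [← h3, hconst t, geoMat_neg]
        group
      obtain ⟨k00, k01, k10, k11⟩ := h1
      rw [h2]
      obtain ⟨hx1, hy1⟩ := hxy (τ t)
      simp only [SL2R.mul_entry, coordMat_entries]
      simp only [zero_div, neg_zero, Real.exp_zero, one_mul]
      have bd (a b A B : ℝ) (ha : |a| ≤ A) (hb : |b| < B) : |a * b| ≤ A * B := by
        rw [abs_mul]; exact mul_le_mul ha hb.le (abs_nonneg _) ((abs_nonneg _).trans ha)
      have hxy1 : |1 + x (τ t) * y (τ t)| ≤ 2 := by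
        refine (abs_add_le _ _).trans ?_
        rw [abs_one, abs_mul]
        have := mul_le_mul hx1 hy1 (abs_nonneg _) zero_le_one
        linarith
      constructor
      · refine (abs_add_le _ _).trans ?_
        have := bd _ _ _ _ hxy1 k01
        have := bd _ _ _ _ hx1 k11
        linarith
      · refine (abs_add_le _ _).trans ?_
        have := bd _ _ _ _ hy1 k00
        linarith)
  have hk0 : k₀ = γ 0 * (h * (h⁻¹ * (γ 0)⁻¹ * k₀)) := by group
  rw [hk0, proj_mul_left (hγ 0)]
  rcases hr with hr | hr <;> rw [hr]
  · exact orbit_proj_mul_geoMat h r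
  · rw [mul_neg, proj_neg]; exact orbit_proj_mul_geoMat h r

end T1S

end

/-! ### Foliations of plane regions by graphs, given by local labels. -/

noncomputable section

/-- Local functions on an open region of the plane whose level sets are the curves of a foliation
transverse to the vertical lines. -/
structure PlaneLabels (ι : Type*) where
  lab : ι → ℝ × ℝ → ℝ
  dom : ι → Set (ℝ × ℝ)
  isOpen_dom : ∀ i, IsOpen (dom i)
  continuousOn_lab : ∀ i, ContinuousOn (lab i) (dom i)
  not_isLocalExtr : ∀ i, ∀ p ∈ dom i, ¬ IsLocalExtr (fun x => lab i (p.1, x)) p.2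
  compat : ∀ i j, ∀ p ∈ dom i ∩ dom j, ∃ U ∈ 𝓝 p,
    ∀ q ∈ U, ∀ q' ∈ U, lab i q = lab i q' → lab j q = lab j q'

namespace PlaneLabels

variable {ι : Type*} (S : PlaneLabels ι)

/-- The graph of `α` is near `t` a part of a leaf. -/
def IsSolAt (α : ℝ → ℝ) (t : ℝ) : Prop :=
  ContinuousAt α t ∧ ∃ i, (t, α t) ∈ S.dom i ∧ ∀ᶠ s in 𝓝 t, S.lab i (s, α s) = S.lab i (t, α t)

variable {S}

theorem IsSolAt.congr {α β : ℝ → ℝ} {t : ℝ} (h : S.IsSolAt α t) (he : β =ᶠ[𝓝 t] α) :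
    S.IsSolAt β t := by
  obtain ⟨hc, i, hi, hl⟩ := h
  have h0 := he.eq_of_nhds
  refine ⟨hc.congr he.symm, i, by rwa [h0], ?_⟩
  filter_upwards [he, hl] with s hs hls
  rw [hs, h0, hls]

theorem IsSolAt.eventually_lab_eq {α : ℝ → ℝ} {t : ℝ} (h : S.IsSolAt α t) {j : ι}
    (hj : (t, α t) ∈ S.dom j) : ∀ᶠ s in 𝓝 t, S.lab j (s, α s) = S.lab j (t, α t) := by
  obtain ⟨hc, i, hi, hl⟩ := h
  obtain ⟨U, hU, hUc⟩ := S.compat i j _ ⟨hi, hj⟩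
  have h1 : ContinuousAt (fun s => (s, α s)) t := continuousAt_id.prodMk hc
  filter_upwards [hl, h1 hU] with s hs hsU
  exact hUc _ hsU _ (mem_of_mem_nhds hU) hs

/-- A box around a point of the domain. -/
theorem exists_box {i : ι} {p : ℝ × ℝ} (hp : p ∈ S.dom i) :
    ∃ r > 0, ∀ q : ℝ × ℝ, |q.1 - p.1| < r → |q.2 - p.2| < r → q ∈ S.dom i := by
  obtain ⟨r, hr, h⟩ := Metric.isOpen_iff.1 (S.isOpen_dom i) p hp
  refine ⟨r, hr, fun q h1 h2 => h ?_⟩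
  rw [Metric.mem_ball, Prod.dist_eq, max_lt_iff, Real.dist_eq, Real.dist_eq]
  exact ⟨h1, h2⟩

/-- Two equal values on a vertical segment would force a local extremum in between, as in Rolle's
theorem. -/
theorem injOn_vertical {i : ι} {p : ℝ × ℝ} {r : ℝ}
    (hr : ∀ q : ℝ × ℝ, |q.1 - p.1| < r → |q.2 - p.2| < r → q ∈ S.dom i) {t : ℝ}
    (ht : |t - p.1| < r) : Set.InjOn (fun x => S.lab i (t, x)) (Set.Ioo (p.2 - r) (p.2 + r)) := by
  have hmem : ∀ x ∈ Set.Ioo (p.2 - r) (p.2 + r), (t, x) ∈ S.dom i := fun x hx =>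
    hr _ ht (abs_lt.2 ⟨by linarith [hx.1], by linarith [hx.2]⟩)
  have key : ∀ x ∈ Set.Ioo (p.2 - r) (p.2 + r), ∀ y ∈ Set.Ioo (p.2 - r) (p.2 + r), x < y →
      S.lab i (t, x) ≠ S.lab i (t, y) := by
    intro x hx y hy hxy heq
    have hsub : Set.Icc x y ⊆ Set.Ioo (p.2 - r) (p.2 + r) := fun z hz =>
      ⟨hx.1.trans_le hz.1, hz.2.trans_lt hy.2⟩
    obtain ⟨c, hc, hext⟩ := exists_isLocalExtr_Ioo (f := fun x => S.lab i (t, x)) hxy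
      ((S.continuousOn_lab i).comp (by fun_prop) fun z hz => hmem z (hsub hz)) heq
    exact S.not_isLocalExtr i (t, c) (hmem c (hsub ⟨hc.1.le, hc.2.le⟩)) hext
  intro x hx y hy heq
  rcases lt_trichotomy x y with h | h | h
  · exact (key x hx y hy h heq).elim
  · exact h
  · exact (key y hy x hx h heq.symm).elim

/-- Uniqueness without any Lipschitz condition: both graphs carry the same constant label, and
labels are injective on vertical lines. -/
theorem IsSolAt.eventually_eq {α β : ℝ → ℝ} {t : ℝ} (hα : S.IsSolAt α t) (hβ : S.IsSolAt β t)
    (h : α t = β t) : α =ᶠ[𝓝 t] β := by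
  obtain ⟨hc, i, hi, hl⟩ := hα
  have hβl := hβ.eventually_lab_eq (j := i) (by rwa [← h])
  obtain ⟨r, hr, hbox⟩ := exists_box hi
  have h2 : Set.Ioo (α t - r) (α t + r) ∈ 𝓝 (α t) := Ioo_mem_nhds (by linarith) (by linarith)
  have h1 : ∀ᶠ s in 𝓝 t, |s - t| < r := by
    have : ContinuousAt (fun s => |s - t|) t := by fun_prop
    exact this.eventually (gt_mem_nhds (by simpa using hr))
  have h3 : β ⁻¹' Set.Ioo (α t - r) (α t + r) ∈ 𝓝 t := hβ.1 (by rw [← h]; exact h2)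
  filter_upwards [hl, hβl, hc h2, h3, h1] with s e1 e2 hs hs' hst
  exact injOn_vertical hbox hst hs hs' (by simp only; rw [e1, e2, h])

/-- The set of agreement is open by local uniqueness and relatively closed by continuity. -/
theorem eqOn_of_isSolAt {α β : ℝ → ℝ} {I : Set ℝ} (hI : IsPreconnected I) (hIo : IsOpen I)
    (hα : ∀ t ∈ I, S.IsSolAt α t) (hβ : ∀ t ∈ I, S.IsSolAt β t) {τ : ℝ} (hτ : τ ∈ I)
    (h : α τ = β τ) : Set.EqOn α β I := by
  have hsub : I ⊆ {t | t ∈ I ∧ α t = β t} := by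
    refine hI.subset_of_closure_inter_subset ?_ ⟨τ, hτ, hτ, h⟩ ?_
    · rw [isOpen_iff_mem_nhds]
      rintro t ⟨ht, hab⟩
      filter_upwards [hIo.mem_nhds ht, (hα t ht).eventually_eq (hβ t ht) hab] with s hs hs'
      exact ⟨hs, hs'⟩
    · rintro t ⟨ht, htI⟩
      refine ⟨htI, ?_⟩
      have hc : ContinuousAt (fun s => α s - β s) t := (hα t htI).1.sub (hβ t htI).1
      have := mem_closure_iff_frequently.1 ht
      by_contra hne
      have h3 := hc.eventually (isOpen_ne.mem_nhds (sub_ne_zero.2 hne))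
      obtain ⟨s, hs, hs'⟩ := (this.and_eventually h3).exists
      exact hs' (sub_eq_zero.2 hs.2)
  exact fun t ht => (hsub ht).2

theorem exists_glue {α β : ℝ → ℝ} {a b a' b' τ : ℝ} (hα : ∀ t ∈ Set.Ioo a b, S.IsSolAt α t)
    (hβ : ∀ t ∈ Set.Ioo a' b', S.IsSolAt β t) (hτ : τ ∈ Set.Ioo a b) (hτ' : τ ∈ Set.Ioo a' b')
    (h : α τ = β τ) : ∃ γ : ℝ → ℝ, Set.EqOn γ α (Set.Ioo a b) ∧
      ∀ t ∈ Set.Ioo (min a a') (max b b'), S.IsSolAt γ t := by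
  classical
  have heq : Set.EqOn α β (Set.Ioo a b ∩ Set.Ioo a' b') := by
    refine eqOn_of_isSolAt (S := S) ?_ (isOpen_Ioo.inter isOpen_Ioo) (fun t ht => hα t ht.1)
      (fun t ht => hβ t ht.2) ⟨hτ, hτ'⟩ h
    exact (Set.ordConnected_Ioo.inter Set.ordConnected_Ioo).isPreconnected
  set γ : ℝ → ℝ := fun t => if t ∈ Set.Ioo a b then α t else β t with hγ
  have h1 : Set.EqOn γ α (Set.Ioo a b) := fun t ht => if_pos ht
  have h2 : Set.EqOn γ β (Set.Ioo a' b') := by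
    intro t ht
    by_cases h : t ∈ Set.Ioo a b
    · rw [h1 h]; exact heq ⟨h, ht⟩
    · exact if_neg h
  refine ⟨γ, h1, fun t ht => ?_⟩
  have hor : t ∈ Set.Ioo a b ∨ t ∈ Set.Ioo a' b' := by
    by_contra! hcon
    obtain ⟨k1, k2⟩ := hcon
    simp only [Set.mem_Ioo, not_and, not_lt] at k1 k2
    rcases le_or_gt t τ with htτ | htτ
    · rcases min_lt_iff.1 ht.1 with k | k
      · linarith [k1 k, hτ.2]
      · linarith [k2 k, hτ'.2]
    · rcases lt_max_iff.1 ht.2 with k | k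
      · linarith [k1 (hτ.1.trans htτ)]
      · linarith [k2 (hτ'.1.trans htτ)]
  rcases hor with h | h
  · exact (hα t h).congr (h1.eventuallyEq_of_mem (isOpen_Ioo.mem_nhds h))
  · exact (hβ t h).congr (h2.eventuallyEq_of_mem (isOpen_Ioo.mem_nhds h))

/-- Points where the label takes a given value, near a given point. -/
theorem exists_lab_eq {i : ι} {p : ℝ × ℝ} (hp : p ∈ S.dom i) {η : ℝ} (hη : 0 < η) :
    ∃ r > 0, ∀ q : ℝ × ℝ, |q.1 - p.1| < r → |q.2 - p.2| < r → ∀ t, |t - p.1| < r →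
      ∃ x, |x - p.2| < η ∧ S.lab i (t, x) = S.lab i q := by
  obtain ⟨r, hr, hbox⟩ := exists_box hp
  obtain ⟨ζ, hζ, hζη, hζr⟩ : ∃ ζ > 0, ζ < η ∧ ζ < r :=
    ⟨min η r / 2, by positivity, by linarith [min_le_left η r, lt_min hη hr],
      by linarith [min_le_right η r, lt_min hη hr]⟩
  have hinj := injOn_vertical hbox (t := p.1) (by simpa using hr)
  have hIcc : Set.Icc (p.2 - ζ) (p.2 + ζ) ⊆ Set.Ioo (p.2 - r) (p.2 + r) := fun x hx =>
    ⟨by linarith [hx.1], by linarith [hx.2]⟩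
  have hmem : ∀ t, |t - p.1| < r → ∀ x ∈ Set.Icc (p.2 - ζ) (p.2 + ζ), (t, x) ∈ S.dom i :=
    fun t ht x hx => hbox _ ht (abs_lt.2 ⟨by linarith [hx.1], by linarith [hx.2]⟩)
  have hcont : ∀ t, |t - p.1| < r →
      ContinuousOn (fun x => S.lab i (t, x)) (Set.Icc (p.2 - ζ) (p.2 + ζ)) := fun t ht =>
    (S.continuousOn_lab i).comp (by fun_prop) (hmem t ht)
  have hp1 : |p.1 - p.1| < r := by simpa using hr
  -- Being continuous and injective, the label is strictly monotone on the vertical line through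
  -- `p`. Its values near `p` lie strictly between those near the two ends, also on neighbouring
  -- vertical lines, where the intermediate value theorem then applies.
  have hsm := (hcont p.1 hp1).strictMonoOn_of_injOn_Icc' (by linarith) (hinj.mono hIcc)
  have hca : ∀ q ∈ S.dom i, ContinuousAt (S.lab i) q := fun q hq =>
    (S.continuousOn_lab i).continuousAt ((S.isOpen_dom i).mem_nhds hq)
  have hlo := hmem p.1 hp1 (p.2 - ζ) ⟨le_rfl, by linarith⟩
  have hup := hmem p.1 hp1 (p.2 + ζ) ⟨by linarith, le_rfl⟩
  -- the values near the end points are separated from the values near `p`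
  have key : ∀ f : ℝ → ℝ, (∀ u v, f u = f v → u = v) → Continuous f →
      f (S.lab i (p.1, p.2 - ζ)) < f (S.lab i p) → f (S.lab i p) < f (S.lab i (p.1, p.2 + ζ)) →
      ∃ r' > 0, ∀ q : ℝ × ℝ, |q.1 - p.1| < r' → |q.2 - p.2| < r' → ∀ t, |t - p.1| < r' →
        ∃ x, |x - p.2| < η ∧ S.lab i (t, x) = S.lab i q := by
    intro f hf hfc h1 h2
    obtain ⟨m₁, hm₁, hm₁'⟩ := exists_between h1
    obtain ⟨m₂, hm₂, hm₂'⟩ := exists_between h2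
    have hcl : ContinuousAt (fun t => f (S.lab i (t, p.2 - ζ))) p.1 :=
      hfc.continuousAt.comp (ContinuousAt.comp (f := fun t => (t, p.2 - ζ)) (hca _ hlo)
        (by fun_prop))
    have hcu : ContinuousAt (fun t => f (S.lab i (t, p.2 + ζ))) p.1 :=
      hfc.continuousAt.comp (ContinuousAt.comp (f := fun t => (t, p.2 + ζ)) (hca _ hup)
        (by fun_prop))
    have hcp : ContinuousAt (fun q => f (S.lab i q)) p := hfc.continuousAt.comp (hca _ hp)
    obtain ⟨r₁, hr₁, h₁⟩ := Metric.eventually_nhds_iff.1 (hcl.eventually (gt_mem_nhds hm₁))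
    obtain ⟨r₂, hr₂, h₂⟩ := Metric.eventually_nhds_iff.1 (hcu.eventually (lt_mem_nhds hm₂'))
    obtain ⟨r₃, hr₃, h₃⟩ := Metric.eventually_nhds_iff.1
      ((hcp.eventually (lt_mem_nhds hm₁')).and (hcp.eventually (gt_mem_nhds hm₂)))
    refine ⟨min (min r₁ r₂) (min r₃ r), by positivity, fun q hq1 hq2 t ht => ?_⟩
    simp only [lt_min_iff] at hq1 hq2 ht
    have hq := h₃ (y := q) (by
      rw [Prod.dist_eq, max_lt_iff, Real.dist_eq, Real.dist_eq]; exact ⟨hq1.2.1, hq2.2.1⟩)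
    have ht1 := h₁ (y := t) (by rw [Real.dist_eq]; exact ht.1.1)
    have ht2 := h₂ (y := t) (by rw [Real.dist_eq]; exact ht.1.2)
    obtain ⟨x, hx, hxq⟩ := intermediate_value_Icc (by linarith : p.2 - ζ ≤ p.2 + ζ)
      (hfc.comp_continuousOn (hcont t ht.2.2)) ⟨(ht1.trans hq.1).le, (hq.2.trans ht2).le⟩
    exact ⟨x, abs_lt.2 ⟨by linarith [hx.1], by linarith [hx.2]⟩, hf _ _ hxq⟩
  -- A change of sign reduces decreasing labels to increasing ones.
  rcases hsm with h | h
  · refine key id (fun _ _ h => h) continuous_id ?_ ?_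
    · exact h ⟨le_rfl, by linarith⟩ ⟨by linarith, by linarith⟩ (by linarith)
    · exact h ⟨by linarith, by linarith⟩ ⟨by linarith, le_rfl⟩ (by linarith)
  · refine key (fun u => -u) (fun _ _ h => neg_injective h) continuous_neg ?_ ?_
    · exact neg_lt_neg (h ⟨le_rfl, by linarith⟩ ⟨by linarith, by linarith⟩ (by linarith))
    · exact neg_lt_neg (h ⟨by linarith, by linarith⟩ ⟨by linarith, le_rfl⟩ (by linarith))

/-- A function whose graph lies in a level set of a label near a point is a solution. -/
theorem isSolAt_of_lab_eq {i : ι} {p : ℝ × ℝ} {r : ℝ}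
    (hbox : ∀ q : ℝ × ℝ, |q.1 - p.1| < r → |q.2 - p.2| < r → q ∈ S.dom i) {α : ℝ → ℝ} {t : ℝ}
    (ht : |t - p.1| < r) (hα : |α t - p.2| < r) {a : ℝ}
    (hl : ∀ᶠ s in 𝓝 t, |α s - p.2| < r ∧ S.lab i (s, α s) = a) : S.IsSolAt α t := by
  have hd : (t, α t) ∈ S.dom i := hbox _ ht hα
  refine ⟨?_, i, hd, ?_⟩
  · rw [Metric.continuousAt_iff']
    intro η hη
    -- The level set meets nearby vertical lines within η of `α t`, and injectivity identifies the
    -- meeting point with `α s`. The second term of the minimum keeps that point inside the box.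
    obtain ⟨r', hr', h⟩ := exists_lab_eq hd (lt_min hη (sub_pos.2 hα))
    have h1 : ∀ᶠ s in 𝓝 t, |s - t| < r' := by
      have : ContinuousAt (fun s => |s - t|) t := by fun_prop
      exact this.eventually (gt_mem_nhds (by simpa using hr'))
    have h2 : ∀ᶠ s in 𝓝 t, |s - p.1| < r := by
      have : ContinuousAt (fun s => |s - p.1|) t := by fun_prop
      exact this.eventually (gt_mem_nhds ht)
    filter_upwards [hl, h1, h2] with s hs hst hsr
    obtain ⟨x, hx, hxl⟩ := h (t, α t) (by simpa using hr') (by simpa using hr') s hst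
    rw [lt_min_iff] at hx
    have hxr : |x - p.2| < r := by
      have := abs_sub_le x (α t) p.2
      linarith [hx.2]
    have : α s = x := by
      refine injOn_vertical hbox hsr ?_ ?_ ?_
      · have := abs_lt.1 hs.1; exact ⟨by linarith [this.1], by linarith [this.2]⟩
      · have := abs_lt.1 hxr; exact ⟨by linarith [this.1], by linarith [this.2]⟩
      · simp only; rw [hs.2, hxl, hl.self_of_nhds.2]
    rw [this, Real.dist_eq]
    exact hx.1
  · filter_upwards [hl] with s hs
    rw [hs.2, hl.self_of_nhds.2]

theorem exists_local_solution {i : ι} {p : ℝ × ℝ} (hp : p ∈ S.dom i) :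
    ∃ r > 0, ∀ q : ℝ × ℝ, |q.1 - p.1| < r → |q.2 - p.2| < r →
      ∃ α : ℝ → ℝ, α q.1 = q.2 ∧ ∀ t ∈ Set.Ioo (p.1 - r) (p.1 + r), S.IsSolAt α t := by
  obtain ⟨R, hR, hbox⟩ := exists_box hp
  obtain ⟨r, hr, h⟩ := exists_lab_eq hp hR
  refine ⟨min r R, by positivity, fun q hq1 hq2 => ?_⟩
  rw [lt_min_iff] at hq1 hq2
  have hex : ∀ t, ∃ x, |t - p.1| < r → |x - p.2| < R ∧ S.lab i (t, x) = S.lab i q := fun t => by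
    by_cases ht : |t - p.1| < r
    · obtain ⟨x, hx⟩ := h q hq1.1 hq2.1 t ht
      exact ⟨x, fun _ => hx⟩
    · exact ⟨0, fun h => (ht h).elim⟩
  choose α hα using hex
  refine ⟨α, ?_, fun t ht => ?_⟩
  · have h1 := hα q.1 hq1.1
    refine injOn_vertical hbox hq1.2 ?_ ?_ h1.2
    · have := abs_lt.1 h1.1; exact ⟨by linarith [this.1], by linarith [this.2]⟩
    · have := abs_lt.1 hq2.2; exact ⟨by linarith [this.1], by linarith [this.2]⟩
  · have ht' : |t - p.1| < min r R := abs_lt.2 ⟨by linarith [ht.1], by linarith [ht.2]⟩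
    rw [lt_min_iff] at ht'
    refine isSolAt_of_lab_eq hbox ht'.2 (hα t ht'.1).1 (a := S.lab i q) ?_
    have : ContinuousAt (fun s => |s - p.1|) t := by fun_prop
    filter_upwards [this.eventually (gt_mem_nhds ht'.1)] with s hs
    exact hα s hs

/-- On a compact set the solutions exist for a uniform time. -/
theorem exists_uniform_solution {K : Set (ℝ × ℝ)} (hK : IsCompact K)
    (hKd : ∀ p ∈ K, ∃ i, p ∈ S.dom i) :
    ∃ r > 0, ∀ q ∈ K, ∃ α : ℝ → ℝ, α q.1 = q.2 ∧
      ∀ t ∈ Set.Ioo (q.1 - r) (q.1 + r), S.IsSolAt α t := by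
  refine hK.induction_on (p := fun K => ∃ r > 0, ∀ q ∈ K, ∃ α : ℝ → ℝ, α q.1 = q.2 ∧
      ∀ t ∈ Set.Ioo (q.1 - r) (q.1 + r), S.IsSolAt α t) ⟨1, one_pos, by simp⟩ ?_ ?_ ?_
  · rintro s t hst ⟨r, hr, h⟩
    exact ⟨r, hr, fun q hq => h q (hst hq)⟩
  · rintro s t ⟨r, hr, h⟩ ⟨r', hr', h'⟩
    refine ⟨min r r', by positivity, ?_⟩
    rintro q (hq | hq)
    · obtain ⟨α, h1, h2⟩ := h q hq
      exact ⟨α, h1, fun t ht => h2 t ⟨by linarith [ht.1, min_le_left r r'],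
        by linarith [ht.2, min_le_left r r']⟩⟩
    · obtain ⟨α, h1, h2⟩ := h' q hq
      exact ⟨α, h1, fun t ht => h2 t ⟨by linarith [ht.1, min_le_right r r'],
        by linarith [ht.2, min_le_right r r']⟩⟩
  · intro p hp
    obtain ⟨i, hi⟩ := hKd p hp
    obtain ⟨r, hr, h⟩ := exists_local_solution hi
    refine ⟨Metric.ball p (r / 2), mem_nhdsWithin_of_mem_nhds (Metric.ball_mem_nhds _ (by positivity)),
      r / 2, by positivity, fun q hq => ?_⟩
    rw [Metric.mem_ball, Prod.dist_eq, max_lt_iff, Real.dist_eq, Real.dist_eq] at hq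
    obtain ⟨α, h1, h2⟩ := h q (by linarith [hq.1]) (by linarith [hq.2])
    have := abs_lt.1 hq.1
    exact ⟨α, h1, fun t ht => h2 t ⟨by linarith [ht.1], by linarith [ht.2]⟩⟩

/-- Continuation of solutions that cannot leave a compact set. -/
theorem exists_solution {K : Set (ℝ × ℝ)} (hK : IsCompact K)
    (hKd : ∀ p ∈ K, ∃ i, p ∈ S.dom i) {a b t₀ x₀ : ℝ} (ht₀ : t₀ ∈ Set.Ioo a b)
    (hap : ∀ a' b' : ℝ, a ≤ a' → b' ≤ b → t₀ ∈ Set.Ioo a' b' → ∀ α : ℝ → ℝ, α t₀ = x₀ →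
      (∀ t ∈ Set.Ioo a' b', S.IsSolAt α t) → ∀ t ∈ Set.Ioo a' b', (t, α t) ∈ K)
    (h₀ : (t₀, x₀) ∈ K) :
    ∃ α : ℝ → ℝ, α t₀ = x₀ ∧ ∀ t ∈ Set.Ioo a b, S.IsSolAt α t := by
  obtain ⟨r, hr, h⟩ := exists_uniform_solution hK hKd
  -- Each induction step gains r/2 on both sides: a point of the graph at most r/2 from an end is
  -- still in `K` by `hap`, and the local solution through it has radius r, so it reaches past that
  -- end.
  have step : ∀ n : ℕ, ∃ α : ℝ → ℝ, α t₀ = x₀ ∧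
      ∀ t ∈ Set.Ioo (max a (t₀ - (n + 1) * (r / 2))) (min b (t₀ + (n + 1) * (r / 2))),
        S.IsSolAt α t := by
    intro n
    induction n with
    | zero =>
      obtain ⟨α, h1, h2⟩ := h _ h₀
      refine ⟨α, h1, fun t ht => h2 t ?_⟩
      simp only [Set.mem_Ioo, max_lt_iff, lt_min_iff, Nat.cast_zero, zero_add, one_mul] at ht
      exact ⟨by linarith [ht.1.2], by linarith [ht.2.2]⟩
    | succ n ih =>
      obtain ⟨α, hα0, hα⟩ := ih
      set A := max a (t₀ - (n + 1) * (r / 2)) with hA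
      set B := min b (t₀ + (n + 1) * (r / 2)) with hB
      have hn : 0 < ((n : ℝ) + 1) * (r / 2) := by positivity
      have hAt : A < t₀ := max_lt ht₀.1 (by linarith)
      have htB : t₀ < B := lt_min ht₀.2 (by linarith)
      have hKα := hap A B (le_max_left _ _) (min_le_left _ _) ⟨hAt, htB⟩ α hα0 hα
      -- extend to the right
      set τ := max t₀ (B - r / 2) with hτ
      have hτ1 : τ ∈ Set.Ioo A B := ⟨hAt.trans_le (le_max_left _ _), max_lt htB (by linarith)⟩
      obtain ⟨β, hβ1, hβ2⟩ := h _ (hKα τ hτ1)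
      simp only at hβ1 hβ2
      obtain ⟨γ, hγα, hγ⟩ := exists_glue hα hβ2 hτ1 ⟨by linarith, by linarith⟩ hβ1.symm
      -- extend to the left
      set τ' := min t₀ (A + r / 2) with hτ'
      have hτ'1 : τ' ∈ Set.Ioo A B := ⟨lt_min hAt (by linarith), (min_le_left _ _).trans_lt htB⟩
      obtain ⟨β', hβ'1, hβ'2⟩ := h _ (hKα τ' hτ'1)
      simp only at hβ'1 hβ'2
      obtain ⟨γ', hγ'α, hγ'⟩ := exists_glue (τ := τ') hγ hβ'2
        ⟨(min_le_left _ _).trans_lt hτ'1.1, hτ'1.2.trans_le (le_max_left _ _)⟩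
        ⟨by linarith, by linarith⟩ (by rw [hγα hτ'1, hβ'1])
      have hγ't : γ' t₀ = x₀ := by
        rw [hγ'α ⟨(min_le_left _ _).trans_lt hAt, htB.trans_le (le_max_left _ _)⟩,
          hγα ⟨hAt, htB⟩, hα0]
      refine ⟨γ', hγ't, fun t ht => hγ' t ?_⟩
      simp only [Set.mem_Ioo, max_lt_iff, lt_min_iff, Nat.cast_add, Nat.cast_one] at ht
      obtain ⟨⟨h1, h2⟩, h3, h4⟩ := ht
      constructor
      · rw [min_lt_iff]
        by_cases hc : t₀ ≤ t
        · left; exact (min_le_left _ _).trans_lt (hAt.trans_le hc)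
        · right
          have k1 : τ' ≤ A + r / 2 := min_le_right _ _
          rcases max_cases a (t₀ - (n + 1) * (r / 2)) with ⟨k, -⟩ | ⟨k, -⟩
          · have : A = a := k
            linarith
          · have : A = t₀ - (n + 1) * (r / 2) := k
            linarith
      · rw [lt_max_iff, lt_max_iff]
        by_cases hc : t ≤ t₀
        · left; left; exact hc.trans_lt htB
        · left; right
          have k1 : B - r / 2 ≤ τ := le_max_right _ _
          rcases min_cases b (t₀ + (n + 1) * (r / 2)) with ⟨k, -⟩ | ⟨k, -⟩
          · have : B = b := k
            linarith
          · have : B = t₀ + (n + 1) * (r / 2) := k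
            linarith
  obtain ⟨n, hn⟩ := exists_nat_gt ((b - a) / (r / 2))
  rw [div_lt_iff₀ (by positivity)] at hn
  obtain ⟨α, h1, h2⟩ := step n
  refine ⟨α, h1, fun t ht => h2 t ⟨max_lt ht.1 ?_, lt_min ht.2 ?_⟩⟩
  · linarith [ht.1, ht₀.2]
  · linarith [ht.2, ht₀.1]

end PlaneLabels

end

/-! ### Plaques of a foliation as graphs in local coordinates. -/

noncomputable section

/-- Only differentiability at one point is assumed, and α is given as a continuous solution. The
increment v of (s, α s) differs by o(v) from (s - t) times a fixed vector, so v = O(s - t), and the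
error is o(s - t). -/
theorem hasDerivAt_of_implicit {f : ℝ × ℝ → ℝ} {f' : ℝ × ℝ →L[ℝ] ℝ} {α : ℝ → ℝ} {t : ℝ}
    (hf : HasFDerivAt f f' (t, α t)) (hα : ContinuousAt α t) (h0 : ∀ᶠ s in 𝓝 t, f (s, α s) = 0)
    (hB : f' (0, 1) ≠ 0) : HasDerivAt α (-f' (1, 0) / f' (0, 1)) t := by
  have hc : Tendsto (fun s => (s, α s)) (𝓝 t) (𝓝 (t, α t)) := continuousAt_id.prodMk hα
  have h1 := hf.isLittleO.comp_tendsto hc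
  set v : ℝ → ℝ × ℝ := fun s => (s, α s) - (t, α t) with hv
  set e : ℝ → ℝ := fun s => α s - α t - (s - t) * (-f' (1, 0) / f' (0, 1)) with he
  have h2 : e =o[𝓝 t] v := by
    have h3 := h1.const_mul_left (-(f' (0, 1))⁻¹)
    refine h3.congr' ?_ (Eventually.of_forall fun s => rfl)
    filter_upwards [h0] with s hs
    have h4 : f' (v s) = (s - t) * f' (1, 0) + (α s - α t) * f' (0, 1) := by
      have : v s = (s - t) • ((1, 0) : ℝ × ℝ) + (α s - α t) • ((0, 1) : ℝ × ℝ) := by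
        simp [hv]
      rw [this, map_add, map_smul, map_smul, smul_eq_mul, smul_eq_mul]
    simp only [Function.comp_apply]
    rw [hs, h0.self_of_nhds]
    change -(f' (0, 1))⁻¹ * (0 - 0 - f' (v s)) = e s
    rw [h4, he]
    field_simp
    ring
  have h5 : (fun s => ((0 : ℝ), e s)) =o[𝓝 t] v := by
    refine (Asymptotics.IsBigO.of_bound 1 (Eventually.of_forall fun s => ?_)).trans_isLittleO h2
    rw [Prod.norm_def]; simp
  have h6 : v =O[𝓝 t] fun s => s - t := by
    refine h5.right_isBigO_sub.trans (Asymptotics.IsBigO.of_bound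
      (max 1 |(-f' (1, 0) / f' (0, 1))|) (Eventually.of_forall fun s => ?_))
    have : v s - (0, e s) = (s - t, (s - t) * (-f' (1, 0) / f' (0, 1))) := by
      simp [hv, he]
    rw [this, Prod.norm_def, Real.norm_eq_abs, Real.norm_eq_abs, abs_mul]
    refine max_le ?_ ?_
    · exact le_mul_of_one_le_left (abs_nonneg _) (le_max_left _ _)
    · rw [mul_comm]
      exact mul_le_mul_of_nonneg_right (le_max_right _ _) (abs_nonneg _)
  rw [hasDerivAt_iff_isLittleO]
  exact (h2.trans_isBigO h6).congr_left fun s => by simp [he]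

theorem IsPreconnected.lt_or_gt_of_ne {A : Type*} [TopologicalSpace A] {s : Set A}
    (hs : IsPreconnected s) {f : A → ℝ} (hf : ContinuousOn f s) {a : ℝ} (hne : ∀ z ∈ s, f z ≠ a) :
    (∀ z ∈ s, f z < a) ∨ ∀ z ∈ s, a < f z := by
  by_contra! hcon
  obtain ⟨⟨z, hz, hza⟩, z', hz', hza'⟩ := hcon
  obtain ⟨y, hy, hya⟩ := hs.intermediate_value hz' hz hf ⟨hza', hza⟩
  exact hne y hy hya

namespace T1S

variable {Γ : Subgroup SL2R}

/-- The map `κ` goes near `a` into a plaque of the foliation. -/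
def SurfaceFoliation.IsLeafAt (W : SurfaceFoliation Γ) {A : Type*} [TopologicalSpace A]
    (κ : A → T1S Γ) (a : A) : Prop :=
  ContinuousAt κ a ∧ ∃ e ∈ W.atlas, κ a ∈ e.source ∧ ∀ᶠ b in 𝓝 a, (e (κ b)).2 = (e (κ a)).2

namespace SurfaceFoliation

variable {W : SurfaceFoliation Γ} {A B : Type*} [TopologicalSpace A] [TopologicalSpace B]

/-- Compatibility of the charts makes the choice of a chart in `IsLeafAt` immaterial. -/
theorem IsLeafAt.eventually_eq {κ : A → T1S Γ} {a : A} (h : W.IsLeafAt κ a)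
    {e : OpenPartialHomeomorph (T1S Γ) ((ℝ × ℝ) × ℝ)} (he : e ∈ W.atlas) (hea : κ a ∈ e.source) :
    ∀ᶠ b in 𝓝 a, (e (κ b)).2 = (e (κ a)).2 := by
  obtain ⟨hc, e', he', hea', hl⟩ := h
  obtain ⟨U, hU, -, hUc⟩ := W.compatible e' he' e he _ ⟨hea', hea⟩
  filter_upwards [hl, hc hU] with b hb hbU
  exact hUc _ hbU _ (mem_of_mem_nhds hU) hb

theorem IsLeafAt.comp {κ : A → T1S Γ} {u : B → A} {b : B} (h : W.IsLeafAt κ (u b))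
    (hu : ContinuousAt u b) : W.IsLeafAt (κ ∘ u) b := by
  obtain ⟨hc, e, he, hea, hl⟩ := h
  exact ⟨hc.comp hu, e, he, hea, hu.eventually hl⟩

theorem IsLeafAt.congr {κ κ' : A → T1S Γ} {a : A} (h : W.IsLeafAt κ a) (hκ : κ' =ᶠ[𝓝 a] κ) :
    W.IsLeafAt κ' a := by
  obtain ⟨hc, e, he, hea, hl⟩ := h
  have h0 := hκ.eq_of_nhds
  refine ⟨hc.congr hκ.symm, e, he, by rwa [h0], ?_⟩
  filter_upwards [hκ, hl] with s hs hls
  rw [hs, h0, hls]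

theorem isLeafCurve_iff {c : ℝ → T1S Γ} : W.IsLeafCurve c ↔ ∀ t, W.IsLeafAt c t := by
  constructor
  · rintro ⟨hc, h⟩ t
    obtain ⟨e, he, hes, hl⟩ := h t
    exact ⟨hc.continuousAt, e, he, hes, hl.mono fun s hs => hs.2⟩
  · intro h
    refine ⟨continuous_iff_continuousAt.2 fun t => (h t).1, fun t => ?_⟩
    obtain ⟨hc, e, he, hes, hl⟩ := h t
    exact ⟨e, he, hes, (hc.eventually (e.open_source.mem_nhds hes)).and hl⟩

end SurfaceFoliation

/-- Local coordinates `Ψ` of `T¹S` with derivative `D`. -/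
structure IsFrame (Ψ : ℝ × ℝ × ℝ → T1S Γ) (D : ℝ × ℝ × ℝ → ((ℝ × ℝ × ℝ) ≃L[ℝ] V3)) : Prop where
  isLocalHomeomorph : IsLocalHomeomorph Ψ
  continuous_symm : Continuous fun q => ((D q).symm : V3 →L[ℝ] ℝ × ℝ × ℝ)
  hasFDerivAt_of_comp : ∀ (γ : ℝ × ℝ → ℝ × ℝ × ℝ) (L : ℝ × ℝ →L[ℝ] V3) (p : ℝ × ℝ),
    ContinuousAt γ p → HasDeriv (fun u => Ψ (γ u)) L p →
      HasFDerivAt γ (((D (γ p)).symm : V3 →L[ℝ] ℝ × ℝ × ℝ).comp L) p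

variable {Ψ : ℝ × ℝ × ℝ → T1S Γ} {D : ℝ × ℝ × ℝ → ((ℝ × ℝ × ℝ) ≃L[ℝ] V3)}

theorem IsFrame.continuous (hΨ : IsFrame Ψ D) : Continuous Ψ := hΨ.isLocalHomeomorph.continuous

/-- A plaque transverse to the third coordinate is the graph of a function. -/
theorem exists_plaque_graph (hΨ : IsFrame Ψ D) {W : SurfaceFoliation Γ}
    {P : T1S Γ → Submodule ℝ V3} (hW : W.IsTangentTo P) {q₀ : ℝ × ℝ × ℝ}
    {e : OpenPartialHomeomorph (T1S Γ) ((ℝ × ℝ) × ℝ)} (he : e ∈ W.atlas) (hq₀ : Ψ q₀ ∈ e.source)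
    (htr : ∀ w, D q₀ w ∈ P (Ψ q₀) → w.1 = 0 → w.2.1 = 0 → w = 0) :
    ∃ (φ : ℝ × ℝ → ℝ) (m : ℝ × ℝ →L[ℝ] ℝ), (∀ᶠ p in 𝓝 (q₀.1, q₀.2.1), ContinuousAt φ p) ∧
      φ (q₀.1, q₀.2.1) = q₀.2.2 ∧ HasFDerivAt φ m (q₀.1, q₀.2.1) ∧
      (∀ w : ℝ × ℝ, D q₀ (w.1, w.2, m w) ∈ P (Ψ q₀)) ∧
      ∀ᶠ q in 𝓝 q₀, ((e (Ψ q)).2 = (e (Ψ q₀)).2 ↔ q.2.2 = φ (q.1, q.2.1)) := by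
  obtain ⟨Θ, hΘ, rfl⟩ := hΨ.isLocalHomeomorph q₀
  set a := (e (Θ q₀)).2 with ha
  set u₀ := (e (Θ q₀)).1 with hu₀
  obtain ⟨L, hLc, hL⟩ := hW e he a
  set E : ℝ × ℝ → T1S Γ := fun u => e.symm (u, a) with hE
  have hEc : Continuous E := by
    have h1 : Continuous e.symm := by
      rw [← continuousOn_univ, ← W.target_eq e he]; exact e.continuousOn_symm
    exact h1.comp (by fun_prop)
  have hE0 : E u₀ = Θ q₀ := e.left_inv hq₀
  have heE (u : ℝ × ℝ) : e (E u) = (u, a) := e.right_inv (by rw [W.target_eq e he]; trivial)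
  set γ : ℝ × ℝ → ℝ × ℝ × ℝ := fun u => Θ.symm (E u) with hγ
  have hEt : ∀ᶠ u in 𝓝 u₀, E u ∈ Θ.target := hEc.continuousAt.eventually
    (Θ.open_target.mem_nhds (by rw [hE0]; exact Θ.map_source hΘ))
  have hγ0 : γ u₀ = q₀ := by rw [hγ]; simp only; rw [hE0]; exact Θ.left_inv hΘ
  have hγc : ∀ u, E u ∈ Θ.target → ContinuousAt γ u := fun u hu =>
    (Θ.continuousAt_symm hu).comp hEc.continuousAt
  have hΘγ : ∀ u, E u ∈ Θ.target → Θ (γ u) = E u := fun u hu => Θ.right_inv hu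
  -- The derivative of the plaque in the coordinates. Its continuity gives strict differentiability,
  -- which the inverse function theorem requires.
  set M : ℝ × ℝ → (ℝ × ℝ →L[ℝ] ℝ × ℝ × ℝ) := fun u =>
    ((D (γ u)).symm : V3 →L[ℝ] ℝ × ℝ × ℝ).comp (L u) with hM
  have hγd : ∀ᶠ u in 𝓝 u₀, HasFDerivAt γ (M u) u := by
    filter_upwards [hEt.eventually_nhds] with u hu
    refine hΨ.hasFDerivAt_of_comp γ (L u) u (hγc u hu.self_of_nhds) ?_
    refine (hL u).1.congr ?_
    filter_upwards [hu] with z hz using hΘγ z hz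
  have hMc : ContinuousAt M u₀ :=
    (hΨ.continuous_symm.continuousAt.comp (hγc u₀ hEt.self_of_nhds)).clm_comp hLc.continuousAt
  have hγs : HasStrictFDerivAt γ (M u₀) u₀ := hasStrictFDerivAt_of_hasFDerivAt_of_continuousAt hγd hMc
  have hrange : ∀ v, D q₀ (M u₀ v) ∈ P (Θ q₀) := fun v => by
    rw [hM]
    simp only [ContinuousLinearMap.comp_apply, ContinuousLinearEquiv.coe_coe]
    rw [hγ0, ContinuousLinearEquiv.apply_symm_apply, ← hE0, ← (hL u₀).2.2]
    exact ⟨v, rfl⟩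
  set pr : ℝ × ℝ × ℝ →L[ℝ] ℝ × ℝ := (ContinuousLinearMap.fst ℝ ℝ (ℝ × ℝ)).prod
    ((ContinuousLinearMap.fst ℝ ℝ ℝ).comp (ContinuousLinearMap.snd ℝ ℝ (ℝ × ℝ))) with hpr
  -- By transversality a vector tangent to the plaque with vanishing first two coordinates is zero.
  -- So these coordinates parametrize the plaque near `u₀`, and φ is the third coordinate as a
  -- function of them.
  have hinj : Function.Injective ((pr.comp (M u₀) : ℝ × ℝ →L[ℝ] ℝ × ℝ) : ℝ × ℝ →ₗ[ℝ] ℝ × ℝ) := by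
    rw [← LinearMap.ker_eq_bot, LinearMap.ker_eq_bot']
    intro v hv
    have h1 : M u₀ v = 0 := htr _ (hrange v) (congrArg Prod.fst hv) (congrArg Prod.snd hv)
    rw [hM] at h1
    simp only [ContinuousLinearMap.comp_apply, ContinuousLinearEquiv.coe_coe,
      EmbeddingLike.map_eq_zero_iff] at h1
    exact (hL u₀).2.1 (by rw [h1, map_zero])
  set Aeq : (ℝ × ℝ) ≃L[ℝ] ℝ × ℝ :=
    (LinearEquiv.ofInjectiveEndo _ hinj).toContinuousLinearEquiv with hAeq
  have hAapp (v : ℝ × ℝ) : Aeq v = pr (M u₀ v) := rfl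
  have hBs : HasStrictFDerivAt (fun u => pr (γ u)) (Aeq : ℝ × ℝ →L[ℝ] ℝ × ℝ) u₀ := by
    have heq : (Aeq : ℝ × ℝ →L[ℝ] ℝ × ℝ) = pr.comp (M u₀) := ContinuousLinearMap.ext fun v => rfl
    rw [heq]
    exact pr.hasStrictFDerivAt.comp u₀ hγs
  set B : ℝ × ℝ → ℝ × ℝ := fun u => pr (γ u) with hB
  have hB0 : B u₀ = (q₀.1, q₀.2.1) := by rw [hB]; simp only [hγ0]; rfl
  set H := hBs.toOpenPartialHomeomorph B with hH
  have hHB : (H : ℝ × ℝ → ℝ × ℝ) = B := rfl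
  have hHs : u₀ ∈ H.source := hBs.mem_toOpenPartialHomeomorph_source
  have hHt : (q₀.1, q₀.2.1) ∈ H.target := hB0 ▸ hBs.image_mem_toOpenPartialHomeomorph_target
  have hH0 : H.symm (q₀.1, q₀.2.1) = u₀ := by rw [← hB0, ← hHB]; exact H.left_inv hHs
  have hHc : ContinuousAt H.symm (q₀.1, q₀.2.1) := H.continuousAt_symm hHt
  have hHEt : ∀ᶠ p in 𝓝 (q₀.1, q₀.2.1), p ∈ H.target ∧ E (H.symm p) ∈ Θ.target := by
    have h1 : ∀ᶠ p in 𝓝 (q₀.1, q₀.2.1), p ∈ H.target := H.open_target.mem_nhds hHt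
    exact h1.and (hHc.eventually (by rw [hH0]; exact hEt))
  have hHd : HasFDerivAt H.symm (Aeq.symm : ℝ × ℝ →L[ℝ] ℝ × ℝ) (q₀.1, q₀.2.1) := by
    have := hBs.to_localInverse.hasFDerivAt
    rw [hB0] at this
    exact this
  set s2 : ℝ × ℝ × ℝ →L[ℝ] ℝ :=
    (ContinuousLinearMap.snd ℝ ℝ ℝ).comp (ContinuousLinearMap.snd ℝ ℝ (ℝ × ℝ)) with hs2
  refine ⟨fun p => s2 (γ (H.symm p)), (s2.comp (M u₀)).comp (Aeq.symm : ℝ × ℝ →L[ℝ] ℝ × ℝ), ?_, ?_, ?_, ?_, ?_⟩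
  · filter_upwards [hHEt] with p hp
    exact s2.continuous.continuousAt.comp
      ((hγc _ hp.2).comp (H.continuousAt_symm hp.1))
  · simp only; rw [hH0, hγ0]; rfl
  · refine (HasFDerivAt.comp (g := fun u => s2 (γ u)) (q₀.1, q₀.2.1) ?_ hHd)
    rw [hH0]
    exact s2.hasFDerivAt.comp u₀ hγs.hasFDerivAt
  · intro w
    have h1 := hrange (Aeq.symm w)
    have h2 : pr (M u₀ (Aeq.symm w)) = w := by rw [← hAapp, Aeq.apply_symm_apply]
    have h3 : M u₀ (Aeq.symm w) = (w.1, w.2, s2 (M u₀ (Aeq.symm w))) :=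
      Prod.ext (Prod.ext_iff.1 h2).1 (Prod.ext (Prod.ext_iff.1 h2).2 rfl)
    rw [h3] at h1
    exact h1
  · have hpc : ContinuousAt (fun q : ℝ × ℝ × ℝ => (q.1, q.2.1)) q₀ := by fun_prop
    have hΘs : ∀ᶠ q in 𝓝 q₀, q ∈ Θ.source := Θ.open_source.mem_nhds hΘ
    have hΘe : ∀ᶠ q in 𝓝 q₀, Θ q ∈ e.source :=
      (Θ.continuousAt hΘ).eventually (e.open_source.mem_nhds hq₀)
    have huc : ContinuousAt (fun q => (e (Θ q)).1) q₀ :=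
      continuousAt_fst.comp ((e.continuousAt hq₀).comp (Θ.continuousAt hΘ))
    have hus : ∀ᶠ q in 𝓝 q₀, (e (Θ q)).1 ∈ H.source :=
      huc.eventually (H.open_source.mem_nhds hHs)
    filter_upwards [hΘs, hΘe, hus, hpc.eventually hHEt] with q h1 h2 h3 h4
    constructor
    · intro hl
      have h5 : E (e (Θ q)).1 = Θ q := by
        rw [hE]; simp only; rw [← hl]; exact e.left_inv h2
      have h6 : γ (e (Θ q)).1 = q := by rw [hγ]; simp only; rw [h5]; exact Θ.left_inv h1
      have h7 : H (e (Θ q)).1 = (q.1, q.2.1) := by rw [hHB, hB]; simp only; rw [h6]; rfl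
      have h8 := H.left_inv h3
      rw [h7] at h8
      rw [h8, h6]; rfl
    · intro hy
      set u := H.symm (q.1, q.2.1) with hu
      have h5 : B u = (q.1, q.2.1) := H.right_inv h4.1
      have h6 : γ u = q :=
        Prod.ext (Prod.ext_iff.1 h5).1 (Prod.ext (Prod.ext_iff.1 h5).2 hy.symm)
      rw [← h6, hΘγ u h4.2, heE]

/-- The label of a chart increases or decreases across a plaque. -/
theorem exists_plaque_sides (hΨ : IsFrame Ψ D) {W : SurfaceFoliation Γ}
    {P : T1S Γ → Submodule ℝ V3} (hW : W.IsTangentTo P) {q₀ : ℝ × ℝ × ℝ}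
    {e : OpenPartialHomeomorph (T1S Γ) ((ℝ × ℝ) × ℝ)} (he : e ∈ W.atlas) (hq₀ : Ψ q₀ ∈ e.source)
    (htr : ∀ w, D q₀ w ∈ P (Ψ q₀) → w.1 = 0 → w.2.1 = 0 → w = 0) :
    ∃ (φ : ℝ × ℝ → ℝ) (m : ℝ × ℝ →L[ℝ] ℝ),
      φ (q₀.1, q₀.2.1) = q₀.2.2 ∧ HasFDerivAt φ m (q₀.1, q₀.2.1) ∧
      (∀ w : ℝ × ℝ, D q₀ (w.1, w.2, m w) ∈ P (Ψ q₀)) ∧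
      ((∀ᶠ q in 𝓝 q₀, (φ (q.1, q.2.1) < q.2.2 → (e (Ψ q₀)).2 < (e (Ψ q)).2) ∧
        (q.2.2 < φ (q.1, q.2.1) → (e (Ψ q)).2 < (e (Ψ q₀)).2)) ∨
      ∀ᶠ q in 𝓝 q₀, (φ (q.1, q.2.1) < q.2.2 → (e (Ψ q)).2 < (e (Ψ q₀)).2) ∧
        (q.2.2 < φ (q.1, q.2.1) → (e (Ψ q₀)).2 < (e (Ψ q)).2)) := by
  obtain ⟨φ, m, hφc, hφ0, hφd, hm, hφ⟩ := exists_plaque_graph hΨ hW he hq₀ htr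
  refine ⟨φ, m, hφ0, hφd, hm, ?_⟩
  set a := (e (Ψ q₀)).2 with ha
  set p₀ := (q₀.1, q₀.2.1) with hp₀
  have hnice : ∀ᶠ q in 𝓝 q₀, ((e (Ψ q)).2 = a ↔ q.2.2 = φ (q.1, q.2.1)) ∧ Ψ q ∈ e.source :=
    hφ.and (hΨ.continuous.continuousAt.eventually (e.open_source.mem_nhds hq₀))
  -- This shear straightens the graph to {z.2 = 0}. Off it the label differs from `a`, hence has a
  -- constant side on each of the two connected halves of a box.
  have hsh : ContinuousAt (fun z : (ℝ × ℝ) × ℝ => (z.1.1, z.1.2, φ z.1 + z.2)) (p₀, 0) := by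
    have h1 : ContinuousAt (fun z : (ℝ × ℝ) × ℝ => φ z.1) (p₀, 0) :=
      ContinuousAt.comp (g := φ) (f := Prod.fst) hφc.self_of_nhds continuousAt_fst
    exact (by fun_prop : ContinuousAt (fun z : (ℝ × ℝ) × ℝ => z.1.1) (p₀, 0)).prodMk
      ((by fun_prop : ContinuousAt (fun z : (ℝ × ℝ) × ℝ => z.1.2) (p₀, 0)).prodMk
        (h1.add continuousAt_snd))
  have hsh0 : (fun z : (ℝ × ℝ) × ℝ => (z.1.1, z.1.2, φ z.1 + z.2)) (p₀, 0) = q₀ := by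
    simp only
    rw [hφ0, add_zero]
  have hev : ∀ᶠ z in 𝓝 (p₀, (0 : ℝ)), ContinuousAt φ z.1 ∧
      (((e (Ψ (z.1.1, z.1.2, φ z.1 + z.2))).2 = a ↔ φ z.1 + z.2 = φ z.1) ∧
        Ψ (z.1.1, z.1.2, φ z.1 + z.2) ∈ e.source) :=
    (continuousAt_fst.eventually hφc).and (hsh.eventually (by rw [hsh0]; exact hnice))
  obtain ⟨r, hr, hball⟩ := Metric.eventually_nhds_iff_ball.1 hev
  rw [← ball_prod_same] at hball
  have hconn : ∀ I : Set ℝ, I.OrdConnected → I ⊆ Metric.ball 0 r → (0 : ℝ) ∉ I →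
      (∀ z ∈ Metric.ball p₀ r ×ˢ I, (e (Ψ (z.1.1, z.1.2, φ z.1 + z.2))).2 < a) ∨
      ∀ z ∈ Metric.ball p₀ r ×ˢ I, a < (e (Ψ (z.1.1, z.1.2, φ z.1 + z.2))).2 := by
    intro I hI hIr h0
    have hmem : ∀ z ∈ Metric.ball p₀ r ×ˢ I, z ∈ Metric.ball p₀ r ×ˢ Metric.ball 0 r :=
      fun z hz => ⟨hz.1, hIr hz.2⟩
    refine ((convex_ball p₀ r).isPreconnected.prod hI.isPreconnected).lt_or_gt_of_ne ?_ ?_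
    · intro z hz
      obtain ⟨h1, h2, h3⟩ := hball z (hmem z hz)
      refine ContinuousAt.continuousWithinAt ?_
      have hsz : ContinuousAt (fun z : (ℝ × ℝ) × ℝ => (z.1.1, z.1.2, φ z.1 + z.2)) z := by
        have h1 : ContinuousAt (fun z : (ℝ × ℝ) × ℝ => φ z.1) z :=
          ContinuousAt.comp (g := φ) (f := Prod.fst) h1 continuousAt_fst
        exact (by fun_prop : ContinuousAt (fun z : (ℝ × ℝ) × ℝ => z.1.1) z).prodMk
          ((by fun_prop : ContinuousAt (fun z : (ℝ × ℝ) × ℝ => z.1.2) z).prodMk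
            (h1.add continuousAt_snd))
      exact continuousAt_snd.comp (ContinuousAt.comp (g := e) (f := fun z : (ℝ × ℝ) × ℝ =>
        Ψ (z.1.1, z.1.2, φ z.1 + z.2)) (e.continuousAt h3)
        (hΨ.continuous.continuousAt.comp (f := fun z : (ℝ × ℝ) × ℝ =>
          (z.1.1, z.1.2, φ z.1 + z.2)) hsz))
    · intro z hz hza
      obtain ⟨h1, h2, h3⟩ := hball z (hmem z hz)
      have := h2.1 hza
      have : z.2 = 0 := by linarith
      exact h0 (this ▸ hz.2)
  -- points near `q₀` in the coordinates adapted to the graph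
  have hcoord : ∀ᶠ q in 𝓝 q₀, ((q.1, q.2.1), q.2.2 - φ (q.1, q.2.1)) ∈
      Metric.ball p₀ r ×ˢ Metric.ball (0 : ℝ) r := by
    have hpc : ContinuousAt (fun q : ℝ × ℝ × ℝ => (q.1, q.2.1)) q₀ := by fun_prop
    have h1 : ContinuousAt (fun q : ℝ × ℝ × ℝ => φ (q.1, q.2.1)) q₀ :=
      ContinuousAt.comp (g := φ) (f := fun q : ℝ × ℝ × ℝ => (q.1, q.2.1)) hφc.self_of_nhds hpc
    have h2 : ContinuousAt (fun q : ℝ × ℝ × ℝ => ((q.1, q.2.1), q.2.2 - φ (q.1, q.2.1))) q₀ :=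
      hpc.prodMk ((by fun_prop : ContinuousAt (fun q : ℝ × ℝ × ℝ => q.2.2) q₀).sub h1)
    refine h2.eventually (prod_mem_nhds (Metric.ball_mem_nhds _ hr) ?_)
    rw [hφ0, sub_self]
    exact Metric.ball_mem_nhds _ hr
  -- the chart is open, so the label takes values on both sides
  have hopen : ∀ U ∈ 𝓝 q₀, (∃ q ∈ U, (e (Ψ q)).2 < a) ∧ ∃ q ∈ U, a < (e (Ψ q)).2 := by
    intro U hU
    have h1 : (fun q => e (Ψ q)) '' U ∈ 𝓝 (e (Ψ q₀)) := by
      have h2 : Ψ '' U ∈ 𝓝 (Ψ q₀) := hΨ.isLocalHomeomorph.isOpenMap.image_mem_nhds hU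
      have h3 : e '' (Ψ '' U) ∈ 𝓝 (e (Ψ q₀)) := e.image_mem_nhds hq₀ h2
      rwa [Set.image_image] at h3
    have hc : Continuous fun s : ℝ => ((e (Ψ q₀)).1, a + s) := by fun_prop
    have h4 : ∀ᶠ s in 𝓝 (0 : ℝ), ((e (Ψ q₀)).1, a + s) ∈ (fun q => e (Ψ q)) '' U :=
      hc.continuousAt (by simpa [ha] using h1)
    obtain ⟨s, ⟨q, hq, hqe⟩, hs0⟩ := ((h4.filter_mono nhdsWithin_le_nhds).and
      (self_mem_nhdsWithin (s := Set.Ioi (0 : ℝ)))).exists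
    obtain ⟨s', ⟨q', hq', hqe'⟩, hs0'⟩ := ((h4.filter_mono nhdsWithin_le_nhds).and
      (self_mem_nhdsWithin (s := Set.Iio (0 : ℝ)))).exists
    have e1 : (e (Ψ q)).2 = a + s := congrArg Prod.snd hqe
    have e2 : (e (Ψ q')).2 = a + s' := congrArg Prod.snd hqe'
    have hs1 : 0 < s := hs0
    have hs2 : s' < 0 := hs0'
    exact ⟨⟨q', hq', by linarith⟩, q, hq, by linarith⟩
  have hside : ∀ q : ℝ × ℝ × ℝ, ∀ I : Set ℝ,
      ((q.1, q.2.1), q.2.2 - φ (q.1, q.2.1)) ∈ Metric.ball p₀ r ×ˢ Metric.ball (0 : ℝ) r →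
      q.2.2 - φ (q.1, q.2.1) ∈ I → ∀ R : ℝ → Prop,
      (∀ z ∈ Metric.ball p₀ r ×ˢ I, R (e (Ψ (z.1.1, z.1.2, φ z.1 + z.2))).2) →
      R (e (Ψ q)).2 := by
    intro q I hq hI R hR
    have := hR ((q.1, q.2.1), q.2.2 - φ (q.1, q.2.1)) ⟨hq.1, hI⟩
    simpa using this
  have hup := hconn (Set.Ioo 0 r) Set.ordConnected_Ioo
    (fun s hs => by rw [Metric.mem_ball, dist_zero_right, Real.norm_eq_abs, abs_of_pos hs.1]; exact hs.2)
    (by simp)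
  have hlo := hconn (Set.Ioo (-r) 0) Set.ordConnected_Ioo
    (fun s hs => by
      rw [Metric.mem_ball, dist_zero_right, Real.norm_eq_abs, abs_of_neg hs.2]; linarith [hs.1])
    (by simp)
  have hI1 : ∀ q : ℝ × ℝ × ℝ,
      ((q.1, q.2.1), q.2.2 - φ (q.1, q.2.1)) ∈ Metric.ball p₀ r ×ˢ Metric.ball (0 : ℝ) r →
      φ (q.1, q.2.1) < q.2.2 → q.2.2 - φ (q.1, q.2.1) ∈ Set.Ioo 0 r := fun q hq h => by
    have := hq.2
    rw [Metric.mem_ball, dist_zero_right, Real.norm_eq_abs, abs_lt] at this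
    exact ⟨by linarith, this.2⟩
  have hI2 : ∀ q : ℝ × ℝ × ℝ,
      ((q.1, q.2.1), q.2.2 - φ (q.1, q.2.1)) ∈ Metric.ball p₀ r ×ˢ Metric.ball (0 : ℝ) r →
      q.2.2 < φ (q.1, q.2.1) → q.2.2 - φ (q.1, q.2.1) ∈ Set.Ioo (-r) 0 := fun q hq h => by
    have := hq.2
    rw [Metric.mem_ball, dist_zero_right, Real.norm_eq_abs, abs_lt] at this
    exact ⟨this.1, by linarith⟩
  -- Equal sides above and below are impossible: the chart is open, so labels on both sides of `a`
  -- occur arbitrarily near `q₀`.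
  rcases hup with hup | hup <;> rcases hlo with hlo | hlo
  · exfalso
    obtain ⟨-, q, ⟨hq1, hq2⟩, hq3⟩ := hopen _ (hcoord.and hnice)
    rcases lt_trichotomy (φ (q.1, q.2.1)) q.2.2 with h | h | h
    · exact absurd (hside q _ hq1 (hI1 q hq1 h) (· < a) hup) (not_lt.2 hq3.le)
    · exact hq3.ne' (hq2.1.2 h.symm)
    · exact absurd (hside q _ hq1 (hI2 q hq1 h) (· < a) hlo) (not_lt.2 hq3.le)
  · right
    filter_upwards [hcoord] with q hq
    exact ⟨fun h => hside q _ hq (hI1 q hq h) (· < a) hup,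
      fun h => hside q _ hq (hI2 q hq h) (a < ·) hlo⟩
  · left
    filter_upwards [hcoord] with q hq
    exact ⟨fun h => hside q _ hq (hI1 q hq h) (a < ·) hup,
      fun h => hside q _ hq (hI2 q hq h) (· < a) hlo⟩
  · exfalso
    obtain ⟨⟨q, ⟨hq1, hq2⟩, hq3⟩, -⟩ := hopen _ (hcoord.and hnice)
    rcases lt_trichotomy (φ (q.1, q.2.1)) q.2.2 with h | h | h
    · exact absurd (hside q _ hq1 (hI1 q hq1 h) (a < ·) hup) (not_lt.2 hq3.le)
    · exact hq3.ne (hq2.1.2 h.symm)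
    · exact absurd (hside q _ hq1 (hI2 q hq1 h) (a < ·) hlo) (not_lt.2 hq3.le)

/-- Along a curve transverse to the foliation the label has no local extremum. -/
theorem not_isLocalExtr_label (hΨ : IsFrame Ψ D) {W : SurfaceFoliation Γ}
    {P : T1S Γ → Submodule ℝ V3} (hW : W.IsTangentTo P) {κ : ℝ → ℝ × ℝ × ℝ} {w : ℝ × ℝ × ℝ} {t : ℝ}
    (hκ : HasDerivAt κ w t)
    {e : OpenPartialHomeomorph (T1S Γ) ((ℝ × ℝ) × ℝ)} (he : e ∈ W.atlas)
    (hq₀ : Ψ (κ t) ∈ e.source)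
    (htr : ∀ w, D (κ t) w ∈ P (Ψ (κ t)) → w.1 = 0 → w.2.1 = 0 → w = 0)
    (hw : D (κ t) w ∉ P (Ψ (κ t))) : ¬ IsLocalExtr (fun s => (e (Ψ (κ s))).2) t := by
  obtain ⟨φ, m, hφ0, hφd, hm, hs⟩ := exists_plaque_sides hΨ hW he hq₀ htr
  intro hext
  -- The height of the curve above the plaque. Its derivative is not zero since the velocity is not
  -- in `P`, but an extremum of the label would be an extremum of the height, as the label lies on
  -- opposite sides above and below.
  set f : ℝ → ℝ := fun s => (κ s).2.2 - φ ((κ s).1, (κ s).2.1) with hf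
  have hf0 : f t = 0 := by rw [hf]; simp only; rw [hφ0, sub_self]
  have h2 : HasDerivAt (fun s => (κ s).2) w.2 t := hκ.snd
  have h1 : HasDerivAt (fun s => (κ s).1) w.1 t := hκ.fst
  have h3 : HasDerivAt (fun s => (κ s).2.1) w.2.1 t := h2.fst
  have h4 : HasDerivAt (fun s => (κ s).2.2) w.2.2 t := h2.snd
  have hfd : HasDerivAt f (w.2.2 - m (w.1, w.2.1)) t :=
    h4.sub (HasFDerivAt.comp_hasDerivAt (f := fun s => ((κ s).1, (κ s).2.1)) t hφd (h1.prodMk h3))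
  have hne : w.2.2 - m (w.1, w.2.1) ≠ 0 := by
    intro h0
    apply hw
    have := hm (w.1, w.2.1)
    simp only at this
    rwa [← sub_eq_zero.1 h0] at this
  have hfext : IsLocalExtr f t := by
    rcases hs with hs | hs <;> rcases hext with h | h
    · left
      filter_upwards [h, hκ.continuousAt.eventually hs] with s h1 h3
      by_contra! hlt
      have hlt' : f s < 0 := by rwa [hf0] at hlt
      exact absurd (h3.2 (by simp only [hf] at hlt'; linarith)) (not_lt.2 h1)
    · right
      filter_upwards [h, hκ.continuousAt.eventually hs] with s h1 h3
      by_contra! hlt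
      have hlt' : 0 < f s := by rwa [hf0] at hlt
      exact absurd (h3.1 (by simp only [hf] at hlt'; linarith)) (not_lt.2 h1)
    · right
      filter_upwards [h, hκ.continuousAt.eventually hs] with s h1 h3
      by_contra! hlt
      have hlt' : 0 < f s := by rwa [hf0] at hlt
      exact absurd (h3.1 (by simp only [hf] at hlt'; linarith)) (not_lt.2 h1)
    · left
      filter_upwards [h, hκ.continuousAt.eventually hs] with s h1 h3
      by_contra! hlt
      have hlt' : f s < 0 := by rwa [hf0] at hlt
      exact absurd (h3.2 (by simp only [hf] at hlt'; linarith)) (not_lt.2 h1)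
  exact hne (hfext.hasDerivAt_eq_zero hfd)

end T1S

end

/-! ### Tubes around a geodesic, and bundles close to those of the geodesic flow. -/

noncomputable section

open T1S UnitTangent

/-- The coordinates of `SL(2, ℝ)`. -/
def coordHomeomorph : OpenPartialHomeomorph (ℝ × ℝ × ℝ) SL2R where
  toFun := coordMat
  invFun := coord
  source := Set.univ
  target := {g | 0 < g 1 1}
  map_source' q _ := coordMat_11_pos q
  map_target' _ _ := trivial
  left_inv' q _ := coord_coordMat q
  right_inv' _ hg := coordMat_coord hg
  open_source := isOpen_univ
  open_target := isOpen_lt continuous_const (continuous_entry 1 1)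
  continuousOn_toFun := continuous_coordMat.continuousOn
  continuousOn_invFun := fun _ hg => (continuousAt_coord (ne_of_gt hg)).continuousWithinAt

/-- Exchange of the last two coordinates. -/
def swapCoord : (ℝ × ℝ × ℝ) ≃L[ℝ] ℝ × ℝ × ℝ :=
  (ContinuousLinearEquiv.refl ℝ ℝ).prodCongr (ContinuousLinearEquiv.prodComm ℝ ℝ ℝ)

@[simp] theorem swapCoord_apply (q : ℝ × ℝ × ℝ) : swapCoord q = (q.1, q.2.2, q.2.1) := rfl

theorem V3.norm_le_mat (v : V3) : ‖v‖ ≤ 2 * (|matD v| + |matU v| + |matL v|) := by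
  refine (V3.norm_le_sum v).trans ?_
  have h0 : v 0 = 2 * matD v := by rw [matD_apply]; ring
  have h1 : v 1 = -(matU v + matL v) := by rw [matU_apply, matL_apply]; ring
  have h2 : v 2 = matU v - matL v := by rw [matU_apply, matL_apply]; ring
  rw [h0, h1, h2, abs_neg, abs_mul, abs_two]
  linarith [abs_add_le (matU v) (matL v), abs_sub (matU v) (matL v)]

/-- The subspaces are nearly in the stable, center and unstable directions of the geodesic flow. -/
structure IsNarrow (δ : ℝ) (Es Ec Eu : Submodule ℝ V3) : Prop where
  stable : ∀ v ∈ Es, |matD v| ≤ δ * ‖v‖ ∧ |matL v| ≤ δ * ‖v‖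
  center : ∀ v ∈ Ec, |matU v| ≤ δ * ‖v‖ ∧ |matL v| ≤ δ * ‖v‖
  unstable : ∀ v ∈ Eu, |matD v| ≤ δ * ‖v‖ ∧ |matU v| ≤ δ * ‖v‖

namespace IsNarrow

variable {δ : ℝ} {Es Ec Eu : Submodule ℝ V3}

theorem norm_stable_le (h : IsNarrow δ Es Ec Eu) (hδ : δ ≤ 1 / 8) {v : V3} (hv : v ∈ Es) :
    ‖v‖ ≤ 4 * |matU v| := by
  have h1 := V3.norm_le_mat v
  have h2 := h.stable v hv
  have h3 := mul_le_mul_of_nonneg_right hδ (norm_nonneg v)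
  linarith [h2.1, h2.2]

theorem norm_center_le (h : IsNarrow δ Es Ec Eu) (hδ : δ ≤ 1 / 8) {v : V3} (hv : v ∈ Ec) :
    ‖v‖ ≤ 4 * |matD v| := by
  have h1 := V3.norm_le_mat v
  have h2 := h.center v hv
  have h3 := mul_le_mul_of_nonneg_right hδ (norm_nonneg v)
  linarith [h2.1, h2.2]

theorem norm_unstable_le (h : IsNarrow δ Es Ec Eu) (hδ : δ ≤ 1 / 8) {v : V3} (hv : v ∈ Eu) :
    ‖v‖ ≤ 4 * |matL v| := by
  have h1 := V3.norm_le_mat v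
  have h2 := h.unstable v hv
  have h3 := mul_le_mul_of_nonneg_right hδ (norm_nonneg v)
  linarith [h2.1, h2.2]

/-- The norms of the two summands are controlled by `matU` and `matD` respectively, so their sum is
at most 8(|matD v| + |matU v|); on each summand `matL` is at most δ times the norm. -/
theorem abs_matL_le_of_mem_sup (h : IsNarrow δ Es Ec Eu) (hδ0 : 0 ≤ δ) (hδ : δ ≤ 1 / 8) {v : V3}
    (hv : v ∈ Es ⊔ Ec) : |matL v| ≤ 8 * δ * (|matD v| + |matU v|) := by
  obtain ⟨vs, hs, vc, hc, rfl⟩ := Submodule.mem_sup.1 hv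
  have h1 := h.norm_stable_le hδ hs
  have h2 := h.norm_center_le hδ hc
  obtain ⟨h3, h4⟩ := h.stable vs hs
  obtain ⟨h5, h6⟩ := h.center vc hc
  have h7 := abs_sub_le (matD vc + matD vs) 0 (matD vs)
  have h8 : |matD vc| ≤ |matD vs + matD vc| + |matD vs| := by
    have := abs_sub (matD vs + matD vc) (matD vs)
    rwa [add_sub_cancel_left] at this
  have h9 : |matU vs| ≤ |matU vs + matU vc| + |matU vc| := by
    have := abs_sub (matU vs + matU vc) (matU vc)
    rwa [add_sub_cancel_right] at this
  have h10 := abs_add_le (matL vs) (matL vc)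
  rw [map_add, map_add, map_add]
  have h11 := mul_le_mul_of_nonneg_right hδ (norm_nonneg vs)
  have h12 := mul_le_mul_of_nonneg_right hδ (norm_nonneg vc)
  have h13 : ‖vs‖ + ‖vc‖ ≤ 8 * (|matD vs + matD vc| + |matU vs + matU vc|) := by linarith
  have h14 := mul_le_mul_of_nonneg_left h13 hδ0
  linarith

theorem abs_matU_le_of_mem_sup (h : IsNarrow δ Es Ec Eu) (hδ0 : 0 ≤ δ) (hδ : δ ≤ 1 / 8) {v : V3}
    (hv : v ∈ Ec ⊔ Eu) : |matU v| ≤ 8 * δ * (|matD v| + |matL v|) := by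
  obtain ⟨vc, hc, vs, hs, rfl⟩ := Submodule.mem_sup.1 hv
  have h1 := h.norm_unstable_le hδ hs
  have h2 := h.norm_center_le hδ hc
  obtain ⟨h3, h4⟩ := h.unstable vs hs
  obtain ⟨h5, h6⟩ := h.center vc hc
  have h8 : |matD vc| ≤ |matD vc + matD vs| + |matD vs| := by
    have := abs_sub (matD vc + matD vs) (matD vs)
    rwa [add_sub_cancel_right] at this
  have h9 : |matL vs| ≤ |matL vc + matL vs| + |matL vc| := by
    have := abs_sub (matL vc + matL vs) (matL vc)
    rwa [add_sub_cancel_left] at this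
  have h10 := abs_add_le (matU vc) (matU vs)
  rw [map_add, map_add, map_add]
  have h11 := mul_le_mul_of_nonneg_right hδ (norm_nonneg vs)
  have h12 := mul_le_mul_of_nonneg_right hδ (norm_nonneg vc)
  have h13 : ‖vs‖ + ‖vc‖ ≤ 8 * (|matD vc + matD vs| + |matL vc + matL vs|) := by linarith
  have h14 := mul_le_mul_of_nonneg_left h13 hδ0
  linarith

/-- On the axis `frameD` sends (t, x, y) to the coefficients t/2, x, y, and the tube is thin enough
for this to hold approximately. So the narrow bundles become planes of small slope in the
coordinates. -/
theorem cone_cs (h : IsNarrow δ Es Ec Eu) (hδ0 : 0 ≤ δ) (hδ : δ ≤ 1 / 256) {q w : ℝ × ℝ × ℝ}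
    (hx : |q.2.1| ≤ 1 / 32) (hy : |q.2.2| ≤ 1 / 32) (hw : frameD q w ∈ Es ⊔ Ec) :
    |w.2.2| ≤ 1 / 8 * (|w.1| + |w.2.1|) := by
  have h1 := h.abs_matL_le_of_mem_sup hδ0 (by linarith) hw
  rw [matD_frameD, matU_frameD, matL_frameD] at h1
  set A := w.2.1 + q.2.1 * w.1 with hA
  have hxw : |q.2.1 * w.1| ≤ 1 / 32 * |w.1| := by
    rw [abs_mul]; exact mul_le_mul_of_nonneg_right hx (abs_nonneg _)
  have hyw : |q.2.2 * w.1| ≤ 1 / 32 * |w.1| := by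
    rw [abs_mul]; exact mul_le_mul_of_nonneg_right hy (abs_nonneg _)
  have hA1 : |A| ≤ |w.2.1| + 1 / 32 * |w.1| := (abs_add_le _ _).trans (by linarith)
  have hyA : |q.2.2 * A| ≤ 1 / 32 * |A| := by
    rw [abs_mul]; exact mul_le_mul_of_nonneg_right hy (abs_nonneg _)
  have hyyA : |q.2.2 ^ 2 * A| ≤ 1 / 32 * (1 / 32 * |A|) := by
    rw [pow_two, mul_assoc, abs_mul]; exact mul_le_mul hy hyA (abs_nonneg _) (by norm_num)
  have hD : |w.1 / 2 + q.2.2 * A| ≤ |w.1| / 2 + 1 / 32 * |A| := by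
    refine (abs_add_le _ _).trans ?_
    rw [abs_div, abs_two]; linarith
  have h2 : |w.2.2| ≤ |w.2.2 - q.2.2 * w.1 - q.2.2 ^ 2 * A| + |q.2.2 * w.1| + |q.2.2 ^ 2 * A| := by
    have e : w.2.2 = (w.2.2 - q.2.2 * w.1 - q.2.2 ^ 2 * A) + q.2.2 * w.1 + q.2.2 ^ 2 * A := by ring
    nth_rewrite 1 [e]
    exact abs_add_three _ _ _
  have h3 : 8 * δ * (|w.1 / 2 + q.2.2 * A| + |A|) ≤ 1 / 32 * (|w.1 / 2 + q.2.2 * A| + |A|) :=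
    mul_le_mul_of_nonneg_right (by linarith) (by positivity)
  linarith [abs_nonneg w.1, abs_nonneg w.2.1]

theorem cone_cu (h : IsNarrow δ Es Ec Eu) (hδ0 : 0 ≤ δ) (hδ : δ ≤ 1 / 256) {q w : ℝ × ℝ × ℝ}
    (hx : |q.2.1| ≤ 1 / 32) (hy : |q.2.2| ≤ 1 / 32) (hw : frameD q w ∈ Ec ⊔ Eu) :
    |w.2.1| ≤ 1 / 8 * (|w.1| + |w.2.2|) := by
  have h1 := h.abs_matU_le_of_mem_sup hδ0 (by linarith) hw
  rw [matD_frameD, matU_frameD, matL_frameD] at h1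
  set A := w.2.1 + q.2.1 * w.1 with hA
  have hxw : |q.2.1 * w.1| ≤ 1 / 32 * |w.1| := by
    rw [abs_mul]; exact mul_le_mul_of_nonneg_right hx (abs_nonneg _)
  have hyw : |q.2.2 * w.1| ≤ 1 / 32 * |w.1| := by
    rw [abs_mul]; exact mul_le_mul_of_nonneg_right hy (abs_nonneg _)
  have hyA : |q.2.2 * A| ≤ 1 / 32 * |A| := by
    rw [abs_mul]; exact mul_le_mul_of_nonneg_right hy (abs_nonneg _)
  have hyyA : |q.2.2 ^ 2 * A| ≤ 1 / 32 * (1 / 32 * |A|) := by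
    rw [pow_two, mul_assoc, abs_mul]; exact mul_le_mul hy hyA (abs_nonneg _) (by norm_num)
  have hD : |w.1 / 2 + q.2.2 * A| ≤ |w.1| / 2 + 1 / 32 * |A| := by
    refine (abs_add_le _ _).trans ?_
    rw [abs_div, abs_two]; linarith
  have hL : |w.2.2 - q.2.2 * w.1 - q.2.2 ^ 2 * A| ≤ |w.2.2| + |q.2.2 * w.1| + |q.2.2 ^ 2 * A| :=
    (abs_sub _ _).trans (by linarith [abs_sub w.2.2 (q.2.2 * w.1)])
  have h2 : |w.2.1| ≤ |A| + |q.2.1 * w.1| := by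
    have := abs_sub A (q.2.1 * w.1)
    rwa [hA, add_sub_cancel_right] at this
  have h3 : 8 * δ * (|w.1 / 2 + q.2.2 * A| + |w.2.2 - q.2.2 * w.1 - q.2.2 ^ 2 * A|) ≤
      1 / 32 * (|w.1 / 2 + q.2.2 * A| + |w.2.2 - q.2.2 * w.1 - q.2.2 ^ 2 * A|) :=
    mul_le_mul_of_nonneg_right (by linarith) (by positivity)
  linarith [abs_nonneg w.1, abs_nonneg w.2.2, abs_nonneg A]

end IsNarrow

namespace T1S

variable {Γ : Subgroup SL2R}

/-- The parametrization of `T¹S` by the coordinates around a geodesic. -/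
def tubeMap (Γ : Subgroup SL2R) (h : SL2R) (q : ℝ × ℝ × ℝ) : T1S Γ := proj Γ (h * coordMat q)

theorem isFrame_tubeMap (hΓ : IsClosedSurfaceGroup Γ) (h : SL2R) : IsFrame (tubeMap Γ h) frameD where
  isLocalHomeomorph := by
    have h1 : IsLocalHomeomorph coordMat :=
      IsLocalHomeomorph.mk _ fun q => ⟨coordHomeomorph, trivial, fun _ _ => rfl⟩
    exact (isCoveringMap_proj hΓ).isLocalHomeomorph.comp
      ((Homeomorph.mulLeft h).isLocalHomeomorph.comp h1)
  continuous_symm := continuous_frameD_symm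
  hasFDerivAt_of_comp γ L p hγ hL := by
    have h1 : HasFrameDeriv (fun u => h * coordMat (γ u)) L p := HasDeriv.hasFrameDeriv hΓ hL
      (continuousAt_const.mul (continuous_coordMat.continuousAt.comp hγ))
    have h2 := h1.mul_left h⁻¹
    simp only [inv_mul_cancel_left] at h2
    have h3 := h2.hasFDerivAt_coord (coordMat_11_pos _).ne'
    simpa only [coord_coordMat] using h3

/-- Exchanging x and y lets every result about center-stable leaves serve for center-unstable ones.
-/
theorem IsFrame.swap {Ψ : ℝ × ℝ × ℝ → T1S Γ} {D : ℝ × ℝ × ℝ → ((ℝ × ℝ × ℝ) ≃L[ℝ] V3)}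
    (hΨ : IsFrame Ψ D) :
    IsFrame (fun q => Ψ (swapCoord q)) (fun q => swapCoord.trans (D (swapCoord q))) where
  isLocalHomeomorph := hΨ.isLocalHomeomorph.comp swapCoord.toHomeomorph.isLocalHomeomorph
  continuous_symm := by
    have h1 : Continuous fun q => ((D (swapCoord q)).symm : V3 →L[ℝ] ℝ × ℝ × ℝ) :=
      hΨ.continuous_symm.comp swapCoord.continuous
    have h2 : Continuous fun q => (swapCoord.symm : ℝ × ℝ × ℝ →L[ℝ] ℝ × ℝ × ℝ).comp
        ((D (swapCoord q)).symm : V3 →L[ℝ] ℝ × ℝ × ℝ) := continuous_const.clm_comp h1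
    exact h2
  hasFDerivAt_of_comp γ L p hγ hL := by
    have h1 := hΨ.hasFDerivAt_of_comp (fun u => swapCoord (γ u)) L p
      (swapCoord.continuous.continuousAt.comp hγ) hL
    have h2 := (swapCoord.symm : ℝ × ℝ × ℝ →L[ℝ] ℝ × ℝ × ℝ).hasFDerivAt.comp p h1
    have h3 : ((swapCoord.symm : ℝ × ℝ × ℝ →L[ℝ] ℝ × ℝ × ℝ) ∘ fun u => swapCoord (γ u)) = γ :=
      funext fun u => swapCoord.symm_apply_apply _
    rw [h3] at h2
    exact h2

/-- Translated back to the identity, right multiplication by `geoMat t` becomes conjugation by a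
diagonal matrix, which fixes the diagonal entries and scales the other two by e^{-t} and e^t. -/
theorem mat_tangentMap_geodesicFlow (hΓ : IsClosedSurfaceGroup Γ) {t : ℝ} {L : V3 →L[ℝ] V3}
    {x : T1S Γ} (hL : HasTangentMap (geodesicFlow t) L x) (v : V3) :
    matD (L v) = matD v ∧ matU (L v) = Real.exp (-t) * matU v ∧
      matL (L v) = Real.exp t * matL v := by
  obtain ⟨g, rfl⟩ := proj_surjective (Γ := Γ) x
  have h1 : HasDeriv (fun v => proj Γ (g * paramMat v * geoMat t)) L 0 := by
    refine HasDeriv.congr hL (Eventually.of_forall fun v => ?_)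
    simp only [param_proj, geodesicFlow_proj]
  have hcont : Continuous fun v => g * paramMat v * geoMat t :=
    (continuous_const.mul continuous_paramMat).mul continuous_const
  have h2 := (HasDeriv.hasFrameDeriv hΓ h1 hcont.continuousAt).mul_left (geoMat (-t) * g⁻¹)
  have h3 (v : V3) : geoMat (-t) * g⁻¹ * (g * paramMat v * geoMat t) =
      geoMat (-t) * paramMat v * geoMat t := by group
  simp only [h3] at h2
  have h4 (i j : Fin 2) (v : V3) : (geoMat (-t) * paramMat v * geoMat t) i j =
      geoMat (-t) i i * paramMat v i j * geoMat t j j := by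
    fin_cases i <;> fin_cases j <;> simp [SL2R.mul_entry, geoMat_entries]
  have hone : geoMat (-t) * paramMat 0 * geoMat t = 1 := by
    rw [paramMat_zero, mul_one, geoMat_neg, inv_mul_cancel]
  have h5 := hasFrameDeriv_paramMat_zero
  have e1 : Real.exp (-t) = Real.exp (-t / 2) * Real.exp (-(t / 2)) := by
    rw [← Real.exp_add]; ring_nf
  have e2 : Real.exp t = Real.exp (-(-t / 2)) * Real.exp (t / 2) := by
    rw [← Real.exp_add]; ring_nf
  have e3 : Real.exp (-(-t / 2)) * Real.exp (-(t / 2)) = 1 := by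
    rw [← Real.exp_add]; simp; ring
  refine ⟨?_, ?_, ?_⟩
  · have a1 := h2.entry11
    simp only [h4 1 1] at a1
    have a2 := a1.unique ((h5.entry11.const_mul (geoMat (-t) 1 1)).mul_const (geoMat t 1 1))
    have a3 := DFunLike.congr_fun a2 v
    rw [hone] at a3
    simp [paramMat_zero, geoMat_entries] at a3
    linear_combination a3 - (matD (L v) - matD v) * e3
  · have a1 := h2.entry01
    simp only [h4 0 1] at a1
    have a2 := a1.unique ((h5.entry01.const_mul (geoMat (-t) 0 0)).mul_const (geoMat t 1 1))
    have a3 := DFunLike.congr_fun a2 v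
    rw [hone] at a3
    simp [paramMat_zero, geoMat_entries] at a3
    rw [e1]
    linear_combination a3
  · have a1 := h2.entry10
    simp only [h4 1 0] at a1
    have a2 := a1.unique ((h5.entry10.const_mul (geoMat (-t) 1 1)).mul_const (geoMat t 0 0))
    have a3 := DFunLike.congr_fun a2 v
    rw [hone] at a3
    simp [paramMat_zero, geoMat_entries] at a3
    rw [e2]
    linear_combination a3

/-- Under the flow `matD` is constant and |matL| does not decrease in forward time, so both vanish
on a vector contracted to 0. -/
theorem mat_of_mem_geodesicStable (hΓ : IsClosedSurfaceGroup Γ) {x : T1S Γ} {v : V3}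
    (hv : v ∈ geodesicStable x) : matD v = 0 ∧ matL v = 0 := by
  obtain ⟨L, hL, hlim⟩ := hv
  have hD := (matD.continuous.tendsto 0).comp hlim
  have hl := (matL.continuous.tendsto 0).comp hlim
  rw [map_zero] at hD hl
  constructor
  · refine tendsto_nhds_unique (f := fun _ : ℝ => matD v) (l := atTop) tendsto_const_nhds ?_
    exact hD.congr fun t => (mat_tangentMap_geodesicFlow hΓ (hL t) v).1
  · have h1 : Tendsto (fun t => |matL (L t v)|) atTop (𝓝 0) := by simpa using hl.abs
    have h2 : |matL v| ≤ 0 := by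
      refine ge_of_tendsto h1 ?_
      filter_upwards [eventually_ge_atTop 0] with t ht
      rw [(mat_tangentMap_geodesicFlow hΓ (hL t) v).2.2, abs_mul, Real.abs_exp]
      exact le_mul_of_one_le_left (abs_nonneg _) (Real.one_le_exp ht)
    exact abs_eq_zero.1 (le_antisymm h2 (abs_nonneg _))

theorem mat_of_mem_geodesicUnstable (hΓ : IsClosedSurfaceGroup Γ) {x : T1S Γ} {v : V3}
    (hv : v ∈ geodesicUnstable x) : matD v = 0 ∧ matU v = 0 := by
  obtain ⟨L, hL, hlim⟩ := hv
  have hD := (matD.continuous.tendsto 0).comp hlim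
  have hl := (matU.continuous.tendsto 0).comp hlim
  rw [map_zero] at hD hl
  constructor
  · refine tendsto_nhds_unique (f := fun _ : ℝ => matD v) (l := atBot) tendsto_const_nhds ?_
    exact hD.congr fun t => (mat_tangentMap_geodesicFlow hΓ (hL t) v).1
  · have h1 : Tendsto (fun t => |matU (L t v)|) atBot (𝓝 0) := by simpa using hl.abs
    have h2 : |matU v| ≤ 0 := by
      refine ge_of_tendsto h1 ?_
      filter_upwards [eventually_le_atBot 0] with t ht
      rw [(mat_tangentMap_geodesicFlow hΓ (hL t) v).2.1, abs_mul, Real.abs_exp]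
      exact le_mul_of_one_le_left (abs_nonneg _) (Real.one_le_exp (by linarith))
    exact abs_eq_zero.1 (le_antisymm h2 (abs_nonneg _))

theorem mat_of_mem_geodesicCenter {x : T1S Γ} {v : V3} (hv : v ∈ geodesicCenter x) :
    matU v = 0 ∧ matL v = 0 := by
  obtain ⟨a, rfl⟩ := Submodule.mem_span_singleton.1 hv
  simp [geodesicField, matU_apply, matL_apply]

theorem abs_le_of_subspacesClose {δ : ℝ} {E : Submodule ℝ V3} {F : Set V3}
    (h : SubspacesClose δ E F) {m : V3 →L[ℝ] ℝ} (hm : ∀ v, |m v| ≤ ‖v‖) (hF : ∀ w ∈ F, m w = 0)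
    {v : V3} (hv : v ∈ E) : |m v| ≤ δ * ‖v‖ := by
  by_cases h0 : v = 0
  · simp [h0]
  have hn : 0 < ‖v‖ := norm_pos_iff.2 h0
  obtain ⟨w, hw, -, hvw⟩ := h.1 (‖v‖⁻¹ • v) (E.smul_mem _ hv) (by
    rw [norm_smul, norm_inv, norm_norm, inv_mul_cancel₀ hn.ne'])
  have h1 := (hm (‖v‖⁻¹ • v - w)).trans hvw
  rw [map_sub, hF w hw, sub_zero, map_smul, smul_eq_mul, abs_mul, abs_of_pos (inv_pos.2 hn),
    inv_mul_le_iff₀ hn] at h1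
  linarith

theorem isNarrow_of_subspacesClose (hΓ : IsClosedSurfaceGroup Γ) {δ : ℝ} {Es Ec Eu : Submodule ℝ V3}
    {x : T1S Γ} (hs : SubspacesClose δ Es (geodesicStable x))
    (hc : SubspacesClose δ Ec (geodesicCenter x))
    (hu : SubspacesClose δ Eu (geodesicUnstable x)) : IsNarrow δ Es Ec Eu where
  stable v hv := ⟨abs_le_of_subspacesClose hs abs_matD_le
      (fun w hw => (mat_of_mem_geodesicStable hΓ hw).1) hv, abs_le_of_subspacesClose hs abs_matL_le
      (fun w hw => (mat_of_mem_geodesicStable hΓ hw).2) hv⟩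
  center v hv := ⟨abs_le_of_subspacesClose hc abs_matU_le
      (fun w hw => (mat_of_mem_geodesicCenter hw).1) hv, abs_le_of_subspacesClose hc abs_matL_le
      (fun w hw => (mat_of_mem_geodesicCenter hw).2) hv⟩
  unstable v hv := ⟨abs_le_of_subspacesClose hu abs_matD_le
      (fun w hw => (mat_of_mem_geodesicUnstable hΓ hw).1) hv,
      abs_le_of_subspacesClose hu abs_matU_le
      (fun w hw => (mat_of_mem_geodesicUnstable hΓ hw).2) hv⟩

end T1S

end

/-! ### Leaves in a tube: slices at fixed time and graphs. -/

noncomputable section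

namespace PlaneLabels

variable {ι : Type*} {S : PlaneLabels ι}

/-- The solutions on growing intervals agree by uniqueness. At time t the one with index ⌈|t - t₀|⌉
is used; its interval has one unit more in radius, so t is interior. -/
theorem exists_global_solution {t₀ x₀ : ℝ}
    (h : ∀ n : ℕ, ∃ α : ℝ → ℝ, α t₀ = x₀ ∧
      ∀ t ∈ Set.Ioo (t₀ - (n + 1)) (t₀ + (n + 1)), S.IsSolAt α t) :
    ∃ α : ℝ → ℝ, α t₀ = x₀ ∧ ∀ t, S.IsSolAt α t := by
  choose α hα0 hα using h
  have hagree : ∀ n k : ℕ, n ≤ k → Set.EqOn (α k) (α n) (Set.Ioo (t₀ - (n + 1)) (t₀ + (n + 1))) := by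
    intro n k hnk
    have hnk' : (n : ℝ) ≤ k := by exact_mod_cast hnk
    exact eqOn_of_isSolAt isPreconnected_Ioo isOpen_Ioo
      (fun t ht => hα k t ⟨by linarith [ht.1], by linarith [ht.2]⟩) (hα n)
      (τ := t₀) ⟨by have := n.cast_nonneg (α := ℝ); linarith, by
        have := n.cast_nonneg (α := ℝ); linarith⟩ ((hα0 k).trans (hα0 n).symm)
  set β : ℝ → ℝ := fun t => α ⌈|t - t₀|⌉₊ t with hβ
  have hβeq : ∀ n : ℕ, Set.EqOn β (α n) (Set.Ioo (t₀ - (n + 1)) (t₀ + (n + 1))) := by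
    intro n t ht
    have hc : |t - t₀| ≤ ⌈|t - t₀|⌉₊ := Nat.le_ceil _
    have hc' := abs_le.1 hc
    rcases le_total n ⌈|t - t₀|⌉₊ with h | h
    · exact hagree _ _ h ht
    · exact (hagree _ _ h ⟨by linarith, by linarith⟩).symm
  refine ⟨β, ?_, fun t => ?_⟩
  · have : ⌈|t₀ - t₀|⌉₊ = 0 := by simp
    rw [hβ]; simp only [this, hα0]
  · obtain ⟨n, hn⟩ := exists_nat_gt |t - t₀|
    have hn' := abs_lt.1 hn
    have ht : t ∈ Set.Ioo (t₀ - (n + 1)) (t₀ + (n + 1)) := ⟨by linarith, by linarith⟩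
    exact (hα n t ht).congr ((hβeq n).eventuallyEq_of_mem (isOpen_Ioo.mem_nhds ht))

end PlaneLabels

namespace T1S

variable {Γ : Subgroup SL2R} {Ψ : ℝ × ℝ × ℝ → T1S Γ} {D : ℝ × ℝ × ℝ → ((ℝ × ℝ × ℝ) ≃L[ℝ] V3)}

/-- The labels induced by the charts of a foliation on a surface transverse to it. -/
def planeLabels (hΨ : IsFrame Ψ D) (W : SurfaceFoliation Γ) (Ω : Set (ℝ × ℝ)) (hΩ : IsOpen Ω)
    (σ : ℝ × ℝ → ℝ × ℝ × ℝ) (hσ : ContinuousOn σ Ω)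
    (hne : ∀ e ∈ W.atlas, ∀ p ∈ Ω, Ψ (σ p) ∈ e.source →
      ¬ IsLocalExtr (fun x => (e (Ψ (σ (p.1, x)))).2) p.2) : PlaneLabels W.atlas where
  lab e p := (e.1 (Ψ (σ p))).2
  dom e := Ω ∩ (fun p => Ψ (σ p)) ⁻¹' e.1.source
  isOpen_dom e := (hΨ.continuous.comp_continuousOn hσ).isOpen_inter_preimage hΩ e.1.open_source
  continuousOn_lab e := continuous_snd.comp_continuousOn (e.1.continuousOn.comp
    ((hΨ.continuous.comp_continuousOn hσ).mono Set.inter_subset_left) fun _ hp => hp.2)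
  not_isLocalExtr e p hp := hne e.1 e.2 p hp.1 hp.2
  compat e e' p hp := by
    obtain ⟨U, hU, -, hUc⟩ := W.compatible e.1 e.2 e'.1 e'.2 _ ⟨hp.1.2, hp.2.2⟩
    have hc : ContinuousAt (fun p => Ψ (σ p)) p :=
      (hΨ.continuous.comp_continuousOn hσ).continuousAt (hΩ.mem_nhds hp.1.1)
    exact ⟨_, hc hU, fun q hq q' hq' => hUc _ hq _ hq'⟩

theorem isSolAt_planeLabels_iff {hΨ : IsFrame Ψ D} {W : SurfaceFoliation Γ} {Ω : Set (ℝ × ℝ)}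
    {hΩ : IsOpen Ω} {σ : ℝ × ℝ → ℝ × ℝ × ℝ} {hσ : ContinuousOn σ Ω}
    {hne : ∀ e ∈ W.atlas, ∀ p ∈ Ω, Ψ (σ p) ∈ e.source →
      ¬ IsLocalExtr (fun x => (e (Ψ (σ (p.1, x)))).2) p.2} {α : ℝ → ℝ} {t : ℝ} :
    (planeLabels hΨ W Ω hΩ σ hσ hne).IsSolAt α t ↔
      ContinuousAt α t ∧ (t, α t) ∈ Ω ∧ W.IsLeafAt (fun s => Ψ (σ (s, α s))) t := by
  constructor
  · rintro ⟨hc, e, he, hl⟩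
    refine ⟨hc, he.1, ?_, e.1, e.2, he.2, hl⟩
    have h1 : ContinuousAt (fun p => Ψ (σ p)) (t, α t) :=
      (hΨ.continuous.comp_continuousOn hσ).continuousAt (hΩ.mem_nhds he.1)
    exact ContinuousAt.comp (f := fun s => (s, α s)) h1 (continuousAt_id.prodMk hc)
  · rintro ⟨hc, hΩt, -, e, he, hes, hl⟩
    exact ⟨hc, ⟨e, he⟩, ⟨hΩt, hes⟩, hl⟩

theorem exists_mem_dom_planeLabels {hΨ : IsFrame Ψ D} {W : SurfaceFoliation Γ} {Ω : Set (ℝ × ℝ)}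
    {hΩ : IsOpen Ω} {σ : ℝ × ℝ → ℝ × ℝ × ℝ} {hσ : ContinuousOn σ Ω}
    {hne : ∀ e ∈ W.atlas, ∀ p ∈ Ω, Ψ (σ p) ∈ e.source →
      ¬ IsLocalExtr (fun x => (e (Ψ (σ (p.1, x)))).2) p.2} {p : ℝ × ℝ} (hp : p ∈ Ω) :
    ∃ i, p ∈ (planeLabels hΨ W Ω hΩ σ hσ hne).dom i := by
  obtain ⟨e, he, hes⟩ := W.cover (Ψ (σ p))
  exact ⟨⟨e, he⟩, hp, hes⟩

/-- Two foliations that are, in a tube around the first axis, nearly tangent to the planes of the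
first two coordinates and of the first and the third coordinate. -/
structure IsTube (W W' : SurfaceFoliation Γ) (P P' : T1S Γ → Submodule ℝ V3)
    (Ψ : ℝ × ℝ × ℝ → T1S Γ) (D : ℝ × ℝ × ℝ → ((ℝ × ℝ × ℝ) ≃L[ℝ] V3)) (ρ : ℝ) : Prop where
  frame : IsFrame Ψ D
  tangent : W.IsTangentTo P
  tangent' : W'.IsTangentTo P'
  pos : 0 < ρ
  cone : ∀ q w, |q.2.1| < ρ → |q.2.2| < ρ → D q w ∈ P (Ψ q) →
    |w.2.2| ≤ 1 / 8 * (|w.1| + |w.2.1|)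
  cone' : ∀ q w, |q.2.1| < ρ → |q.2.2| < ρ → D q w ∈ P' (Ψ q) →
    |w.2.1| ≤ 1 / 8 * (|w.1| + |w.2.2|)

variable {W W' : SurfaceFoliation Γ} {P P' : T1S Γ → Submodule ℝ V3} {ρ : ℝ}

namespace IsTube

theorem swap (T : IsTube W W' P P' Ψ D ρ) : IsTube W' W P' P (fun q => Ψ (swapCoord q))
    (fun q => swapCoord.trans (D (swapCoord q))) ρ where
  frame := T.frame.swap
  tangent := T.tangent'
  tangent' := T.tangent
  pos := T.pos
  cone q w hx hy hw := T.cone' (swapCoord q) (swapCoord w) hy hx hw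
  cone' q w hx hy hw := T.cone (swapCoord q) (swapCoord w) hy hx hw

theorem transverse (T : IsTube W W' P P' Ψ D ρ) {q : ℝ × ℝ × ℝ} (hx : |q.2.1| < ρ)
    (hy : |q.2.2| < ρ) (w : ℝ × ℝ × ℝ) (hw : D q w ∈ P (Ψ q)) (h1 : w.1 = 0) (h2 : w.2.1 = 0) :
    w = 0 := by
  have h := T.cone q w hx hy hw
  rw [h1, h2, abs_zero, add_zero, mul_zero] at h
  exact Prod.ext h1 (Prod.ext h2 (abs_eq_zero.1 (le_antisymm h (abs_nonneg _))))

/-- The last clause is how the graph is used: every continuous map into the leaf satisfies the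
equation of the graph near the point, whatever its source, so the same φ differentiates curves and
surfaces in the leaf. -/
theorem exists_leaf_graph (T : IsTube W W' P P' Ψ D ρ) {q : ℝ × ℝ × ℝ} (hx : |q.2.1| < ρ)
    (hy : |q.2.2| < ρ) :
    ∃ (φ : ℝ × ℝ → ℝ) (m : ℝ × ℝ →L[ℝ] ℝ), φ (q.1, q.2.1) = q.2.2 ∧
      HasFDerivAt φ m (q.1, q.2.1) ∧ (∀ w : ℝ × ℝ, D q (w.1, w.2, m w) ∈ P (Ψ q)) ∧
      (∀ w : ℝ × ℝ, |m w| ≤ 1 / 8 * (|w.1| + |w.2|)) ∧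
      ∀ (A : Type) [TopologicalSpace A] (F : A → ℝ × ℝ × ℝ) (a : A), F a = q → ContinuousAt F a →
        W.IsLeafAt (fun b => Ψ (F b)) a →
          ∀ᶠ b in 𝓝 a, (F b).2.2 = φ ((F b).1, (F b).2.1) := by
  obtain ⟨e, he, hes⟩ := W.cover (Ψ q)
  obtain ⟨φ, m, -, hφ0, hφd, hm, hφ⟩ :=
    exists_plaque_graph T.frame T.tangent he hes (T.transverse hx hy)
  refine ⟨φ, m, hφ0, hφd, hm, fun w => T.cone q _ hx hy (hm w), fun A _ F a hFa hF hl => ?_⟩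
  have h1 := hl.eventually_eq he (by rwa [hFa])
  have h2 : ∀ᶠ b in 𝓝 a, _ := hF.eventually (by rw [hFa]; exact hφ)
  filter_upwards [h1, h2] with b hb1 hb2
  rw [hFa] at hb1
  exact hb2.1 hb1

theorem not_isLocalExtr_vertical (T : IsTube W W' P P' Ψ D ρ) {t x y : ℝ} (hx : |x| < ρ)
    (hy : |y| < ρ) {e : OpenPartialHomeomorph (T1S Γ) ((ℝ × ℝ) × ℝ)} (he : e ∈ W.atlas)
    (hes : Ψ (t, x, y) ∈ e.source) : ¬ IsLocalExtr (fun y => (e (Ψ (t, x, y))).2) y := by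
  have hκ : HasDerivAt (fun y : ℝ => (t, x, y)) (0, 0, 1) y :=
    (hasDerivAt_const y t).prodMk ((hasDerivAt_const y x).prodMk (hasDerivAt_id y))
  refine not_isLocalExtr_label T.frame T.tangent hκ he hes (T.transverse (q := (t, x, y)) hx hy) ?_
  intro hw
  have := T.transverse (q := (t, x, y)) hx hy _ hw rfl rfl
  simp at this

/-- A curve in a slice `t = const` of a leaf. -/
theorem hasDerivAt_slice (T : IsTube W W' P P' Ψ D ρ) {t x : ℝ} {α : ℝ → ℝ} (hx : |x| < ρ)
    (hy : |α x| < ρ) (hc : ContinuousAt α x) (hl : W.IsLeafAt (fun x => Ψ (t, x, α x)) x) :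
    ∃ s, HasDerivAt α s x ∧ |s| ≤ 1 / 8 := by
  obtain ⟨φ, m, hφ0, hφd, hm, hm8, hφ⟩ := T.exists_leaf_graph (q := (t, x, α x)) hx hy
  have h1 := hφ ℝ (fun x => (t, x, α x)) x rfl
    (continuousAt_const.prodMk (continuousAt_id.prodMk hc)) hl
  refine ⟨m (0, 1), ?_, by have := hm8 (0, 1); simpa using this⟩
  have h2 : HasDerivAt (fun x : ℝ => (t, x)) (0, 1) x :=
    (hasDerivAt_const x t).prodMk (hasDerivAt_id x)
  exact (HasFDerivAt.comp_hasDerivAt (f := fun x : ℝ => (t, x)) x hφd h2).congr_of_eventuallyEq h1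

theorem slice_lipschitz (T : IsTube W W' P P' Ψ D ρ) {t a b : ℝ} {α : ℝ → ℝ}
    (ha : -ρ ≤ a) (hb : b ≤ ρ) (h : ∀ x ∈ Set.Ioo a b, |α x| < ρ ∧ ContinuousAt α x ∧
      W.IsLeafAt (fun x => Ψ (t, x, α x)) x) {x x' : ℝ} (hx : x ∈ Set.Ioo a b)
    (hx' : x' ∈ Set.Ioo a b) : |α x' - α x| ≤ 1 / 8 * |x' - x| := by
  have hd : ∀ z ∈ Set.Ioo a b, ∃ s, HasDerivAt α s z ∧ |s| ≤ 1 / 8 := fun z hz =>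
    T.hasDerivAt_slice (abs_lt.2 ⟨by linarith [hz.1], by linarith [hz.2]⟩) (h z hz).1 (h z hz).2.1
      (h z hz).2.2
  choose! s hs hs8 using hd
  exact (convex_Ioo a b).norm_image_sub_le_of_norm_hasDerivWithin_le
    (fun z hz => (hs z hz).hasDerivWithinAt) (fun z hz => hs8 z hz) hx hx'

/-- Leaves of the trace on a time slice have slope at most 1/8, so over the half-width ρ/2 they stay
within ρ/4 + (1/8)(3ρ/4) < 3ρ/8 of the axis and can be continued. -/
theorem exists_slice (T : IsTube W W' P P' Ψ D ρ) (t : ℝ) {ξ η : ℝ} (hξ : |ξ| ≤ ρ / 4)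
    (hη : |η| ≤ ρ / 4) :
    ∃ α : ℝ → ℝ, α ξ = η ∧ ∀ x ∈ Set.Ioo (-(ρ / 2)) (ρ / 2), |α x| ≤ 3 * ρ / 8 ∧
      ContinuousAt α x ∧ W.IsLeafAt (fun x => Ψ (t, x, α x)) x := by
  have hρ := T.pos
  set Ω : Set (ℝ × ℝ) := {p | |p.1| < ρ ∧ |p.2| < ρ} with hΩ
  have hΩo : IsOpen Ω := (isOpen_lt continuous_fst.abs continuous_const).inter
    (isOpen_lt continuous_snd.abs continuous_const)
  set S := planeLabels T.frame W Ω hΩo (fun p => (t, p.1, p.2)) (by fun_prop)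
    (fun e he p hp hes => T.not_isLocalExtr_vertical hp.1 hp.2 he hes) with hS
  have hξ' := abs_le.1 hξ
  have hap : ∀ a' b' : ℝ, -(ρ / 2) ≤ a' → b' ≤ ρ / 2 → ξ ∈ Set.Ioo a' b' → ∀ α : ℝ → ℝ, α ξ = η →
      (∀ x ∈ Set.Ioo a' b', S.IsSolAt α x) → ∀ x ∈ Set.Ioo a' b', |α x| ≤ 3 * ρ / 8 := by
    intro a' b' ha hb hξI α hα hsol x hx
    have h1 := T.slice_lipschitz (t := t) (α := α) (by linarith : -ρ ≤ a') (by linarith : b' ≤ ρ)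
      (fun z hz => by
        have := isSolAt_planeLabels_iff.1 (hsol z hz)
        exact ⟨this.2.1.2, this.1, this.2.2⟩) hξI hx
    rw [hα] at h1
    have h2 : |x - ξ| ≤ 3 * ρ / 4 := abs_le.2 ⟨by linarith [hx.1], by linarith [hx.2]⟩
    have h3 := abs_sub_abs_le_abs_sub (α x) η
    linarith
  obtain ⟨α, hα, hsol⟩ := S.exists_solution
    (K := Set.Icc (-(ρ / 2)) (ρ / 2) ×ˢ Set.Icc (-(3 * ρ / 8)) (3 * ρ / 8))
    (isCompact_Icc.prod isCompact_Icc)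
    (fun p hp => exists_mem_dom_planeLabels ⟨abs_lt.2 ⟨by linarith [hp.1.1], by linarith [hp.1.2]⟩,
      abs_lt.2 ⟨by linarith [hp.2.1], by linarith [hp.2.2]⟩⟩)
    (a := -(ρ / 2)) (b := ρ / 2) (t₀ := ξ) (x₀ := η) ⟨by linarith, by linarith⟩
    (fun a' b' ha hb hξI α hα hsol x hx => ⟨⟨by linarith [hx.1], by linarith [hx.2]⟩,
      abs_le.1 (hap a' b' ha hb hξI α hα hsol x hx)⟩)
    ⟨⟨by linarith, by linarith⟩, abs_le.1 (hη.trans (by linarith))⟩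
  refine ⟨α, hα, fun x hx => ⟨hap _ _ le_rfl le_rfl ⟨by linarith, by linarith⟩ α hα hsol x hx, ?_⟩⟩
  have := isSolAt_planeLabels_iff.1 (hsol x hx)
  exact ⟨this.1, this.2.2⟩

end IsTube

/-- In the tube the graph of `G` is a piece of a leaf of `W`. -/
structure IsLeafGraph (W : SurfaceFoliation Γ) (Ψ : ℝ × ℝ × ℝ → T1S Γ) (ρ : ℝ) (G : ℝ → ℝ → ℝ) :
    Prop where
  abs_le : ∀ t x, |x| < ρ / 2 → |G t x| ≤ 3 * ρ / 8
  continuousAt : ∀ t x, |x| < ρ / 2 → ContinuousAt (fun p : ℝ × ℝ => G p.1 p.2) (t, x)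
  isLeafAt : ∀ t x, |x| < ρ / 2 → W.IsLeafAt (fun p : ℝ × ℝ => Ψ (p.1, p.2, G p.1 p.2)) (t, x)

namespace IsLeafGraph

variable {G : ℝ → ℝ → ℝ}

theorem hasFDerivAt (hG : IsLeafGraph W Ψ ρ G) (T : IsTube W W' P P' Ψ D ρ) (t : ℝ) {x : ℝ}
    (hx : |x| < ρ / 2) :
    ∃ m : ℝ × ℝ →L[ℝ] ℝ, HasFDerivAt (fun p : ℝ × ℝ => G p.1 p.2) m (t, x) ∧
      (∀ w : ℝ × ℝ, D (t, x, G t x) (w.1, w.2, m w) ∈ P (Ψ (t, x, G t x))) ∧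
      ∀ w : ℝ × ℝ, |m w| ≤ 1 / 8 * (|w.1| + |w.2|) := by
  have hρ := T.pos
  obtain ⟨φ, m, hφ0, hφd, hm, hm8, hφ⟩ := T.exists_leaf_graph (q := (t, x, G t x))
    (by simp only; linarith) (by simp only; linarith [hG.abs_le t x hx])
  have h1 := hφ (ℝ × ℝ) (fun p => (p.1, p.2, G p.1 p.2)) (t, x) rfl
    (continuousAt_fst.prodMk (continuousAt_snd.prodMk (hG.continuousAt t x hx)))
    (hG.isLeafAt t x hx)
  exact ⟨m, hφd.congr_of_eventuallyEq h1, hm, hm8⟩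

theorem lipschitz (hG : IsLeafGraph W Ψ ρ G) (T : IsTube W W' P P' Ψ D ρ) (t : ℝ) {x x' : ℝ}
    (hx : |x| < ρ / 2) (hx' : |x'| < ρ / 2) : |G t x' - G t x| ≤ 1 / 8 * |x' - x| := by
  have hρ := T.pos
  refine T.slice_lipschitz (t := t) (by linarith : -ρ ≤ -(ρ / 2)) (by linarith : ρ / 2 ≤ ρ) ?_
    (abs_lt.1 hx) (abs_lt.1 hx')
  intro z hz
  have hz' : |z| < ρ / 2 := abs_lt.2 hz
  have hc : ContinuousAt (fun z : ℝ => (t, z)) z := by fun_prop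
  exact ⟨by linarith [hG.abs_le t z hz'], ContinuousAt.comp (f := fun z : ℝ => (t, z))
    (hG.continuousAt t z hz') hc, (hG.isLeafAt t z hz').comp (u := fun z : ℝ => (t, z)) hc⟩

end IsLeafGraph

end T1S

end

/-! ### Leaf graphs, their intersections and the curves between two intersections. -/

noncomputable section

namespace T1S

variable {Γ : Subgroup SL2R} {Ψ : ℝ × ℝ × ℝ → T1S Γ} {D : ℝ × ℝ × ℝ → ((ℝ × ℝ × ℝ) ≃L[ℝ] V3)}
  {W W' : SurfaceFoliation Γ} {P P' : T1S Γ → Submodule ℝ V3} {ρ : ℝ}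

theorem eventually_abs_sub_lt {A : Type*} [TopologicalSpace A] {f : A → ℝ} {a : A} {c r : ℝ}
    (hf : ContinuousAt f a) (h : |f a - c| < r) : ∀ᶠ b in 𝓝 a, |f b - c| < r :=
  (hf.sub continuousAt_const).abs.eventually (gt_mem_nhds h)

theorem eq_of_eventually_eq {f : ℝ → ℝ} {I : Set ℝ} (hI : Convex ℝ I)
    (h : ∀ x ∈ I, ∀ᶠ y in 𝓝 x, f y = f x) {x y : ℝ} (hx : x ∈ I) (hy : y ∈ I) : f y = f x := by
  have hd : ∀ z ∈ I, HasDerivWithinAt f 0 I z := fun z hz =>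
    ((hasDerivAt_const z (f z)).congr_of_eventuallyEq (h z hz)).hasDerivWithinAt
  have := hI.norm_image_sub_le_of_norm_hasDerivWithin_le (C := 0) hd (fun z _ => by simp) hx hy
  rw [zero_mul, Real.norm_eq_abs] at this
  exact sub_eq_zero.1 (abs_eq_zero.1 (le_antisymm this (abs_nonneg _)))

namespace IsTube

/-- Slices of a leaf through a curve in the leaf fit together: one step. -/
theorem exists_joint_step (T : IsTube W W' P P' Ψ D ρ) {G : ℝ → ℝ → ℝ}
    (hG : ∀ t, ∀ x ∈ Set.Ioo (-(ρ / 2)) (ρ / 2), |G t x| ≤ 3 * ρ / 8 ∧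
      ContinuousAt (G t) x ∧ W.IsLeafAt (fun x => Ψ (t, x, G t x)) x) (t₀ : ℝ) {x₀ : ℝ}
    (hx₀ : x₀ ∈ Set.Ioo (-(ρ / 2)) (ρ / 2)) :
    ∃ r > 0, ∀ ζ : ℝ → ℝ, ContinuousAt ζ t₀ → |ζ t₀ - x₀| < r →
      ContinuousAt (fun t => G t (ζ t)) t₀ → W.IsLeafAt (fun t => Ψ (t, ζ t, G t (ζ t))) t₀ →
      ∀ x, |x - x₀| < r → x ∈ Set.Ioo (-(ρ / 2)) (ρ / 2) ∧
        ContinuousAt (fun p : ℝ × ℝ => G p.1 p.2) (t₀, x) ∧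
        W.IsLeafAt (fun p : ℝ × ℝ => Ψ (p.1, p.2, G p.1 p.2)) (t₀, x) := by
  have hρ := T.pos
  -- The slices are chosen separately for each time, so joint continuity has to be proved. It comes
  -- from one chart: the label is constant along each slice and along the curve ζ that all the
  -- slices meet, hence constant on their union.
  obtain ⟨e, he, hes⟩ := W.cover (Ψ (t₀, x₀, G t₀ x₀))
  obtain ⟨R₀, hR₀, hbox₀⟩ := Metric.eventually_nhds_iff.1
    (T.frame.continuous.continuousAt.eventually (e.open_source.mem_nhds hes))
  obtain ⟨R, hR, hRR, hR1, hR2, hR3⟩ : ∃ R > 0, R ≤ R₀ ∧ R ≤ ρ / 2 - x₀ ∧ R ≤ x₀ + ρ / 2 ∧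
      R ≤ ρ / 8 := by
    refine ⟨min (min R₀ (ρ / 2 - x₀)) (min (x₀ + ρ / 2) (ρ / 8)), ?_, ?_, ?_, ?_, ?_⟩
    · exact lt_min (lt_min hR₀ (by linarith [hx₀.2])) (lt_min (by linarith [hx₀.1]) (by linarith))
    · exact (min_le_left _ _).trans (min_le_left _ _)
    · exact (min_le_left _ _).trans (min_le_right _ _)
    · exact (min_le_right _ _).trans (min_le_left _ _)
    · exact (min_le_right _ _).trans (min_le_right _ _)
  set y₀ := G t₀ x₀ with hy₀
  have hbox : ∀ t x y : ℝ, |t - t₀| < R → |x - x₀| < R → |y - y₀| < R → Ψ (t, x, y) ∈ e.source := by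
    intro t x y ht hx hy
    refine hbox₀ ?_
    rw [Prod.dist_eq, Prod.dist_eq, max_lt_iff, max_lt_iff, Real.dist_eq, Real.dist_eq, Real.dist_eq]
    exact ⟨ht.trans_le hRR, hx.trans_le hRR, hy.trans_le hRR⟩
  have hI : ∀ x, |x - x₀| < R → x ∈ Set.Ioo (-(ρ / 2)) (ρ / 2) := fun x hx => by
    have := abs_lt.1 hx
    exact ⟨by linarith, by linarith⟩
  have hlip : ∀ t, ∀ x ∈ Set.Ioo (-(ρ / 2)) (ρ / 2), ∀ x' ∈ Set.Ioo (-(ρ / 2)) (ρ / 2),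
      |G t x' - G t x| ≤ 1 / 8 * |x' - x| := fun t x hx x' hx' =>
    T.slice_lipschitz (t := t) (by linarith : -ρ ≤ -(ρ / 2)) (by linarith : ρ / 2 ≤ ρ)
      (fun z hz => ⟨by linarith [(hG t z hz).1], (hG t z hz).2⟩) hx hx'
  refine ⟨R / 2, by positivity, fun ζ hζ hζx hGζ hl x hx => ?_⟩
  have hζI := hI (ζ t₀) (by linarith)
  have hyζ : |G t₀ (ζ t₀) - y₀| < R / 4 := by
    have := hlip t₀ x₀ hx₀ (ζ t₀) hζI
    linarith
  have hsζ : Ψ (t₀, ζ t₀, G t₀ (ζ t₀)) ∈ e.source :=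
    hbox _ _ _ (by simpa using hR) (by linarith) (by linarith)
  set a := (e (Ψ (t₀, ζ t₀, G t₀ (ζ t₀)))).2 with ha
  -- on nearby slices the label is constant
  have hlab : ∀ᶠ t in 𝓝 t₀, |t - t₀| < R ∧ ∀ x, |x - x₀| < R / 2 →
      |G t x - y₀| < R / 2 ∧ (e (Ψ (t, x, G t x))).2 = a := by
    have e1 : ∀ᶠ t in 𝓝 t₀, |t - t₀| < R := eventually_abs_sub_lt continuousAt_id (by simpa using hR)
    filter_upwards [e1, eventually_abs_sub_lt hζ hζx, eventually_abs_sub_lt hGζ hyζ,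
      hl.eventually_eq he hsζ] with t h1 h2 h3 h4
    have hb : ∀ z, |z - x₀| < R / 2 → |G t z - y₀| < R / 2 := fun z hz => by
      have k1 := hlip t (ζ t) (hI _ (by linarith)) z (hI _ (by linarith))
      have k2 := abs_sub_le z x₀ (ζ t)
      rw [abs_sub_comm x₀ (ζ t)] at k2
      have k3 := abs_sub_le (G t z) (G t (ζ t)) y₀
      linarith
    refine ⟨h1, fun z hz => ⟨hb z hz, ?_⟩⟩
    have hconv : Convex ℝ {z : ℝ | |z - x₀| < R / 2} := by
      have : {z : ℝ | |z - x₀| < R / 2} = Metric.ball x₀ (R / 2) := by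
        ext z; simp [Real.dist_eq]
      rw [this]; exact convex_ball _ _
    refine (eq_of_eventually_eq (f := fun z => (e (Ψ (t, z, G t z))).2) hconv ?_ h2 hz).trans h4
    intro u hu
    have hu' : |u - x₀| < R := by have : |u - x₀| < R / 2 := hu; linarith
    exact (hG t u (hI u hu')).2.2.eventually_eq he
      (hbox _ _ _ h1 hu' (by have := hb u hu; linarith))
  -- continuity in `t`
  have hxR : |x - x₀| < R := by linarith
  have hct : ContinuousAt (fun t => G t x) t₀ := by
    set Ω : Set (ℝ × ℝ) := {p | |p.2| < ρ} with hΩ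
    have hΩo : IsOpen Ω := isOpen_lt continuous_snd.abs continuous_const
    have hxρ : |x| < ρ := by
      have := abs_lt.2 (hI x hxR); linarith
    set S := planeLabels T.frame W Ω hΩo (fun p => (p.1, x, p.2)) (by fun_prop)
      (fun e he p hp hes => T.not_isLocalExtr_vertical hxρ hp he hes) with hS
    have hy0 := (hG t₀ x₀ hx₀).1
    refine (PlaneLabels.isSolAt_of_lab_eq (S := S) (i := ⟨e, he⟩) (p := (t₀, y₀)) (r := R)
      (α := fun t => G t x) (a := a) ?_ (by simpa using hR) ?_ ?_).1
    · intro q hq1 hq2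
      refine ⟨?_, hbox _ _ _ hq1 hxR hq2⟩
      have := abs_sub_abs_le_abs_sub q.2 y₀
      change |q.2| < ρ
      simp only at hq2
      linarith
    · have := (hlab.self_of_nhds.2 x hx).1
      simp only; linarith
    · filter_upwards [hlab] with t ht
      exact ⟨by have := (ht.2 x hx).1; linarith, (ht.2 x hx).2⟩
  have hxI := hI x hxR
  have hcont : ContinuousAt (fun p : ℝ × ℝ => G p.1 p.2) (t₀, x) := by
    rw [Metric.continuousAt_iff']
    intro η hη
    have e1 : ∀ᶠ p : ℝ × ℝ in 𝓝 (t₀, x), |p.2 - x| < η :=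
      eventually_abs_sub_lt continuousAt_snd (by simpa using hη)
    have e2 : ∀ᶠ p : ℝ × ℝ in 𝓝 (t₀, x), |G p.1 x - G t₀ x| < η / 2 :=
      eventually_abs_sub_lt (f := fun p : ℝ × ℝ => G p.1 x)
        (ContinuousAt.comp (g := fun t => G t x) (f := Prod.fst) hct continuousAt_fst)
        (by simpa using hη)
    have e3 : ∀ᶠ p : ℝ × ℝ in 𝓝 (t₀, x), p.2 ∈ Set.Ioo (-(ρ / 2)) (ρ / 2) :=
      continuousAt_snd.eventually (isOpen_Ioo.mem_nhds hxI)
    filter_upwards [e1, e2, e3] with p h1 h2 h3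
    rw [Real.dist_eq]
    have k1 := hlip p.1 x hxI p.2 h3
    have k2 := abs_sub_le (G p.1 p.2) (G p.1 x) (G t₀ x)
    linarith
  refine ⟨hxI, hcont, ?_, e, he, ?_, ?_⟩
  · exact T.frame.continuous.continuousAt.comp
      (f := fun p : ℝ × ℝ => (p.1, p.2, G p.1 p.2))
      (continuousAt_fst.prodMk (continuousAt_snd.prodMk hcont))
  · exact hbox _ _ _ (by simpa using hR) hxR (by linarith [(hlab.self_of_nhds.2 x hx).1])
  · have e1 : ∀ᶠ p : ℝ × ℝ in 𝓝 (t₀, x), |p.2 - x₀| < R / 2 :=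
      eventually_abs_sub_lt continuousAt_snd hx
    filter_upwards [e1, continuousAt_fst.eventually hlab] with p h1 h2
    rw [(h2.2 p.2 h1).2, (hlab.self_of_nhds.2 x hx).2]

/-- The leaf through a curve is a graph in the tube. -/
theorem exists_leafGraph (T : IsTube W W' P P' Ψ D ρ) {ξ η : ℝ → ℝ} (hξc : Continuous ξ)
    (hηc : Continuous η) (hξ : ∀ t, |ξ t| ≤ ρ / 4) (hη : ∀ t, |η t| ≤ ρ / 4)
    (hl : ∀ t, W.IsLeafAt (fun t => Ψ (t, ξ t, η t)) t) :
    ∃ G : ℝ → ℝ → ℝ, IsLeafGraph W Ψ ρ G ∧ ∀ t, G t (ξ t) = η t := by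
  have hρ := T.pos
  choose G hGξ hG using fun t => T.exists_slice t (hξ t) (hη t)
  have hjoint : ∀ t, ∀ x ∈ Set.Ioo (-(ρ / 2)) (ρ / 2),
      ContinuousAt (fun p : ℝ × ℝ => G p.1 p.2) (t, x) ∧
        W.IsLeafAt (fun p : ℝ × ℝ => Ψ (p.1, p.2, G p.1 p.2)) (t, x) := by
    intro t
    have hξI : ξ t ∈ Set.Ioo (-(ρ / 2)) (ρ / 2) := by
      have := abs_le.1 (hξ t)
      exact ⟨by linarith, by linarith⟩
    -- Joint continuity is known at the given curve and spreads in x: if it holds at one point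
    -- within the radius r of x₀, the vertical line through that point serves as the curve ζ at x₀.
    -- So `U` is open, relatively closed and contains ξ t.
    set U : Set ℝ := {x | x ∈ Set.Ioo (-(ρ / 2)) (ρ / 2) ∧
      ContinuousAt (fun p : ℝ × ℝ => G p.1 p.2) (t, x) ∧
        W.IsLeafAt (fun p : ℝ × ℝ => Ψ (p.1, p.2, G p.1 p.2)) (t, x)} with hU
    have hconst : ∀ x₁ ∈ U, ContinuousAt (fun s => G s x₁) t ∧
        W.IsLeafAt (fun s => Ψ (s, x₁, G s x₁)) t := by
      rintro x₁ ⟨-, h1, h2⟩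
      have hc : ContinuousAt (fun s : ℝ => (s, x₁)) t := by fun_prop
      exact ⟨ContinuousAt.comp (f := fun s : ℝ => (s, x₁)) h1 hc,
        h2.comp (u := fun s : ℝ => (s, x₁)) hc⟩
    have hnear : ∀ x₀ ∈ Set.Ioo (-(ρ / 2)) (ρ / 2), ∃ r > 0, ∀ x₁ ∈ U, |x₁ - x₀| < r →
        ∀ x, |x - x₀| < r → x ∈ U := by
      intro x₀ hx₀
      obtain ⟨r, hr, h⟩ := T.exists_joint_step hG t hx₀
      refine ⟨r, hr, fun x₁ hx₁ hx₁r x hx => ?_⟩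
      exact h (fun _ => x₁) continuousAt_const hx₁r (hconst x₁ hx₁).1 (hconst x₁ hx₁).2 x hx
    have hsub : Set.Ioo (-(ρ / 2)) (ρ / 2) ⊆ U := by
      refine isPreconnected_Ioo.subset_of_closure_inter_subset ?_ ⟨ξ t, hξI, ?_⟩ ?_
      · rw [Metric.isOpen_iff]
        intro x₀ hx₀
        obtain ⟨r, hr, h⟩ := hnear x₀ hx₀.1
        refine ⟨r, hr, fun x hx => h x₀ hx₀ (by simpa using hr) x ?_⟩
        rwa [Metric.mem_ball, Real.dist_eq] at hx
      · obtain ⟨r, hr, h⟩ := T.exists_joint_step hG t hξI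
        exact h ξ hξc.continuousAt (by simpa using hr) (by simpa only [hGξ] using hηc.continuousAt)
          (by simpa only [hGξ] using hl t) (ξ t) (by simpa using hr)
      · rintro x₀ ⟨hx₀c, hx₀⟩
        obtain ⟨r, hr, h⟩ := hnear x₀ hx₀
        obtain ⟨x₁, hx₁, hx₁r⟩ := Metric.mem_closure_iff.1 hx₀c r hr
        rw [dist_comm, Real.dist_eq] at hx₁r
        exact h x₁ hx₁ hx₁r x₀ (by simpa using hr)
    exact fun x hx => (hsub hx).2
  exact ⟨G, ⟨fun t x hx => (hG t x (abs_lt.1 hx)).1, fun t x hx => (hjoint t x (abs_lt.1 hx)).1,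
    fun t x hx => (hjoint t x (abs_lt.1 hx)).2⟩, hGξ⟩

/-- A leaf of `W` and a leaf of `W'` intersect in a curve. -/
theorem exists_crossing (T : IsTube W W' P P' Ψ D ρ) {G G' : ℝ → ℝ → ℝ}
    (hG : IsLeafGraph W Ψ ρ G) (hG' : IsLeafGraph W' (fun q => Ψ (swapCoord q)) ρ G') :
    ∃ x : ℝ → ℝ, Continuous x ∧ (∀ t, |x t| ≤ 3 * ρ / 8) ∧ ∀ t, G' t (G t (x t)) = x t := by
  have hρ := T.pos
  have hhalf : ∀ x, |x| ≤ 3 * ρ / 8 → |x| < ρ / 2 := fun x hx => by linarith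
  set f : ℝ → ℝ → ℝ := fun t x => x - G' t (G t x) with hf
  have hfc : ∀ t x, |x| ≤ 3 * ρ / 8 → ContinuousAt (fun p : ℝ × ℝ => f p.1 p.2) (t, x) := by
    intro t x hx
    have h1 := hG.continuousAt t x (hhalf x hx)
    have h2 := hG'.continuousAt t (G t x) (hhalf _ (hG.abs_le t x (hhalf x hx)))
    exact continuousAt_snd.sub (ContinuousAt.comp (g := fun p : ℝ × ℝ => G' p.1 p.2)
      (f := fun p : ℝ × ℝ => (p.1, G p.1 p.2)) h2
      (continuousAt_fst.prodMk h1))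
  -- The composite of two graphs of slope 1/8 has slope at most 1/64, so x minus the composite
  -- separates points. This makes the root depend continuously on t.
  have hmono : ∀ t x x', |x| ≤ 3 * ρ / 8 → |x'| ≤ 3 * ρ / 8 →
      1 / 2 * |x - x'| ≤ |f t x - f t x'| := by
    intro t x x' hx hx'
    have h1 := hG.lipschitz T t (hhalf _ hx') (hhalf _ hx)
    have h2 := hG'.lipschitz T.swap t (hhalf _ (hG.abs_le t x' (hhalf _ hx')))
      (hhalf _ (hG.abs_le t x (hhalf _ hx)))
    have h3 : x - x' = (f t x - f t x') + (G' t (G t x) - G' t (G t x')) := by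
      simp only [hf]; ring
    have h4 : |x - x'| ≤ |f t x - f t x'| + |G' t (G t x) - G' t (G t x')| := by
      conv_lhs => rw [h3]
      exact abs_add_le _ _
    linarith [abs_nonneg (x - x')]
  have hroot : ∀ t, ∃ x, |x| ≤ 3 * ρ / 8 ∧ f t x = 0 := by
    intro t
    have hc : ContinuousOn (f t) (Set.Icc (-(3 * ρ / 8)) (3 * ρ / 8)) := fun x hx =>
      (ContinuousAt.comp (f := fun x : ℝ => (t, x)) (hfc t x (abs_le.2 hx))
        (by fun_prop)).continuousWithinAt
    have hb : ∀ x, |x| ≤ 3 * ρ / 8 → |G' t (G t x)| ≤ 3 * ρ / 8 := fun x hx =>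
      hG'.abs_le t _ (hhalf _ (hG.abs_le t x (hhalf x hx)))
    have h1 := abs_le.1 (hb (-(3 * ρ / 8)) (by rw [abs_neg, abs_of_pos (by positivity)]))
    have h2 := abs_le.1 (hb (3 * ρ / 8) (by rw [abs_of_pos (by positivity)]))
    obtain ⟨x, hx, hx0⟩ := intermediate_value_Icc (by linarith : -(3 * ρ / 8) ≤ 3 * ρ / 8) hc
      (show (0 : ℝ) ∈ Set.Icc _ _ from ⟨by simp only [hf]; linarith, by simp only [hf]; linarith⟩)
    exact ⟨x, abs_le.2 hx, hx0⟩
  choose x hx hx0 using hroot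
  refine ⟨x, continuous_iff_continuousAt.2 fun t₀ => ?_, hx, fun t => by
    have := hx0 t; simp only [hf] at this; linarith⟩
  rw [Metric.continuousAt_iff']
  intro η hη
  have h1 : ContinuousAt (fun t => f t (x t₀)) t₀ :=
    ContinuousAt.comp (f := fun t : ℝ => (t, x t₀)) (hfc t₀ (x t₀) (hx t₀)) (by fun_prop)
  have h2 := eventually_abs_sub_lt (c := 0) (r := η / 2) h1 (by rw [hx0]; simpa using hη)
  filter_upwards [h2] with t ht
  have h3 := hmono t (x t) (x t₀) (hx t) (hx t₀)
  rw [hx0 t, zero_sub, abs_neg] at h3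
  rw [sub_zero] at ht
  rw [Real.dist_eq]
  linarith

/-- A curve contained in a leaf of both foliations is tangent to the intersection. -/
theorem exists_hasDerivAt (T : IsTube W W' P P' Ψ D ρ) {α β : ℝ → ℝ} {t : ℝ}
    (hαc : ContinuousAt α t) (hβc : ContinuousAt β t) (hα : |α t| < ρ) (hβ : |β t| < ρ)
    (hl : W.IsLeafAt (fun s => Ψ (s, α s, β s)) t) (hl' : W'.IsLeafAt (fun s => Ψ (s, α s, β s)) t) :
    ∃ a b : ℝ, HasDerivAt α a t ∧ HasDerivAt β b t ∧
      D (t, α t, β t) (1, a, b) ∈ P (Ψ (t, α t, β t)) ⊓ P' (Ψ (t, α t, β t)) := by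
  obtain ⟨φ, m, hφ0, hφd, hm, hm8, hφ⟩ := T.exists_leaf_graph (q := (t, α t, β t)) hα hβ
  obtain ⟨χ, k, hχ0, hχd, hk, hk8, hχ⟩ := T.swap.exists_leaf_graph (q := (t, β t, α t)) hβ hα
  have h1 : ∀ᶠ s in 𝓝 t, β s = φ (s, α s) := hφ ℝ (fun s => (s, α s, β s)) t rfl
    (continuousAt_id.prodMk (hαc.prodMk hβc)) hl
  have h2 : ∀ᶠ s in 𝓝 t, α s = χ (s, β s) := hχ ℝ (fun s => (s, β s, α s)) t rfl
    (continuousAt_id.prodMk (hβc.prodMk hαc)) hl'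
  simp only at hφ0 hχ0 hφd hχd hm hk
  -- The two graph equations combine to α = χ(s, φ(s, α)), whose derivative in α is at most 1/64, so
  -- implicit differentiation applies.
  have hcomp : HasFDerivAt (fun p : ℝ × ℝ => χ (p.1, φ p))
      (k.comp ((ContinuousLinearMap.fst ℝ ℝ ℝ).prod m)) (t, α t) := by
    refine HasFDerivAt.comp (f := fun p : ℝ × ℝ => (p.1, φ p)) (t, α t) ?_
      (hasFDerivAt_fst.prodMk hφd)
    simp only
    rwa [hφ0]
  have hF := hasFDerivAt_snd.sub hcomp
  have hB : |k (0, m (0, 1))| ≤ 1 / 64 := by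
    have a1 := hk8 (0, m (0, 1))
    have a2 := hm8 (0, 1)
    simp only [abs_zero, zero_add, abs_one] at a1 a2
    linarith
  have hαd := hasDerivAt_of_implicit (α := α) hF hαc (by
    filter_upwards [h1, h2] with s e1 e2
    simp only [Pi.sub_apply]
    rw [← e1, ← e2, sub_self]) (by
    simp only [sub_apply, ContinuousLinearMap.coe_snd',
      ContinuousLinearMap.comp_apply, ContinuousLinearMap.prod_apply, ContinuousLinearMap.coe_fst']
    intro h0
    rw [abs_le] at hB
    linarith)
  obtain ⟨a, hαa⟩ : ∃ a, HasDerivAt α a t := ⟨_, hαd⟩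
  have hβb : HasDerivAt β (m (1, a)) t :=
    (HasFDerivAt.comp_hasDerivAt (f := fun s => (s, α s)) t hφd
      ((hasDerivAt_id t).prodMk hαa)).congr_of_eventuallyEq h1
  have hαa' : HasDerivAt α (k (1, m (1, a))) t :=
    (HasFDerivAt.comp_hasDerivAt (f := fun s => (s, β s)) t hχd
      ((hasDerivAt_id t).prodMk hβb)).congr_of_eventuallyEq h2
  have ha := hαa.unique hαa'
  refine ⟨a, m (1, a), hαa, hβb, hm (1, a), ?_⟩
  have := hk (1, m (1, a))
  simp only at this
  rw [← ha] at this
  exact this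

/-- Between two curves of `W'` in a leaf of `W` the leaf is filled with such curves. -/
theorem exists_between (T : IsTube W W' P P' Ψ D ρ) {G : ℝ → ℝ → ℝ}
    (hG : IsLeafGraph W Ψ ρ G) {x₁ x₂ : ℝ → ℝ} (h1c : Continuous x₁) (h2c : Continuous x₂)
    (h1 : ∀ t, |x₁ t| ≤ 3 * ρ / 8) (h2 : ∀ t, |x₂ t| ≤ 3 * ρ / 8)
    (h1l : ∀ t, W'.IsLeafAt (fun t => Ψ (t, x₁ t, G t (x₁ t))) t)
    (h2l : ∀ t, W'.IsLeafAt (fun t => Ψ (t, x₂ t, G t (x₂ t))) t) {p : ℝ}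
    (hp : p ∈ Set.Ioo (x₁ 0) (x₂ 0)) :
    ∃ α : ℝ → ℝ, α 0 = p ∧ ∀ t, ContinuousAt α t ∧ |α t| ≤ 3 * ρ / 8 ∧
      W'.IsLeafAt (fun t => Ψ (t, α t, G t (α t))) t := by
  have hρ := T.pos
  set Ω : Set (ℝ × ℝ) := {p | |p.2| < ρ / 2} with hΩ
  have hΩo : IsOpen Ω := isOpen_lt continuous_snd.abs continuous_const
  have hσ : ContinuousOn (fun p : ℝ × ℝ => (p.1, p.2, G p.1 p.2)) Ω := fun p hp =>
    (continuousAt_fst.prodMk (continuousAt_snd.prodMk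
      (hG.continuousAt p.1 p.2 hp))).continuousWithinAt
  -- In the leaf of `W` a curve of constant time has |dy| ≤ |dx| / 8, whereas tangency to `W'` at
  -- constant time would require |dx| ≤ |dy| / 8. So `W'` cuts the leaf transversally to these
  -- curves and its labels foliate the (t, x)-plane.
  have hne : ∀ e ∈ W'.atlas, ∀ p ∈ Ω, Ψ (p.1, p.2, G p.1 p.2) ∈ e.source →
      ¬ IsLocalExtr (fun x => (e (Ψ (p.1, x, G p.1 x))).2) p.2 := by
    rintro e he ⟨t, x⟩ hx hes
    have hx' : |x| < ρ / 2 := hx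
    have hy := hG.abs_le t x hx'
    obtain ⟨m, hm, -, hm8⟩ := hG.hasFDerivAt T t hx'
    have hGd : HasDerivAt (G t) (m (0, 1)) x :=
      HasFDerivAt.comp_hasDerivAt (f := fun x : ℝ => (t, x)) x hm
        ((hasDerivAt_const x t).prodMk (hasDerivAt_id x))
    have hκ : HasDerivAt (fun x : ℝ => (t, G t x, x)) (0, m (0, 1), 1) x :=
      (hasDerivAt_const x t).prodMk (hGd.prodMk (hasDerivAt_id x))
    refine not_isLocalExtr_label T.swap.frame T.tangent' hκ he hes
      (T.swap.transverse (q := (t, G t x, x)) (by simp only; linarith) (by simp only; linarith)) ?_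
    intro hw
    have k1 := T.swap.cone (t, G t x, x) _ (by simp only; linarith) (by simp only; linarith) hw
    have k2 := hm8 (0, 1)
    simp only [abs_zero, zero_add, abs_one] at k1 k2
    linarith
  set S := planeLabels T.frame W' Ω hΩo (fun p => (p.1, p.2, G p.1 p.2)) hσ hne with hS
  have hmem : ∀ t x, |x| ≤ 3 * ρ / 8 → (t, x) ∈ Ω := fun t x hx => by
    change |x| < ρ / 2; linarith
  have hs1 : ∀ t, S.IsSolAt x₁ t := fun t =>
    isSolAt_planeLabels_iff.2 ⟨h1c.continuousAt, hmem t _ (h1 t), h1l t⟩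
  have hs2 : ∀ t, S.IsSolAt x₂ t := fun t =>
    isSolAt_planeLabels_iff.2 ⟨h2c.continuousAt, hmem t _ (h2 t), h2l t⟩
  -- solutions do not cross
  have hlt : ∀ a b : ℝ, (0 : ℝ) ∈ Set.Ioo a b → ∀ α β : ℝ → ℝ, α 0 < β 0 →
      (∀ t ∈ Set.Ioo a b, S.IsSolAt α t) → (∀ t ∈ Set.Ioo a b, S.IsSolAt β t) →
      ∀ t ∈ Set.Ioo a b, α t < β t := by
    intro a b h0 α β hαβ hα hβ t ht
    by_contra! hcon
    have hc : ContinuousOn (fun t => β t - α t) (Set.Ioo a b) := fun s hs =>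
      ((hβ s hs).1.sub (hα s hs).1).continuousWithinAt
    obtain ⟨τ, hτ, hτ0⟩ := isPreconnected_Ioo.intermediate_value ht h0 hc
      (show (0 : ℝ) ∈ Set.Icc _ _ from ⟨by linarith, by linarith⟩)
    have := PlaneLabels.eqOn_of_isSolAt isPreconnected_Ioo isOpen_Ioo hα hβ hτ
      (sub_eq_zero.1 hτ0).symm h0
    linarith
  have hbetween : ∀ a b : ℝ, (0 : ℝ) ∈ Set.Ioo a b → ∀ α : ℝ → ℝ, α 0 = p →
      (∀ t ∈ Set.Ioo a b, S.IsSolAt α t) → ∀ t ∈ Set.Ioo a b, x₁ t < α t ∧ α t < x₂ t :=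
    fun a b h0 α hα0 hα t ht =>
      ⟨hlt a b h0 x₁ α (by rw [hα0]; exact hp.1) (fun s _ => hs1 s) hα t ht,
        hlt a b h0 α x₂ (by rw [hα0]; exact hp.2) hα (fun s _ => hs2 s) t ht⟩
  obtain ⟨α, hα0, hα⟩ := S.exists_global_solution (t₀ := 0) (x₀ := p) (by
    intro n
    have hn : (0 : ℝ) < n + 1 := by positivity
    -- The two given curves are barriers that solutions cannot cross, which provides the compact set
    -- needed for continuation.
    set K : Set (ℝ × ℝ) := (Set.Icc (0 - ((n : ℝ) + 1)) (0 + (n + 1)) ×ˢ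
      Set.Icc (-(3 * ρ / 8)) (3 * ρ / 8)) ∩ {q | x₁ q.1 ≤ q.2 ∧ q.2 ≤ x₂ q.1} with hK
    have hKc : IsCompact K := (isCompact_Icc.prod isCompact_Icc).inter_right
      ((isClosed_le (h1c.comp continuous_fst) continuous_snd).inter
        (isClosed_le continuous_snd (h2c.comp continuous_fst)))
    have hK' : ∀ t ∈ Set.Icc (0 - ((n : ℝ) + 1)) (0 + (n + 1)), ∀ x, x₁ t ≤ x → x ≤ x₂ t →
        (t, x) ∈ K := fun t ht x k1 k2 =>
      ⟨⟨ht, (abs_le.1 (h1 t)).1.trans k1, k2.trans (abs_le.1 (h2 t)).2⟩, k1, k2⟩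
    refine S.exists_solution hKc (fun q hq => exists_mem_dom_planeLabels
      (hmem q.1 q.2 (abs_le.2 hq.1.2))) ⟨by linarith, by linarith⟩ ?_
      (hK' 0 ⟨by linarith, by linarith⟩ p hp.1.le hp.2.le)
    intro a b ha hb h0 α hα0 hα t ht
    obtain ⟨k1, k2⟩ := hbetween a b h0 α hα0 hα t ht
    exact hK' t ⟨ha.trans ht.1.le, ht.2.le.trans hb⟩ _ k1.le k2.le)
  refine ⟨α, hα0, fun t => ?_⟩
  obtain ⟨k1, k2⟩ := hbetween (-|t| - 1) (|t| + 1)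
    ⟨by linarith [abs_nonneg t], by linarith [abs_nonneg t]⟩ α hα0 (fun s _ => hα s) t
    ⟨by linarith [neg_abs_le t], by linarith [le_abs_self t]⟩
  obtain ⟨k3, -, k4⟩ := isSolAt_planeLabels_iff.1 (hα t)
  exact ⟨k3, abs_le.2 ⟨(abs_le.1 (h1 t)).1.trans k1.le, k2.le.trans (abs_le.1 (h2 t)).2⟩, k4⟩

end IsTube

end T1S

end

/-! ### Maps that preserve the center bundle, and curves close to the same geodesic. -/

noncomputable section

open T1S UnitTangent

theorem norm_frameD_le {q : ℝ × ℝ × ℝ} (hy : |q.2.2| ≤ 1) (a b : ℝ) :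
    ‖frameD q (0, a, b)‖ ≤ 8 * (|a| + |b|) := by
  refine (V3.norm_le_mat _).trans ?_
  rw [matD_frameD, matU_frameD, matL_frameD]
  simp only [mul_zero, add_zero, zero_div, zero_add, sub_zero]
  have h1 : |q.2.2 * a| ≤ |a| := by
    rw [abs_mul]; exact mul_le_of_le_one_left (abs_nonneg _) hy
  have h2 : |q.2.2 ^ 2 * a| ≤ |a| := by
    rw [abs_mul, abs_pow]
    exact mul_le_of_le_one_left (abs_nonneg _) (pow_le_one₀ (abs_nonneg _) hy)
  have h3 := abs_sub b (q.2.2 ^ 2 * a)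
  linarith [abs_nonneg a, abs_nonneg b]

theorem SL2R.abs_mul_entry_le {g k : SL2R} {A B : ℝ} (hg : ∀ i j, |g i j| ≤ A)
    (hk : ∀ i j, |k i j| ≤ B) (i j : Fin 2) : |(g * k) i j| ≤ 2 * (A * B) := by
  rw [SL2R.mul_entry]
  refine (abs_add_le _ _).trans ?_
  have hA : 0 ≤ A := (abs_nonneg _).trans (hg 0 0)
  rw [abs_mul, abs_mul]
  linarith [mul_le_mul (hg i 0) (hk 0 j) (abs_nonneg _) hA,
    mul_le_mul (hg i 1) (hk 1 j) (abs_nonneg _) hA]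

theorem SL2R.abs_inv_entry_le {g : SL2R} {A : ℝ} (hg : ∀ i j, |g i j| ≤ A) (i j : Fin 2) :
    |g⁻¹ i j| ≤ A := by
  have h := SL2R.inv_entries g
  fin_cases i <;> fin_cases j <;> simp [h, hg, abs_neg]

theorem SL2R.abs_entry_le_of_distOneSq {g : SL2R} {B : ℝ} (h : distOneSq g ≤ B) (i j : Fin 2) :
    |g i j| ≤ 2 + B := by
  unfold distOneSq at h
  have key : ∀ z : ℝ, (z - 1) ^ 2 ≤ B → |z| ≤ 2 + B := fun z hz => by
    rw [abs_le]; constructor <;> nlinarith [sq_nonneg z, sq_nonneg (z - 2)]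
  have key' : ∀ z : ℝ, z ^ 2 ≤ B → |z| ≤ 2 + B := fun z hz => by
    rw [abs_le]; constructor <;> nlinarith [sq_nonneg (z - 1), sq_nonneg (z + 1)]
  have h1 := sq_nonneg (g 0 0 - 1)
  have h2 := sq_nonneg (g 0 1)
  have h3 := sq_nonneg (g 1 0)
  have h4 := sq_nonneg (g 1 1 - 1)
  have k1 := key (g 0 0) (by linarith)
  have k2 := key' (g 0 1) (by linarith)
  have k3 := key' (g 1 0) (by linarith)
  have k4 := key (g 1 1) (by linarith)
  fin_cases i <;> fin_cases j <;> assumption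

theorem abs_coordMat_zero_entry_le {x y : ℝ} (hx : |x| ≤ 1) (hy : |y| ≤ 1) (i j : Fin 2) :
    |coordMat (0, x, y) i j| ≤ 2 := by
  have h : |1 + x * y| ≤ 2 := by
    refine (abs_add_le _ _).trans ?_
    rw [abs_one, abs_mul]
    linarith [mul_le_mul hx hy (abs_nonneg _) zero_le_one]
  fin_cases i <;> fin_cases j <;> simp [coordMat_entries]
  · exact h
  · linarith
  · linarith

theorem coordMat_eq_geoMat_mul (t x y : ℝ) : coordMat (t, x, y) = geoMat t * coordMat (0, x, y) := by
  rw [geoMat_mul_coordMat]; simp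

theorem coord_neg (g : SL2R) : coord (-g) = coord g := by
  simp [coord, Matrix.SpecialLinearGroup.coe_neg]

/-- Curves at bounded distance from each other that are close to geodesics are close to the same
geodesic. -/
theorem eq_geoMat_of_distOneSq_le {g₀ g₁ : ℝ → SL2R} {h₀ h₁ : SL2R} {τ₀ τ₁ x₀ y₀ x₁ y₁ : ℝ → ℝ}
    {B : ℝ} (hτ₀ : StrictMono τ₀) (hτ₁ : StrictMono τ₁) (hs₀ : Function.Surjective τ₀)
    (hs₁ : Function.Surjective τ₁) (hb₀ : ∀ t, |x₀ t| ≤ 1 ∧ |y₀ t| ≤ 1)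
    (hb₁ : ∀ t, |x₁ t| ≤ 1 ∧ |y₁ t| ≤ 1)
    (hg₀ : ∀ t, g₀ (τ₀ t) = h₀ * coordMat (t, x₀ t, y₀ t))
    (hg₁ : ∀ t, g₁ (τ₁ t) = h₁ * coordMat (t, x₁ t, y₁ t))
    (hB : ∀ u, distOneSq ((g₀ u)⁻¹ * g₁ u) ≤ B) :
    ∃ r, h₁ = h₀ * geoMat r ∨ h₁ = -(h₀ * geoMat r) := by
  set e₀ := hτ₀.orderIsoOfSurjective τ₀ hs₀ with he₀
  set e₁ := hτ₁.orderIsoOfSurjective τ₁ hs₁ with he₁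
  have e0 (u : ℝ) : τ₀ (e₀.symm u) = u := e₀.apply_symm_apply u
  have e1 (u : ℝ) : τ₁ (e₁.symm u) = u := e₁.apply_symm_apply u
  have hE : ∀ (u : ℝ) (i j : Fin 2), |(geoMat (-e₀.symm u) * (h₀⁻¹ * h₁) * geoMat (e₁.symm u)) i j| ≤
      2 * (2 * (2 * (2 + B)) * 2) := by
    intro u
    have k0 := hg₀ (e₀.symm u)
    have k1 := hg₁ (e₁.symm u)
    rw [e0, coordMat_eq_geoMat_mul] at k0
    rw [e1, coordMat_eq_geoMat_mul] at k1
    set d₀ := coordMat (0, x₀ (e₀.symm u), y₀ (e₀.symm u)) with hd₀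
    set d₁ := coordMat (0, x₁ (e₁.symm u), y₁ (e₁.symm u)) with hd₁
    -- At a common parameter u, the relative position of the geodesics is that of the curves, up to
    -- the bounded displacements of each curve from its own geodesic.
    have h2 : geoMat (-e₀.symm u) * (h₀⁻¹ * h₁) * geoMat (e₁.symm u) =
        d₀ * ((g₀ u)⁻¹ * g₁ u) * d₁⁻¹ := by
      rw [k0, k1, geoMat_neg]; group
    rw [h2]
    exact SL2R.abs_mul_entry_le (SL2R.abs_mul_entry_le
      (abs_coordMat_zero_entry_le (hb₀ _).1 (hb₀ _).2) (SL2R.abs_entry_le_of_distOneSq (hB u)))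
      (SL2R.abs_inv_entry_le (abs_coordMat_zero_entry_le (hb₁ _).1 (hb₁ _).2))
  obtain ⟨r, hr⟩ := eq_geoMat_of_bounded (k := h₀⁻¹ * h₁) (T₀ := e₀.symm) (T₁ := e₁.symm)
    e₀.symm.tendsto_atTop e₁.symm.tendsto_atTop e₀.symm.tendsto_atBot e₁.symm.tendsto_atBot
    fun u => ⟨hE u 0 1, hE u 1 0⟩
  refine ⟨r, hr.imp (fun h => ?_) fun h => ?_⟩
  · rw [← h, mul_inv_cancel_left]
  · rw [← mul_neg, ← h, mul_inv_cancel_left]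

namespace T1S

variable {Γ : Subgroup SL2R}

/-- A family of curves tangent to `Ec` in a tube, through the points of a transverse arc `σ`. -/
structure CenterArc (Ec : T1S Γ → Submodule ℝ V3) (h : SL2R) (a b : ℝ) (σ σ' : ℝ → ℝ × ℝ × ℝ)
    (κ : ℝ → ℝ → ℝ × ℝ × ℝ) : Prop where
  hasDerivAt : ∀ s ∈ Set.Ioo a b, HasDerivAt σ (σ' s) s
  apply_zero : ∀ s ∈ Set.Ioo a b, κ s 0 = σ s
  fst : ∀ s ∈ Set.Ioo a b, ∀ t, (κ s t).1 = t
  bound : ∀ s ∈ Set.Ioo a b, ∀ t, |(κ s t).2.1| ≤ 1 / 32 ∧ |(κ s t).2.2| ≤ 1 / 32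
  tangent : ∀ s ∈ Set.Ioo a b, ∀ t, ∃ w, w.1 = 1 ∧ HasDerivAt (κ s) w t ∧
    frameD (κ s t) w ∈ Ec (tubeMap Γ h (κ s t))

/-- A map with derivative `DG` that preserves the line field `Ec`. -/
structure PreservesCenter (Ec : T1S Γ → Submodule ℝ V3) (G : T1S Γ → T1S Γ)
    (DG : T1S Γ → V3 →L[ℝ] V3) : Prop where
  hasTangentMap : ∀ x, HasTangentMap G (DG x) x
  continuous : Continuous DG
  injective : ∀ x, Function.Injective (DG x)
  mapsTo : ∀ x, ∀ v ∈ Ec x, DG x v ∈ Ec (G x)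
  continuous_center : Continuous fun x => (Ec x).starProjection
  center_ne_bot : ∀ x, Ec x ≠ ⊥
  narrow : ∀ x, ∀ v ∈ Ec x, |matU v| ≤ 1 / 256 * ‖v‖ ∧ |matL v| ≤ 1 / 256 * ‖v‖

namespace PreservesCenter

variable {Ec : T1S Γ → Submodule ℝ V3} {G : T1S Γ → T1S Γ} {DG : T1S Γ → V3 →L[ℝ] V3}

theorem norm_le (hG : PreservesCenter Ec G DG) {x : T1S Γ} {v : V3} (hv : v ∈ Ec x) :
    ‖v‖ ≤ 4 * |matD v| := by
  have h1 := V3.norm_le_mat v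
  have h2 := hG.narrow x v hv
  linarith [h2.1, h2.2, norm_nonneg v]

theorem exists_norm_bounds (hΓ : IsClosedSurfaceGroup Γ) (hG : PreservesCenter Ec G DG) :
    ∃ C c : ℝ, 0 < C ∧ 0 < c ∧ ∀ x v, ‖DG x v‖ ≤ C * ‖v‖ ∧ c * ‖v‖ ≤ ‖DG x v‖ := by
  have := compactSpace hΓ
  obtain ⟨C, hC⟩ := isCompact_univ.exists_bound_of_continuousOn hG.continuous.continuousOn
  have hK : IsCompact ((Set.univ : Set (T1S Γ)) ×ˢ Metric.sphere (0 : V3) 1) :=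
    isCompact_univ.prod (isCompact_sphere 0 1)
  have hne : ((Set.univ : Set (T1S Γ)) ×ˢ Metric.sphere (0 : V3) 1).Nonempty :=
    ⟨(proj Γ 1, EuclideanSpace.single 0 1), trivial, by simp⟩
  have hcont : Continuous fun p : T1S Γ × V3 => ‖DG p.1 p.2‖ :=
    ((hG.continuous.comp continuous_fst).clm_apply continuous_snd).norm
  obtain ⟨p, ⟨-, hp⟩, hmin⟩ := hK.exists_isMinOn hne hcont.continuousOn
  have hp1 : ‖p.2‖ = 1 := by simpa using hp
  refine ⟨|C| + 1, ‖DG p.1 p.2‖, by positivity, ?_, fun x v => ⟨?_, ?_⟩⟩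
  · rw [norm_pos_iff]
    intro h0
    have := hG.injective p.1 (h0.trans (map_zero _).symm)
    rw [this, norm_zero] at hp1
    exact zero_ne_one hp1
  · refine ((DG x).le_opNorm v).trans (mul_le_mul_of_nonneg_right ?_ (norm_nonneg v))
    linarith [hC x trivial, le_abs_self C]
  · by_cases hv : v = 0
    · simp [hv]
    have hn : 0 < ‖v‖ := norm_pos_iff.2 hv
    have h1 : ‖DG p.1 p.2‖ ≤ ‖DG x (‖v‖⁻¹ • v)‖ := hmin (a := (x, ‖v‖⁻¹ • v)) ⟨trivial, by
      simp [norm_smul, hn.ne']⟩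
    rw [map_smul, norm_smul, norm_inv, norm_norm, le_inv_mul_iff₀ hn] at h1
    linarith

/-- The map may reverse the center direction, but then it does so everywhere in the tube, which is
connected. Reversed center curves are handled by running them backwards. -/
theorem exists_sign (hG : PreservesCenter Ec G DG) {Ψ : ℝ × ℝ × ℝ → T1S Γ}
    (hΨ : Continuous Ψ) : ∃ ε : ℝ, (ε = 1 ∨ ε = -1) ∧
      ∀ q, ∀ u ∈ Ec (Ψ q), 0 < matD u → 0 < ε * matD (DG (Ψ q) u) := by
  have hne : ∀ x, ∀ v ∈ Ec x, v ≠ 0 → matD v ≠ 0 := fun x v hv h0 hD => by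
    have := hG.norm_le hv
    rw [hD, abs_zero, mul_zero] at this
    exact h0 (norm_le_zero_iff.1 this)
  have hmD : ∀ v : V3, matD v = inner ℝ (EuclideanSpace.single 0 1 : V3) v / 2 := fun v => by
    rw [matD_apply, EuclideanSpace.inner_single_left]; simp
  -- The orthogonal projection of `Z` to `Ec` is a continuous section with positive `matD`, since no
  -- nonzero vector of `Ec` is orthogonal to `Z`.
  set u₀ : T1S Γ → V3 := fun x => (Ec x).starProjection (EuclideanSpace.single 0 1) with hu₀
  have hu₀m : ∀ x, u₀ x ∈ Ec x := fun x => by simp [hu₀]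
  have hu₀c : Continuous u₀ := hG.continuous_center.clm_apply continuous_const
  have hu₀D : ∀ x, 0 < matD (u₀ x) := by
    intro x
    have h1 : matD (u₀ x) = ‖u₀ x‖ ^ 2 / 2 := by
      rw [hmD, ← real_inner_self_eq_norm_sq]
      congr 1
      have h2 := Submodule.inner_starProjection_left_eq_right (Ec x)
        (EuclideanSpace.single 0 1 : V3) (u₀ x)
      rw [Submodule.starProjection_eq_self_iff.2 (hu₀m x)] at h2
      exact h2.symm
    rw [h1]
    have : u₀ x ≠ 0 := by
      obtain ⟨v, hv, hv0⟩ := Submodule.exists_mem_ne_zero_of_ne_bot (hG.center_ne_bot x)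
      intro h0
      apply hne x v hv hv0
      rw [hmD]
      have h2 : inner ℝ (u₀ x) v = inner ℝ (EuclideanSpace.single 0 1 : V3) v := by
        simp only [hu₀]
        rw [Submodule.inner_starProjection_left_eq_right,
          Submodule.starProjection_eq_self_iff.2 hv]
      rw [← h2, h0, inner_zero_left, zero_div]
    positivity
  have hDne : ∀ x, ∀ u ∈ Ec x, 0 < matD u → matD (DG x u) ≠ 0 := fun x u hu hD =>
    hne _ _ (hG.mapsTo x u hu) fun h0 => by
      have : u = 0 := hG.injective x (h0.trans (map_zero _).symm)
      rw [this, map_zero] at hD; exact lt_irrefl _ hD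
  have hsame : ∀ x, ∀ u ∈ Ec x, 0 < matD u →
      (0 < matD (DG x u) ↔ 0 < matD (DG x (u₀ x))) := by
    intro x u hu hD
    -- Vectors of `Ec` with positive `matD` form a convex set on which `matD` of the image does not
    -- vanish, so its sign there is that at `u₀`.
    have hmem : ∀ r ∈ Set.Icc (0 : ℝ) 1, matD (DG x ((1 - r) • u + r • u₀ x)) ≠ 0 := by
      intro r hr
      refine hDne x _ (Submodule.add_mem _ (Submodule.smul_mem _ _ hu)
        (Submodule.smul_mem _ _ (hu₀m x))) ?_
      simp only [map_add, map_smul, smul_eq_mul]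
      rcases hr.1.eq_or_lt with h | h
      · rw [← h]; simpa using hD
      · have := mul_pos h (hu₀D x)
        have := mul_nonneg (by linarith [hr.2] : 0 ≤ 1 - r) hD.le
        linarith
    have hc : ContinuousOn (fun r : ℝ => matD (DG x ((1 - r) • u + r • u₀ x))) (Set.Icc 0 1) :=
      Continuous.continuousOn (by fun_prop)
    rcases isPreconnected_Icc.lt_or_gt_of_ne hc hmem with h | h
    · have h0 := h 0 (by simp)
      have h1 := h 1 (by simp)
      simp only [sub_zero, one_smul, zero_smul, add_zero, sub_self, zero_add] at h0 h1
      exact ⟨fun k => absurd k h0.not_gt, fun k => absurd k h1.not_gt⟩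
    · have h0 := h 0 (by simp)
      have h1 := h 1 (by simp)
      simp only [sub_zero, one_smul, zero_smul, add_zero, sub_self, zero_add] at h0 h1
      exact ⟨fun _ => h1, fun _ => h0⟩
  have hc : Continuous fun q => matD (DG (Ψ q) (u₀ (Ψ q))) :=
    matD.continuous.comp ((hG.continuous.comp hΨ).clm_apply (hu₀c.comp hΨ))
  rcases isPreconnected_univ.lt_or_gt_of_ne hc.continuousOn (a := 0)
    (fun q _ => hDne _ _ (hu₀m _) (hu₀D _)) with h | h
  · refine ⟨-1, Or.inr rfl, fun q u hu hD => ?_⟩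
    have h1 : ¬ 0 < matD (DG (Ψ q) u) := fun k =>
      absurd ((hsame _ u hu hD).1 k) (h q trivial).not_gt
    have h2 := hDne _ u hu hD
    have := lt_of_le_of_ne (not_lt.1 h1) h2
    linarith
  · refine ⟨1, Or.inl rfl, fun q u hu hD => ?_⟩
    rw [one_mul]
    exact (hsame _ u hu hD).2 (h q trivial)

end PreservesCenter

end T1S

end

/-! ### Images of center curves and the bound on transverse arcs. -/

noncomputable section

open T1S UnitTangent

namespace T1S

variable {Γ : Subgroup SL2R} {Ec : T1S Γ → Submodule ℝ V3} {G : T1S Γ → T1S Γ}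
  {DG : T1S Γ → V3 →L[ℝ] V3} {h : SL2R} {a b : ℝ} {σ σ' : ℝ → ℝ × ℝ × ℝ} {κ : ℝ → ℝ → ℝ × ℝ × ℝ}

theorem continuous_tubeMap (Γ : Subgroup SL2R) (h : SL2R) : Continuous (tubeMap Γ h) :=
  continuous_proj.comp (continuous_const.mul continuous_coordMat)

namespace PreservesCenter

theorem exists_lift (hΓ : IsClosedSurfaceGroup Γ) (hG : PreservesCenter Ec G DG)
    (hGc : Continuous G) (h : SL2R) : ∃ g : ℝ × ℝ × ℝ → SL2R,
      ∀ q, HasFrameDeriv g ((DG (tubeMap Γ h q)).comp (frameD q : ℝ × ℝ × ℝ →L[ℝ] V3)) q := by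
  obtain ⟨g₀, hg₀⟩ := proj_surjective (Γ := Γ) (G (tubeMap Γ h 0))
  obtain ⟨g, hgc, -, hg⟩ := T1S.exists_lift hΓ (hGc.comp (continuous_tubeMap Γ h)) (a := 0) hg₀
  refine ⟨g, fun q => HasDeriv.hasFrameDeriv hΓ ?_ hgc.continuousAt⟩
  refine ((hG.hasTangentMap (tubeMap Γ h q)).comp_hasDeriv hΓ
    (hasDeriv_proj_coordMat hΓ h q)).congr (Eventually.of_forall fun q => ?_)
  exact hg q

/-- A curve tangent to `Ec` in a tube, transported by a map that preserves `Ec`, is close to a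
geodesic. -/
theorem exists_geodesic (hG : PreservesCenter Ec G DG) {c ε : ℝ} (hc : 0 < c)
    (hcG : ∀ x v, c * ‖v‖ ≤ ‖DG x v‖) (hε : ε = 1 ∨ ε = -1)
    (hpos : ∀ q, ∀ u ∈ Ec (tubeMap Γ h q), 0 < matD u → 0 < ε * matD (DG (tubeMap Γ h q) u))
    {g : ℝ × ℝ × ℝ → SL2R}
    (hg : ∀ q, HasFrameDeriv g ((DG (tubeMap Γ h q)).comp (frameD q : ℝ × ℝ × ℝ →L[ℝ] V3)) q)
    {k : ℝ → ℝ × ℝ × ℝ} (hk : ∀ t, |(k t).2.1| ≤ 1 / 32 ∧ |(k t).2.2| ≤ 1 / 32)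
    (hk' : ∀ t, ∃ w, w.1 = 1 ∧ HasDerivAt k w t ∧ frameD (k t) w ∈ Ec (tubeMap Γ h (k t))) :
    ∃ (h' : SL2R) (τ x y : ℝ → ℝ), StrictMono τ ∧ Function.Surjective τ ∧
      (∀ t, |x t| ≤ 1 / 32 ∧ |y t| ≤ 1 / 32) ∧
      ∀ t, g (k (ε * τ t)) = h' * coordMat (t, x t, y t) := by
  choose w hw1 hw2 hw3 using hk'
  set u : ℝ → V3 := fun t => frameD (k t) (w t) with hu
  set v : ℝ → V3 := fun t => ε • DG (tubeMap Γ h (k (ε * t))) (u (ε * t)) with hv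
  -- The curve has unit speed in the time coordinate, so `matD` is 1/2 up to the small term y matU.
  have huD : ∀ t, 1 / 4 ≤ matD (u t) := by
    intro t
    have h1 : matD (u t) = 1 / 2 + (k t).2.2 * matU (u t) := by
      simp only [hu]
      rw [matD_frameD, matU_frameD, hw1]
    have h2 := (hG.narrow _ _ (hw3 t)).1
    have h3 := hG.norm_le (hw3 t)
    have h4 : |(k t).2.2 * matU (u t)| ≤ 1 / 32 * (1 / 64 * |matD (u t)|) := by
      rw [abs_mul]
      exact mul_le_mul (hk t).2 (by simp only [hu]; linarith) (abs_nonneg _) (by norm_num)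
    have h5 := neg_abs_le ((k t).2.2 * matU (u t))
    rcases abs_cases (matD (u t)) with ⟨h6, -⟩ | ⟨h6, -⟩ <;> linarith
  have hvE : ∀ t, v t ∈ Ec (G (tubeMap Γ h (k (ε * t)))) := fun t =>
    Submodule.smul_mem _ _ (hG.mapsTo _ _ (hw3 _))
  have hvD : ∀ t, 0 < matD (v t) := by
    intro t
    simp only [hv, map_smul, smul_eq_mul]
    exact hpos _ _ (hw3 _) (by linarith [huD (ε * t)])
  have hεn : ‖ε‖ = 1 := by rcases hε with rfl | rfl <;> simp
  have hvn : ∀ t, c / 4 ≤ ‖v t‖ := by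
    intro t
    simp only [hv, norm_smul, hεn, one_mul]
    refine le_trans ?_ (hcG _ _)
    have h1 := (le_abs_self _).trans (abs_matD_le (u (ε * t)))
    have h2 := mul_le_mul_of_nonneg_left ((huD (ε * t)).trans h1) hc.le
    linarith
  have hv0 : ∀ t, v t 0 = 2 * matD (v t) := fun t => by rw [matD_apply]; ring
  have hnv : ∀ t, ‖v t‖ ≤ 2 * v t 0 := by
    intro t
    have := hG.norm_le (hvE t)
    rw [abs_of_pos (hvD t)] at this
    rw [hv0]; linarith
  have hvel : ∀ t, HasFrameVel (fun t => g (k (ε * t))) (v t) t := by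
    intro t
    have h1 : HasDerivAt (fun t => k (ε * t)) (ε • w (ε * t)) t := by
      have h2 : HasDerivAt (fun t : ℝ => ε * t) ε t := by simpa using (hasDerivAt_id t).const_mul ε
      exact (hw2 (ε * t)).scomp t h2
    have h3 := (hg (k (ε * t))).comp_hasDerivAt (u := fun t => k (ε * t)) h1
    have h4 : ((DG (tubeMap Γ h (k (ε * t)))).comp
        (frameD (k (ε * t)) : ℝ × ℝ × ℝ →L[ℝ] V3)) (ε • w (ε * t)) = v t := by
      simp [hv, hu]
    rw [h4] at h3
    exact h3
  -- The image velocity is in the cone of aperture 1/256 about the flow, and ‖v‖ ≤ 2 v 0 doubles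
  -- this to θ = 1/128. The tube width is 3θ < 1/32 whatever the derivative of the map; only the
  -- lower bound c/8 on the speed depends on it.
  obtain ⟨h', τ, τ', x, y, h1, h2, h3, -, -, h4, h5⟩ := exists_geodesic_coord hvel
    (θ := 1 / 128) (a := c / 8) (by norm_num) (by norm_num) (by positivity)
    (fun t => by linarith [hnv t, hvn t])
    (fun t => by linarith [hnv t, (hG.narrow _ _ (hvE t)).1])
    (fun t => by linarith [hnv t, (hG.narrow _ _ (hvE t)).2])
  refine ⟨h', τ, x, y, strictMono_of_deriv_pos fun t => ?_, h3, fun t => ?_, h5⟩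
  · rw [(h1 t).deriv]; exact (h2 t).1
  · constructor <;> linarith [(h4 t).1, (h4 t).2]

/-- A map of bounded derivative distorts distances in a tube by a bounded amount. -/
theorem distOneSq_lift_le (hG : PreservesCenter Ec G DG) {C : ℝ} (hC : 0 < C)
    (hCG : ∀ x v, ‖DG x v‖ ≤ C * ‖v‖) {g : ℝ × ℝ × ℝ → SL2R}
    (hg : ∀ q, HasFrameDeriv g ((DG (tubeMap Γ h q)).comp (frameD q : ℝ × ℝ × ℝ →L[ℝ] V3)) q)
    {p q : ℝ × ℝ × ℝ} (hpq : p.1 = q.1) (hp : |p.2.1| ≤ 1 / 32 ∧ |p.2.2| ≤ 1 / 32)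
    (hq : |q.2.1| ≤ 1 / 32 ∧ |q.2.2| ≤ 1 / 32) :
    distOneSq ((g p)⁻¹ * g q) ≤ Real.exp (32 * C) := by
  -- outside `[0, 1]` the segment may leave the tube, which does not matter for the integral
  set l : ℝ → ℝ × ℝ × ℝ := fun r => p + r • (q - p) with hl
  have hlc : Continuous l := by simp only [hl]; fun_prop
  set v : ℝ → V3 := fun r => DG (tubeMap Γ h (l r)) (frameD (l r) (q - p)) with hv
  have hvc : Continuous v :=
    (hG.continuous.comp ((continuous_tubeMap Γ h).comp hlc)).clm_apply
      ((continuous_frameD.comp hlc).clm_apply continuous_const)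
  have hvel : ∀ r, HasFrameVel (fun r => g (l r)) (v r) r := by
    intro r
    have h1 : HasDerivAt l (q - p) r := by
      have := ((hasDerivAt_id r).smul_const (q - p)).const_add p
      rw [one_smul] at this
      exact this
    exact (hg (l r)).comp_hasDerivAt h1
  have h1 := distOneSq_le_of_hasFrameVel hvc hvel
  have e0 : l 0 = p := by simp [hl]
  have e1 : l 1 = q := by simp [hl]
  rw [e0, e1] at h1
  have hb : ∀ r ∈ Set.Icc (0 : ℝ) 1, ‖v r‖ ≤ C := by
    intro r hr
    refine (hCG _ _).trans (mul_le_of_le_one_right hC.le ?_)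
    have h2 : q - p = (0, (q - p).2.1, (q - p).2.2) := by
      refine Prod.ext ?_ rfl
      simp [hpq]
    have h3 : |(l r).2.2| ≤ 1 := by
      have : (l r).2.2 = (1 - r) * p.2.2 + r * q.2.2 := by simp [hl]; ring
      rw [this]
      refine (abs_add_le _ _).trans ?_
      rw [abs_mul, abs_mul, abs_of_nonneg hr.1, abs_of_nonneg (by linarith [hr.2] : 0 ≤ 1 - r)]
      nlinarith [hr.1, hr.2, hp.2, hq.2]
    rw [h2]
    -- The segment between two points of the tube at equal times has length at most 8(1/16 + 1/16) =
    -- 1.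
    refine (norm_frameD_le h3 _ _).trans ?_
    have h4 : |(q - p).2.1| ≤ 1 / 16 := (abs_sub _ _).trans (by linarith [hp.1, hq.1])
    have h5 : |(q - p).2.2| ≤ 1 / 16 := (abs_sub _ _).trans (by linarith [hp.2, hq.2])
    linarith
  have h2 : ∫ r in (0 : ℝ)..1, ‖v r‖ ≤ C := by
    have := intervalIntegral.integral_mono_on (μ := MeasureTheory.volume)
      (g := fun _ => C) (zero_le_one (α := ℝ))
      (hvc.norm.intervalIntegrable 0 1) (continuous_const.intervalIntegrable 0 1) hb
    simpa using this
  have h3 : Real.exp (32 * ∫ r in (0 : ℝ)..1, ‖v r‖) ≤ Real.exp (32 * C) :=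
    Real.exp_le_exp.2 (by linarith)
  linarith

/-- The image of the transverse arc stays close to one geodesic. -/
theorem exists_coord_bound (hΓ : IsClosedSurfaceGroup Γ) (hG : PreservesCenter Ec G DG)
    (A : CenterArc Ec h a b σ σ' κ) (hab : a < b) {g : ℝ × ℝ × ℝ → SL2R}
    (hg : ∀ q, HasFrameDeriv g ((DG (tubeMap Γ h q)).comp (frameD q : ℝ × ℝ × ℝ →L[ℝ] V3)) q) :
    ∃ k : SL2R, ∀ s ∈ Set.Ioo a b, (k * g (σ s)) 1 1 ≠ 0 ∧
      |(coord (k * g (σ s))).2.1| ≤ 1 / 32 ∧ |(coord (k * g (σ s))).2.2| ≤ 1 / 32 := by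
  obtain ⟨C, c, hC, hc, hCc⟩ := hG.exists_norm_bounds hΓ
  obtain ⟨ε, hε, hpos⟩ := hG.exists_sign (continuous_tubeMap Γ h)
  have hgeo : ∀ s ∈ Set.Ioo a b, _ := fun s hs => hG.exists_geodesic hc (fun x v => (hCc x v).2) hε
    hpos hg (A.bound s hs) (A.tangent s hs)
  have hs₀ : (a + b) / 2 ∈ Set.Ioo a b := ⟨by linarith, by linarith⟩
  obtain ⟨h₀, τ₀, x₀, y₀, m₀, s₀, b₀, g₀⟩ := hgeo _ hs₀
  refine ⟨h₀⁻¹, fun s hs => ?_⟩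
  obtain ⟨h₁, τ₁, x₁, y₁, m₁, s₁, b₁, g₁⟩ := hgeo _ hs
  -- The distance between the images of two curves is bounded by a constant depending on the map,
  -- but finiteness is enough to give both images the same geodesic. The resulting coordinate bound
  -- 1/32 no longer involves that constant.
  obtain ⟨r, hr⟩ := eq_geoMat_of_distOneSq_le (g₀ := fun t => g (κ ((a + b) / 2) (ε * t)))
    (g₁ := fun t => g (κ s (ε * t))) m₀ m₁ s₀ s₁
    (fun t => ⟨(b₀ t).1.trans (by norm_num), (b₀ t).2.trans (by norm_num)⟩)
    (fun t => ⟨(b₁ t).1.trans (by norm_num), (b₁ t).2.trans (by norm_num)⟩) g₀ g₁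
    (fun u => hG.distOneSq_lift_le hC (fun x v => (hCc x v).1) hg
      ((A.fst _ hs₀ _).trans (A.fst _ hs _).symm) (A.bound _ hs₀ _) (A.bound _ hs _))
  obtain ⟨t, ht⟩ := s₁ 0
  have h2 := g₁ t
  rw [ht, mul_zero, A.apply_zero s hs] at h2
  have h3 : h₀⁻¹ * g (σ s) = coordMat (t + r, x₁ t, y₁ t) ∨
      h₀⁻¹ * g (σ s) = -coordMat (t + r, x₁ t, y₁ t) := by
    refine hr.imp (fun e => ?_) fun e => ?_
    · rw [h2, e, mul_assoc, inv_mul_cancel_left, geoMat_mul_coordMat]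
    · rw [h2, e, neg_mul, mul_neg, mul_assoc, inv_mul_cancel_left, geoMat_mul_coordMat]
  have h4 := (coordMat_11_pos (t + r, x₁ t, y₁ t)).ne'
  rcases h3 with h3 | h3
  · rw [h3, coord_coordMat]
    exact ⟨h4, b₁ t⟩
  · rw [h3, coord_neg, coord_coordMat]
    exact ⟨by simpa using h4, b₁ t⟩

/-- A map that preserves `Ec` and expands a transverse bundle by a large factor bounds the length
of transverse arcs to families of curves tangent to `Ec`. -/
theorem arc_length_le (hΓ : IsClosedSurfaceGroup Γ) (hG : PreservesCenter Ec G DG)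
    (hGc : Continuous G) (A : CenterArc Ec h a b σ σ' κ) {K : ℝ} (hK : 8000 ≤ K)
    {pr : ℝ × ℝ × ℝ →L[ℝ] ℝ} (hpr : ∀ q : ℝ × ℝ × ℝ, |q.2.1| ≤ 1 / 32 → |q.2.2| ≤ 1 / 32 → |pr q| ≤ 1 / 32)
    {E : T1S Γ → Submodule ℝ V3} (hE : ∀ x, ∀ vs ∈ E x, ∀ vc ∈ Ec x, DG x vs ∈ E (G x) ∧
      K * ‖vs‖ ≤ ‖DG x vs‖ ∧ K * ‖DG x vc‖ * ‖vs‖ ≤ ‖DG x vs‖ * ‖vc‖)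
    (hlow : ∀ x, ∀ vs ∈ E x, ∀ q : ℝ × ℝ × ℝ, |q.2.1| ≤ 1 / 32 → |q.2.2| ≤ 1 / 32 → ∀ vc,
      ‖vc‖ ≤ 1 / 100 * ‖vs‖ → 1 / 16 * ‖vs‖ ≤ |pr ((frameD q).symm (vs + vc))|)
    (hσ : ∀ s ∈ Set.Ioo a b, ∃ vs ∈ E (tubeMap Γ h (σ s)), ∃ vc ∈ Ec (tubeMap Γ h (σ s)),
      frameD (σ s) (σ' s) = vs + vc ∧ 1 / 4 ≤ ‖vs‖ ∧ ‖vc‖ ≤ 20) {s₀ s₁ : ℝ}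
    (h0 : a < s₀) (h01 : s₀ < s₁) (h1 : s₁ < b) : K * (s₁ - s₀) ≤ 4 := by
  obtain ⟨g, hg⟩ := hG.exists_lift hΓ hGc h
  obtain ⟨k, hk⟩ := hG.exists_coord_bound hΓ A (h0.trans (h01.trans h1)) hg
  -- The image arc moves in the coordinate `pr` at speed at least (1/16) · K · (1/4), while this
  -- coordinate stays within 1/32. The mean value theorem then bounds the length of the parameter
  -- interval.
  have hd : ∀ s ∈ Set.Ioo a b, ∃ d, HasDerivAt (fun s => pr (coord (k * g (σ s)))) d s ∧
      K / 64 ≤ |d| := by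
    intro s hs
    obtain ⟨vs, hvs, vc, hvc, hdec, hvs4, hvc20⟩ := hσ s hs
    obtain ⟨k1, k2, k3⟩ := hk s hs
    have h2 : HasFrameVel (fun s => k * g (σ s)) _ s :=
      ((hg (σ s)).mul_left k).comp_hasDerivAt (A.hasDerivAt s hs)
    refine ⟨_, pr.hasFDerivAt.comp_hasDerivAt s (h2.hasDerivAt_coord k1), ?_⟩
    simp only [ContinuousLinearMap.comp_apply, ContinuousLinearEquiv.coe_coe, hdec, map_add (DG _)]
    obtain ⟨e1, e2, e3⟩ := hE _ vs hvs vc hvc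
    refine le_trans ?_ (hlow _ _ e1 _ k2 k3 _ ?_)
    · have := mul_le_mul_of_nonneg_left hvs4 (by linarith : 0 ≤ K)
      linarith
    · have f1 : ‖DG (tubeMap Γ h (σ s)) vs‖ * ‖vc‖ ≤ ‖DG (tubeMap Γ h (σ s)) vs‖ * 20 :=
        mul_le_mul_of_nonneg_left hvc20 (norm_nonneg _)
      -- This is where 8000 enters: the center part of the image is at most 20/2000 = 1/100 of the
      -- expanded part and cannot cancel it in the coordinate `pr`.
      have f2 : 2000 ≤ K * ‖vs‖ := by nlinarith
      have f3 := mul_le_mul_of_nonneg_right f2 (norm_nonneg (DG (tubeMap Γ h (σ s)) vc))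
      linarith
  choose! d hd1 hd2 using hd
  have hsub : Set.Icc s₀ s₁ ⊆ Set.Ioo a b := fun s hs => ⟨h0.trans_le hs.1, hs.2.trans_lt h1⟩
  obtain ⟨s, hs, hs'⟩ := exists_hasDerivAt_eq_slope (fun s => pr (coord (k * g (σ s)))) d h01
    (fun s hs => (hd1 s (hsub hs)).continuousAt.continuousWithinAt)
    (fun s hs => hd1 s (hsub (Set.Ioo_subset_Icc_self hs)))
  have h2 := hd2 s (hsub (Set.Ioo_subset_Icc_self hs))
  have hb : ∀ s ∈ Set.Icc s₀ s₁, |pr (coord (k * g (σ s)))| ≤ 1 / 32 := fun s hs =>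
    hpr _ (hk s (hsub hs)).2.1 (hk s (hsub hs)).2.2
  have h3 := (abs_sub (pr (coord (k * g (σ s₁)))) (pr (coord (k * g (σ s₀))))).trans
    (add_le_add (hb s₁ ⟨h01.le, le_rfl⟩) (hb s₀ ⟨le_rfl, h01.le⟩))
  rw [hs', abs_div, abs_of_pos (sub_pos.2 h01), le_div_iff₀ (sub_pos.2 h01)] at h2
  linarith

end PreservesCenter

end T1S

end

/-! ### Iterates with large absolute and relative expansion. -/

noncomputable section

open T1S UnitTangent

/-- A pointwise strict inequality between continuous functions on a compact set has a uniform
gap. -/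
theorem IsCompact.exists_mul_le_of_lt {X : Type*} [TopologicalSpace X] {S : Set X}
    (hS : IsCompact S) {α β : X → ℝ} (hα : ContinuousOn α S) (hβ : ContinuousOn β S)
    (h0 : ∀ p ∈ S, 0 < α p) (h : ∀ p ∈ S, α p < β p) : ∃ K, 1 < K ∧ ∀ p ∈ S, K * α p ≤ β p := by
  rcases S.eq_empty_or_nonempty with rfl | hne
  · exact ⟨2, one_lt_two, by simp⟩
  obtain ⟨p, hp, hmin⟩ := hS.exists_isMinOn hne (hβ.div hα fun p hp => (h0 p hp).ne')
  refine ⟨β p / α p, (one_lt_div (h0 p hp)).2 (h p hp), fun q hq => ?_⟩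
  rw [← le_div_iff₀ (h0 q hq)]
  exact hmin hq

namespace T1S

variable {Γ : Subgroup SL2R} {f : T1S Γ ≃ₜ T1S Γ} {Df : T1S Γ → (V3 ≃L[ℝ] V3)}
  {Es Ec Eu E : T1S Γ → Submodule ℝ V3} {G G' : T1S Γ → T1S Γ} {DG DG' : T1S Γ → V3 →L[ℝ] V3}
  {K K' : ℝ}

theorem exists_iterate (hΓ : IsClosedSurfaceGroup Γ) (hf : IsC1Diffeo f Df) (n : ℕ) :
    ∃ (F : T1S Γ ≃ₜ T1S Γ) (D : T1S Γ → (V3 ≃L[ℝ] V3)), IsC1Diffeo F D ∧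
      (∀ x, (D x : V3 →L[ℝ] V3) = iterDeriv f Df n x) ∧
      ∀ E, IsInvariantSubbundle f Df E → IsInvariantSubbundle F D E := by
  induction n with
  | zero =>
    refine ⟨Homeomorph.refl _, fun _ => ContinuousLinearEquiv.refl ℝ V3,
      ⟨fun x => hasTangentMap_id x, continuous_const⟩, fun x => rfl, fun E hE =>
      ⟨hE.nontrivial, hE.continuous, fun x => ?_⟩⟩
    exact Submodule.map_id _
  | succ n ih =>
    obtain ⟨F, D, hF, hD, hinv⟩ := ih
    have he : ∀ x, ((Df x).trans (D (f x)) : V3 →L[ℝ] V3) =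
        (D (f x) : V3 →L[ℝ] V3).comp (Df x : V3 →L[ℝ] V3) := fun x => rfl
    have h1 : ∀ x, HasTangentMap (fun y => F (f y))
        ((D (f x) : V3 →L[ℝ] V3).comp (Df x : V3 →L[ℝ] V3)) x := fun x =>
      HasTangentMap.comp hΓ (f := F) (f' := f) (hF.hasTangentMap (f x)) (hf.hasTangentMap x)
    have h2 : Continuous fun x => (D (f x) : V3 →L[ℝ] V3).comp (Df x : V3 →L[ℝ] V3) :=
      (hF.continuous_deriv.comp f.continuous).clm_comp hf.continuous_deriv
    refine ⟨f.trans F, fun x => (Df x).trans (D (f x)), ⟨fun x => ?_, ?_⟩, fun x => ?_,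
      fun E hE => ⟨hE.nontrivial, hE.continuous, fun x => ?_⟩⟩
    · rw [he]; exact h1 x
    · simp only [he]; exact h2
    · rw [he, hD]
      rfl
    · have h1 := (hinv E hE).invariant (f x)
      rw [← hE.invariant x, ← Submodule.map_comp] at h1
      exact h1

/-- The derivative of the inverse map is the inverse operator at the preimage, and inversion of
operators is continuous. -/
theorem IsC1Diffeo.symm (hΓ : IsClosedSurfaceGroup Γ) (hf : IsC1Diffeo f Df) :
    IsC1Diffeo f.symm fun x => (Df (f.symm x)).symm where
  hasTangentMap x := by
    have := (hf.hasTangentMap (f.symm x)).symm hΓ f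
    rwa [f.apply_symm_apply] at this
  continuous_deriv := by
    have h1 : Continuous fun x => (Df (f.symm x) : V3 →L[ℝ] V3) :=
      hf.continuous_deriv.comp f.symm.continuous
    have h2 : (fun x => ((Df (f.symm x)).symm : V3 →L[ℝ] V3)) =
        fun x => ContinuousLinearMap.inverse (Df (f.symm x) : V3 →L[ℝ] V3) := by
      funext x
      rw [ContinuousLinearMap.inverse_equiv]
    rw [h2, continuous_iff_continuousAt]
    intro x
    exact ContinuousAt.comp (g := ContinuousLinearMap.inverse)
      (f := fun x => (Df (f.symm x) : V3 →L[ℝ] V3))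
      (contDiffAt_map_inverse (n := 0) (Df (f.symm x))).continuousAt h1.continuousAt

theorem IsInvariantSubbundle.apply_mem (hE : IsInvariantSubbundle f Df E) {x : T1S Γ} {v : V3}
    (hv : v ∈ E x) : Df x v ∈ E (f x) := by
  rw [← hE.invariant]
  exact Submodule.mem_map_of_mem hv

theorem IsInvariantSubbundle.symm (hE : IsInvariantSubbundle f Df E) :
    IsInvariantSubbundle f.symm (fun x => (Df (f.symm x)).symm) E where
  nontrivial := hE.nontrivial
  continuous := hE.continuous
  invariant x := by
    have h1 := hE.invariant (f.symm x)
    rw [f.apply_symm_apply] at h1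
    rw [← h1, ← Submodule.map_comp]
    convert Submodule.map_id _
    ext v
    simp

theorem IsInvariantSubbundle.isClosed (hE : IsInvariantSubbundle f Df E) :
    IsClosed {p : T1S Γ × V3 | p.2 ∈ E p.1} := by
  have h1 : {p : T1S Γ × V3 | p.2 ∈ E p.1} = {p | (E p.1).starProjection p.2 = p.2} := by
    ext p
    exact Submodule.starProjection_eq_self_iff.symm
  rw [h1]
  exact isClosed_eq ((hE.continuous.comp continuous_fst).clm_apply continuous_snd) continuous_snd

/-- The map `G` preserves `Ec` and `E`, and expands `E` by the factor `K`, both absolutely and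
relatively to `Ec`. -/
structure Expands (Ec E : T1S Γ → Submodule ℝ V3) (K : ℝ) (G : T1S Γ → T1S Γ)
    (DG : T1S Γ → V3 →L[ℝ] V3) : Prop where
  preservesCenter : PreservesCenter Ec G DG
  continuous : Continuous G
  expand : ∀ x, ∀ vs ∈ E x, ∀ vc ∈ Ec x, DG x vs ∈ E (G x) ∧
    K * ‖vs‖ ≤ ‖DG x vs‖ ∧ K * ‖DG x vc‖ * ‖vs‖ ≤ ‖DG x vs‖ * ‖vc‖

/-- Both rates multiply. For the relative rate the two inequalities are multiplied and the common
factor ‖DG vs‖ is cancelled; it is positive when vs ≠ 0 because DG is injective. -/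
theorem Expands.comp (hΓ : IsClosedSurfaceGroup Γ) (hK : 0 ≤ K) (hK' : 0 ≤ K')
    (h' : Expands Ec E K' G' DG') (h : Expands Ec E K G DG) :
    Expands Ec E (K' * K) (fun x => G' (G x)) fun x => (DG' (G x)).comp (DG x) where
  preservesCenter :=
    { hasTangentMap x := (h'.preservesCenter.hasTangentMap (G x)).comp hΓ
        (h.preservesCenter.hasTangentMap x)
      continuous := (h'.preservesCenter.continuous.comp h.continuous).clm_comp
        h.preservesCenter.continuous
      injective x := (h'.preservesCenter.injective _).comp (h.preservesCenter.injective x)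
      mapsTo x v hv := h'.preservesCenter.mapsTo _ _ (h.preservesCenter.mapsTo x v hv)
      continuous_center := h.preservesCenter.continuous_center
      center_ne_bot := h.preservesCenter.center_ne_bot
      narrow := h.preservesCenter.narrow }
  continuous := h'.continuous.comp h.continuous
  expand x vs hs vc hc := by
    obtain ⟨a1, a2, a3⟩ := h.expand x vs hs vc hc
    obtain ⟨b1, b2, b3⟩ := h'.expand _ _ a1 _ (h.preservesCenter.mapsTo x vc hc)
    refine ⟨b1, ?_, ?_⟩
    · exact (by nlinarith : K' * K * ‖vs‖ ≤ K' * ‖DG x vs‖).trans b2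
    · simp only [ContinuousLinearMap.comp_apply]
      by_cases h0 : vs = 0
      · simp [h0]
      have h1 : 0 < ‖DG x vs‖ := norm_pos_iff.2 fun e =>
        h0 (h.preservesCenter.injective x (e.trans (map_zero _).symm))
      refine le_of_mul_le_mul_right ?_ h1
      have c1 := mul_le_mul_of_nonneg_right b3 (mul_nonneg hK (norm_nonneg vs))
      have c2 := mul_le_mul_of_nonneg_left a3 (norm_nonneg (DG' (G x) (DG x vs)))
      linarith

/-- The iterates of an expanding map expand by arbitrarily large factors. -/
theorem Expands.exists_ge (hΓ : IsClosedSurfaceGroup Γ) (hK : 1 < K) (h : Expands Ec E K G DG)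
    (B : ℝ) : ∃ K' G' DG', B ≤ K' ∧ Expands Ec E K' G' DG' := by
  have key : ∀ n : ℕ, ∃ G' DG', Expands Ec E (K ^ (n + 1)) G' DG' := by
    intro n
    induction n with
    | zero => exact ⟨G, DG, by simpa using h⟩
    | succ n ih =>
      obtain ⟨G', DG', h'⟩ := ih
      have := h'.comp hΓ (by positivity) (by positivity) h
      rw [← pow_succ] at this
      exact ⟨_, _, this⟩
  obtain ⟨n, hn⟩ := pow_unbounded_of_one_lt B hK
  obtain ⟨G', DG', h'⟩ := key n
  exact ⟨_, G', DG', hn.le.trans (pow_le_pow_right₀ hK.le n.le_succ), h'⟩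

/-- An inequality between homogeneous functions of two vectors may be checked on unit vectors. -/
theorem mul_norm_le_of_unit {A B : V3 →L[ℝ] V3} {P Q : Submodule ℝ V3} {K : ℝ}
    (h : ∀ v ∈ P, ∀ w ∈ Q, ‖v‖ = 1 → ‖w‖ = 1 → K * ‖A v‖ ≤ ‖B w‖) :
    ∀ v ∈ P, ∀ w ∈ Q, K * ‖A v‖ * ‖w‖ ≤ ‖B w‖ * ‖v‖ := by
  intro v hv w hw
  by_cases h0 : v = 0
  · simp [h0]
  by_cases h1 : w = 0
  · simp [h1]
  have hv0 := norm_pos_iff.2 h0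
  have hw0 := norm_pos_iff.2 h1
  have := h _ (Submodule.smul_mem P ‖v‖⁻¹ hv) _ (Submodule.smul_mem Q ‖w‖⁻¹ hw)
    (by simp [norm_smul, hv0.ne']) (by simp [norm_smul, hw0.ne'])
  rw [map_smul, map_smul, norm_smul, norm_smul, norm_inv, norm_inv, norm_norm, norm_norm] at this
  field_simp at this
  linarith

theorem exists_norm_eq_one {P : Submodule ℝ V3} (h : P ≠ ⊥) : ∃ v ∈ P, ‖v‖ = 1 := by
  obtain ⟨v, hv, h0⟩ := Submodule.exists_mem_ne_zero_of_ne_bot h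
  have hv0 := norm_pos_iff.2 h0
  exact ⟨‖v‖⁻¹ • v, P.smul_mem _ hv, by simp [norm_smul, hv0.ne']⟩

theorem IsC1Diffeo.preservesCenter (hf : IsC1Diffeo f Df) (hc : IsInvariantSubbundle f Df Ec)
    (hn : ∀ x, ∀ v ∈ Ec x, |matU v| ≤ 1 / 256 * ‖v‖ ∧ |matL v| ≤ 1 / 256 * ‖v‖) :
    PreservesCenter Ec f fun x => (Df x : V3 →L[ℝ] V3) where
  hasTangentMap := hf.hasTangentMap
  continuous := hf.continuous_deriv
  injective x := (Df x).injective
  mapsTo x v hv := hc.apply_mem hv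
  continuous_center := hc.continuous
  center_ne_bot := hc.nontrivial
  narrow := hn

theorem IsInvariantSubbundle.isCompact_unit (hΓ : IsClosedSurfaceGroup Γ)
    (hE : IsInvariantSubbundle f Df E) (hc : IsInvariantSubbundle f Df Ec) :
    IsCompact {p : T1S Γ × V3 × V3 | (p.2.1 ∈ E p.1 ∧ p.2.2 ∈ Ec p.1) ∧ ‖p.2.1‖ = 1 ∧ ‖p.2.2‖ = 1} := by
  have := compactSpace hΓ
  have h1 : IsCompact ((Set.univ : Set (T1S Γ)) ×ˢ
      (Metric.sphere (0 : V3) 1 ×ˢ Metric.sphere (0 : V3) 1)) :=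
    isCompact_univ.prod ((isCompact_sphere 0 1).prod (isCompact_sphere 0 1))
  have h2 : IsClosed {p : T1S Γ × V3 × V3 | p.2.1 ∈ E p.1 ∧ p.2.2 ∈ Ec p.1} :=
    (hE.isClosed.preimage (f := fun p : T1S Γ × V3 × V3 => (p.1, p.2.1)) (by fun_prop)).inter
      (hc.isClosed.preimage (f := fun p : T1S Γ × V3 × V3 => (p.1, p.2.2)) (by fun_prop))
  convert h1.inter_left h2 using 1
  ext p
  simp

/-- The strict inequalities of domination hold on the compact set of pairs of unit vectors, hence
with a uniform factor greater than 1 for the iterate f^l; powers make it large. The stable bundle is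
expanded by the inverse of that iterate, the unstable bundle by the iterate itself. -/
theorem IsPartiallyHyperbolic.exists_expands (hΓ : IsClosedSurfaceGroup Γ)
    (h : IsPartiallyHyperbolic f Df Es Ec Eu)
    (hn : ∀ x, ∀ v ∈ Ec x, |matU v| ≤ 1 / 256 * ‖v‖ ∧ |matL v| ≤ 1 / 256 * ‖v‖) (B : ℝ) :
    (∃ K G DG, B ≤ K ∧ Expands Ec Es K G DG) ∧ ∃ K G DG, B ≤ K ∧ Expands Ec Eu K G DG := by
  obtain ⟨l, -, hdom⟩ := h.domination
  obtain ⟨F, D, hF, hD, hinv⟩ := exists_iterate hΓ h.isC1Diffeo l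
  simp only [← hD] at hdom
  have hs := hinv _ h.stable
  have hc := hinv _ h.center
  have hu := hinv _ h.unstable
  have hcont : ∀ v : T1S Γ × V3 × V3 → V3, Continuous v → Continuous fun p => ‖D p.1 (v p)‖ :=
    fun v hv => ((hF.continuous_deriv.comp continuous_fst).clm_apply hv).norm
  have hne : ∀ x v, ‖v‖ = 1 → 0 < ‖D x v‖ := fun x v hv => norm_pos_iff.2 fun e => by
    rw [(D x).map_eq_zero_iff.1 e, norm_zero] at hv
    exact zero_ne_one hv
  constructor
  · obtain ⟨K, hK, hle⟩ := (hs.isCompact_unit hΓ hc).exists_mul_le_of_lt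
      (α := fun p => ‖D p.1 p.2.1‖) (β := fun p => min 1 ‖D p.1 p.2.2‖)
      (hcont _ (by fun_prop)).continuousOn
      (continuous_const.min (hcont _ (by fun_prop))).continuousOn
      (fun p hp => hne _ _ hp.2.1) (fun p hp => by
        -- Domination is a statement about triples of unit vectors, so some unit vector of the third
        -- bundle has to be supplied.
        obtain ⟨vu, hvu, hvu1⟩ := exists_norm_eq_one (h.unstable.nontrivial p.1)
        exact (hdom p.1 _ hp.1.1 _ hp.1.2 vu hvu hp.2.1 hp.2.2 hvu1).1)
    have h1 : ∀ x, ∀ v ∈ Es x, ∀ w ∈ Ec x, ‖v‖ = 1 → ‖w‖ = 1 → K * ‖D x v‖ ≤ 1 ∧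
        K * ‖D x v‖ ≤ ‖D x w‖ := fun x v hv w hw hv1 hw1 =>
      le_min_iff.1 (hle (x, v, w) ⟨⟨hv, hw⟩, hv1, hw1⟩)
    refine Expands.exists_ge hΓ hK (G := F.symm)
      (DG := fun x => ((D (F.symm x)).symm : V3 →L[ℝ] V3))
      ⟨(hF.symm hΓ).preservesCenter hc.symm hn, F.symm.continuous, fun x vs hvs vc hvc => ?_⟩ B
    have a1 := hs.symm.apply_mem hvs
    have a2 := hc.symm.apply_mem hvc
    refine ⟨a1, ?_, ?_⟩
    · obtain ⟨w, hw, hw1⟩ := exists_norm_eq_one (h.center.nontrivial (F.symm x))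
      have := mul_norm_le_of_unit (A := (D (F.symm x) : V3 →L[ℝ] V3))
        (B := ContinuousLinearMap.id ℝ V3) (P := Es (F.symm x)) (Q := Ec (F.symm x)) (K := K)
        (fun v hv w hw hv1 hw1 => by simpa [hw1] using (h1 _ v hv w hw hv1 hw1).1) _ a1 _ hw
      simpa [hw1] using this
    · have := mul_norm_le_of_unit (A := (D (F.symm x) : V3 →L[ℝ] V3))
        (B := (D (F.symm x) : V3 →L[ℝ] V3)) (P := Es (F.symm x)) (Q := Ec (F.symm x)) (K := K)
        (fun v hv w hw hv1 hw1 => (h1 _ v hv w hw hv1 hw1).2) _ a1 _ a2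
      simp only [ContinuousLinearEquiv.coe_coe, ContinuousLinearEquiv.apply_symm_apply] at this ⊢
      linarith
  · obtain ⟨K, hK, hle⟩ := (hu.isCompact_unit hΓ hc).exists_mul_le_of_lt
      (β := fun p => ‖D p.1 p.2.1‖) (α := fun p => max 1 ‖D p.1 p.2.2‖)
      (continuous_const.max (hcont _ (by fun_prop))).continuousOn
      (hcont _ (by fun_prop)).continuousOn
      (fun p hp => lt_max_of_lt_left one_pos) (fun p hp => by
        obtain ⟨vs, hvs, hvs1⟩ := exists_norm_eq_one (h.stable.nontrivial p.1)
        exact (hdom p.1 vs hvs _ hp.1.2 _ hp.1.1 hvs1 hp.2.2 hp.2.1).2)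
    have h1 : ∀ x, ∀ w ∈ Ec x, ∀ v ∈ Eu x, ‖w‖ = 1 → ‖v‖ = 1 → K ≤ ‖D x v‖ ∧
        K * ‖D x w‖ ≤ ‖D x v‖ := fun x w hw v hv hw1 hv1 => by
      have h2 := hle (x, v, w) ⟨⟨hv, hw⟩, hv1, hw1⟩
      have h3 : K * 1 ≤ K * max 1 ‖D x w‖ :=
        mul_le_mul_of_nonneg_left (le_max_left _ _) (by linarith)
      have h4 : K * ‖D x w‖ ≤ K * max 1 ‖D x w‖ :=
        mul_le_mul_of_nonneg_left (le_max_right _ _) (by linarith)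
      exact ⟨by linarith, h4.trans h2⟩
    refine Expands.exists_ge hΓ hK (G := F) (DG := fun x => (D x : V3 →L[ℝ] V3))
      ⟨hF.preservesCenter hc hn, F.continuous, fun x vs hvs vc hvc =>
        ⟨hu.apply_mem hvs, ?_, ?_⟩⟩ B
    · obtain ⟨w, hw, hw1⟩ := exists_norm_eq_one (h.center.nontrivial x)
      have := mul_norm_le_of_unit (A := ContinuousLinearMap.id ℝ V3)
        (B := (D x : V3 →L[ℝ] V3)) (P := Ec x) (Q := Eu x) (K := K)
        (fun w hw v hv hw1 hv1 => by simpa [hw1] using (h1 _ w hw v hv hw1 hv1).1) _ hw _ hvs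
      simpa [hw1] using this
    · exact mul_norm_le_of_unit (A := (D x : V3 →L[ℝ] V3))
        (B := (D x : V3 →L[ℝ] V3)) (P := Ec x) (Q := Eu x) (K := K)
        (fun w hw v hv hw1 hv1 => (h1 _ w hw v hv hw1 hv1).2) _ hvc _ hvs

end T1S

end

/-! ### At most one center curve in a thin tube. -/

noncomputable section

open T1S UnitTangent

namespace IsNarrow

variable {δ : ℝ} {Es Ec Eu : Submodule ℝ V3}

/-- The direction of a slice arc has `matU` equal to 1 and small `matD`, so its stable part is
bounded below and its center part above, as `arc_length_le` requires. -/
theorem exists_decomp_cs (h : IsNarrow (1 / 256) Es Ec Eu) {q : ℝ × ℝ × ℝ} (hy : |q.2.2| ≤ 1 / 32)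
    {m : ℝ} (hw : frameD q (0, 1, m) ∈ Es ⊔ Ec) :
    ∃ vs ∈ Es, ∃ vc ∈ Ec, frameD q (0, 1, m) = vs + vc ∧ 1 / 4 ≤ ‖vs‖ ∧ ‖vc‖ ≤ 20 := by
  obtain ⟨vs, hs, vc, hc, he⟩ := Submodule.mem_sup.1 hw
  refine ⟨vs, hs, vc, hc, he.symm, ?_⟩
  have h1 := h.norm_stable_le (by norm_num) hs
  have h2 := h.norm_center_le (by norm_num) hc
  obtain ⟨h3, h4⟩ := h.stable vs hs
  obtain ⟨h5, h6⟩ := h.center vc hc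
  have eD : matD vs + matD vc = q.2.2 := by
    rw [← map_add, he, matD_frameD]; simp
  have eU : matU vs + matU vc = 1 := by
    rw [← map_add, he, matU_frameD]; simp
  have h7 : |matD vc| ≤ |q.2.2| + |matD vs| := by
    rw [← eq_sub_iff_add_eq'] at eD; rw [eD]; exact abs_sub _ _
  have h8 : |matU vs| ≤ 1 + |matU vc| := by
    rw [← eq_sub_iff_add_eq] at eU; rw [eU]; exact (abs_sub _ _).trans (by simp)
  have h9 : 1 ≤ |matU vs| + |matU vc| := by
    have := abs_add_le (matU vs) (matU vc); rwa [eU, abs_one] at this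
  have h10 := abs_matU_le vs
  constructor <;> linarith

theorem exists_decomp_cu (h : IsNarrow (1 / 256) Es Ec Eu) {q : ℝ × ℝ × ℝ} (hy : |q.2.2| ≤ 1 / 32)
    {m : ℝ} (hm : |m| ≤ 1 / 8) (hw : frameD q (0, m, 1) ∈ Ec ⊔ Eu) :
    ∃ vu ∈ Eu, ∃ vc ∈ Ec, frameD q (0, m, 1) = vu + vc ∧ 1 / 4 ≤ ‖vu‖ ∧ ‖vc‖ ≤ 20 := by
  obtain ⟨vc, hc, vu, hu, he⟩ := Submodule.mem_sup.1 hw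
  refine ⟨vu, hu, vc, hc, by rw [← he, add_comm], ?_⟩
  have h1 := h.norm_unstable_le (by norm_num) hu
  have h2 := h.norm_center_le (by norm_num) hc
  obtain ⟨h3, h4⟩ := h.unstable vu hu
  obtain ⟨h5, h6⟩ := h.center vc hc
  have eD : matD vc + matD vu = q.2.2 * m := by
    rw [← map_add, he, matD_frameD]; simp
  have eL : matL vc + matL vu = 1 - q.2.2 ^ 2 * m := by
    rw [← map_add, he, matL_frameD]; simp
  have hym : |q.2.2 * m| ≤ 1 / 32 * (1 / 8) := by
    rw [abs_mul]; exact mul_le_mul hy hm (abs_nonneg _) (by norm_num)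
  have hyym : |q.2.2 ^ 2 * m| ≤ 1 / 32 * (1 / 32 * (1 / 8)) := by
    rw [pow_two, mul_assoc, abs_mul]; exact mul_le_mul hy hym (abs_nonneg _) (by norm_num)
  have h7 : |matD vc| ≤ |q.2.2 * m| + |matD vu| := by
    rw [← eq_sub_iff_add_eq] at eD; rw [eD]; exact abs_sub _ _
  have h11 := abs_le.1 hyym
  have h8 : |matL vu| ≤ 2 + |matL vc| := by
    rw [← eq_sub_iff_add_eq'] at eL; rw [eL]
    refine (abs_sub _ _).trans (add_le_add_left ?_ _)
    rw [abs_le]; constructor <;> linarith [h11.1, h11.2]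
  have h9 : 1 - q.2.2 ^ 2 * m ≤ |matL vc| + |matL vu| := by
    rw [← eL]; exact (le_abs_self _).trans (abs_add_le _ _)
  have h10 := abs_matL_le vu
  constructor <;> linarith [h11.1, h11.2]

/-- Near the axis the stable coordinate is governed by `matU`, the dominant coefficient on `Es`; a
center part a hundred times smaller cannot cancel it. -/
theorem le_abs_fst_frameD_symm (h : IsNarrow (1 / 256) Es Ec Eu) {q : ℝ × ℝ × ℝ}
    (hx : |q.2.1| ≤ 1 / 32) (hy : |q.2.2| ≤ 1 / 32) {vs vc : V3} (hs : vs ∈ Es)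
    (hc : ‖vc‖ ≤ 1 / 100 * ‖vs‖) : 1 / 16 * ‖vs‖ ≤ |((frameD q).symm (vs + vc)).2.1| := by
  rw [frameD_symm_apply]
  simp only [map_add]
  have h1 := h.norm_stable_le (by norm_num) hs
  obtain ⟨h3, h4⟩ := h.stable vs hs
  have h5 := abs_matD_le vc
  have h6 := abs_matU_le vc
  set D := matD vs + matD vc with hD
  set U := matU vs + matU vc with hU
  have hDle : |D| ≤ 1 / 50 * ‖vs‖ := (abs_add_le _ _).trans (by linarith [norm_nonneg vs])
  have hUle : 1 / 5 * ‖vs‖ ≤ |U| := by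
    have := abs_sub U (matU vc)
    rw [hU, add_sub_cancel_right, ← hU] at this
    linarith [norm_nonneg vs]
  have hxy : |2 * q.2.1 * q.2.2 * U| ≤ 1 / 16 * |U| := by
    rw [abs_mul, abs_mul, abs_mul, abs_two]
    refine mul_le_mul_of_nonneg_right ?_ (abs_nonneg _)
    have := mul_le_mul hx hy (abs_nonneg _) (by norm_num)
    linarith
  have hDx : |2 * D * q.2.1| ≤ 1 / 16 * |D| := by
    rw [abs_mul, abs_mul, abs_two]
    have := mul_le_mul_of_nonneg_left hx (abs_nonneg D)
    linarith
  have e : U = ((1 + 2 * q.2.1 * q.2.2) * U - 2 * D * q.2.1) - 2 * q.2.1 * q.2.2 * U +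
    2 * D * q.2.1 := by ring
  have h7 := abs_add_le (((1 + 2 * q.2.1 * q.2.2) * U - 2 * D * q.2.1) - 2 * q.2.1 * q.2.2 * U)
    (2 * D * q.2.1)
  rw [← e] at h7
  have h8 := abs_sub ((1 + 2 * q.2.1 * q.2.2) * U - 2 * D * q.2.1) (2 * q.2.1 * q.2.2 * U)
  linarith [norm_nonneg vs]

theorem le_abs_snd_frameD_symm (h : IsNarrow (1 / 256) Es Ec Eu) {q : ℝ × ℝ × ℝ}
    (hy : |q.2.2| ≤ 1 / 32) {vu vc : V3} (hu : vu ∈ Eu)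
    (hc : ‖vc‖ ≤ 1 / 100 * ‖vu‖) : 1 / 16 * ‖vu‖ ≤ |((frameD q).symm (vu + vc)).2.2| := by
  rw [frameD_symm_apply]
  simp only [map_add]
  have h1 := h.norm_unstable_le (by norm_num) hu
  obtain ⟨h3, h4⟩ := h.unstable vu hu
  have h5 := abs_matD_le vc
  have h6 := abs_matU_le vc
  have h6' := abs_matL_le vc
  set D := matD vu + matD vc with hD
  set U := matU vu + matU vc with hU
  set L := matL vu + matL vc with hL
  have hDle : |D| ≤ 1 / 50 * ‖vu‖ := (abs_add_le _ _).trans (by linarith [norm_nonneg vu])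
  have hUle : |U| ≤ 1 / 50 * ‖vu‖ := (abs_add_le _ _).trans (by linarith [norm_nonneg vu])
  have hLle : 1 / 5 * ‖vu‖ ≤ |L| := by
    have := abs_sub L (matL vc)
    rw [hL, add_sub_cancel_right, ← hL] at this
    linarith [norm_nonneg vu]
  have hyy : |U * q.2.2 ^ 2| ≤ 1 * |U| := by
    rw [abs_mul, mul_comm, abs_pow]
    exact mul_le_mul_of_nonneg_right (pow_le_one₀ (abs_nonneg _) (by linarith)) (abs_nonneg _)
  have hDx : |2 * D * q.2.2| ≤ 1 / 16 * |D| := by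
    rw [abs_mul, abs_mul, abs_two]
    have := mul_le_mul_of_nonneg_left hy (abs_nonneg D)
    linarith
  have e : L = (2 * D * q.2.2 + L - U * q.2.2 ^ 2) + U * q.2.2 ^ 2 - 2 * D * q.2.2 := by ring
  have h7 := abs_sub ((2 * D * q.2.2 + L - U * q.2.2 ^ 2) + U * q.2.2 ^ 2) (2 * D * q.2.2)
  rw [← e] at h7
  have h8 := abs_add_le (2 * D * q.2.2 + L - U * q.2.2 ^ 2) (U * q.2.2 ^ 2)
  linarith [norm_nonneg vu]

end IsNarrow

namespace T1S

variable {Γ : Subgroup SL2R}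

/-- The stable part of a vector in both sums also lies in the sum of the other two bundles, hence is
zero by independence. -/
theorem IsPartiallyHyperbolic.inf_le {f : T1S Γ ≃ₜ T1S Γ} {Df : T1S Γ → (V3 ≃L[ℝ] V3)}
    {Es Ec Eu : T1S Γ → Submodule ℝ V3} (h : IsPartiallyHyperbolic f Df Es Ec Eu) (x : T1S Γ) :
    (Es x ⊔ Ec x) ⊓ (Ec x ⊔ Eu x) ≤ Ec x := by
  rintro v ⟨h1, h2⟩
  obtain ⟨vs, hs, vc, hc, rfl⟩ := Submodule.mem_sup.1 h1
  obtain ⟨wc, hwc, wu, hu, he⟩ := Submodule.mem_sup.1 h2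
  have hind := (h.splitting x).submodule_iSupIndep 0
  have hs' : vs ∈ ⨆ j, ⨆ (_ : j ≠ (0 : Fin 3)), ![Es x, Ec x, Eu x] j := by
    have e : vs = (wc - vc) + wu := by rw [sub_add_eq_add_sub, he, add_sub_cancel_right]
    rw [e]
    refine Submodule.add_mem _ ?_ ?_
    · exact le_iSup₂_of_le (f := fun j (_ : j ≠ (0 : Fin 3)) => ![Es x, Ec x, Eu x] j) 1
        (by decide) le_rfl (Submodule.sub_mem _ hwc hc)
    · exact le_iSup₂_of_le (f := fun j (_ : j ≠ (0 : Fin 3)) => ![Es x, Ec x, Eu x] j) 2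
        (by decide) le_rfl hu
  have h0 : vs = 0 := Submodule.disjoint_def.1 hind vs hs hs'
  rwa [h0, zero_add]

/-- In a surface foliated by center curves inside a tube there is no strip between two of them: the
dynamics expand the strip, but its images stay near one geodesic. -/
theorem IsTube.not_lt (hΓ : IsClosedSurfaceGroup Γ) {h : SL2R}
    {e : (ℝ × ℝ × ℝ) ≃L[ℝ] ℝ × ℝ × ℝ} (he1 : ∀ q, (e q).1 = q.1)
    (he2 : ∀ q : ℝ × ℝ × ℝ, |q.2.1| ≤ 1 / 32 → |q.2.2| ≤ 1 / 32 →
      |(e q).2.1| ≤ 1 / 32 ∧ |(e q).2.2| ≤ 1 / 32)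
    {W W' : SurfaceFoliation Γ} {P P' Ec E : T1S Γ → Submodule ℝ V3}
    (T : IsTube W W' P P' (fun q => tubeMap Γ h (e q)) (fun q => e.trans (frameD (e q))) (1 / 32))
    (hPP : ∀ x, P x ⊓ P' x ≤ Ec x)
    (hexp : ∀ B, ∃ K G DG, B ≤ K ∧ Expands Ec E K G DG) {pr : ℝ × ℝ × ℝ →L[ℝ] ℝ}
    (hpr : ∀ q : ℝ × ℝ × ℝ, |q.2.1| ≤ 1 / 32 → |q.2.2| ≤ 1 / 32 → |pr q| ≤ 1 / 32)
    (hlow : ∀ x, ∀ vs ∈ E x, ∀ q : ℝ × ℝ × ℝ, |q.2.1| ≤ 1 / 32 → |q.2.2| ≤ 1 / 32 → ∀ vc,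
      ‖vc‖ ≤ 1 / 100 * ‖vs‖ → 1 / 16 * ‖vs‖ ≤ |pr ((frameD q).symm (vs + vc))|)
    (hdec : ∀ x, ∀ q : ℝ × ℝ × ℝ, |q.2.1| ≤ 1 / 32 → |q.2.2| ≤ 1 / 32 → ∀ m : ℝ, |m| ≤ 1 / 8 →
      frameD (e q) (e (0, 1, m)) ∈ P x → ∃ vs ∈ E x, ∃ vc ∈ Ec x,
        frameD (e q) (e (0, 1, m)) = vs + vc ∧ 1 / 4 ≤ ‖vs‖ ∧ ‖vc‖ ≤ 20)
    {G : ℝ → ℝ → ℝ} (hG : IsLeafGraph W (fun q => tubeMap Γ h (e q)) (1 / 32) G) {x₁ x₂ : ℝ → ℝ}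
    (h1c : Continuous x₁) (h2c : Continuous x₂) (h1 : ∀ t, |x₁ t| ≤ 3 * (1 / 32) / 8)
    (h2 : ∀ t, |x₂ t| ≤ 3 * (1 / 32) / 8)
    (h1l : ∀ t, W'.IsLeafAt (fun t => tubeMap Γ h (e (t, x₁ t, G t (x₁ t)))) t)
    (h2l : ∀ t, W'.IsLeafAt (fun t => tubeMap Γ h (e (t, x₂ t, G t (x₂ t)))) t) :
    ¬ x₁ 0 < x₂ 0 := by
  intro hlt
  -- The strip is filled with curves contained in leaves of both foliations. They are tangent to
  -- `Ec` by `hPP`, and the time 0 slice is an arc across them.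
  have hbet := fun p hp => T.exists_between hG h1c h2c h1 h2 h1l h2l (p := p) hp
  choose! α hα0 hα using hbet
  have hGb : ∀ t x, |x| ≤ 3 * (1 / 32) / 8 → |G t x| ≤ 3 * (1 / 32) / 8 := fun t x hx =>
    hG.abs_le t x (by linarith)
  have hsm : ∀ s ∈ Set.Ioo (x₁ 0) (x₂ 0), |s| ≤ 3 * (1 / 32) / 8 := fun s hs => by
    rw [← hα0 s hs]; exact (hα s hs 0).2.1
  have hm := fun s (hs : s ∈ Set.Ioo (x₁ 0) (x₂ 0)) => hG.hasFDerivAt T 0 (x := s)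
    (by linarith [hsm s hs])
  choose! m hm1 hm2 hm3 using hm
  have A : CenterArc Ec h (x₁ 0) (x₂ 0) (fun s => e (0, s, G 0 s)) (fun s => e (0, 1, m s (0, 1)))
      (fun s t => e (t, α s t, G t (α s t))) :=
    { hasDerivAt s hs := by
        have d1 : HasDerivAt (fun s : ℝ => ((0 : ℝ), s)) (0, 1) s :=
          (hasDerivAt_const s 0).prodMk (hasDerivAt_id s)
        have d2 : HasDerivAt (fun s => G 0 s) (m s (0, 1)) s :=
          (hm1 s hs).comp_hasDerivAt (f := fun s : ℝ => ((0 : ℝ), s)) s d1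
        exact (e : ℝ × ℝ × ℝ →L[ℝ] ℝ × ℝ × ℝ).hasFDerivAt.comp_hasDerivAt s
          ((hasDerivAt_const s 0).prodMk ((hasDerivAt_id s).prodMk d2))
      apply_zero s hs := by simp only [hα0 s hs]
      fst s hs t := he1 _
      bound s hs t := he2 _ ((hα s hs t).2.1.trans (by norm_num))
        ((hGb _ _ (hα s hs t).2.1).trans (by norm_num))
      tangent s hs t := by
        have hαb := (hα s hs t).2.1
        have hαl : |α s t| < 1 / 32 / 2 := by linarith
        have hpair : ContinuousAt (fun t => (t, α s t)) t :=
          continuousAt_id.prodMk (hα s hs t).1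
        have hβ : ContinuousAt (fun t => G t (α s t)) t :=
          ContinuousAt.comp (f := fun t => (t, α s t)) (hG.continuousAt t _ hαl) hpair
        obtain ⟨a', b', e1, e2, e3⟩ := T.exists_hasDerivAt (hα s hs t).1 hβ (by linarith)
          (by linarith [hGb t _ hαb])
          ((hG.isLeafAt t _ hαl).comp (u := fun t => (t, α s t)) hpair) (hα s hs t).2.2
        refine ⟨e (1, a', b'), he1 _, ?_, hPP _ e3⟩
        exact (e : ℝ × ℝ × ℝ →L[ℝ] ℝ × ℝ × ℝ).hasFDerivAt.comp_hasDerivAt t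
          ((hasDerivAt_id t).prodMk (e1.prodMk e2)) }
  -- The middle half of the arc has length (x₂ 0 - x₁ 0) / 2. With K ≥ 16 / (x₂ 0 - x₁ 0), K times
  -- this length is at least 8, against the bound 4.
  obtain ⟨K, F, DF, hK, hF⟩ := hexp (max 8000 (16 / (x₂ 0 - x₁ 0)))
  have hK' := (le_max_right _ _).trans hK
  rw [div_le_iff₀ (sub_pos.2 hlt)] at hK'
  have := hF.preservesCenter.arc_length_le hΓ hF.continuous A ((le_max_left _ _).trans hK) hpr
    hF.expand hlow (fun s hs => hdec _ _ ((hsm s hs).trans (by norm_num))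
      ((hGb 0 s (hsm s hs)).trans (by norm_num)) _ (by simpa using hm3 s hs (0, 1))
      (hm2 s hs (0, 1)))
    (s₀ := x₁ 0 + (x₂ 0 - x₁ 0) / 4) (s₁ := x₂ 0 - (x₂ 0 - x₁ 0) / 4)
    (by linarith) (by linarith) (by linarith)
  have e : x₂ 0 - (x₂ 0 - x₁ 0) / 4 - (x₁ 0 + (x₂ 0 - x₁ 0) / 4) = (x₂ 0 - x₁ 0) / 2 := by ring
  rw [e] at this
  linarith

/-- Two center curves in a thin tube around a geodesic coincide. -/
theorem center_curves_eq (hΓ : IsClosedSurfaceGroup Γ) {f : T1S Γ ≃ₜ T1S Γ}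
    {Df : T1S Γ → (V3 ≃L[ℝ] V3)} {Es Ec Eu : T1S Γ → Submodule ℝ V3}
    {Wcs Wcu : SurfaceFoliation Γ} (hf : IsPartiallyHyperbolic f Df Es Ec Eu)
    (hW : IsDynamicallyCoherent f Es Ec Eu Wcs Wcu)
    (hn : ∀ x, IsNarrow (1 / 256) (Es x) (Ec x) (Eu x)) {h : SL2R} {x₁ y₁ x₂ y₂ : ℝ → ℝ}
    (hx₁ : Continuous x₁) (hy₁ : Continuous y₁) (hx₂ : Continuous x₂) (hy₂ : Continuous y₂)
    (hb₁ : ∀ t, |x₁ t| ≤ 1 / 128 ∧ |y₁ t| ≤ 1 / 128)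
    (hb₂ : ∀ t, |x₂ t| ≤ 1 / 128 ∧ |y₂ t| ≤ 1 / 128)
    (hs₁ : ∀ t, Wcs.IsLeafAt (fun t => tubeMap Γ h (t, x₁ t, y₁ t)) t)
    (hu₁ : ∀ t, Wcu.IsLeafAt (fun t => tubeMap Γ h (t, x₁ t, y₁ t)) t)
    (hs₂ : ∀ t, Wcs.IsLeafAt (fun t => tubeMap Γ h (t, x₂ t, y₂ t)) t)
    (hu₂ : ∀ t, Wcu.IsLeafAt (fun t => tubeMap Γ h (t, x₂ t, y₂ t)) t) :
    x₁ 0 = x₂ 0 ∧ y₁ 0 = y₂ 0 := by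
  have T : IsTube Wcs Wcu (fun x => Es x ⊔ Ec x) (fun x => Ec x ⊔ Eu x) (tubeMap Γ h) frameD
      (1 / 32) :=
    { frame := isFrame_tubeMap hΓ h
      tangent := hW.tangent_cs
      tangent' := hW.tangent_cu
      pos := by norm_num
      cone := fun q w hx hy hw => (hn _).cone_cs (by norm_num) le_rfl hx.le hy.le hw
      cone' := fun q w hx hy hw => (hn _).cone_cu (by norm_num) le_rfl hx.le hy.le hw }
  have hexp := hf.exists_expands hΓ fun x => (hn x).center
  have hl {z : ℝ} (hz : |z| ≤ 3 * (1 / 32) / 8) : |z| < 1 / 32 / 2 := by linarith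
  -- The center-stable leaf of the first curve and the center-unstable leaf of the second, as graphs
  -- in the tube; 1/128 is ρ/4 for ρ = 1/32. Their intersection is a third center curve, sharing a
  -- leaf with each of the given ones.
  obtain ⟨G, hG, hGe⟩ := T.exists_leafGraph hx₁ hy₁ (fun t => (hb₁ t).1.trans (by norm_num))
    (fun t => (hb₁ t).2.trans (by norm_num)) hs₁
  obtain ⟨G', hG', hGe'⟩ := T.swap.exists_leafGraph hy₂ hx₂
    (fun t => (hb₂ t).2.trans (by norm_num)) (fun t => (hb₂ t).1.trans (by norm_num)) hu₂
  obtain ⟨x₃, hx₃, hb₃, hc₃⟩ := T.exists_crossing hG hG'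
  have hpair₃ : Continuous fun t => (t, x₃ t) := by fun_prop
  have hy₃ : Continuous fun t => G t (x₃ t) := continuous_iff_continuousAt.2 fun t =>
    ContinuousAt.comp (f := fun t => (t, x₃ t)) (hG.continuousAt t _ (hl (hb₃ t)))
      hpair₃.continuousAt
  have hby₃ : ∀ t, |G t (x₃ t)| ≤ 3 * (1 / 32) / 8 := fun t => hG.abs_le t _ (hl (hb₃ t))
  have hs₃ : ∀ t, Wcs.IsLeafAt (fun t => tubeMap Γ h (t, x₃ t, G t (x₃ t))) t := fun t =>
    (hG.isLeafAt t _ (hl (hb₃ t))).comp (u := fun t => (t, x₃ t)) hpair₃.continuousAt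
  have hu₃ : ∀ t, Wcu.IsLeafAt (fun t => tubeMap Γ h (t, x₃ t, G t (x₃ t))) t := fun t => by
    have := (hG'.isLeafAt t _ (hl (hby₃ t))).comp (u := fun t => (t, G t (x₃ t)))
      (continuous_id.prodMk hy₃).continuousAt
    simpa only [Function.comp_def, swapCoord_apply, hc₃] using this
  have key : x₁ 0 = x₃ 0 := by
    have hu₁' : ∀ t, Wcu.IsLeafAt (fun t => tubeMap Γ h (t, x₁ t, G t (x₁ t))) t := by
      simpa only [hGe] using hu₁
    have hb₁' : ∀ t, |x₁ t| ≤ 3 * (1 / 32) / 8 := fun t => (hb₁ t).1.trans (by norm_num)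
    have main := fun {z₁ z₂ : ℝ → ℝ} => IsTube.not_lt hΓ (h := h)
      (e := ContinuousLinearEquiv.refl ℝ (ℝ × ℝ × ℝ)) (fun q => rfl) (fun q hx hy => ⟨hx, hy⟩) T
      hf.inf_le (fun B => (hexp B).1)
      (pr := (ContinuousLinearMap.fst ℝ ℝ ℝ).comp (ContinuousLinearMap.snd ℝ ℝ (ℝ × ℝ)))
      (fun q hx hy => hx) (fun x vs hvs q hx hy vc hvc => (hn x).le_abs_fst_frameD_symm hx hy hvs hvc)
      (fun x q hx hy m hm hw => (hn x).exists_decomp_cs hy hw) hG (x₁ := z₁) (x₂ := z₂)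
    exact le_antisymm (not_lt.1 (main hx₃ hx₁ hb₃ hb₁' hu₃ hu₁'))
      (not_lt.1 (main hx₁ hx₃ hb₁' hb₃ hu₁' hu₃))
  have key' : y₂ 0 = G 0 (x₃ 0) := by
    have hs₂' : ∀ t, Wcs.IsLeafAt (fun t => tubeMap Γ h (swapCoord (t, y₂ t, G' t (y₂ t)))) t := by
      simpa only [hGe', swapCoord_apply] using hs₂
    have hs₃' : ∀ t, Wcs.IsLeafAt
        (fun t => tubeMap Γ h (swapCoord (t, G t (x₃ t), G' t (G t (x₃ t))))) t := by
      simpa only [hc₃, swapCoord_apply] using hs₃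
    have hb₂' : ∀ t, |y₂ t| ≤ 3 * (1 / 32) / 8 := fun t => (hb₂ t).2.trans (by norm_num)
    have main := fun {z₁ z₂ : ℝ → ℝ} => IsTube.not_lt hΓ (h := h)
      (e := swapCoord) (fun q => rfl) (fun q hx hy => ⟨hy, hx⟩) T.swap
      (fun x => (inf_comm _ _).trans_le (hf.inf_le x)) (fun B => (hexp B).2)
      (pr := (ContinuousLinearMap.snd ℝ ℝ ℝ).comp (ContinuousLinearMap.snd ℝ ℝ (ℝ × ℝ)))
      (fun q hx hy => hy) (fun x vs hvs q hx hy vc hvc => (hn x).le_abs_snd_frameD_symm hy hvs hvc)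
      (fun x q hx hy m hm hw => (hn x).exists_decomp_cu (q := swapCoord q) hx hm hw) hG'
      (x₁ := z₁) (x₂ := z₂)
    exact le_antisymm (not_lt.1 (main hy₃ hy₂ hby₃ hb₂' hs₃' hs₂'))
      (not_lt.1 (main hy₂ hy₃ hb₂' hby₃ hs₂' hs₃'))
  -- `key` equates the x coordinates of the first and third curves at time 0, `key'` the y
  -- coordinates of the second and third. The graphs G and G' give the remaining coordinates.
  constructor
  · rw [key, ← hc₃ 0, ← key', hGe']
  · rw [key', ← key, hGe]

end T1S

end

/-! ### Center leaves with a common shadow coincide. -/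

noncomputable section

open T1S UnitTangent

namespace T1S

variable {Γ : Subgroup SL2R}

/-- Both maps stay near `a` in the same plaque, so switching between them in any manner stays in it.
-/
theorem SurfaceFoliation.IsLeafAt.ite {W : SurfaceFoliation Γ} {A : Type*} [TopologicalSpace A]
    {κ κ' : A → T1S Γ} {a : A} (h : W.IsLeafAt κ a) (h' : W.IsLeafAt κ' a) (heq : κ a = κ' a)
    (p : A → Prop) [DecidablePred p] : W.IsLeafAt (fun b => if p b then κ b else κ' b) a := by
  obtain ⟨hc, e, he, hea, hl⟩ := h
  have hl' := h'.eventually_eq he (heq ▸ hea)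
  have ha : (if p a then κ a else κ' a) = κ a := by rw [← heq, ite_self]
  refine ⟨?_, e, he, ?_, ?_⟩
  · rw [ContinuousAt, ha]
    exact hc.if' (heq ▸ h'.1)
  · simpa only [ha] using hea
  · filter_upwards [hl, hl'] with b hb hb'
    rw [ha]
    split_ifs
    · exact hb
    · rw [hb', heq]

/-- Curves in a leaf with a common point can be concatenated. -/
theorem SurfaceFoliation.IsLeafCurve.concat {W : SurfaceFoliation Γ} {c c' : ℝ → T1S Γ}
    (h : W.IsLeafCurve c) (h' : W.IsLeafCurve c') {a b a' b' : ℝ} (hb : c b = c' a') :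
    W.IsLeafCurve fun t => if t ≤ 1 / 2 then c (a + 2 * t * (b - a))
      else c' (a' + (2 * t - 1) * (b' - a')) := by
  rw [isLeafCurve_iff] at *
  intro t
  have h1 : W.IsLeafAt (fun t => c (a + 2 * t * (b - a))) t :=
    (h _).comp (u := fun t => a + 2 * t * (b - a)) (by fun_prop)
  have h2 : W.IsLeafAt (fun t => c' (a' + (2 * t - 1) * (b' - a'))) t :=
    (h' _).comp (u := fun t => a' + (2 * t - 1) * (b' - a')) (by fun_prop)
  rcases lt_trichotomy t (1 / 2) with ht | rfl | ht
  · refine h1.congr ?_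
    filter_upwards [eventually_lt_nhds ht] with r hr
    rw [if_pos hr.le]
  · exact h1.ite h2 (by
      rw [show a + 2 * (1 / 2) * (b - a) = b by ring,
        show a' + (2 * (1 / 2) - 1) * (b' - a') = a' by ring, hb]) _
  · refine h2.congr ?_
    filter_upwards [eventually_gt_nhds ht] with r hr
    rw [if_neg hr.not_ge]

/-- From `c 0` follow `c` to the common point and then `c'`: the result is a curve in leaves of both
foliations, so it ends in the center leaf of `c 0`. -/
theorem IsCenterLeaf.range_subset {Wcs Wcu : SurfaceFoliation Γ} {X : T1S Γ → V3}
    {c c' : ℝ → T1S Γ} (h : IsCenterLeaf Wcs Wcu X c) (h' : IsCenterLeaf Wcs Wcu X c') {u u' : ℝ}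
    (hu : c u = c' u') : Set.range c' ⊆ Set.range c := by
  rintro _ ⟨b, rfl⟩
  rw [h.range_eq]
  refine ⟨_, h.leafCurve_cs.concat h'.leafCurve_cs (a := 0) (b' := b) hu,
    h.leafCurve_cu.concat h'.leafCurve_cu hu, ?_, ?_⟩
  · norm_num
  · norm_num

/-- Center leaves near the same orbit of the geodesic flow coincide. -/
theorem IsCenterLeaf.range_eq_of_orbit_eq (hΓ : IsClosedSurfaceGroup Γ) {f : T1S Γ ≃ₜ T1S Γ}
    {Df : T1S Γ → (V3 ≃L[ℝ] V3)} {Es Ec Eu : T1S Γ → Submodule ℝ V3}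
    {Wcs Wcu : SurfaceFoliation Γ} (hf : IsPartiallyHyperbolic f Df Es Ec Eu)
    (hW : IsDynamicallyCoherent f Es Ec Eu Wcs Wcu)
    (hn : ∀ x, IsNarrow (1 / 256) (Es x) (Ec x) (Eu x)) {X : T1S Γ → V3} {c₁ c₂ : ℝ → T1S Γ}
    (h₁ : IsCenterLeaf Wcs Wcu X c₁) (h₂ : IsCenterLeaf Wcs Wcu X c₂) {k₁ k₂ : SL2R}
    {s₁ x₁ y₁ s₂ x₂ y₂ : ℝ → ℝ} (hs₁ : Continuous s₁) (hs₂ : Continuous s₂)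
    (hx₁ : Continuous x₁) (hy₁ : Continuous y₁) (hx₂ : Continuous x₂) (hy₂ : Continuous y₂)
    (hb₁ : ∀ t, |x₁ t| ≤ 1 / 128 ∧ |y₁ t| ≤ 1 / 128)
    (hb₂ : ∀ t, |x₂ t| ≤ 1 / 128 ∧ |y₂ t| ≤ 1 / 128)
    (hc₁ : ∀ t, c₁ (s₁ t) = proj Γ (k₁ * coordMat (t, x₁ t, y₁ t)))
    (hc₂ : ∀ t, c₂ (s₂ t) = proj Γ (k₂ * coordMat (t, x₂ t, y₂ t)))
    (ho : orbit (proj Γ k₁) = orbit (proj Γ k₂)) : Set.range c₁ = Set.range c₂ := by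
  obtain ⟨r, hr⟩ : proj Γ k₁ ∈ orbit (proj Γ k₂) := by
    rw [← ho]
    exact ⟨0, by simp only [geodesicFlow_proj, geoMat_zero, mul_one]⟩
  simp only [geodesicFlow_proj] at hr
  -- Equal orbits mean k₁ = γ k₂ `geoMat r`. Shifting the time of the first curve by r therefore
  -- puts both curves in the tube of k₂.
  obtain ⟨γ, hγ, hγk⟩ := proj_eq_iff.1 hr
  have e₁ : (fun t => tubeMap Γ k₂ (t, x₁ (t - r), y₁ (t - r))) = fun t => c₁ (s₁ (t - r)) := by
    funext t
    rw [hc₁, hγk, mul_assoc, proj_mul_left hγ, mul_assoc, geoMat_mul_coordMat, sub_add_cancel]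
    rfl
  have e₂ : (fun t => tubeMap Γ k₂ (t, x₂ t, y₂ t)) = fun t => c₂ (s₂ t) :=
    funext fun t => (hc₂ t).symm
  have hleaf {W : SurfaceFoliation Γ} {c : ℝ → T1S Γ} (h : W.IsLeafCurve c) {u : ℝ → ℝ}
      (hu : Continuous u) (t : ℝ) : W.IsLeafAt (fun t => c (u t)) t :=
    (SurfaceFoliation.isLeafCurve_iff.1 h _).comp hu.continuousAt
  obtain ⟨hx, hy⟩ := center_curves_eq hΓ hf hW hn (h := k₂) (x₁ := fun t => x₁ (t - r))
    (y₁ := fun t => y₁ (t - r)) (by fun_prop) (by fun_prop) hx₂ hy₂ (fun t => hb₁ _) hb₂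
    (by rw [e₁]; exact hleaf h₁.leafCurve_cs (by fun_prop))
    (by rw [e₁]; exact hleaf h₁.leafCurve_cu (by fun_prop))
    (by rw [e₂]; exact hleaf h₂.leafCurve_cs hs₂)
    (by rw [e₂]; exact hleaf h₂.leafCurve_cu hs₂)
  have hmeet : c₁ (s₁ (0 - r)) = c₂ (s₂ 0) := by
    rw [← congrFun e₁ 0, ← congrFun e₂ 0, hx, hy]
  exact (h₂.range_subset h₁ hmeet.symm).antisymm (h₁.range_subset h₂ hmeet)

end T1S

end

theorem theoremt (Γ : Subgroup SL2R) (hΓ : IsClosedSurfaceGroup Γ) :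
    ∃ ε₀ : ℝ, 0 < ε₀ ∧ ∀ ε : ℝ, 0 < ε → ε < ε₀ → ∃ δ : ℝ, 0 < δ ∧
      ∀ (f : T1S Γ ≃ₜ T1S Γ) (Df : T1S Γ → (V3 ≃L[ℝ] V3))
        (Es Ec Eu : T1S Γ → Submodule ℝ V3) (Wcs Wcu : T1S.SurfaceFoliation Γ)
        (X : T1S Γ → V3),
        T1S.IsPartiallyHyperbolic f Df Es Ec Eu →
        T1S.IsDynamicallyCoherent f Es Ec Eu Wcs Wcu →
        (∀ x, T1S.SubspacesClose δ (Es x) (T1S.geodesicStable x) ∧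
          T1S.SubspacesClose δ (Ec x) (T1S.geodesicCenter x) ∧
          T1S.SubspacesClose δ (Eu x) (T1S.geodesicUnstable x)) →
        T1S.Orients X Ec →
        (∀ x, ‖X x - T1S.geodesicField x‖ ≤ δ) →
        ∀ c₁ c₂ : ℝ → T1S Γ,
          T1S.IsCenterLeaf Wcs Wcu X c₁ → T1S.IsCenterLeaf Wcs Wcu X c₂ →
          Set.range c₁ ≠ Set.range c₂ →
          ∃ x₁ x₂ : T1S Γ,
            (T1S.IsShadowedBy ε c₁ x₁ ∧
              ∀ y, T1S.IsShadowedBy ε c₁ y → T1S.orbit y = T1S.orbit x₁) ∧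
            (T1S.IsShadowedBy ε c₂ x₂ ∧
              ∀ y, T1S.IsShadowedBy ε c₂ y → T1S.orbit y = T1S.orbit x₂) ∧
            T1S.orbit x₁ ≠ T1S.orbit x₂ := by
  obtain ⟨ε₀, hε₀, -, huniq⟩ := T1S.exists_shadow_unique hΓ
  refine ⟨ε₀, hε₀, fun ε hε hεε₀ => ?_⟩
  -- The first bound makes the tube of width 3θ fit the shadowing distance. The bound 1/400 ensures
  -- 3θ ≤ 1/128, the width allowed in `center_curves_eq`, and θ/2 ≤ 1/256, the required narrowness
  -- of the bundles; δ is θ/2.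
  obtain ⟨θ, hθ, hθε, hθ1⟩ : ∃ θ : ℝ, 0 < θ ∧ 48 * θ ≤ ε ∧ θ ≤ 1 / 400 :=
    ⟨min (ε / 48) (1 / 400), by positivity, by linarith [min_le_left (ε / 48) (1 / 400)],
      min_le_right _ _⟩
  refine ⟨θ / 2, by positivity, ?_⟩
  intro f Df Es Ec Eu Wcs Wcu X hf hW hclose hX hXZ c₁ c₂ h₁ h₂ hne
  have hn : ∀ x, IsNarrow (1 / 256) (Es x) (Ec x) (Eu x) := by
    intro x
    have h := T1S.isNarrow_of_subspacesClose hΓ (hclose x).1 (hclose x).2.1 (hclose x).2.2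
    have hle (v : V3) : θ / 2 * ‖v‖ ≤ 1 / 256 * ‖v‖ :=
      mul_le_mul_of_nonneg_right (by linarith) (norm_nonneg v)
    exact ⟨fun v hv => (h.stable v hv).imp (·.trans (hle v)) (·.trans (hle v)),
      fun v hv => (h.center v hv).imp (·.trans (hle v)) (·.trans (hle v)),
      fun v hv => (h.unstable v hv).imp (·.trans (hle v)) (·.trans (hle v))⟩
  obtain ⟨k₁, s₁, s₁', x₁, y₁, hs₁, hsurj₁, hx₁, hy₁, hb₁, hc₁⟩ :=
    T1S.exists_tube hΓ h₁.hasVelocity hθ (by linarith) fun t => hXZ _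
  obtain ⟨k₂, s₂, s₂', x₂, y₂, hs₂, hsurj₂, hx₂, hy₂, hb₂, hc₂⟩ :=
    T1S.exists_tube hΓ h₂.hasVelocity hθ (by linarith) fun t => hXZ _
  have hsmall {x y : ℝ → ℝ} {r : ℝ} (hr : 3 * θ ≤ r) (hb : ∀ t, |x t| ≤ 3 * θ ∧ |y t| ≤ 3 * θ)
      (t : ℝ) : |x t| ≤ r ∧ |y t| ≤ r := ⟨(hb t).1.trans hr, (hb t).2.trans hr⟩
  have hcont {s s' : ℝ → ℝ} (hs : ∀ t, HasDerivAt s (s' t) t ∧ |s' t - 1| ≤ 2 * θ) :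
      Continuous s := continuous_iff_continuousAt.2 fun t => (hs t).1.continuousAt
  have hhalf {s s' : ℝ → ℝ} (hs : ∀ t, HasDerivAt s (s' t) t ∧ |s' t - 1| ≤ 2 * θ) (t : ℝ) :
      1 / 2 ≤ s' t := by linarith [(abs_le.1 (hs t).2).1]
  refine ⟨T1S.proj Γ k₁, T1S.proj Γ k₂,
    ⟨T1S.isShadowedBy_of_tube hΓ hs₁ hb₁ hc₁ (by linarith) hθε,
      huniq ε hε hεε₀ c₁ k₁ s₁ s₁' x₁ y₁ (fun t => (hs₁ t).1) (hhalf hs₁) hsurj₁ hx₁ hy₁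
        (hsmall (by linarith) hb₁) hc₁⟩,
    ⟨T1S.isShadowedBy_of_tube hΓ hs₂ hb₂ hc₂ (by linarith) hθε,
      huniq ε hε hεε₀ c₂ k₂ s₂ s₂' x₂ y₂ (fun t => (hs₂ t).1) (hhalf hs₂) hsurj₂ hx₂ hy₂
        (hsmall (by linarith) hb₂) hc₂⟩, fun ho => hne ?_⟩
  exact h₁.range_eq_of_orbit_eq hΓ hf hW hn h₂ (hcont hs₁) (hcont hs₂) hx₁ hy₁ hx₂ hy₂
    (hsmall (by linarith) hb₁) (hsmall (by linarith) hb₂) hc₁ hc₂ ho
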